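/- Let $q_0>0$, $q_\pm\in\mathbb C$ with $|q_\pm|=q_0$, and let $q\in C^2(\mathbb R^2,\mathbb C)$ be a solution of the DNLS equation $iq_t+q_{xx}-i(|q|^2q)_x=0$ such that, for every $t$, $q(x,t)\to q_\pm$ as $x\to\pm\infty$, $(1+|x|)(q(\cdot,t)-q_\pm)\in L^1(\mathbb R^\pm)$ and $q_x(\cdot,t),q_{xx}(\cdot,t)\in L^1(\mathbb R)$, and such that $q,q_x$ are bounded on $\mathbb R\times[-T,T]$ for every $T$. **Notation.** Put $k=\frac12(z-\frac{q_0^2}z)$, $\lambda=\frac12(z+\frac{q_0^2}z)$, $\theta(x,t;z)=k\lambda[x-(2k^2-q_0^2)t]$, $\Sigma=(\mathbb R\cup i\mathbb R)\setminus\{0\}$, $D^\pm=\{z:\pm\mathrm{Re}\,z\,\mathrm{Im}\,z>0\}$, and $\sigma_3=\mathrm{diag}(1,-1)$. Let $\Phi_\pm(x,t;z)$ be the Jost solutions of $\Phi_x=(ik^2\sigma_3+kQ)\Phi$, $Q=\begin{pmatrix}0&q\\-q^*&0\end{pmatrix}$, with $\mu_\pm:=\Phi_\pm e^{-i\theta\sigma_3}\to\begin{pmatrix}1&iq_\pm/z\\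 iq_\pm^*/z&1\end{pmatrix}$ as $x\to\pm\infty$. The columns $\Phi_{+1},\Phi_{-2}$ are considered for $z\in D^+\cup\Sigma$ and $\Phi_{-1},\Phi_{+2}$ for $z\in D^-\cup\Sigma$. With $s(z)=1+q_0^2/z^2$, let $s_{11}=\mathrm{Wr}(\Phi_{+1},\Phi_{-2})/s$, $s_{22}=\mathrm{Wr}(\Phi_{-1},\Phi_{+2})/s$, $s_{12}=\mathrm{Wr}(\Phi_{+2},\Phi_{-2})/s$, $s_{21}=\mathrm{Wr}(\Phi_{-1},\Phi_{+1})/s$ (these do not depend on $x,t$), $\rho=s_{21}/s_{11}$ and $\tilde\rho=s_{12}/s_{22}$. **Assumptions on the spectrum.** There are no spectral singularities: $s_{11}s_{22}\neq0$ on $\Sigma\setminus\{\pm iq_0\}$, and $1/s_{11}$ (from $D^+\cup\Sigma$) and $1/s_{22}$ (from $D^-\cup\Sigma$) extend continuously to $\pm iq_0$. The zeros of $s_{11}$ in $\{\mathrm{Re}\,z>0,\ \mathrm{Im}\,z>0,\ |z|\ge q_0\}$ are the distinct points $z_1,\dots,z_{N_1}$ with $|z_n|>q_0$ and $w_1,\dots,w_{N_2}$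 with $|w_m|=q_0$, and all are double ($s_{11}=s_{11}'=0\ne s_{11}''$). Let $\eta_n$, $1\le n\le 4N_1+2N_2$, run through the points $\pm z_n,\ \pm q_0^2/z_n^*,\ \pm w_m$, and let $\widehat\eta_n=-q_0^2/\eta_n\in D^-$. **Norming constants.** At $p=\widehat\eta_n$ let $b[p],d[p]$ be the constants, independent of $x,t$, with $\Phi_{+2}(x,t;p)=b[p]\,\Phi_{-1}(x,t;p)$ and $\Phi_{+2}'(x,t;p)-b[p]\,\Phi_{-1}'(x,t;p)=d[p]\,\Phi_{-1}(x,t;p)$, where $'=\partial_z$, and let $A[p]=\frac{2b[p]}{s_{22}''(p)}$, $B[p]=\frac{d[p]}{b[p]}-\frac{s_{22}'''(p)}{3s_{22}''(p)}$, $\widehat D_n=B[\widehat\eta_n]+2i\theta'(\widehat\eta_n)$. **Riemann–Hilbert data.** Let $M=(\mu_{+1}/s_{11},\ \mu_{-2})$ in $D^+$ and $M=(\mu_{-1},\ \mu_{+2}/s_{22})$ in $D^-$, let $M^+$ be the boundary value of $M$ on $\Sigma$ from $D^+$, and let $J=e^{i\theta\sigma_3}\begin{pmatrix}0&-\tilde\rho\\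 \rho&\rho\tilde\rho\end{pmatrix}e^{-i\theta\sigma_3}$. Orient $\Sigma$ with $D^+$ on its left. Finally let $v_-(x,t)=\frac12\int_{-\infty}^x(|q(y,t)|^2-q_0^2)\,dy$, and let $\mu_{-11}$ be the first entry of the first column of $\mu_-$. **Proposition (reconstruction formula, NZBCs).** For all $(x,t)\in\mathbb R^2$ the function $(M^+J)_{12}(x,t;\cdot)$ is absolutely integrable on $\Sigma$ and $$q(x,t)=e^{iv_-(x,t)}\Big(q_-e^{iv_-(x,t)}-i\,\alpha^T\gamma+\frac1{2\pi}\int_\Sigma (M^+J)_{12}(x,t;\zeta)\,d\zeta\Big),$$ where $\alpha=(\alpha^{(1)},\alpha^{(2)})^T$ and $\gamma=(\gamma^{(1)},\gamma^{(2)})^T$ have the blocks, indexed by $n=1,\dots,4N_1+2N_2$, $$\alpha^{(1)}=\big(A[\widehat\eta_n]e^{2i\theta(\widehat\eta_n)}\widehat D_n\big)_n,\quad \alpha^{(2)}=\big(A[\widehat\eta_n]e^{2i\theta(\widehat\eta_n)}\big)_n,\quad \gamma^{(1)}=\big(\mu_{-11}(\widehat\eta_n)\big)_n,\quad \gamma^{(2)}=\big(\mu_{-11}'(\widehat\eta_n)\big)_n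 .$$ In particular, if $q$ is reflectionless ($\rho=\tilde\rho=0$ on $\Sigma\setminus\{\pm iq_0\}$), then for all $(x,t)$ $$q(x,t)=e^{iv_-(x,t)}\big(q_-e^{iv_-(x,t)}-i\,\alpha^T\gamma\big).$$ -/

import Mathlib

open Complex Filter Topology MeasureTheory
open scoped Matrix ComplexConjugate

noncomputable section

namespace DNLS

/-! ### The equation and the boundary conditions -/

/-- `q` is a classical (`C²`) solution on `ℝ × ℝ` of `i q_t + q_xx - i (|q|² q)_x = 0`;
the arguments of `q` are `x` and `t`, in this order. -/
def IsSolution (q : ℝ → ℝ → ℂ) : Prop :=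
  ContDiff ℝ 2 (Function.uncurry q) ∧
  ∀ x t : ℝ,
    I * deriv (fun τ => q x τ) t + deriv (deriv (fun y => q y t)) x
      - I * deriv (fun y => ((‖q y t‖ : ℂ) ^ 2) * q y t) x = 0

/-- Nonzero boundary conditions `q → q_±` as `x → ±∞`, with `|q_±| = q₀ > 0`. The limits are
attained in the weighted `L¹` sense used to build the Jost solutions, the `x`-derivatives
`q_x`, `q_xx` are integrable, and `q`, `q_x` are bounded locally uniformly in time. -/
structure HasNZBC (q : ℝ → ℝ → ℂ) (q₀ : ℝ) (qm qp : ℂ) : Prop where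
  q₀_pos : 0 < q₀
  norm_qm : ‖qm‖ = q₀
  norm_qp : ‖qp‖ = q₀
  tendsto_bot : ∀ t, Tendsto (fun x => q x t) atBot (𝓝 qm)
  tendsto_top : ∀ t, Tendsto (fun x => q x t) atTop (𝓝 qp)
  integrable_bot : ∀ t, IntegrableOn (fun x => ((1 + |x| : ℝ) : ℂ) * (q x t - qm)) (Set.Iic 0)
  integrable_top : ∀ t, IntegrableOn (fun x => ((1 + |x| : ℝ) : ℂ) * (q x t - qp)) (Set.Ici 0)
  integrable_deriv : ∀ t, Integrable (deriv (fun x => q x t))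
  integrable_deriv2 : ∀ t, Integrable (deriv (deriv (fun x => q x t)))
  locally_bounded : ∀ T : ℝ, ∃ C : ℝ, ∀ x t : ℝ, |t| ≤ T →
    ‖q x t‖ ≤ C ∧ ‖deriv (fun y => q y t) x‖ ≤ C

/-! ### The uniformization variable `z = k + λ` -/

/-- `k = (z - q₀² / z) / 2`. -/
def kz (q₀ : ℝ) (z : ℂ) : ℂ := (z - (q₀ : ℂ) ^ 2 / z) / 2

/-- `λ = (z + q₀² / z) / 2`. -/
def lamz (q₀ : ℝ) (z : ℂ) : ℂ := (z + (q₀ : ℂ) ^ 2 / z) / 2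

/-- `θ(x, t; z) = k λ (x - (2 k² - q₀²) t)`. -/
def theta (q₀ : ℝ) (x t : ℝ) (z : ℂ) : ℂ :=
  kz q₀ z * lamz q₀ z * ((x : ℂ) - (2 * kz q₀ z ^ 2 - (q₀ : ℂ) ^ 2) * (t : ℂ))

/-- The contour `Σ = (ℝ ∪ iℝ) \ {0}`. -/
def contour : Set ℂ := {z | (z.im = 0 ∨ z.re = 0) ∧ z ≠ 0}

/-- `D⁺ = {Re z Im z > 0}`. -/
def Dplus : Set ℂ := {z | 0 < z.re * z.im}

/-- `D⁻ = {Re z Im z < 0}`. -/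
def Dminus : Set ℂ := {z | z.re * z.im < 0}

/-- The branch points `± i q₀`. -/
def branchPts (q₀ : ℝ) : Set ℂ := {I * q₀, -(I * q₀)}

/-! ### Jost solutions -/

def sigma3 : Matrix (Fin 2) (Fin 2) ℂ := !![1, 0; 0, -1]

/-- The matrix `Q` attached to a value `u` of the potential. -/
def Qmat (u : ℂ) : Matrix (Fin 2) (Fin 2) ℂ := !![0, u; -conj u, 0]

/-- `X = i k² σ₃ + k Q`. -/
def laxX (u k : ℂ) : Matrix (Fin 2) (Fin 2) ℂ := (I * k ^ 2) • sigma3 + k • Qmat u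

/-- `E_±(z)`, with `qb = q_±`. -/
def Emat (qb z : ℂ) : Matrix (Fin 2) (Fin 2) ℂ := !![1, I * qb / z; I * conj qb / z, 1]

/-- The sign of `i θ` in the `j`-th column of `exp (i θ σ₃)`. -/
def colSign : Fin 2 → ℂ := ![1, -1]

/-- `φ` is a solution of `Φ_x = X Φ` at time `t` whose product with the `j`-th diagonal entry of
`exp (-i θ σ₃)` tends to the `j`-th column of `E` along `l` (`l = atBot` or `l = atTop`). -/
def IsJostColumn (q : ℝ → ℝ → ℂ) (q₀ : ℝ) (qb : ℂ) (l : Filter ℝ) (j : Fin 2)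
    (t : ℝ) (z : ℂ) (φ : ℝ → Fin 2 → ℂ) : Prop :=
  (∀ x, HasDerivAt φ (laxX (q x t) (kz q₀ z) *ᵥ φ x) x) ∧
  Tendsto (fun x => exp (-(colSign j * (I * theta q₀ x t z))) • φ x) l
    (𝓝 (fun i => Emat qb z i j))

open Classical in
/-- The `j`-th column of the Jost solution normalized along `l`, as a function of `x`, `t`, `z`.
It is uniquely determined by `IsJostColumn` for `z` in `Σ` and in the domain to which that column
extends: `D⁺` for `Φ_{+1}` and `Φ_{-2}`, and `D⁻` for `Φ_{-1}` and `Φ_{+2}`. It is used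
only there. -/
def jost (q : ℝ → ℝ → ℂ) (q₀ : ℝ) (qb : ℂ) (l : Filter ℝ) (j : Fin 2)
    (x t : ℝ) (z : ℂ) : Fin 2 → ℂ :=
  if h : ∃ φ : ℝ → Fin 2 → ℂ, IsJostColumn q q₀ qb l j t z φ then h.choose x else 0

/-- The columns of `Φ₊` (`j = 0, 1` for the first and the second column). -/
def PhiP (q : ℝ → ℝ → ℂ) (q₀ : ℝ) (qp : ℂ) (j : Fin 2) (x t : ℝ) (z : ℂ) : Fin 2 → ℂ :=
  jost q q₀ qp atTop j x t z

/-- The columns of `Φ₋`. -/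
def PhiM (q : ℝ → ℝ → ℂ) (q₀ : ℝ) (qm : ℂ) (j : Fin 2) (x t : ℝ) (z : ℂ) : Fin 2 → ℂ :=
  jost q q₀ qm atBot j x t z

/-- The columns of `μ₊ = Φ₊ exp (-i θ σ₃)`. -/
def muP (q : ℝ → ℝ → ℂ) (q₀ : ℝ) (qp : ℂ) (j : Fin 2) (x t : ℝ) (z : ℂ) : Fin 2 → ℂ :=
  exp (-(colSign j * (I * theta q₀ x t z))) • PhiP q q₀ qp j x t z

/-- The columns of `μ₋ = Φ₋ exp (-i θ σ₃)`. -/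
def muM (q : ℝ → ℝ → ℂ) (q₀ : ℝ) (qm : ℂ) (j : Fin 2) (x t : ℝ) (z : ℂ) : Fin 2 → ℂ :=
  exp (-(colSign j * (I * theta q₀ x t z))) • PhiM q q₀ qm j x t z

/-! ### Scattering coefficients -/

/-- The Wronskian determinant of two columns. -/
def Wr (u v : Fin 2 → ℂ) : ℂ := u 0 * v 1 - u 1 * v 0

/-- `s(z) = 1 + q₀² / z²`, the determinant of `E_±(z)`. -/
def sdet (q₀ : ℝ) (z : ℂ) : ℂ := 1 + (q₀ : ℂ) ^ 2 / z ^ 2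

/-- The scattering coefficients, by their Wronskian representations. The Wronskians do not depend
on `x` and `t` and are evaluated at `x = t = 0`. -/
def s11 (q : ℝ → ℝ → ℂ) (q₀ : ℝ) (qm qp z : ℂ) : ℂ :=
  Wr (PhiP q q₀ qp 0 0 0 z) (PhiM q q₀ qm 1 0 0 z) / sdet q₀ z

/-- A scattering coefficient; see `s11`. -/
def s22 (q : ℝ → ℝ → ℂ) (q₀ : ℝ) (qm qp z : ℂ) : ℂ :=
  Wr (PhiM q q₀ qm 0 0 0 z) (PhiP q q₀ qp 1 0 0 z) / sdet q₀ z

/-- A scattering coefficient; see `s11`. -/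
def s12 (q : ℝ → ℝ → ℂ) (q₀ : ℝ) (qm qp z : ℂ) : ℂ :=
  Wr (PhiP q q₀ qp 1 0 0 z) (PhiM q q₀ qm 1 0 0 z) / sdet q₀ z

/-- A scattering coefficient; see `s11`. -/
def s21 (q : ℝ → ℝ → ℂ) (q₀ : ℝ) (qm qp z : ℂ) : ℂ :=
  Wr (PhiM q q₀ qm 0 0 0 z) (PhiP q q₀ qp 0 0 0 z) / sdet q₀ z

/-- The reflection coefficient `ρ = s₂₁ / s₁₁`. -/
def rho (q : ℝ → ℝ → ℂ) (q₀ : ℝ) (qm qp z : ℂ) : ℂ := s21 q q₀ qm qp z / s11 q q₀ qm qp z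

/-- The reflection coefficient `ρ̃ = s₁₂ / s₂₂`. -/
def rhoT (q : ℝ → ℝ → ℂ) (q₀ : ℝ) (qm qp z : ℂ) : ℂ := s12 q q₀ qm qp z / s22 q q₀ qm qp z

/-- No spectral singularities: `s₁₁ s₂₂ ≠ 0` on `Σ`, and `1 / s₁₁`, `1 / s₂₂` extend
continuously to the branch points `± i q₀`. -/
def NoSpectralSingularity (q : ℝ → ℝ → ℂ) (q₀ : ℝ) (qm qp : ℂ) : Prop :=
  (∀ z ∈ contour \ branchPts q₀, s11 q q₀ qm qp z ≠ 0 ∧ s22 q q₀ qm qp z ≠ 0) ∧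
  ∀ p ∈ branchPts q₀,
    (∃ l : ℂ, Tendsto (fun z => 1 / s11 q q₀ qm qp z) (𝓝[(Dplus ∪ contour) \ {p}] p) (𝓝 l)) ∧
    (∃ l : ℂ, Tendsto (fun z => 1 / s22 q q₀ qm qp z) (𝓝[(Dminus ∪ contour) \ {p}] p) (𝓝 l))

/-! ### Discrete spectrum -/

/-- `f` has a double zero at `p`. -/
def IsDoubleZero (f : ℂ → ℂ) (p : ℂ) : Prop :=
  f p = 0 ∧ deriv f p = 0 ∧ iteratedDeriv 2 f p ≠ 0

/-- The zeros of `s₁₁` in the part `|z| ≥ q₀` of the open first quadrant are the pairwise distinct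
points `z_1, …, z_{N₁}` with `|z_n| > q₀` and `w_1, …, w_{N₂}` with `|w_m| = q₀`, and all of them
are double. -/
structure HasDoubleSpectrum (q : ℝ → ℝ → ℂ) (q₀ : ℝ) (qm qp : ℂ) {N₁ N₂ : ℕ}
    (zs : Fin N₁ → ℂ) (ws : Fin N₂ → ℂ) : Prop where
  injective_zs : Function.Injective zs
  injective_ws : Function.Injective ws
  range_zs : Set.range zs =
    {z | 0 < z.re ∧ 0 < z.im ∧ q₀ < ‖z‖ ∧ s11 q q₀ qm qp z = 0}
  range_ws : Set.range ws =
    {z | 0 < z.re ∧ 0 < z.im ∧ ‖z‖ = q₀ ∧ s11 q q₀ qm qp z = 0}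
  double_zs : ∀ n, IsDoubleZero (s11 q q₀ qm qp) (zs n)
  double_ws : ∀ m, IsDoubleZero (s11 q q₀ qm qp) (ws m)

/-- The `4 N₁ + 2 N₂` indices of the points `η_n`. -/
abbrev EtaIndex (N₁ N₂ : ℕ) : Type := (Fin 4 × Fin N₁) ⊕ (Fin 2 × Fin N₂)

/-- The points `η_n`: all of `z_n`, `-z_n`, `q₀² / z_n^*`, `-q₀² / z_n^*`, `w_m`, `-w_m`. -/
def eta (q₀ : ℝ) {N₁ N₂ : ℕ} (zs : Fin N₁ → ℂ) (ws : Fin N₂ → ℂ) : EtaIndex N₁ N₂ → ℂ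
  | Sum.inl (i, n) =>
      (![zs n, -zs n, (q₀ : ℂ) ^ 2 / conj (zs n), -((q₀ : ℂ) ^ 2 / conj (zs n))] : Fin 4 → ℂ) i
  | Sum.inr (i, m) => (![ws m, -ws m] : Fin 2 → ℂ) i

/-- The points `η̂_n = -q₀² / η_n`. -/
def etaHat (q₀ : ℝ) {N₁ N₂ : ℕ} (zs : Fin N₁ → ℂ) (ws : Fin N₂ → ℂ) (n : EtaIndex N₁ N₂) : ℂ :=
  -((q₀ : ℂ) ^ 2 / eta q₀ zs ws n)

open Classical in
/-- The coefficient `c`, independent of `x` and `t`, with `u(x, t) = c v(x, t)`. -/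
def propCoeff (u v : ℝ → ℝ → Fin 2 → ℂ) : ℂ :=
  if h : ∃ c : ℂ, ∀ x t, u x t = c • v x t then h.choose else 0

open Classical in
/-- `b[z₀]`: the coefficient of `Φ_{+1}` over `Φ_{-2}` at `z₀ ∈ D⁺`, and of `Φ_{+2}` over `Φ_{-1}`
at `z₀ ∈ D⁻`. -/
def coeffb (q : ℝ → ℝ → ℂ) (q₀ : ℝ) (qm qp p : ℂ) : ℂ :=
  if p ∈ Dplus then
    propCoeff (fun x t => PhiP q q₀ qp 0 x t p) (fun x t => PhiM q q₀ qm 1 x t p)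
  else
    propCoeff (fun x t => PhiP q q₀ qp 1 x t p) (fun x t => PhiM q q₀ qm 0 x t p)

open Classical in
/-- `d[z₀]`: the coefficient of `Φ_{+1}' - b[z₀] Φ_{-2}'` over `Φ_{-2}` at `z₀ ∈ D⁺`, and of
`Φ_{+2}' - b[z₀] Φ_{-1}'` over `Φ_{-1}` at `z₀ ∈ D⁻`; the prime is `d/dz`. -/
def coeffd (q : ℝ → ℝ → ℂ) (q₀ : ℝ) (qm qp p : ℂ) : ℂ :=
  if p ∈ Dplus then
    propCoeff
      (fun x t => deriv (PhiP q q₀ qp 0 x t) p - coeffb q q₀ qm qp p • deriv (PhiM q q₀ qm 1 x t) p)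
      (fun x t => PhiM q q₀ qm 1 x t p)
  else
    propCoeff
      (fun x t => deriv (PhiP q q₀ qp 1 x t) p - coeffb q q₀ qm qp p • deriv (PhiM q q₀ qm 0 x t) p)
      (fun x t => PhiM q q₀ qm 0 x t p)

open Classical in
/-- `A[z₀] = 2 b[z₀] / s_jj''(z₀)`, with `j = 1` in `D⁺` and `j = 2` in `D⁻`. -/
def coeffA (q : ℝ → ℝ → ℂ) (q₀ : ℝ) (qm qp p : ℂ) : ℂ :=
  if p ∈ Dplus then 2 * coeffb q q₀ qm qp p / iteratedDeriv 2 (s11 q q₀ qm qp) p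
  else 2 * coeffb q q₀ qm qp p / iteratedDeriv 2 (s22 q q₀ qm qp) p

open Classical in
/-- `B[z₀] = d[z₀] / b[z₀] - s_jj'''(z₀) / (3 s_jj''(z₀))`. -/
def coeffB (q : ℝ → ℝ → ℂ) (q₀ : ℝ) (qm qp p : ℂ) : ℂ :=
  if p ∈ Dplus then
    coeffd q q₀ qm qp p / coeffb q q₀ qm qp p
      - iteratedDeriv 3 (s11 q q₀ qm qp) p / (3 * iteratedDeriv 2 (s11 q q₀ qm qp) p)
  else
    coeffd q q₀ qm qp p / coeffb q q₀ qm qp p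
      - iteratedDeriv 3 (s22 q q₀ qm qp) p / (3 * iteratedDeriv 2 (s22 q q₀ qm qp) p)

/-! ### The Riemann-Hilbert problem -/

open Classical in
/-- The sectionally meromorphic matrix `M(x, t; z)`, for `z ∈ D⁺ ∪ D⁻`. -/
def RHM (q : ℝ → ℝ → ℂ) (q₀ : ℝ) (qm qp : ℂ) (x t : ℝ) (z : ℂ) : Matrix (Fin 2) (Fin 2) ℂ :=
  if z ∈ Dplus then
    (Matrix.of ![(s11 q q₀ qm qp z)⁻¹ • muP q q₀ qp 0 x t z, muM q q₀ qm 1 x t z])ᵀ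
  else
    (Matrix.of ![muM q q₀ qm 0 x t z, (s22 q q₀ qm qp z)⁻¹ • muP q q₀ qp 1 x t z])ᵀ

/-- The boundary value `M⁺(x, t; ζ)` on `Σ`, the limit of `M` from `D⁺`. -/
def RHMplus (q : ℝ → ℝ → ℂ) (q₀ : ℝ) (qm qp : ℂ) (x t : ℝ) (ζ : ℂ) :
    Matrix (Fin 2) (Fin 2) ℂ :=
  limUnder (𝓝[Dplus] ζ) (RHM q q₀ qm qp x t)

/-- The jump matrix `J = exp (i θ σ₃) [0, -ρ̃; ρ, ρ ρ̃] exp (-i θ σ₃)`. -/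
def RHJ (q : ℝ → ℝ → ℂ) (q₀ : ℝ) (qm qp : ℂ) (x t : ℝ) (ζ : ℂ) : Matrix (Fin 2) (Fin 2) ℂ :=
  Matrix.diagonal (fun j => exp (colSign j * (I * theta q₀ x t ζ))) *
    !![0, -rhoT q q₀ qm qp ζ; rho q q₀ qm qp ζ, rho q q₀ qm qp ζ * rhoT q q₀ qm qp ζ] *
    Matrix.diagonal (fun j => exp (-(colSign j * (I * theta q₀ x t ζ))))

/-- Absolute integrability of `f` on the four rays of `Σ`. -/
def ContourIntegrable (f : ℂ → ℂ) : Prop :=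
  IntegrableOn (fun r : ℝ => f r) (Set.Ioi 0) ∧
  IntegrableOn (fun r : ℝ => f (-(r : ℂ))) (Set.Ioi 0) ∧
  IntegrableOn (fun r : ℝ => f (I * r)) (Set.Ioi 0) ∧
  IntegrableOn (fun r : ℝ => f (-(I * r))) (Set.Ioi 0)

/-- `∫_Σ f(ζ) dζ`, where `Σ` is oriented as the boundary of `D⁺`, with `D⁺` on its left: the two
real rays run from `0` to `∞` and the two imaginary rays run from `∞` to `0`. -/
def contourIntegral (f : ℂ → ℂ) : ℂ :=
  (∫ r in Set.Ioi (0 : ℝ), f r) - (∫ r in Set.Ioi (0 : ℝ), f (-(r : ℂ)))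
    - I * (∫ r in Set.Ioi (0 : ℝ), f (I * r)) + I * (∫ r in Set.Ioi (0 : ℝ), f (-(I * r)))

/-! ### The ingredients of the reconstruction formula -/

/-- `v₋(x, t) = (1/2) ∫_{-∞}^x (|q(y, t)|² - q₀²) dy`. -/
def vMinus (q : ℝ → ℝ → ℂ) (q₀ x t : ℝ) : ℝ :=
  (1 / 2) * ∫ y in Set.Iic x, (‖q y t‖ ^ 2 - q₀ ^ 2)

/-- `D̂_n = B[η̂_n] + 2 i θ'(η̂_n)`, as a function of the point `p = η̂_n`. -/
def Dhat (q : ℝ → ℝ → ℂ) (q₀ : ℝ) (qm qp : ℂ) (x t : ℝ) (p : ℂ) : ℂ :=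
  coeffB q q₀ qm qp p + 2 * I * deriv (theta q₀ x t) p

/-- The column `α = (α⁽¹⁾, α⁽²⁾)`. -/
def alphaVec (q : ℝ → ℝ → ℂ) (q₀ : ℝ) (qm qp : ℂ) {N₁ N₂ : ℕ} (zs : Fin N₁ → ℂ) (ws : Fin N₂ → ℂ)
    (x t : ℝ) : EtaIndex N₁ N₂ ⊕ EtaIndex N₁ N₂ → ℂ :=
  Sum.elim
    (fun n => coeffA q q₀ qm qp (etaHat q₀ zs ws n)
      * exp (2 * I * theta q₀ x t (etaHat q₀ zs ws n)) * Dhat q q₀ qm qp x t (etaHat q₀ zs ws n))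
    (fun n => coeffA q q₀ qm qp (etaHat q₀ zs ws n)
      * exp (2 * I * theta q₀ x t (etaHat q₀ zs ws n)))

/-- The column `γ = (γ⁽¹⁾, γ⁽²⁾)`, of the values of `μ_{-11}` and of its `z`-derivative at the
points `η̂_n`. -/
def gammaVec (q : ℝ → ℝ → ℂ) (q₀ : ℝ) (qm : ℂ) {N₁ N₂ : ℕ} (zs : Fin N₁ → ℂ) (ws : Fin N₂ → ℂ)
    (x t : ℝ) : EtaIndex N₁ N₂ ⊕ EtaIndex N₁ N₂ → ℂ :=
  Sum.elim
    (fun n => muM q q₀ qm 0 x t (etaHat q₀ zs ws n) 0)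
    (fun n => deriv (fun z => muM q q₀ qm 0 x t z 0) (etaHat q₀ zs ws n))

end DNLS

end

namespace DNLS

/-! ### Grönwall inequalities -/

/-! The DNLS equation is the compatibility condition of a linear Lax pair (`zero_curvature`). Hence
there is one fundamental matrix W(k; x, t), entire in k, that solves both linear equations
(`exists_lax_flow`), and a Jost column is W applied to a vector depending on z alone. For Φ_{-2} and
Φ_{+1} these vectors are analytic in D⁺ and continuous up to Σ, branch points included
(`exists_left_jost`, `exists_scat`). The other two columns come from the symmetries z ↦ -q₀²/z and z
↦ z^*. So the Wronskians do not depend on x and t, and zeros of s₂₂ give proportionality constants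
that do not either.

The formula itself is one contour computation. Take f₊ = μ_{-12} in D⁺ and f₋ = μ_{+12}/s₂₂ in D⁻.
Their difference on Σ is exactly the entry (M⁺J)₁₂ (`Scat.jump_entry`, `Scat.jump_diff`). Both
satisfy z f → i q e^{-iv₋} at infinity and z f → i q₋ e^{iv₋} at the origin. The poles of f₋ are
double and sit at the points η̂_n; the norming constants give their principal parts
(`Scat.tendsto_sub_principal`), and the residues add up to α^T γ. After the rational function made
of these principal parts is subtracted from both f₊ and f₋, Cauchy's theorem on the four quadrants
(`contourIntegral_jump`) evaluates the integral of the jump as 2πi (b - a), where a = i q e^{-iv₋} -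
α^T γ comes from the large arcs and b = i q₋ e^{iv₋} from the small ones. Solving for q is the
reconstruction formula.

The analytic core is the behaviour for large z (`SmoothPotential.asymptotics`). In the moving frame
E(q(x, t)) the x-equation is diagonal up to an integrable perturbation. Its off-diagonal part is
O(1/|z|) against a diagonal gap of order |z|², so after one integration by parts the Jost column
misses the frame vector only by O(|z|^{-3}). The diagonal term that survives produces the phase v₋,
and the leading coefficient of μ_{-12} is q. The cubic rate also gives s₁₂ = o(z^{-2}), hence the
integrability of the jump. The behaviour at the origin follows from that at infinity by z ↦ -q₀²/z.
-/

/-- With U the right-hand side of the hypothesis, U e^{-∫K} - ∫ε is nonincreasing: the K-terms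
combine to K e^{-∫K}(u - U) ≤ 0, and the forcing is damped because e^{-∫K} ≤ 1. -/
theorem gronwall_integral {u K ε : ℝ → ℝ} (hu : Continuous u) (hKc : Continuous K)
    (hεc : Continuous ε) (hK : ∀ x, 0 ≤ K x) (hε : ∀ x, 0 ≤ ε x) {a b c : ℝ} (hab : a ≤ b)
    (h : ∀ x ∈ Set.Icc a b, u x ≤ c + ∫ s in a..x, (K s * u s + ε s)) :
    u b ≤ (c + ∫ s in a..b, ε s) * Real.exp (∫ s in a..b, K s) := by
  set U : ℝ → ℝ := fun x => c + ∫ s in a..x, (K s * u s + ε s) with hU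
  have hUd : ∀ x, HasDerivAt U (K x * u x + ε x) x := fun x =>
    (((hKc.mul hu).add hεc).integral_hasStrictDerivAt a x).hasDerivAt.const_add c
  have hKd : ∀ x, HasDerivAt (fun x => ∫ s in a..x, K s) (K x) x := fun x =>
    (hKc.integral_hasStrictDerivAt a x).hasDerivAt
  have hεd : ∀ x, HasDerivAt (fun x => ∫ s in a..x, ε s) (ε x) x := fun x =>
    (hεc.integral_hasStrictDerivAt a x).hasDerivAt
  set F : ℝ → ℝ := fun x => U x * Real.exp (-∫ s in a..x, K s) - ∫ s in a..x, ε s with hF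
  have hFd : ∀ x, HasDerivAt F ((K x * u x + ε x) * Real.exp (-∫ s in a..x, K s) +
      U x * (Real.exp (-∫ s in a..x, K s) * (-K x)) - ε x) x := fun x =>
    ((hUd x).fun_mul ((hKd x).fun_neg.exp)).fun_sub (hεd x)
  have hanti : AntitoneOn F (Set.Icc a b) := by
    refine antitoneOn_of_deriv_nonpos (convex_Icc a b)
      (fun x _ => (hFd x).continuousAt.continuousWithinAt)
      (fun x _ => (hFd x).differentiableAt.differentiableWithinAt) fun x hx => ?_
    rw [interior_Icc] at hx
    have hx' : x ∈ Set.Icc a b := Set.Ioo_subset_Icc_self hx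
    rw [(hFd x).deriv]
    have h1 : 0 ≤ ∫ s in a..x, K s := intervalIntegral.integral_nonneg hx'.1 fun s _ => hK s
    have h2 : Real.exp (-∫ s in a..x, K s) ≤ 1 := Real.exp_le_one_iff.2 (by linarith)
    have h3 := Real.exp_pos (-∫ s in a..x, K s)
    have h4 : u x ≤ U x := h x hx'
    have h5 : K x * Real.exp (-∫ s in a..x, K s) * (u x - U x) ≤ 0 :=
      mul_nonpos_of_nonneg_of_nonpos (mul_nonneg (hK x) h3.le) (by linarith)
    have h6 : ε x * Real.exp (-∫ s in a..x, K s) ≤ ε x := mul_le_of_le_one_right (hε x) h2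
    nlinarith
  have h1 : F b ≤ F a := hanti (Set.left_mem_Icc.2 hab) (Set.right_mem_Icc.2 hab) hab
  have h2 : F a = c := by simp [hF, hU]
  have h3 : U b * Real.exp (-∫ s in a..b, K s) ≤ c + ∫ s in a..b, ε s := by
    have : F b = U b * Real.exp (-∫ s in a..b, K s) - ∫ s in a..b, ε s := rfl
    linarith
  calc u b ≤ U b := h b (Set.right_mem_Icc.2 hab)
    _ = U b * Real.exp (-∫ s in a..b, K s) * Real.exp (∫ s in a..b, K s) := by
      rw [mul_assoc, ← Real.exp_add]; simp
    _ ≤ _ := mul_le_mul_of_nonneg_right h3 (Real.exp_pos _).le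

section Dissipative
variable {V : Type*} [NormedAddCommGroup V] [NormedSpace ℂ V] [CompleteSpace V]

/-- If `y' = α y + g` with `Re α ≤ 0`, then `‖y‖` grows at most by the integral of `‖g‖`. -/
theorem norm_le_of_hasDerivAt_dissipative {α : ℂ} (hα : α.re ≤ 0) {y g : ℝ → V}
    (hg : Continuous g) (hy : ∀ x, HasDerivAt y (α • y x + g x) x) {a b : ℝ} (hab : a ≤ b) :
    ‖y b‖ ≤ ‖y a‖ + ∫ s in a..b, ‖g s‖ := by
  -- The integrating factor e^{α(b-x)} has modulus at most one for x ≤ b and equals one at b, so it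
  -- can be dropped from every estimate.
  have he : ∀ x : ℝ, HasDerivAt (fun x : ℝ => exp (α * (b - x))) (-α * exp (α * (b - x))) x := by
    intro x
    have h1 : HasDerivAt (fun x : ℝ => α * ((b : ℂ) - x)) (α * (0 - 1)) x :=
      ((hasDerivAt_const x (b : ℂ)).fun_sub (Complex.ofRealCLM.hasDerivAt (x := x))).const_mul α
    convert h1.cexp using 1; ring
  have hd : ∀ x : ℝ, HasDerivAt (fun x : ℝ => exp (α * (b - x)) • y x)
      (exp (α * (b - x)) • g x) x := by
    intro x
    convert (he x).fun_smul (hy x) using 1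
    module
  have hyc : Continuous y := continuous_iff_continuousAt.2 fun x => (hy x).continuousAt
  have hint := intervalIntegral.integral_eq_sub_of_hasDerivAt (a := a) (b := b) (fun x _ => hd x)
    (Continuous.intervalIntegrable (by fun_prop) _ _)
  have h0 : exp (α * ((b : ℂ) - b)) • y b = y b := by simp
  rw [h0, eq_sub_iff_add_eq] at hint
  have hle : ∀ s, s ≤ b → ‖exp (α * ((b : ℂ) - s))‖ ≤ 1 := by
    intro s hs
    rw [Complex.norm_exp, Real.exp_le_one_iff]
    have : (α * ((b : ℂ) - s)).re = α.re * (b - s) := by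
      rw [← Complex.ofReal_sub, Complex.re_mul_ofReal]
    rw [this]
    exact mul_nonpos_of_nonpos_of_nonneg hα (by linarith)
  rw [← hint, add_comm ‖y a‖]
  refine (norm_add_le _ _).trans (add_le_add ?_ ?_)
  · refine (intervalIntegral.norm_integral_le_integral_norm hab).trans ?_
    refine intervalIntegral.integral_mono_on hab (Continuous.intervalIntegrable (by fun_prop) _ _)
      (Continuous.intervalIntegrable (by fun_prop) _ _) fun s hs => ?_
    rw [norm_smul]
    exact mul_le_of_le_one_left (norm_nonneg _) (hle s hs.2)
  · rw [norm_smul]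
    exact mul_le_of_le_one_left (norm_nonneg _) (hle a hab)

theorem norm_le_exp_of_hasDerivAt_of_le {A : ℝ → V →L[ℂ] V} {y f : ℝ → V} (hA : Continuous A)
    (hf : Continuous f) (hy : ∀ x, HasDerivAt y (A x (y x) + f x) x) {K a b : ℝ} (hab : a ≤ b)
    (hK : ∀ x ∈ Set.uIcc a b, ‖A x‖ ≤ K) :
    ‖y b‖ ≤ (‖y a‖ + |∫ s in a..b, ‖f s‖|) * Real.exp (K * |b - a|) := by
  have hyc : Continuous y := continuous_iff_continuousAt.2 fun x => (hy x).continuousAt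
  rw [Set.uIcc_of_le hab] at hK
  have hK0 : 0 ≤ K := (norm_nonneg _).trans (hK a (Set.left_mem_Icc.2 hab))
  have hbase : ∀ x ∈ Set.Icc a b, ‖y x‖ ≤ ‖y a‖ + ∫ s in a..x, (K * ‖y s‖ + ‖f s‖) := by
    intro x hx
    have hg : Continuous fun s => A s (y s) + f s := (hA.clm_apply hyc).add hf
    refine (norm_le_of_hasDerivAt_dissipative (α := 0) le_rfl hg (by simpa using hy) hx.1).trans
      (add_le_add le_rfl ?_)
    refine intervalIntegral.integral_mono_on hx.1 (hg.norm.intervalIntegrable _ _)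
      (Continuous.intervalIntegrable (by fun_prop) _ _) fun s hs => ?_
    refine (norm_add_le _ _).trans (add_le_add ((A s).le_opNorm _ |>.trans ?_) le_rfl)
    exact mul_le_mul_of_nonneg_right (hK s ⟨hs.1, hs.2.trans hx.2⟩) (norm_nonneg _)
  have := gronwall_integral hyc.norm continuous_const hf.norm (fun _ => hK0)
    (fun _ => norm_nonneg _) hab hbase
  rw [intervalIntegral.integral_const, smul_eq_mul] at this
  rwa [abs_of_nonneg (intervalIntegral.integral_nonneg hab fun _ _ => norm_nonneg _),
    abs_of_nonneg (sub_nonneg.2 hab), mul_comm K]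

theorem norm_le_exp_of_hasDerivAt {A : ℝ → V →L[ℂ] V} {y f : ℝ → V} (hA : Continuous A)
    (hf : Continuous f) (hy : ∀ x, HasDerivAt y (A x (y x) + f x) x) {K a b : ℝ}
    (hK : ∀ x ∈ Set.uIcc a b, ‖A x‖ ≤ K) :
    ‖y b‖ ≤ (‖y a‖ + |∫ s in a..b, ‖f s‖|) * Real.exp (K * |b - a|) := by
  rcases le_total a b with hab | hab
  · exact norm_le_exp_of_hasDerivAt_of_le hA hf hy hab hK
  -- For b ≤ a, reflecting x ↦ -x turns the backward estimate into the forward one.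
  · have h := norm_le_exp_of_hasDerivAt_of_le (A := fun x => -A (-x)) (f := fun x => -f (-x))
      (y := fun x => y (-x)) (by fun_prop) (by fun_prop)
      (fun x => by
        have := (hy (-x)).scomp x (hasDerivAt_neg x)
        convert this using 1
        · rfl
        · simp [add_comm]) (K := K) (neg_le_neg hab)
      (fun x hx => by
        rw [norm_neg]; apply hK
        rw [Set.uIcc_of_le (neg_le_neg hab)] at hx
        rw [Set.uIcc_of_ge hab]
        exact ⟨by linarith [hx.2], by linarith [hx.1]⟩)
    simp only [neg_neg, norm_neg] at h
    rw [intervalIntegral.integral_comp_neg (fun s => ‖f s‖)] at h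
    simp only [neg_neg] at h
    rwa [intervalIntegral.integral_symm, abs_neg, ← abs_neg (-b - -a), neg_sub, neg_sub_neg] at h

end Dissipative

/-! ### Linear ordinary differential equations -/

section LinearODE
variable {V : Type*} [NormedAddCommGroup V] [NormedSpace ℂ V] [CompleteSpace V]

theorem linear_ode_unique {A : ℝ → V →L[ℂ] V} (hA : Continuous A) {y z : ℝ → V}
    (hy : ∀ x, HasDerivAt y (A x (y x)) x) (hz : ∀ x, HasDerivAt z (A x (z x)) x) {a : ℝ}
    (h : y a = z a) : y = z := by
  funext b
  obtain ⟨K, hK⟩ := (isCompact_uIcc (a := a) (b := b)).exists_bound_of_continuousOn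
    hA.continuousOn
  have := norm_le_exp_of_hasDerivAt (f := fun _ => 0) (y := fun x => y x - z x) hA
    continuous_const (fun x => by simpa using (hy x).fun_sub (hz x)) hK
  simpa [h, sub_eq_zero] using this

/-- The terms of the Picard series of `y' = A y`, `y a = v`. -/
noncomputable def picardTerm (A : ℝ → V →L[ℂ] V) (a : ℝ) (v : V) : ℕ → ℝ → V
  | 0 => fun _ => v
  | n + 1 => fun x => ∫ s in a..x, A s (picardTerm A a v n s)

theorem continuous_picardTerm {A : ℝ → V →L[ℂ] V} (hA : Continuous A) (a : ℝ) (v : V) (n : ℕ) :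
    Continuous (picardTerm A a v n) := by
  induction n with
  | zero => exact continuous_const
  | succ n ih =>
    exact continuous_iff_continuousAt.2 fun x =>
      ((hA.clm_apply ih).integral_hasStrictDerivAt a x).hasDerivAt.continuousAt

theorem norm_picardTerm_le {A : ℝ → V →L[ℂ] V} (hA : Continuous A) (a : ℝ) (v : V) {K R : ℝ}
    (hK0 : 0 ≤ K) (hK : ∀ x, |x - a| ≤ R → ‖A x‖ ≤ K) (n : ℕ) (x : ℝ) (hx : |x - a| ≤ R) :
    ‖picardTerm A a v n x‖ ≤ ‖v‖ * ((K * |x - a|) ^ n / n.factorial) := by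
  induction n generalizing x with
  | zero => simp [picardTerm]
  | succ n ih =>
    have hc : Continuous fun s => A s (picardTerm A a v n s) :=
      hA.clm_apply (continuous_picardTerm hA a v n)
    calc ‖picardTerm A a v (n + 1) x‖ ≤ ∫ s in Set.uIoc a x, ‖A s (picardTerm A a v n s)‖ :=
        intervalIntegral.norm_integral_le_integral_norm_uIoc
      _ ≤ ∫ s in Set.uIoc a x, K * (‖v‖ * (K ^ n / n.factorial)) * |s - a| ^ n := by
        refine setIntegral_mono_on ?_ ?_ measurableSet_uIoc fun s hs => ?_
        · exact intervalIntegrable_iff.1 (hc.norm.intervalIntegrable _ _)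
        · exact intervalIntegrable_iff.1 (Continuous.intervalIntegrable (by fun_prop) _ _)
        · have hs' : |s - a| ≤ R :=
            (Set.abs_sub_left_of_mem_uIcc (Set.uIoc_subset_uIcc hs)).trans hx
          refine ((A s).le_opNorm _).trans ?_
          calc ‖A s‖ * ‖picardTerm A a v n s‖
              ≤ K * (‖v‖ * ((K * |s - a|) ^ n / n.factorial)) :=
              mul_le_mul (hK s hs') (ih s hs') (norm_nonneg _) hK0
            _ = _ := by rw [mul_pow]; ring
      _ = _ := by
        rw [integral_const_mul, integral_pow_abs_sub_uIoc, Nat.factorial_succ, mul_pow]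
        push_cast
        have : (n.factorial : ℝ) ≠ 0 := by positivity
        have : (n : ℝ) + 1 ≠ 0 := by positivity
        field_simp
        ring

/-- The factorial decay of the Picard terms beats any bound of A on a compact interval, so the
series converges, and can be differentiated term by term, near every x. Linearity makes the solution
global. -/
theorem exists_linear_ode_solution {A : ℝ → V →L[ℂ] V} (hA : Continuous A) (a : ℝ) (v : V) :
    ∃ y : ℝ → V, y a = v ∧ ∀ x, HasDerivAt y (A x (y x)) x := by
  have ha : ∀ n, picardTerm A a v (n + 1) a = 0 := fun n => by simp [picardTerm]
  have hd : ∀ n x, HasDerivAt (picardTerm A a v (n + 1)) (A x (picardTerm A a v n x)) x :=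
    fun n x => ((hA.clm_apply (continuous_picardTerm hA a v n)).integral_hasStrictDerivAt
      a x).hasDerivAt
  refine ⟨fun x => v + ∑' n, picardTerm A a v (n + 1) x, by simp [ha], fun x => ?_⟩
  set R := |x - a| + 1 with hR
  obtain ⟨K, hK⟩ := (isCompact_closedBall a R).exists_bound_of_continuousOn hA.continuousOn
  have hK' : ∀ x, |x - a| ≤ R → ‖A x‖ ≤ K := fun x hx => hK x (by simpa [Real.dist_eq] using hx)
  have hK0 : 0 ≤ K := (norm_nonneg _).trans (hK' a (by simp [hR]; positivity))
  have hsum : Summable fun n : ℕ => ‖v‖ * ((K * R) ^ n / n.factorial) :=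
    (Real.summable_pow_div_factorial _).mul_left _
  have hb : ∀ n y, |y - a| ≤ R → ‖picardTerm A a v n y‖ ≤ ‖v‖ * ((K * R) ^ n / n.factorial) := by
    intro n y hy
    refine (norm_picardTerm_le hA a v hK0 hK' n y hy).trans ?_
    gcongr
  have hx : x ∈ Metric.ball a R := by simp [Real.dist_eq, hR]
  have hs0 : Summable fun n => picardTerm A a v n x :=
    Summable.of_norm_bounded hsum fun n => hb n x (by simp [hR])
  have key := hasDerivAt_tsum_of_isPreconnected (g := fun n => picardTerm A a v (n + 1))
    (g' := fun n y => A y (picardTerm A a v n y)) (hsum.mul_left K) Metric.isOpen_ball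
    (convex_ball a R).isPreconnected (fun n y _ => hd n y)
    (fun n y hy => by
      have hy' : |y - a| ≤ R := by
        rw [Metric.mem_ball, Real.dist_eq] at hy; exact hy.le
      exact ((A y).le_opNorm _).trans (mul_le_mul (hK' y hy') (hb n y hy') (norm_nonneg _) hK0))
    (Metric.mem_ball_self (by positivity : 0 < R))
    (by simp only [ha]; exact summable_zero) hx
  convert key.const_add v using 1
  rw [← (A x).map_tsum hs0, hs0.tsum_eq_zero_add]
  simp [picardTerm]

end LinearODE

/-! ### Dependence on parameters -/

section Param
variable {𝕜 : Type*} [RCLike 𝕜]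

/-- First-order Taylor expansion in a parameter, uniform for `x` in a compact interval. -/
theorem eventually_norm_sub_sub_smul_le {E : Type*} [NormedAddCommGroup E] [NormedSpace 𝕜 E]
    {F F' : 𝕜 → ℝ → E} (hF : ∀ p x, HasDerivAt (fun p => F p x) (F' p x) p)
    (hF' : Continuous (Function.uncurry F')) (p₀ : 𝕜) (a b : ℝ) {ε : ℝ} (hε : 0 < ε) :
    ∀ᶠ p in 𝓝 p₀, ∀ x ∈ Set.uIcc a b,
      ‖F p x - F p₀ x - (p - p₀) • F' p₀ x‖ ≤ ε * ‖p - p₀‖ := by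
  have h1 : ∀ᶠ p in 𝓝 p₀, ∀ x ∈ Set.uIcc a b, ‖F' p x - F' p₀ x‖ < ε := by
    refine isCompact_uIcc.eventually_forall_of_forall_eventually fun x _ => ?_
    have hc : Continuous fun w : 𝕜 × ℝ => ‖F' w.1 w.2 - F' p₀ w.2‖ :=
      (hF'.sub (hF'.comp (Continuous.prodMk_right p₀ |>.comp continuous_snd))).norm
    exact hc.continuousAt.eventually_lt continuousAt_const (by simpa using hε)
  obtain ⟨δ, hδ, hb⟩ := Metric.eventually_nhds_iff_ball.1 h1
  filter_upwards [Metric.ball_mem_nhds p₀ hδ] with p hp x hx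
  have := Convex.norm_image_sub_le_of_norm_hasDerivWithin_le
    (f := fun p => F p x - (p - p₀) • F' p₀ x) (f' := fun p => F' p x - F' p₀ x)
    (s := Metric.ball p₀ δ) (x := p₀) (y := p) (C := ε)
    (fun p _ => by
      have := (hF p x).fun_sub (((hasDerivAt_id p).sub_const p₀).smul_const (F' p₀ x))
      simpa using this.hasDerivWithinAt)
    (fun p hp => (hb p hp x hx).le) (convex_ball _ _) (Metric.mem_ball_self hδ) hp
  simp only [sub_self, zero_smul, sub_zero] at this
  convert this using 2
  abel

variable {V : Type*} [NormedAddCommGroup V] [NormedSpace ℂ V] [CompleteSpace V] [NormedSpace 𝕜 V]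
  [NormedAlgebra 𝕜 ℂ] [IsScalarTower 𝕜 ℂ V]

/-- Differentiable dependence on a parameter of the solutions of a linear equation: the derivative
is the solution `G` of the linearized equation. -/
theorem hasDerivAt_param_of_linear_ode {A A' : 𝕜 → ℝ → V →L[ℂ] V} {Y : 𝕜 → ℝ → V} {G : ℝ → V}
    {p₀ : 𝕜} (hAd : ∀ p x, HasDerivAt (fun p => A p x) (A' p x) p)
    (hA : Continuous (Function.uncurry A)) (hA' : Continuous (Function.uncurry A'))
    (hY : ∀ p x, HasDerivAt (Y p) (A p x (Y p x)) x)
    (hG : ∀ x, HasDerivAt G (A p₀ x (G x) + A' p₀ x (Y p₀ x)) x) {a : ℝ}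
    (ha : HasDerivAt (fun p => Y p a) (G a) p₀) (b : ℝ) :
    HasDerivAt (fun p => Y p b) (G b) p₀ := by
  have hYc : ∀ p, Continuous (Y p) := fun p =>
    continuous_iff_continuousAt.2 fun x => (hY p x).continuousAt
  have hGc : Continuous G := continuous_iff_continuousAt.2 fun x => (hG x).continuousAt
  have hAc : ∀ p, Continuous (A p) := fun p => hA.comp (Continuous.prodMk_right p)
  have hAc' : ∀ p, Continuous (A' p) := fun p => hA'.comp (Continuous.prodMk_right p)
  obtain ⟨K, hK⟩ := (isCompact_uIcc (a := a) (b := b)).exists_bound_of_continuousOn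
    (hAc p₀).continuousOn
  obtain ⟨M₁, hM₁⟩ := (isCompact_uIcc (a := a) (b := b)).exists_bound_of_continuousOn
    (hYc p₀).continuousOn
  obtain ⟨M₂, hM₂⟩ := (isCompact_uIcc (a := a) (b := b)).exists_bound_of_continuousOn
    hGc.continuousOn
  have hM₁0 : 0 ≤ M₁ := (norm_nonneg _).trans (hM₁ a Set.left_mem_uIcc)
  have hM₂0 : 0 ≤ M₂ := (norm_nonneg _).trans (hM₂ a Set.left_mem_uIcc)
  have hclose : ∀ η > 0, ∀ᶠ p in 𝓝 p₀, ∀ x ∈ Set.uIcc a b, ‖A p x - A p₀ x‖ ≤ η := by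
    intro η hη
    have : ∀ᶠ p in 𝓝 p₀, ∀ x ∈ Set.uIcc a b, ‖A p x - A p₀ x‖ < η := by
      refine isCompact_uIcc.eventually_forall_of_forall_eventually fun x _ => ?_
      have hc : Continuous fun w : 𝕜 × ℝ => ‖A w.1 w.2 - A p₀ w.2‖ :=
        (hA.sub (hA.comp (Continuous.prodMk_right p₀ |>.comp continuous_snd))).norm
      exact hc.continuousAt.eventually_lt continuousAt_const (by simpa using hη)
    exact this.mono fun p hp x hx => (hp x hx).le
  -- C collects the initial error, the forcing and the Grönwall factor. Errors of relative size c /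
  -- C in the data and in the coefficients therefore give a remainder of relative size c.
  set C := (1 + (M₁ + M₂) * |b - a|) * Real.exp ((K + 1) * |b - a|) with hC
  have hC0 : 0 < C := by positivity
  rw [hasDerivAt_iff_isLittleO, Asymptotics.isLittleO_iff]
  intro c hc
  have hη : 0 < c / C := div_pos hc hC0
  have hη1 : 0 < min (c / C) 1 := lt_min hη one_pos
  rw [hasDerivAt_iff_isLittleO, Asymptotics.isLittleO_iff] at ha
  filter_upwards [ha hη, hclose _ hη1, eventually_norm_sub_sub_smul_le hAd hA' p₀ a b hη]
    with p hpa hpc hpd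
  -- The parameter field is ℝ for the time variable and ℂ for the spectral one; the increment is
  -- moved into ℂ so that it commutes with the ℂ-linear coefficients.
  set γ : ℂ := algebraMap 𝕜 ℂ (p - p₀) with hγ
  have hγn : ‖γ‖ = ‖p - p₀‖ := norm_algebraMap' ℂ _
  have hsm : ∀ w : V, (p - p₀) • w = γ • w := fun w => (algebraMap_smul ℂ (p - p₀) w).symm
  have hsm' : ∀ w : V →L[ℂ] V, (p - p₀) • w = γ • w := fun w =>
    (algebraMap_smul ℂ (p - p₀) w).symm
  set f : ℝ → V := fun x => (A p x - A p₀ x - γ • A' p₀ x) (Y p₀ x)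
    + γ • (A p x - A p₀ x) (G x) with hf
  have hfc : Continuous f := by
    have h1 := hAc p
    have h2 := hAc p₀
    have h3 := hAc' p₀
    have h4 := hYc p₀
    fun_prop
  -- The first-order Taylor remainder solves the equation with parameter p and a forcing f that is
  -- small compared with the increment of the parameter.
  have hE : ∀ x, HasDerivAt (fun x => Y p x - Y p₀ x - γ • G x)
      (A p x (Y p x - Y p₀ x - γ • G x) + f x) x := by
    intro x
    convert ((hY p x).fun_sub (hY p₀ x)).fun_sub ((hG x).const_smul γ) using 1
    · rfl
    · simp only [hf, map_sub, _root_.sub_apply, _root_.smul_apply, map_smul]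
      module
  have hfb : ∀ x ∈ Set.uIcc a b, ‖f x‖ ≤ c / C * (M₁ + M₂) * ‖p - p₀‖ := by
    intro x hx
    have h1 : ‖(A p x - A p₀ x - γ • A' p₀ x) (Y p₀ x)‖ ≤ (c / C * ‖p - p₀‖) * M₁ :=
      (ContinuousLinearMap.le_opNorm _ _).trans
        (mul_le_mul (hsm' (A' p₀ x) ▸ hpd x hx) (hM₁ x hx) (norm_nonneg _) (by positivity))
    have h2 : ‖(A p x - A p₀ x) (G x)‖ ≤ c / C * M₂ :=
      (ContinuousLinearMap.le_opNorm _ _).trans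
        (mul_le_mul ((hpc x hx).trans (min_le_left _ _)) (hM₂ x hx) (norm_nonneg _) hη.le)
    refine (norm_add_le _ _).trans ?_
    rw [norm_smul, hγn]
    nlinarith [norm_nonneg (p - p₀)]
  have hKp : ∀ x ∈ Set.uIcc a b, ‖A p x‖ ≤ K + 1 := fun x hx => by
    have h1 := hK x hx
    have h2 := (hpc x hx).trans (min_le_right _ _)
    have h3 := norm_add_le (A p₀ x) (A p x - A p₀ x)
    rw [add_sub_cancel] at h3
    linarith
  have hfin := norm_le_exp_of_hasDerivAt (hAc p) hfc hE hKp
  have hint : |∫ s in a..b, ‖f s‖| ≤ c / C * (M₁ + M₂) * ‖p - p₀‖ * |b - a| := by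
    have := intervalIntegral.norm_integral_le_of_norm_le_const (a := a) (b := b)
      (f := fun s => ‖f s‖) (C := c / C * (M₁ + M₂) * ‖p - p₀‖)
      fun x hx => by simpa using hfb x (Set.uIoc_subset_uIcc hx)
    simpa using this
  simp only [hsm] at hpa ⊢
  calc ‖Y p b - Y p₀ b - γ • G b‖
      ≤ (c / C * ‖p - p₀‖ + c / C * (M₁ + M₂) * ‖p - p₀‖ * |b - a|)
        * Real.exp ((K + 1) * |b - a|) :=
        hfin.trans (mul_le_mul_of_nonneg_right (add_le_add hpa hint) (Real.exp_pos _).le)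
    _ = c / C * C * ‖p - p₀‖ := by rw [hC]; ring
    _ = c * ‖p - p₀‖ := by rw [div_mul_cancel₀ _ hC0.ne']

end Param

/-! ### The Lax pair and its fundamental solution -/

/-- The algebra of operators on `ℂ²`. -/
abbrev Op : Type := (Fin 2 → ℂ) →L[ℂ] (Fin 2 → ℂ)

/-- A matrix as a continuous linear map. -/
noncomputable def matOp : Matrix (Fin 2) (Fin 2) ℂ →ₗ[ℂ] Op :=
  (Matrix.toLin'.trans LinearMap.toContinuousLinearMap).toLinearMap

theorem matOp_apply (M : Matrix (Fin 2) (Fin 2) ℂ) (v : Fin 2 → ℂ) : matOp M v = M *ᵥ v := rfl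

theorem matOp_mul (M N : Matrix (Fin 2) (Fin 2) ℂ) : matOp (M * N) = matOp M ∘L matOp N := by
  ext1 v
  change (M * N) *ᵥ v = M *ᵥ (N *ᵥ v)
  rw [Matrix.mulVec_mulVec]

section LinearMat
variable {F : Type*} [NormedAddCommGroup F] [NormedSpace ℂ F] (L : Matrix (Fin 2) (Fin 2) ℂ →ₗ[ℂ] F)

/-- Reduces the regularity of L applied to a matrix function to that of its four entries, for any
linear L; below L is both the action on vectors and left multiplication on operators. -/
theorem map_mat_eq (a b c d : ℂ) : L !![a, b; c, d] =
    a • L !![1, 0; 0, 0] + b • L !![0, 1; 0, 0] + c • L !![0, 0; 1, 0] + d • L !![0, 0; 0, 1] := by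
  simp only [← LinearMap.map_smul, ← LinearMap.map_add]
  congr 1
  ext i j
  fin_cases i <;> fin_cases j <;> simp

theorem continuous_map_mat {X : Type*} [TopologicalSpace X] {a b c d : X → ℂ} (ha : Continuous a)
    (hb : Continuous b) (hc : Continuous c) (hd : Continuous d) :
    Continuous fun x => L !![a x, b x; c x, d x] := by
  simp only [map_mat_eq L (a _)]
  fun_prop

theorem hasDerivAt_map_mat {𝕜 : Type*} [RCLike 𝕜] [NormedAlgebra 𝕜 ℂ] [NormedSpace 𝕜 F]
    [IsScalarTower 𝕜 ℂ F] {a b c d : 𝕜 → ℂ} {a' b' c' d' : ℂ} {p : 𝕜}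
    (ha : HasDerivAt a a' p) (hb : HasDerivAt b b' p) (hc : HasDerivAt c c' p)
    (hd : HasDerivAt d d' p) :
    HasDerivAt (fun x => L !![a x, b x; c x, d x]) (L !![a', b'; c', d']) p := by
  simp only [map_mat_eq L (a _), map_mat_eq L a']
  exact (((ha.smul_const _).fun_add (hb.smul_const _)).fun_add (hc.smul_const _)).fun_add
    (hd.smul_const _)

end LinearMat

/-- Left multiplication by a matrix. -/
noncomputable def leftMat : Matrix (Fin 2) (Fin 2) ℂ →ₗ[ℂ] (Op →L[ℂ] Op) :=
  (ContinuousLinearMap.compL ℂ (Fin 2 → ℂ) (Fin 2 → ℂ) (Fin 2 → ℂ)).toLinearMap.comp matOp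

theorem laxX_eq (u k : ℂ) : laxX u k = !![I * k ^ 2, k * u; -(k * conj u), -(I * k ^ 2)] := by
  ext i j
  fin_cases i <;> fin_cases j <;> simp [laxX, sigma3, Qmat]

/-- The time part `T = -(2 k² - |u|²) X + i k σ₃ Q_x` of the Lax pair, with `v = u_x`. -/
noncomputable def laxT (u v k : ℂ) : Matrix (Fin 2) (Fin 2) ℂ :=
  !![-(2 * k ^ 2 - u * conj u) * (I * k ^ 2), -(2 * k ^ 2 - u * conj u) * (k * u) + I * k * v;
    (2 * k ^ 2 - u * conj u) * (k * conj u) + I * k * conj v, (2 * k ^ 2 - u * conj u) * (I * k ^ 2)]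

/-- The `x`-derivative of `laxT`, with `w = u_xx`. -/
noncomputable def laxTx (u v w k : ℂ) : Matrix (Fin 2) (Fin 2) ℂ :=
  !![(v * conj u + u * conj v) * (I * k ^ 2),
    (v * conj u + u * conj v) * (k * u) - (2 * k ^ 2 - u * conj u) * (k * v) + I * k * w;
    -(v * conj u + u * conj v) * (k * conj u) + (2 * k ^ 2 - u * conj u) * (k * conj v)
      + I * k * conj w, -(v * conj u + u * conj v) * (I * k ^ 2)]

/-- The zero-curvature identity, with `s = u_t`. -/
theorem zero_curvature {u v w s k : ℂ} (h : s = I * w + (2 * u * conj u * v + u ^ 2 * conj v)) :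
    laxTx u v w k + laxT u v k * laxX u k =
      laxX u k * laxT u v k + !![0, k * s; -(k * conj s), 0] := by
  have h' : conj s = -I * conj w + (2 * u * conj u * conj v + conj u ^ 2 * v) := by
    rw [h]
    simp only [map_add, map_mul, map_pow, conj_I, Complex.conj_conj, map_ofNat]
    ring
  have hI : I ^ 2 = -1 := I_sq
  rw [laxX_eq, laxTx, laxT, h', h]
  simp only [Matrix.mul_fin_two, Matrix.of_add_of, Matrix.cons_add_cons, Matrix.empty_add_empty,
    EmbeddingLike.apply_eq_iff_eq, Matrix.vecCons_inj, and_true]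
  refine ⟨⟨?_, ?_⟩, ?_, ?_⟩
  · ring
  · linear_combination (-2 * k ^ 3 * v) * hI
  · linear_combination (2 * k ^ 3 * conj v) * hI
  · ring

/-- The forcing becomes part of a homogeneous equation on V × ℂ whose last component stays equal to
one. -/
theorem exists_linear_ode_solution_inhomogeneous {V : Type*} [NormedAddCommGroup V]
    [NormedSpace ℂ V] [CompleteSpace V] {A : ℝ → V →L[ℂ] V} {f : ℝ → V} (hA : Continuous A)
    (hf : Continuous f) (a : ℝ) (v : V) :
    ∃ y : ℝ → V, y a = v ∧ ∀ x, HasDerivAt y (A x (y x) + f x) x := by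
  have hB : Continuous fun x => ((A x).coprod ((ContinuousLinearMap.toSpanSingleton ℂ (f x)))).prod
      (0 : V × ℂ →L[ℂ] ℂ) := by
    have h1 : Continuous fun x => (A x) ∘L ContinuousLinearMap.fst ℂ V ℂ :=
      hA.clm_comp continuous_const
    have h2 : Continuous fun x => (ContinuousLinearMap.snd ℂ V ℂ).smulRight (f x) :=
      (ContinuousLinearMap.smulRightL ℂ (V × ℂ) V
        (ContinuousLinearMap.snd ℂ V ℂ)).continuous.comp hf
    have h3 : Continuous fun x => (ContinuousLinearMap.inl ℂ V ℂ) ∘L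
        ((A x) ∘L ContinuousLinearMap.fst ℂ V ℂ + (ContinuousLinearMap.snd ℂ V ℂ).smulRight (f x)) :=
      continuous_const.clm_comp (h1.add h2)
    refine h3.congr fun x => ?_
    ext w <;> simp
  obtain ⟨Y, hYa, hY⟩ := exists_linear_ode_solution hB a (v, (1 : ℂ))
  have h2 : ∀ x, (Y x).2 = 1 := by
    have hd : ∀ x, HasDerivAt (fun x => (Y x).2) 0 x := fun x => by
      have := (ContinuousLinearMap.snd ℝ V ℂ).hasFDerivAt.comp_hasDerivAt x (hY x)
      exact this.congr_deriv (by simp)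
    intro x
    have := is_const_of_deriv_eq_zero (fun x => (hd x).differentiableAt) (fun x => (hd x).deriv) x a
    rw [this, hYa]
  refine ⟨fun x => (Y x).1, by simp [hYa], fun x => ?_⟩
  exact ((ContinuousLinearMap.fst ℝ V ℂ).hasFDerivAt.comp_hasDerivAt x (hY x)).congr_deriv
    (by simp [h2])

/-! ### Derivatives of the potential -/

section Solution
variable {q : ℝ → ℝ → ℂ}

theorem IsSolution.hasDerivAt_x (hq : IsSolution q) (x t : ℝ) :
    HasDerivAt (fun y => q y t) (deriv (fun y => q y t) x) x := by
  have h : ContDiff ℝ 2 (fun y => q y t) := hq.1.comp (contDiff_id.prodMk contDiff_const)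
  exact (h.differentiable (by norm_num) x).hasDerivAt

theorem IsSolution.contDiff_x (hq : IsSolution q) (t : ℝ) : ContDiff ℝ 2 (fun y => q y t) :=
  hq.1.comp (contDiff_id.prodMk contDiff_const)

theorem IsSolution.contDiff_t (hq : IsSolution q) (x : ℝ) : ContDiff ℝ 2 (fun s => q x s) :=
  hq.1.comp (contDiff_const.prodMk contDiff_id)

theorem hasDerivAt_deriv_of_contDiff_two {u : ℝ → ℂ} (hu : ContDiff ℝ 2 u) (x : ℝ) :
    HasDerivAt (deriv u) (deriv (deriv u) x) x := by
  have h : ContDiff ℝ (1 + 1) u := by rw [one_add_one_eq_two]; exact hu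
  exact ((contDiff_succ_iff_deriv.1 h).2.2.differentiable (by norm_num) x).hasDerivAt

theorem continuous_deriv_deriv_of_contDiff_two {u : ℝ → ℂ} (hu : ContDiff ℝ 2 u) :
    Continuous (deriv (deriv u)) := by
  have h : ContDiff ℝ (1 + 1) u := by rw [one_add_one_eq_two]; exact hu
  exact (contDiff_succ_iff_deriv.1 h).2.2.continuous_deriv (by norm_num)

theorem IsSolution.hasDerivAt_xx (hq : IsSolution q) (x t : ℝ) :
    HasDerivAt (deriv (fun y => q y t)) (deriv (deriv (fun y => q y t)) x) x :=
  hasDerivAt_deriv_of_contDiff_two (hq.contDiff_x t) x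

theorem IsSolution.hasDerivAt_t (hq : IsSolution q) (x t : ℝ) :
    HasDerivAt (fun s => q x s) (deriv (fun s => q x s) t) t :=
  ((hq.contDiff_t x).differentiable (by norm_num) t).hasDerivAt

theorem IsSolution.deriv_x_eq (hq : IsSolution q) (x t : ℝ) :
    deriv (fun y => q y t) x = fderiv ℝ (Function.uncurry q) (x, t) (1, 0) := by
  have h := (hq.1.differentiable (by norm_num) (x, t)).hasFDerivAt
  have h2 : HasDerivAt (fun y : ℝ => (y, t)) ((1 : ℝ), (0 : ℝ)) x :=
    (hasDerivAt_id x).prodMk (hasDerivAt_const x t)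
  exact (h.comp_hasDerivAt x h2).deriv

theorem IsSolution.deriv_t_eq (hq : IsSolution q) (x t : ℝ) :
    deriv (fun s => q x s) t = fderiv ℝ (Function.uncurry q) (x, t) (0, 1) := by
  have h := (hq.1.differentiable (by norm_num) (x, t)).hasFDerivAt
  have h2 : HasDerivAt (fun s : ℝ => (x, s)) ((0 : ℝ), (1 : ℝ)) t :=
    (hasDerivAt_const t x).prodMk (hasDerivAt_id t)
  exact (h.comp_hasDerivAt t h2).deriv

theorem IsSolution.continuous_q (hq : IsSolution q) : Continuous fun p : ℝ × ℝ => q p.1 p.2 :=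
  hq.1.continuous

theorem IsSolution.continuous_qx (hq : IsSolution q) :
    Continuous fun p : ℝ × ℝ => deriv (fun y => q y p.2) p.1 := by
  simp only [hq.deriv_x_eq]
  exact (hq.1.continuous_fderiv (by norm_num)).clm_apply continuous_const

theorem IsSolution.continuous_qt (hq : IsSolution q) :
    Continuous fun p : ℝ × ℝ => deriv (fun s => q p.1 s) p.2 := by
  simp only [hq.deriv_t_eq]
  exact (hq.1.continuous_fderiv (by norm_num)).clm_apply continuous_const

/-- The equation solved for `q_t`. -/
theorem IsSolution.deriv_t_eq_of_equation (hq : IsSolution q) (x t : ℝ) :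
    deriv (fun s => q x s) t = I * deriv (deriv (fun y => q y t)) x
      + (2 * q x t * conj (q x t) * deriv (fun y => q y t) x
        + q x t ^ 2 * conj (deriv (fun y => q y t) x)) := by
  have h := hq.2 x t
  have hx := hq.hasDerivAt_x x t
  have h1 : (fun y => ((‖q y t‖ : ℂ) ^ 2) * q y t) = fun y => (q y t * conj (q y t)) * q y t := by
    funext y; rw [Complex.mul_conj, Complex.normSq_eq_norm_sq]; push_cast; ring
  have hc : HasDerivAt (fun y => conj (q y t)) (conj (deriv (fun y => q y t) x)) x := hx.star
  rw [h1, ((hx.fun_mul hc).fun_mul hx).deriv] at h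
  have hI : I ^ 2 = -1 := I_sq
  linear_combination (-I) * h + (deriv (fun s => q x s) t - ((deriv (fun y => q y t) x *
    conj (q x t) + q x t * conj (deriv (fun y => q y t) x)) * q x t
    + q x t * conj (q x t) * deriv (fun y => q y t) x)) * hI

/-! ### The flow of the Lax pair -/

theorem hasDerivAt_laxT (hq : IsSolution q) (k : ℂ) {F : Type*} [NormedAddCommGroup F]
    [NormedSpace ℂ F] (L : Matrix (Fin 2) (Fin 2) ℂ →ₗ[ℂ] F) (x t : ℝ) :
    HasDerivAt (fun y => L (laxT (q y t) (deriv (fun y => q y t) y) k))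
      (L (laxTx (q x t) (deriv (fun y => q y t) x) (deriv (deriv (fun y => q y t)) x) k)) x := by
  have hx := hq.hasDerivAt_x x t
  have hc : HasDerivAt (fun y => conj (q y t)) (conj (deriv (fun y => q y t) x)) x := hx.star
  have hxx := hq.hasDerivAt_xx x t
  have hcc : HasDerivAt (fun y => conj (deriv (fun y => q y t) y))
    (conj (deriv (deriv (fun y => q y t)) x)) x := hxx.star
  have hn := (hx.fun_mul hc).const_sub (2 * k ^ 2)
  refine hasDerivAt_map_mat L ?_ ?_ ?_ ?_
  · exact (hn.fun_neg.mul_const (I * k ^ 2)).congr_deriv (by ring)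
  · exact ((hn.fun_neg.fun_mul (hx.const_mul k)).fun_add (hxx.const_mul (I * k))).congr_deriv (by ring)
  · exact ((hn.fun_mul (hc.const_mul k)).fun_add (hcc.const_mul (I * k))).congr_deriv (by ring)
  · exact (hn.mul_const (I * k ^ 2)).congr_deriv (by ring)

/-- The `k`-derivative of `laxX`. -/
noncomputable def laxXk (u k : ℂ) : Matrix (Fin 2) (Fin 2) ℂ :=
  !![I * (2 * k), u; -conj u, -(I * (2 * k))]

/-- The `k`-derivative of `laxT`. -/
noncomputable def laxTk (u v k : ℂ) : Matrix (Fin 2) (Fin 2) ℂ :=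
  !![-(8 * I * k ^ 3 - 2 * I * (u * conj u) * k), -(6 * k ^ 2 - u * conj u) * u + I * v;
    (6 * k ^ 2 - u * conj u) * conj u + I * conj v, 8 * I * k ^ 3 - 2 * I * (u * conj u) * k]

section Deriv
variable {F : Type*} [NormedAddCommGroup F] [NormedSpace ℂ F]
  (L : Matrix (Fin 2) (Fin 2) ℂ →ₗ[ℂ] F)

theorem hasDerivAt_laxX_k (u k : ℂ) : HasDerivAt (fun k => L (laxX u k)) (L (laxXk u k)) k := by
  simp only [laxX_eq]
  have h2 : HasDerivAt (fun k : ℂ => k ^ 2) (2 * k) k := by simpa using hasDerivAt_pow 2 k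
  have h1 := hasDerivAt_id' k
  refine hasDerivAt_map_mat L (h2.const_mul I) ?_ ?_ (h2.const_mul I).fun_neg
  · simpa using h1.mul_const u
  · simpa using (h1.mul_const (conj u)).fun_neg

theorem hasDerivAt_laxT_k (u v k : ℂ) : HasDerivAt (fun k => L (laxT u v k)) (L (laxTk u v k)) k := by
  have h2 : HasDerivAt (fun k : ℂ => k ^ 2) (2 * k) k := by simpa using hasDerivAt_pow 2 k
  have h1 := hasDerivAt_id' k
  have hn := (h2.const_mul 2).sub_const (u * conj u)
  refine hasDerivAt_map_mat L ?_ ?_ ?_ ?_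
  · exact (hn.fun_neg.fun_mul (h2.const_mul I)).congr_deriv (by ring)
  · exact ((hn.fun_neg.fun_mul (h1.mul_const u)).fun_add ((h1.const_mul I).mul_const v)).congr_deriv (by ring)
  · exact ((hn.fun_mul (h1.mul_const (conj u))).fun_add
      ((h1.const_mul I).mul_const (conj v))).congr_deriv (by ring)
  · exact (hn.fun_mul (h2.const_mul I)).congr_deriv (by ring)

theorem continuous_laxX {X : Type*} [TopologicalSpace X] {u k : X → ℂ} (hu : Continuous u)
    (hk : Continuous k) : Continuous fun x => L (laxX (u x) (k x)) := by
  simp only [laxX_eq]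
  have := Complex.continuous_conj.comp hu
  refine continuous_map_mat L ?_ ?_ ?_ ?_ <;> fun_prop

theorem continuous_laxT {X : Type*} [TopologicalSpace X] {u v k : X → ℂ} (hu : Continuous u)
    (hv : Continuous v) (hk : Continuous k) : Continuous fun x => L (laxT (u x) (v x) (k x)) := by
  have := Complex.continuous_conj.comp hu
  have := Complex.continuous_conj.comp hv
  refine continuous_map_mat L ?_ ?_ ?_ ?_ <;> fun_prop

theorem continuous_laxXk {X : Type*} [TopologicalSpace X] {u k : X → ℂ} (hu : Continuous u)
    (hk : Continuous k) : Continuous fun x => L (laxXk (u x) (k x)) := by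
  have := Complex.continuous_conj.comp hu
  refine continuous_map_mat L ?_ ?_ ?_ ?_ <;> fun_prop

theorem continuous_laxTk {X : Type*} [TopologicalSpace X] {u v k : X → ℂ} (hu : Continuous u)
    (hv : Continuous v) (hk : Continuous k) : Continuous fun x => L (laxTk (u x) (v x) (k x)) := by
  have := Complex.continuous_conj.comp hu
  have := Complex.continuous_conj.comp hv
  refine continuous_map_mat L ?_ ?_ ?_ ?_ <;> fun_prop

end Deriv

theorem hasDerivAt_op_comp {M W : ℝ → Op} {M' W' : Op} {x : ℝ} (hM : HasDerivAt M M' x)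
    (hW : HasDerivAt W W' x) : HasDerivAt (fun y => M y ∘L W y) (M' ∘L W x + M x ∘L W') x := by
  have h := ((isBoundedBilinearMap_comp (𝕜 := ℂ) (E := Fin 2 → ℂ) (F := Fin 2 → ℂ)
    (G := Fin 2 → ℂ)).hasFDerivAt (M x, W x)).restrictScalars ℝ
  exact (h.comp_hasDerivAt x (hM.prodMk hW)).congr_deriv (add_comm _ _)

/-- The fundamental solution of the Lax pair: it solves the `x`-equation and the `t`-equation and
is entire in `k`. -/
theorem exists_lax_flow (hq : IsSolution q) : ∃ W : ℂ → ℝ → ℝ → Op,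
    (∀ k, W k 0 0 = 1) ∧
    (∀ k x t, HasDerivAt (fun y => W k y t) (matOp (laxX (q x t) k) ∘L W k x t) x) ∧
    (∀ k x t, HasDerivAt (fun s => W k x s)
      (matOp (laxT (q x t) (deriv (fun y => q y t) x) k) ∘L W k x t) t) ∧
    (∀ x t, Differentiable ℂ fun k => W k x t) := by
  have cq := hq.continuous_q
  have cqx := hq.continuous_qx
  have cqt := hq.continuous_qt
  have cqs : ∀ t, Continuous fun x => q x t := fun t =>
    cq.comp (by fun_prop : Continuous fun x : ℝ => (x, t))
  have c0 : Continuous fun t => q 0 t := cq.comp (by fun_prop : Continuous fun t : ℝ => ((0 : ℝ), t))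
  have c0x : Continuous fun t => deriv (fun y => q y t) 0 :=
    cqx.comp (by fun_prop : Continuous fun t : ℝ => ((0 : ℝ), t))
  have hT0 : ∀ k, Continuous fun t => leftMat (laxT (q 0 t) (deriv (fun y => q y t) 0) k) := fun k =>
    continuous_laxT (F := Op →L[ℂ] Op) leftMat c0 c0x continuous_const
  have hX : ∀ k t, Continuous fun x => leftMat (laxX (q x t) k) := fun k t =>
    continuous_laxX (F := Op →L[ℂ] Op) leftMat (cqs t) continuous_const
  -- Integrate the time equation along x = 0, then the space equation from there at each fixed t.
  -- What remains is the time equation away from x = 0 and analyticity in k.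
  choose V hV0 hV using fun k => exists_linear_ode_solution (hT0 k) 0 (1 : Op)
  choose W hW0 hW using fun k t => exists_linear_ode_solution (hX k t) 0 (V k t)
  refine ⟨fun k x t => W k t x, fun k => by simp only [hW0, hV0], fun k x t => hW k t x,
    fun k x t => ?_, fun x t k => ?_⟩
  -- The candidate for ∂ₜW is T W. By zero curvature it solves the x-equation differentiated in t,
  -- and at x = 0 it has the right value; dependence on the parameter t then identifies it with ∂ₜW.
  · refine hasDerivAt_param_of_linear_ode (𝕜 := ℝ) (A := fun t x => leftMat (laxX (q x t) k))
      (A' := fun t x => leftMat !![0, k * deriv (fun s => q x s) t;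
        -(k * conj (deriv (fun s => q x s) t)), 0]) (Y := fun t x => W k t x)
      (G := fun x => leftMat (laxT (q x t) (deriv (fun y => q y t) x) k) (W k t x)) (a := 0)
      (fun s y => ?_) ?_ ?_ (fun s y => hW k s y) (fun y => ?_) ?_ x
    · simp only [laxX_eq]
      have h := hq.hasDerivAt_t y s
      exact hasDerivAt_map_mat (F := Op →L[ℂ] Op) leftMat (hasDerivAt_const _ _) (h.const_mul k)
        (h.star.const_mul k).fun_neg (hasDerivAt_const _ _)
    · exact continuous_laxX (F := Op →L[ℂ] Op) leftMat (cq.comp continuous_swap) continuous_const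
    · have h1 := cqt.comp (continuous_swap (X := ℝ) (Y := ℝ))
      have h2 := Complex.continuous_conj.comp h1
      exact continuous_map_mat (F := Op →L[ℂ] Op) leftMat continuous_const (continuous_const.mul h1)
        (continuous_const.mul h2).neg continuous_const
    · have h1 := hasDerivAt_op_comp (hasDerivAt_laxT hq k (F := Op) matOp y t) (hW k t y)
      have hz := congrArg matOp (zero_curvature (k := k) (hq.deriv_t_eq_of_equation y t))
      rw [map_add, map_add, matOp_mul, matOp_mul] at hz
      have := congrArg (fun Z : Op => Z ∘L W k t y) hz
      simp only [ContinuousLinearMap.add_comp, ContinuousLinearMap.comp_assoc] at this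
      exact h1.congr_deriv this
    · simp only [hW0]
      exact hV k t
  -- Analyticity in k follows the same two legs: the variational equation in t along x = 0, then the
  -- one in x with that derivative as initial value.
  · have hVk : ∀ t, ∃ V' : Op, HasDerivAt (fun k => V k t) V' k := by
      obtain ⟨G, hG0, hG⟩ := exists_linear_ode_solution_inhomogeneous (hT0 k)
        (f := fun t => leftMat (laxTk (q 0 t) (deriv (fun y => q y t) 0) k) (V k t))
        ((continuous_laxTk (F := Op →L[ℂ] Op) leftMat c0 c0x continuous_const).clm_apply
          (continuous_iff_continuousAt.2 fun t => (hV k t).continuousAt)) 0 0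
      intro t
      refine ⟨G t, hasDerivAt_param_of_linear_ode (𝕜 := ℂ)
        (A := fun k t => leftMat (laxT (q 0 t) (deriv (fun y => q y t) 0) k))
        (A' := fun k t => leftMat (laxTk (q 0 t) (deriv (fun y => q y t) 0) k))
        (fun k t => hasDerivAt_laxT_k (F := Op →L[ℂ] Op) leftMat _ _ _) ?_ ?_ (fun k t => hV k t) hG (a := 0) ?_ t⟩
      · exact continuous_laxT (F := Op →L[ℂ] Op) leftMat (c0.comp continuous_snd) (c0x.comp continuous_snd) continuous_fst
      · exact continuous_laxTk (F := Op →L[ℂ] Op) leftMat (c0.comp continuous_snd) (c0x.comp continuous_snd) continuous_fst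
      · simp only [hV0, hG0]
        exact hasDerivAt_const _ _
    obtain ⟨V', hV'⟩ := hVk t
    obtain ⟨G, hG0, hG⟩ := exists_linear_ode_solution_inhomogeneous (hX k t)
      (f := fun x => leftMat (laxXk (q x t) k) (W k t x))
      ((continuous_laxXk (F := Op →L[ℂ] Op) leftMat (cqs t) continuous_const).clm_apply
        (continuous_iff_continuousAt.2 fun x => (hW k t x).continuousAt)) 0 V'
    refine (hasDerivAt_param_of_linear_ode (𝕜 := ℂ) (A := fun k x => leftMat (laxX (q x t) k))
      (A' := fun k x => leftMat (laxXk (q x t) k)) (Y := fun k x => W k t x)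
      (fun k x => hasDerivAt_laxX_k (F := Op →L[ℂ] Op) leftMat _ _) ?_ ?_ (fun k x => hW k t x) hG (a := 0) ?_
      x).differentiableAt
    · exact continuous_laxX (F := Op →L[ℂ] Op) leftMat ((cqs t).comp continuous_snd) continuous_fst
    · exact continuous_laxXk (F := Op →L[ℂ] Op) leftMat ((cqs t).comp continuous_snd) continuous_fst
    · simp only [hW0, hG0]
      exact hV'

end Solution

/-! ### Wronskians -/

theorem Wr_smul_left (c : ℂ) (u v : Fin 2 → ℂ) : Wr (c • u) v = c * Wr u v := by
  simp [Wr]; ring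

theorem Wr_smul_right (c : ℂ) (u v : Fin 2 → ℂ) : Wr u (c • v) = c * Wr u v := by
  simp [Wr]; ring

theorem Wr_swap (u v : Fin 2 → ℂ) : Wr u v = -Wr v u := by
  simp [Wr]; ring

theorem Wr_self (u : Fin 2 → ℂ) : Wr u u = 0 := by
  simp [Wr]; ring

/-- Cramer's rule. -/
theorem Wr_smul_eq (u v w : Fin 2 → ℂ) : Wr u v • w = Wr w v • u + Wr u w • v := by
  ext i; fin_cases i <;> simp [Wr] <;> ring

theorem continuous_Wr : Continuous fun p : (Fin 2 → ℂ) × (Fin 2 → ℂ) => Wr p.1 p.2 := by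
  unfold Wr; fun_prop

theorem exists_smul_eq_of_Wr_eq_zero {u v : Fin 2 → ℂ} (hv : v ≠ 0) (h : Wr u v = 0) :
    ∃ c : ℂ, u = c • v := by
  by_cases h0 : v 0 = 0
  · have h1 : v 1 ≠ 0 := fun h1 => hv (by ext i; fin_cases i <;> simp [h0, h1])
    refine ⟨u 1 / v 1, ?_⟩
    have : u 0 = 0 := by
      simp only [Wr, h0, mul_zero, sub_zero, mul_eq_zero, h1, or_false] at h; exact h
    ext i; fin_cases i <;> simp [h0, h1, this]
  · refine ⟨u 0 / v 0, ?_⟩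
    ext i; fin_cases i
    · simp [h0]
    · simp only [Wr] at h
      simp; field_simp; linear_combination -h

theorem hasDerivAt_Wr {φ ψ : ℝ → Fin 2 → ℂ} {φ' ψ' : Fin 2 → ℂ} {x : ℝ}
    (hφ : HasDerivAt φ φ' x) (hψ : HasDerivAt ψ ψ' x) :
    HasDerivAt (fun y => Wr (φ y) (ψ y)) (Wr φ' (ψ x) + Wr (φ x) ψ') x := by
  rw [hasDerivAt_pi] at hφ hψ
  refine (((hφ 0).fun_mul (hψ 1)).fun_sub ((hφ 1).fun_mul (hψ 0))).congr_deriv ?_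
  simp [Wr]; ring

theorem Wr_mulVec_add (M : Matrix (Fin 2) (Fin 2) ℂ) (u v : Fin 2 → ℂ) :
    Wr (M *ᵥ u) v + Wr u (M *ᵥ v) = (M 0 0 + M 1 1) * Wr u v := by
  simp [Wr, Matrix.mulVec, dotProduct, Fin.sum_univ_two]; ring

/-- The Wronskian of two solutions of a traceless linear system is constant. -/
theorem Wr_eq_of_hasDerivAt {M : ℝ → Matrix (Fin 2) (Fin 2) ℂ} (hM : ∀ x, M x 0 0 + M x 1 1 = 0)
    {φ ψ : ℝ → Fin 2 → ℂ} (hφ : ∀ x, HasDerivAt φ (M x *ᵥ φ x) x)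
    (hψ : ∀ x, HasDerivAt ψ (M x *ᵥ ψ x) x) (x y : ℝ) : Wr (φ x) (ψ x) = Wr (φ y) (ψ y) := by
  have hd : ∀ x, HasDerivAt (fun x => Wr (φ x) (ψ x)) 0 x := fun x => by
    have := hasDerivAt_Wr (hφ x) (hψ x)
    rwa [Wr_mulVec_add, hM, zero_mul] at this
  exact is_const_of_deriv_eq_zero (fun x => (hd x).differentiableAt) (fun x => (hd x).deriv) x y

theorem laxX_trace (u k : ℂ) : laxX u k 0 0 + laxX u k 1 1 = 0 := by simp [laxX_eq]

theorem laxT_trace (u v k : ℂ) : laxT u v k 0 0 + laxT u v k 1 1 = 0 := by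
  simp [laxT]; ring

theorem hasDerivAt_op_apply {W : ℝ → Op} {A B : Op} {x : ℝ} (h : HasDerivAt W (A ∘L B) x)
    (v : Fin 2 → ℂ) : HasDerivAt (fun y => W y v) (A (B v)) x := by
  have := (((ContinuousLinearMap.apply ℂ (Fin 2 → ℂ)) v).restrictScalars ℝ).hasFDerivAt
    (x := W x) |>.comp_hasDerivAt x h
  exact this

/-- The preimage of `v` under an operator of determinant one. -/
noncomputable def opInv (A : Op) (v : Fin 2 → ℂ) : Fin 2 → ℂ :=
  ![Wr v (A ![0, 1]), Wr (A ![1, 0]) v]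

theorem apply_opInv {A : Op} (hA : ∀ u v, Wr (A u) (A v) = Wr u v) (v : Fin 2 → ℂ) :
    A (opInv A v) = v := by
  have h : Wr (A ![1, 0]) (A ![0, 1]) = 1 := by rw [hA]; simp [Wr]
  have h1 : opInv A v = Wr v (A ![0, 1]) • ![1, 0] + Wr (A ![1, 0]) v • ![0, 1] := by
    ext i; fin_cases i <;> simp [opInv]
  rw [h1, map_add, map_smul, map_smul, ← Wr_smul_eq, h, one_smul]

/-! ### The uniformization variable -/

/-- The product `k λ`. -/
noncomputable def kap (q₀ : ℝ) (z : ℂ) : ℂ := kz q₀ z * lamz q₀ z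

theorem theta_eq (q₀ x t : ℝ) (z : ℂ) : theta q₀ x t z =
    kap q₀ z * x - kap q₀ z * (2 * kz q₀ z ^ 2 - q₀ ^ 2) * t := by
  unfold theta kap; ring

theorem mem_closedDplus_iff {z : ℂ} : z ∈ Dplus ∪ contour ↔ z ≠ 0 ∧ 0 ≤ z.re * z.im := by
  simp only [Dplus, contour, Set.mem_union, Set.mem_ofPred_eq]
  constructor
  · rintro (h | ⟨h | h, h0⟩)
    · exact ⟨fun h0 => by simp [h0] at h, h.le⟩
    · simp [h, h0]
    · simp [h, h0]
  · rintro ⟨h0, h⟩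
    rcases h.lt_or_eq with h | h
    · exact Or.inl h
    · exact Or.inr ⟨(mul_eq_zero.1 h.symm).symm, h0⟩

theorem mem_closedDminus_iff {z : ℂ} : z ∈ Dminus ∪ contour ↔ z ≠ 0 ∧ z.re * z.im ≤ 0 := by
  simp only [Dminus, contour, Set.mem_union, Set.mem_ofPred_eq]
  constructor
  · rintro (h | ⟨h | h, h0⟩)
    · exact ⟨fun h0 => by simp [h0] at h, h.le⟩
    · simp [h, h0]
    · simp [h, h0]
  · rintro ⟨h0, h⟩
    rcases h.lt_or_eq with h | h
    · exact Or.inl h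
    · exact Or.inr ⟨(mul_eq_zero.1 h).symm, h0⟩

theorem isOpen_Dplus : IsOpen Dplus :=
  isOpen_lt continuous_const (by fun_prop)

theorem isOpen_Dminus : IsOpen Dminus :=
  isOpen_lt (by fun_prop) continuous_const

theorem kap_eq (q₀ : ℝ) {z : ℂ} (hz : z ≠ 0) : kap q₀ z = (z ^ 2 - q₀ ^ 4 / z ^ 2) / 4 := by
  unfold kap kz lamz; field_simp; ring

/-- Shows that Im(kλ) has the sign of Re z Im z, which is why D⁺ and D⁻ are the domains where the
exponentials of the respective columns decay. -/
theorem kap_im (q₀ : ℝ) {z : ℂ} (hz : z ≠ 0) :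
    (kap q₀ z).im = z.re * z.im * (1 + q₀ ^ 4 / Complex.normSq z ^ 2) / 2 := by
  have hn : Complex.normSq z ≠ 0 := by simpa using hz
  have h : kap q₀ z = (z ^ 2 - q₀ ^ 4 * (conj z ^ 2 * ((Complex.normSq z : ℂ))⁻¹ ^ 2)) / 4 := by
    rw [kap_eq q₀ hz, div_eq_mul_inv _ (z ^ 2), ← inv_pow, Complex.inv_def]
    push_cast; ring
  have h2 : kap q₀ z = (z ^ 2 - ((q₀ ^ 4 * (Complex.normSq z)⁻¹ ^ 2 : ℝ) : ℂ) * conj z ^ 2)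
      * ((1 / 4 : ℝ) : ℂ) := by
    rw [h]; push_cast; ring
  rw [h2, Complex.im_mul_ofReal, Complex.sub_im, Complex.im_ofReal_mul, pow_two z,
    pow_two (conj z), Complex.mul_im, Complex.mul_im, Complex.conj_re, Complex.conj_im]
  field_simp
  ring

theorem kap_im_nonneg (q₀ : ℝ) {z : ℂ} (hz : z ∈ Dplus ∪ contour) : 0 ≤ (kap q₀ z).im := by
  rw [mem_closedDplus_iff] at hz
  rw [kap_im q₀ hz.1]
  have := hz.2
  positivity

theorem kap_sq_add (q₀ : ℝ) {z : ℂ} (hz : z ≠ 0) :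
    kap q₀ z ^ 2 = kz q₀ z ^ 2 * (kz q₀ z ^ 2 + q₀ ^ 2) := by
  unfold kap kz lamz; field_simp; ring

theorem differentiableAt_kz (q₀ : ℝ) {z : ℂ} (hz : z ≠ 0) : DifferentiableAt ℂ (kz q₀) z := by
  unfold kz; fun_prop (disch := exact hz)

theorem differentiableAt_lamz (q₀ : ℝ) {z : ℂ} (hz : z ≠ 0) : DifferentiableAt ℂ (lamz q₀) z := by
  unfold lamz; fun_prop (disch := exact hz)

theorem differentiableAt_kap (q₀ : ℝ) {z : ℂ} (hz : z ≠ 0) : DifferentiableAt ℂ (kap q₀) z :=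
  (differentiableAt_kz q₀ hz).mul (differentiableAt_lamz q₀ hz)

/-- The `j`-th column of `E`. -/
noncomputable def Ecol (qb z : ℂ) (j : Fin 2) : Fin 2 → ℂ := fun i => Emat qb z i j

theorem Ecol_one (qb z : ℂ) : Ecol qb z 1 = ![I * qb / z, 1] := by
  ext i; fin_cases i <;> simp [Ecol, Emat]

theorem Ecol_zero (qb z : ℂ) : Ecol qb z 0 = ![1, I * conj qb / z] := by
  ext i; fin_cases i <;> simp [Ecol, Emat]

/-! ### The constant-coefficient background -/

/-- The operator `X_b + i k λ` of the background with constant potential `qb`. -/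
noncomputable def bgOp (q₀ : ℝ) (qb z : ℂ) : Op :=
  matOp (laxX qb (kz q₀ z)) + (I * kap q₀ z) • 1

/-- X_b is traceless with square -(kλ)². Adding i kλ therefore gives an operator with eigenvalues 0
and 2i kλ, which becomes nilpotent where kλ = 0; no diagonalization is needed, so the branch points
are not exceptional. -/
theorem bgOp_comp_self {q₀ : ℝ} {qb z : ℂ} (hz : z ≠ 0) (hqb : ‖qb‖ = q₀) :
    bgOp q₀ qb z ∘L bgOp q₀ qb z = (2 * I * kap q₀ z) • bgOp q₀ qb z := by
  have h1 : matOp (laxX qb (kz q₀ z)) ∘L matOp (laxX qb (kz q₀ z)) = (-(kap q₀ z ^ 2)) • 1 := by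
    have hn : qb * conj qb = q₀ ^ 2 := by rw [Complex.mul_conj, Complex.normSq_eq_norm_sq, hqb]; simp
    have hI : I ^ 2 = -1 := I_sq
    have : laxX qb (kz q₀ z) * laxX qb (kz q₀ z) = (-(kap q₀ z ^ 2)) • 1 := by
      rw [kap_sq_add q₀ hz, laxX_eq, Matrix.mul_fin_two, Matrix.one_fin_two]
      ext i j
      fin_cases i <;> fin_cases j <;> simp
      · linear_combination kz q₀ z ^ 4 * hI - kz q₀ z ^ 2 * hn
      · ring
      · ring
      · linear_combination kz q₀ z ^ 4 * hI - kz q₀ z ^ 2 * hn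
    rw [← matOp_mul, this, map_smul]
    congr 1
    ext v
    simp [matOp_apply]
  have hI : I ^ 2 = -1 := I_sq
  unfold bgOp
  rw [ContinuousLinearMap.add_comp, ContinuousLinearMap.comp_add, h1]
  ext v : 1
  simp only [_root_.add_apply, _root_.smul_apply, ContinuousLinearMap.comp_apply,
    one_apply_eq_self, map_smul, smul_smul, smul_add]
  rw [show I * kap q₀ z * (I * kap q₀ z) = -(kap q₀ z ^ 2) by linear_combination kap q₀ z ^ 2 * hI,
    show 2 * I * kap q₀ z * (I * kap q₀ z) = -(2 * kap q₀ z ^ 2) by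
      linear_combination 2 * kap q₀ z ^ 2 * hI]
  module

theorem bgOp_apply (q₀ : ℝ) (qb z : ℂ) (v : Fin 2 → ℂ) : bgOp q₀ qb z v =
    ![(I * kz q₀ z ^ 2 + I * kap q₀ z) * v 0 + kz q₀ z * qb * v 1,
      -(kz q₀ z * conj qb) * v 0 + (-(I * kz q₀ z ^ 2) + I * kap q₀ z) * v 1] := by
  rw [bgOp, _root_.add_apply, _root_.smul_apply, one_apply_eq_self, matOp_apply, laxX_eq]
  ext i
  fin_cases i <;> simp [dotProduct, Fin.sum_univ_two] <;> ring

/-- The second column of E is an eigenvector of X_b with eigenvalue -i kλ, hence a stationary state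
of the modified background equation. -/
theorem bgOp_Ecol {q₀ : ℝ} {qb z : ℂ} (hz : z ≠ 0) (hqb : ‖qb‖ = q₀) :
    bgOp q₀ qb z (Ecol qb z 1) = 0 := by
  have hn : qb * conj qb = q₀ ^ 2 := by rw [Complex.mul_conj, Complex.normSq_eq_norm_sq, hqb]; simp
  have hI : I ^ 2 = -1 := I_sq
  have h1 : kz q₀ z + lamz q₀ z = z := by unfold kz lamz; ring
  have h2 : lamz q₀ z - kz q₀ z = q₀ ^ 2 / z := by unfold kz lamz; ring
  rw [Ecol_one, bgOp_apply]
  ext i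
  fin_cases i
  · have : (I * kz q₀ z ^ 2 + I * kap q₀ z) * (I * qb / z) + kz q₀ z * qb * 1 =
        kz q₀ z * qb * (I ^ 2 * (kz q₀ z + lamz q₀ z) / z + 1) := by unfold kap; ring
    simpa [h1, hI, hz] using this
  · have : -(kz q₀ z * conj qb) * (I * qb / z) + (-(I * kz q₀ z ^ 2) + I * kap q₀ z) * 1 =
        I * kz q₀ z * ((lamz q₀ z - kz q₀ z) - (qb * conj qb) / z) := by unfold kap; ring
    simpa [h2, hn] using this

/-! ### Duhamel's formula around the background -/

/-- `∫₀ˢ exp (2 i κ τ) dτ`. -/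
noncomputable def expPrim (κ : ℂ) (s : ℝ) : ℂ := ∫ τ in (0 : ℝ)..s, exp (2 * I * κ * τ)

theorem hasDerivAt_expPrim (κ : ℂ) (s : ℝ) : HasDerivAt (expPrim κ) (exp (2 * I * κ * s)) s := by
  have hc : Continuous fun τ : ℝ => exp (2 * I * κ * τ) := by fun_prop
  exact (hc.integral_hasStrictDerivAt 0 s).hasDerivAt

theorem continuous_expPrim (κ : ℂ) : Continuous (expPrim κ) :=
  continuous_iff_continuousAt.2 fun s => (hasDerivAt_expPrim κ s).continuousAt

/-- Lets the primitive replace (e^{2iκs} - 1)/(2iκ), so that κ = 0 is covered without a division. -/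
theorem exp_eq_expPrim (κ : ℂ) (s : ℝ) : exp (2 * I * κ * s) = 1 + 2 * I * κ * expPrim κ s := by
  have hd : ∀ s : ℝ, HasDerivAt (fun s : ℝ => exp (2 * I * κ * s) - 2 * I * κ * expPrim κ s) 0 s := by
    intro s
    have h1 : HasDerivAt (fun s : ℝ => 2 * I * κ * (s : ℂ)) (2 * I * κ * 1) s :=
      (Complex.ofRealCLM.hasDerivAt (x := s)).const_mul _
    exact (h1.cexp.fun_sub ((hasDerivAt_expPrim κ s).const_mul (2 * I * κ))).congr_deriv (by ring)
  have := is_const_of_deriv_eq_zero (fun x => (hd x).differentiableAt) (fun x => (hd x).deriv) s 0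
  simp [expPrim] at this
  simp only [expPrim]
  linear_combination this

theorem norm_exp_two_I_le {κ : ℂ} (hκ : 0 ≤ κ.im) {s : ℝ} (hs : 0 ≤ s) :
    ‖exp (2 * I * κ * s)‖ ≤ 1 := by
  rw [Complex.norm_exp, Real.exp_le_one_iff, Complex.re_mul_ofReal]
  have : (2 * I * κ).re = -2 * κ.im := by simp
  rw [this]
  nlinarith [mul_nonneg hκ hs]

/-- At κ = 0 the primitive is s itself, so linear growth is the best bound that is uniform up to the
boundary. It is the source of the weight 1 + |x| on the potential. -/
theorem norm_expPrim_le {κ : ℂ} (hκ : 0 ≤ κ.im) {s : ℝ} (hs : 0 ≤ s) : ‖expPrim κ s‖ ≤ s := by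
  have := intervalIntegral.norm_integral_le_of_norm_le_const (a := 0) (b := s)
    (f := fun τ : ℝ => exp (2 * I * κ * τ)) (C := 1) fun x hx => by
      rw [Set.uIoc_of_le hs] at hx
      exact norm_exp_two_I_le hκ hx.1.le
  simpa [expPrim, abs_of_nonneg hs] using this

/-- The propagator `exp (i κ s) exp (s X_b)` of the background, where `B = X_b + i κ`. -/
noncomputable def bgProp (κ : ℂ) (B : Op) (s : ℝ) : Op := 1 + expPrim κ s • B

theorem bgProp_apply (κ : ℂ) (B : Op) (s : ℝ) (v : Fin 2 → ℂ) :
    bgProp κ B s v = v + expPrim κ s • B v := rfl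

theorem norm_bgProp_le {κ : ℂ} (hκ : 0 ≤ κ.im) (B : Op) {s : ℝ} (hs : 0 ≤ s) (v : Fin 2 → ℂ) :
    ‖bgProp κ B s v‖ ≤ (1 + s * ‖B‖) * ‖v‖ := by
  rw [bgProp_apply, add_mul, one_mul]
  refine (norm_add_le _ _).trans (add_le_add le_rfl ?_)
  rw [norm_smul, mul_assoc]
  exact mul_le_mul (norm_expPrim_le hκ hs) (B.le_opNorm v) (norm_nonneg _) hs

/-- Variation of constants: along a solution, the y-derivative of the background propagator from y
to x applied to ν(y) is the propagated perturbation alone, because B² = 2iκB makes the background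
terms cancel. -/
theorem duhamel {κ : ℂ} {B : Op} (hB : B ∘L B = (2 * I * κ) • B) {R : ℝ → Op} (hR : Continuous R)
    {ν : ℝ → Fin 2 → ℂ} (hν : ∀ x, HasDerivAt ν (B (ν x) + R x (ν x)) x) (a x : ℝ) :
    ν x - bgProp κ B (x - a) (ν a) = ∫ y in a..x, bgProp κ B (x - y) (R y (ν y)) := by
  have hBB : ∀ v, B (B v) = (2 * I * κ) • B v := fun v => DFunLike.congr_fun hB v
  have hνc : Continuous ν := continuous_iff_continuousAt.2 fun x => (hν x).continuousAt
  have hd : ∀ y, HasDerivAt (fun y => bgProp κ B (x - y) (ν y)) (bgProp κ B (x - y) (R y (ν y))) y := by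
    intro y
    have h1 : HasDerivAt (fun y => expPrim κ (x - y)) (-exp (2 * I * κ * (x - y : ℝ))) y := by
      have := (hasDerivAt_expPrim κ (x - y)).scomp y ((hasDerivAt_id y).const_sub x)
      exact this.congr_deriv (by simp)
    have h2 : HasDerivAt (fun y => B (ν y)) (B (B (ν y) + R y (ν y))) y :=
      (B.restrictScalars ℝ).hasFDerivAt.comp_hasDerivAt y (hν y)
    refine ((hν y).fun_add (h1.fun_smul h2)).congr_deriv ?_
    rw [bgProp_apply, map_add, hBB, exp_eq_expPrim]
    module
  have hc : Continuous fun y => bgProp κ B (x - y) (R y (ν y)) := by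
    simp only [bgProp_apply]
    have := (continuous_expPrim κ).comp (by fun_prop : Continuous fun y : ℝ => x - y)
    have h2 : Continuous fun y => R y (ν y) := hR.clm_apply hνc
    exact h2.add (this.smul (B.continuous.comp h2))
  rw [intervalIntegral.integral_eq_sub_of_hasDerivAt (fun y _ => hd y)
    (hc.intervalIntegrable _ _)]
  simp [bgProp_apply, expPrim]

/-! ### Estimates on the left half-line -/

/-- The weight `(1 + |y|) ‖u y - qb‖`. -/
noncomputable def weight (u : ℝ → ℂ) (qb : ℂ) (y : ℝ) : ℝ := (1 + |y|) * ‖u y - qb‖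

theorem weight_nonneg (u : ℝ → ℂ) (qb : ℂ) (y : ℝ) : 0 ≤ weight u qb y := by
  unfold weight; positivity

/-- A potential that tends to `qb` at `-∞` in the weighted sense. -/
structure LeftPotential (u : ℝ → ℂ) (qb : ℂ) (q₀ : ℝ) : Prop where
  cont : Continuous u
  pos : 0 < q₀
  norm_eq : ‖qb‖ = q₀
  integrable : IntegrableOn (weight u qb) (Set.Iic 0)

/-- The difference `X - X_b`. -/
noncomputable def pertOp (u : ℝ → ℂ) (qb k : ℂ) (x : ℝ) : Op :=
  matOp (laxX (u x) k) - matOp (laxX qb k)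

theorem norm_pertOp_le (u : ℝ → ℂ) (qb k : ℂ) (x : ℝ) (v : Fin 2 → ℂ) :
    ‖pertOp u qb k x v‖ ≤ ‖k‖ * ‖u x - qb‖ * ‖v‖ := by
  have h : pertOp u qb k x v = ![k * (u x - qb) * v 1, -(k * conj (u x - qb)) * v 0] := by
    rw [pertOp, _root_.sub_apply, matOp_apply, matOp_apply, laxX_eq, laxX_eq]
    ext i
    fin_cases i <;> simp [dotProduct, Fin.sum_univ_two] <;> ring
  rw [h, pi_norm_le_iff_of_nonneg (by positivity)]
  intro i
  fin_cases i
  · simpa using mul_le_mul_of_nonneg_left (norm_le_pi_norm v 1) (by positivity)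
  · have : ‖conj (u x - qb)‖ = ‖u x - qb‖ := Complex.norm_conj _
    simp only [map_sub] at this
    simpa [this] using mul_le_mul_of_nonneg_left (norm_le_pi_norm v 0) (by positivity)

section LeftEstimates
variable {u : ℝ → ℂ} {qb : ℂ} {q₀ : ℝ}

theorem LeftPotential.continuous_weight (hu : LeftPotential u qb q₀) :
    Continuous (weight u qb) := by
  have := hu.cont
  unfold weight; fun_prop

theorem LeftPotential.continuous_pertOp (hu : LeftPotential u qb q₀) (k : ℂ) :
    Continuous (pertOp u qb k) :=
  (continuous_laxX (F := Op) matOp hu.cont continuous_const).sub continuous_const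

/-- The total weight. -/
noncomputable def totalWeight (u : ℝ → ℂ) (qb : ℂ) : ℝ := ∫ y in Set.Iic (0 : ℝ), weight u qb y

theorem LeftPotential.integral_weight_le (hu : LeftPotential u qb q₀) {a b : ℝ} (hab : a ≤ b)
    (hb : b ≤ 0) : ∫ y in a..b, weight u qb y ≤ ∫ y in Set.Iic b, weight u qb y := by
  rw [intervalIntegral.integral_of_le hab]
  exact setIntegral_mono_set (hu.integrable.mono_set (Set.Iic_subset_Iic.2 hb))
    (Eventually.of_forall fun y => weight_nonneg u qb y) Set.Ioc_subset_Iic_self.eventuallyLE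

theorem LeftPotential.integral_weight_le_total (hu : LeftPotential u qb q₀) {b : ℝ}
    (hb : b ≤ 0) : ∫ y in Set.Iic b, weight u qb y ≤ totalWeight u qb :=
  setIntegral_mono_set hu.integrable
    (Eventually.of_forall fun y => weight_nonneg u qb y) (Set.Iic_subset_Iic.2 hb).eventuallyLE

/-- The constant in front of the weight in the Volterra kernel. -/
noncomputable def kernelConst (q₀ : ℝ) (qb z : ℂ) : ℝ := ‖kz q₀ z‖ * (1 + ‖bgOp q₀ qb z‖)

theorem kernelConst_nonneg (q₀ : ℝ) (qb z : ℂ) : 0 ≤ kernelConst q₀ qb z := by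
  unfold kernelConst; positivity

/-- For y ≤ x ≤ 0 one has x - y ≤ |y|, so the linear growth of the propagator is absorbed by the
weight at y and the bound does not depend on x. -/
theorem norm_kernel_le {z : ℂ} (hz : z ∈ Dplus ∪ contour) {x y : ℝ} (hyx : y ≤ x) (hx : x ≤ 0)
    (v : Fin 2 → ℂ) : ‖bgProp (kap q₀ z) (bgOp q₀ qb z) (x - y) (pertOp u qb (kz q₀ z) y v)‖ ≤
      kernelConst q₀ qb z * weight u qb y * ‖v‖ := by
  refine (norm_bgProp_le (kap_im_nonneg q₀ hz) _ (sub_nonneg.2 hyx) _).trans ?_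
  have h1 : 1 + (x - y) * ‖bgOp q₀ qb z‖ ≤ (1 + |y|) * (1 + ‖bgOp q₀ qb z‖) := by
    have : x - y ≤ |y| := by rw [abs_of_nonpos (hyx.trans hx)]; linarith
    nlinarith [norm_nonneg (bgOp q₀ qb z), abs_nonneg y]
  calc _ ≤ ((1 + |y|) * (1 + ‖bgOp q₀ qb z‖)) * (‖kz q₀ z‖ * ‖u y - qb‖ * ‖v‖) :=
        mul_le_mul h1 (norm_pertOp_le u qb _ y v) (norm_nonneg _) (by positivity)
    _ = _ := by unfold kernelConst weight; ring

/-- The equation `ν' = (X + i k λ) ν`. -/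
def IsModSol (u : ℝ → ℂ) (q₀ : ℝ) (z : ℂ) (ν : ℝ → Fin 2 → ℂ) : Prop :=
  ∀ x, HasDerivAt ν (laxX (u x) (kz q₀ z) *ᵥ ν x + (I * kap q₀ z) • ν x) x

theorem IsModSol.hasDerivAt {z : ℂ} {ν : ℝ → Fin 2 → ℂ} (h : IsModSol u q₀ z ν) (qb : ℂ) (x : ℝ) :
    HasDerivAt ν (bgOp q₀ qb z (ν x) + pertOp u qb (kz q₀ z) x (ν x)) x := by
  refine (h x).congr_deriv ?_
  rw [bgOp, pertOp, _root_.add_apply, _root_.sub_apply, _root_.smul_apply, one_apply_eq_self,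
    matOp_apply, matOp_apply]
  abel

theorem IsModSol.continuous {z : ℂ} {ν : ℝ → Fin 2 → ℂ} (h : IsModSol u q₀ z ν) : Continuous ν :=
  continuous_iff_continuousAt.2 fun x => (h x).continuousAt

theorem IsModSol.sub {z : ℂ} {ν ν' : ℝ → Fin 2 → ℂ} (h : IsModSol u q₀ z ν)
    (h' : IsModSol u q₀ z ν') : IsModSol u q₀ z fun x => ν x - ν' x := fun x => by
  refine ((h x).fun_sub (h' x)).congr_deriv ?_
  rw [Matrix.mulVec_sub, smul_sub]; abel

theorem bgProp_Ecol {z : ℂ} (hz : z ≠ 0) (hqb : ‖qb‖ = q₀) (s : ℝ) :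
    bgProp (kap q₀ z) (bgOp q₀ qb z) s (Ecol qb z 1) = Ecol qb z 1 := by
  rw [bgProp_apply, bgOp_Ecol hz hqb, smul_zero, add_zero]

variable (hu : LeftPotential u qb q₀) {z : ℂ} (hz : z ∈ Dplus ∪ contour)
include hu hz

theorem IsModSol.norm_integral_kernel_le {ν : ℝ → Fin 2 → ℂ} (hνc : Continuous ν)
    {a b x : ℝ} (hab : a ≤ b) (hbx : b ≤ x) (hx : x ≤ 0) :
    ‖∫ y in a..b, bgProp (kap q₀ z) (bgOp q₀ qb z) (x - y) (pertOp u qb (kz q₀ z) y (ν y))‖ ≤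
      ∫ y in a..b, kernelConst q₀ qb z * weight u qb y * ‖ν y‖ := by
  refine intervalIntegral.norm_integral_le_of_norm_le hab (ae_of_all _ fun y hy => ?_) ?_
  · exact norm_kernel_le hz (hy.2.trans hbx) hx _
  · have := hu.continuous_weight
    exact Continuous.intervalIntegrable (by fun_prop) _ _

/-- Grönwall in Duhamel's formula. The propagator fixes the initial value, so the bound is
independent of the starting point a, which will be sent to -∞. -/
theorem IsModSol.norm_le {ν : ℝ → Fin 2 → ℂ} (hν : IsModSol u q₀ z ν) {a : ℝ}
    (ha : ν a = Ecol qb z 1) {x : ℝ} (hax : a ≤ x) (hx : x ≤ 0) :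
    ‖ν x‖ ≤ ‖Ecol qb z 1‖ * Real.exp (kernelConst q₀ qb z * totalWeight u qb) := by
  have hz0 := (mem_closedDplus_iff.1 hz).1
  have hw := hu.continuous_weight
  have hk := kernelConst_nonneg q₀ qb z
  have h := gronwall_integral (u := fun x => ‖ν x‖) (K := fun y => kernelConst q₀ qb z * weight u qb y)
    (ε := fun _ => 0) hν.continuous.norm (by fun_prop) continuous_const
    (fun y => mul_nonneg hk (weight_nonneg u qb y)) (fun _ => le_rfl) hax (c := ‖Ecol qb z 1‖)
    fun x' hx' => by
      have h1 := duhamel (bgOp_comp_self hz0 hu.norm_eq) (hu.continuous_pertOp (kz q₀ z))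
        (fun x => hν.hasDerivAt qb x) a x'
      rw [ha, bgProp_Ecol hz0 hu.norm_eq, sub_eq_iff_eq_add] at h1
      rw [h1, add_comm]
      refine (norm_add_le _ _).trans (add_le_add le_rfl ?_)
      simpa using IsModSol.norm_integral_kernel_le hu hz hν.continuous hx'.1 le_rfl (hx'.2.trans hx)
  refine h.trans ?_
  simp only [intervalIntegral.integral_zero, add_zero, intervalIntegral.integral_const_mul]
  gcongr
  exact (hu.integral_weight_le hax hx).trans (hu.integral_weight_le_total hx)

/-- Again uniform in the starting point; in the limit a → -∞ this is the normalization of the Jost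
solution at -∞. -/
theorem IsModSol.norm_sub_le {ν : ℝ → Fin 2 → ℂ} (hν : IsModSol u q₀ z ν) {a : ℝ}
    (ha : ν a = Ecol qb z 1) {x : ℝ} (hax : a ≤ x) (hx : x ≤ 0) :
    ‖ν x - Ecol qb z 1‖ ≤ kernelConst q₀ qb z * (‖Ecol qb z 1‖ *
      Real.exp (kernelConst q₀ qb z * totalWeight u qb)) * ∫ y in Set.Iic x, weight u qb y := by
  have hz0 := (mem_closedDplus_iff.1 hz).1
  have hw := hu.continuous_weight
  have hk := kernelConst_nonneg q₀ qb z
  have hc := hν.continuous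
  have h1 := duhamel (bgOp_comp_self hz0 hu.norm_eq) (hu.continuous_pertOp (kz q₀ z))
    (fun x => hν.hasDerivAt qb x) a x
  rw [ha, bgProp_Ecol hz0 hu.norm_eq] at h1
  rw [h1]
  set M := ‖Ecol qb z 1‖ * Real.exp (kernelConst q₀ qb z * totalWeight u qb) with hM
  calc _ ≤ ∫ y in a..x, kernelConst q₀ qb z * weight u qb y * ‖ν y‖ :=
        IsModSol.norm_integral_kernel_le hu hz hν.continuous hax le_rfl hx
    _ ≤ ∫ y in a..x, kernelConst q₀ qb z * M * weight u qb y := by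
        refine intervalIntegral.integral_mono_on hax
          (Continuous.intervalIntegrable (by fun_prop) _ _)
          (Continuous.intervalIntegrable (by fun_prop) _ _) fun y hy => ?_
        have := hν.norm_le hu hz ha hy.1 (hy.2.trans hx)
        have h2 := weight_nonneg u qb y
        calc _ ≤ kernelConst q₀ qb z * weight u qb y * M := by gcongr
          _ = _ := by ring
    _ = kernelConst q₀ qb z * M * ∫ y in a..x, weight u qb y :=
        intervalIntegral.integral_const_mul _ _
    _ ≤ _ := by
        have := hu.integral_weight_le hax hx
        gcongr

/-- The Cauchy estimate for solutions started farther and farther to the left: they differ only by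
the effect of the potential beyond the nearer starting point, hence by a tail of the weight. -/
theorem IsModSol.norm_sub_le_of_le {ν ν' : ℝ → Fin 2 → ℂ} (hν : IsModSol u q₀ z ν)
    (hν' : IsModSol u q₀ z ν') {a b : ℝ} (hab : a ≤ b) (hb : b ≤ 0)
    (ha : ν a = Ecol qb z 1) (hb' : ν' b = Ecol qb z 1) {x : ℝ} (hbx : b ≤ x) (hx : x ≤ 0) :
    ‖ν x - ν' x‖ ≤ kernelConst q₀ qb z * (‖Ecol qb z 1‖ *
      Real.exp (kernelConst q₀ qb z * totalWeight u qb)) * (∫ y in Set.Iic b, weight u qb y) *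
      Real.exp (kernelConst q₀ qb z * totalWeight u qb) := by
  have hz0 := (mem_closedDplus_iff.1 hz).1
  have hw := hu.continuous_weight
  have hk := kernelConst_nonneg q₀ qb z
  have hd := hν.sub hν'
  have hdu := fun (ν : ℝ → Fin 2 → ℂ) (hν : IsModSol u q₀ z ν) =>
    duhamel (bgOp_comp_self hz0 hu.norm_eq) (hu.continuous_pertOp (kz q₀ z))
      (fun x => hν.hasDerivAt qb x)
  set M := ‖Ecol qb z 1‖ * Real.exp (kernelConst q₀ qb z * totalWeight u qb) with hM
  have hcF : ∀ (ν : ℝ → Fin 2 → ℂ) (hν : IsModSol u q₀ z ν) (x : ℝ), Continuous fun y =>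
      bgProp (kap q₀ z) (bgOp q₀ qb z) (x - y) (pertOp u qb (kz q₀ z) y (ν y)) := by
    intro ν hν x
    simp only [bgProp_apply]
    have := (continuous_expPrim (kap q₀ z)).comp (by fun_prop : Continuous fun y : ℝ => x - y)
    have h2 : Continuous fun y => pertOp u qb (kz q₀ z) y (ν y) :=
      (hu.continuous_pertOp _).clm_apply hν.continuous
    exact h2.add (this.smul ((bgOp q₀ qb z).continuous.comp h2))
  have h := gronwall_integral (u := fun x => ‖ν x - ν' x‖)
    (K := fun y => kernelConst q₀ qb z * weight u qb y)
    (ε := fun _ => 0) hd.continuous.norm (by fun_prop) continuous_const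
    (fun y => mul_nonneg hk (weight_nonneg u qb y)) (fun _ => le_rfl) hbx
    (c := kernelConst q₀ qb z * M * ∫ y in Set.Iic b, weight u qb y)
    fun x' hx' => by
      have h1 := hdu ν hν a x'
      have h2 := hdu ν' hν' b x'
      rw [ha, bgProp_Ecol hz0 hu.norm_eq] at h1
      rw [hb', bgProp_Ecol hz0 hu.norm_eq] at h2
      -- Splitting the integral from a at the point b: the part over [a, b] is a source controlled
      -- by the tail of the weight, and the part over [b, x'] is the Grönwall kernel acting on the
      -- difference.
      have h3 : ν x' - ν' x' =
          (∫ y in a..b, bgProp (kap q₀ z) (bgOp q₀ qb z) (x' - y) (pertOp u qb (kz q₀ z) y (ν y))) +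
          ∫ y in b..x', bgProp (kap q₀ z) (bgOp q₀ qb z) (x' - y)
            (pertOp u qb (kz q₀ z) y (ν y - ν' y)) := by
        rw [show ν x' - ν' x' = (ν x' - Ecol qb z 1) - (ν' x' - Ecol qb z 1) by abel, h1, h2,
          ← intervalIntegral.integral_add_adjacent_intervals
            ((hcF ν hν x').intervalIntegrable a b) ((hcF ν hν x').intervalIntegrable b x'),
          add_sub_assoc, ← intervalIntegral.integral_sub
            ((hcF ν hν x').intervalIntegrable b x') ((hcF ν' hν' x').intervalIntegrable b x')]
        simp only [map_sub]
      rw [h3]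
      refine (norm_add_le _ _).trans (add_le_add ?_ ?_)
      · calc _ ≤ ∫ y in a..b, kernelConst q₀ qb z * weight u qb y * ‖ν y‖ :=
              IsModSol.norm_integral_kernel_le hu hz hν.continuous hab hx'.1 (hx'.2.trans hx)
          _ ≤ ∫ y in a..b, kernelConst q₀ qb z * M * weight u qb y := by
              have hc := hν.continuous
              refine intervalIntegral.integral_mono_on hab
                (Continuous.intervalIntegrable (by fun_prop) _ _)
                (Continuous.intervalIntegrable (by fun_prop) _ _) fun y hy => ?_
              have := hν.norm_le hu hz ha hy.1 (hy.2.trans hb)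
              have h2 := weight_nonneg u qb y
              calc _ ≤ kernelConst q₀ qb z * weight u qb y * M := by gcongr
                _ = _ := by ring
          _ = kernelConst q₀ qb z * M * ∫ y in a..b, weight u qb y :=
              intervalIntegral.integral_const_mul _ _
          _ ≤ _ := by
              have := hu.integral_weight_le hab hb
              gcongr
      · simpa using IsModSol.norm_integral_kernel_le hu hz hd.continuous hx'.1 le_rfl (hx'.2.trans hx)
  refine h.trans ?_
  have hI : 0 ≤ ∫ y in Set.Iic b, weight u qb y := integral_nonneg fun y => weight_nonneg u qb y
  simp only [intervalIntegral.integral_zero, add_zero, intervalIntegral.integral_const_mul]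
  gcongr
  exact (hu.integral_weight_le hbx hx).trans (hu.integral_weight_le_total hx)

end LeftEstimates

/-! ### The Jost vector at `-∞` -/

/-- `W` is the fundamental solution, entire in `k`, of `Φ_x = X Φ` for the potential `u`. -/
structure IsSpaceFlow (u : ℝ → ℂ) (W : ℂ → ℝ → Op) : Prop where
  zero : ∀ k, W k 0 = 1
  deriv : ∀ k x, HasDerivAt (W k) (matOp (laxX (u x) k) ∘L W k x) x
  diff : ∀ x, Differentiable ℂ fun k => W k x

section
variable {u : ℝ → ℂ} {qb : ℂ} {q₀ : ℝ} {W : ℂ → ℝ → Op}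

theorem IsSpaceFlow.hasDerivAt_apply (hW : IsSpaceFlow u W) (k : ℂ) (v : Fin 2 → ℂ) (x : ℝ) :
    HasDerivAt (fun x => W k x v) (laxX (u x) k *ᵥ W k x v) x :=
  hasDerivAt_op_apply (hW.deriv k x) v

theorem IsSpaceFlow.Wr_apply (hW : IsSpaceFlow u W) (k : ℂ) (x : ℝ) (v w : Fin 2 → ℂ) :
    Wr (W k x v) (W k x w) = Wr v w := by
  rw [Wr_eq_of_hasDerivAt (fun x => laxX_trace (u x) k) (hW.hasDerivAt_apply k v)
    (hW.hasDerivAt_apply k w) x 0, hW.zero]; rfl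

theorem hasDerivAt_exp_mul_ofReal (c : ℂ) (x : ℝ) :
    HasDerivAt (fun x : ℝ => exp (c * x)) (c * exp (c * x)) x := by
  have h1 : HasDerivAt (fun s : ℝ => c * (s : ℂ)) (c * 1) x :=
    (Complex.ofRealCLM.hasDerivAt (x := x)).const_mul _
  exact h1.cexp.congr_deriv (by ring)

theorem isModSol_exp_smul {z : ℂ} {φ : ℝ → Fin 2 → ℂ}
    (hφ : ∀ x, HasDerivAt φ (laxX (u x) (kz q₀ z) *ᵥ φ x) x) :
    IsModSol u q₀ z fun x => exp (I * kap q₀ z * x) • φ x := fun x => by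
  refine ((hasDerivAt_exp_mul_ofReal (I * kap q₀ z) x).fun_smul (hφ x)).congr_deriv ?_
  rw [Matrix.mulVec_smul, smul_smul]

/-- The value at `0` of the solution with the data of the background at `-N`. -/
noncomputable def jostApprox (W : ℂ → ℝ → Op) (qb : ℂ) (q₀ : ℝ) (N : ℕ) (z : ℂ) : Fin 2 → ℂ :=
  opInv (W (kz q₀ z) (-N)) (exp (I * kap q₀ z * N) • Ecol qb z 1)

theorem differentiableAt_Ecol (qb : ℂ) {z : ℂ} (hz : z ≠ 0) (j : Fin 2) :
    DifferentiableAt ℂ (fun z => Ecol qb z j) z := by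
  rw [differentiableAt_pi]
  intro i
  fin_cases j <;> fin_cases i <;> simp [Ecol, Emat] <;> fun_prop (disch := exact hz)

theorem IsSpaceFlow.differentiableAt_jostApprox (hW : IsSpaceFlow u W) (N : ℕ) {z : ℂ}
    (hz : z ≠ 0) : DifferentiableAt ℂ (jostApprox W qb q₀ N) z := by
  have hWz : DifferentiableAt ℂ (fun z => W (kz q₀ z) (-N)) z :=
    (hW.diff (-N) (kz q₀ z)).comp z (differentiableAt_kz q₀ hz)
  have hE : DifferentiableAt ℂ (fun z => exp (I * kap q₀ z * N) • Ecol qb z 1) z :=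
    (((differentiableAt_kap q₀ hz).const_mul I).mul_const _).cexp.smul (differentiableAt_Ecol qb hz 1)
  have h1 := differentiableAt_pi.1 (hWz.clm_apply (differentiableAt_const (![0, 1] : Fin 2 → ℂ)))
  have h2 := differentiableAt_pi.1 (hWz.clm_apply (differentiableAt_const (![1, 0] : Fin 2 → ℂ)))
  have h3 := differentiableAt_pi.1 hE
  rw [differentiableAt_pi]
  intro i
  fin_cases i
  · exact ((h3 0).mul (h1 1)).sub ((h3 1).mul (h1 0))
  · exact ((h2 0).mul (h3 1)).sub ((h2 1).mul (h3 0))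

theorem LeftPotential.tendsto_tail (hu : LeftPotential u qb q₀) :
    Tendsto (fun b => ∫ y in Set.Iic b, weight u qb y) atBot (𝓝 0) := by
  have h := intervalIntegral_tendsto_integral_Iic 0 hu.integrable tendsto_id
  have h2 := h.const_sub (∫ y in Set.Iic (0 : ℝ), weight u qb y)
  rw [sub_self] at h2
  refine h2.congr' ?_
  filter_upwards [eventually_le_atBot 0] with b hb
  rw [id, ← intervalIntegral.integral_Iic_sub_Iic
    (hu.integrable.mono_set (Set.Iic_subset_Iic.2 hb)) hu.integrable]
  abel

/-- The constant in the rate of convergence of `jostApprox`. -/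
noncomputable def jostConst (u : ℝ → ℂ) (qb : ℂ) (q₀ : ℝ) (z : ℂ) : ℝ :=
  kernelConst q₀ qb z * (‖Ecol qb z 1‖ * Real.exp (kernelConst q₀ qb z * totalWeight u qb))
    * Real.exp (kernelConst q₀ qb z * totalWeight u qb)

theorem continuousAt_jostConst {z : ℂ} (hz : z ≠ 0) : ContinuousAt (jostConst u qb q₀) z := by
  have h1 : ContinuousAt (kz q₀) z := (differentiableAt_kz q₀ hz).continuousAt
  have h2 : ContinuousAt (fun z => Ecol qb z 1) z := (differentiableAt_Ecol qb hz 1).continuousAt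
  have h3 : ContinuousAt (kap q₀) z := (differentiableAt_kap q₀ hz).continuousAt
  have h4 : ContinuousAt (fun z => matOp (laxX qb (kz q₀ z))) z :=
    ((continuous_laxX (F := Op) matOp (u := fun _ : ℂ => qb) continuous_const
      continuous_id).continuousAt (x := kz q₀ z)).comp h1
  have h5 : ContinuousAt (kernelConst q₀ qb) z := by
    unfold kernelConst bgOp
    exact h1.norm.mul (continuousAt_const.add (h4.add ((continuousAt_const.mul h3).smul
      continuousAt_const)).norm)
  unfold jostConst
  fun_prop

/-- The approximations are analytic away from z = 0, since W is entire in k, and they converge at a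
rate that is locally uniform on D⁺ ∪ Σ because `jostConst` is continuous in z. Locally uniform
limits keep analyticity inside D⁺ and continuity up to Σ. -/
theorem exists_left_jost (hu : LeftPotential u qb q₀) (hW : IsSpaceFlow u W) :
    ∃ J : ℂ → Fin 2 → ℂ, ContinuousOn J (Dplus ∪ contour) ∧ DifferentiableOn ℂ J Dplus ∧
      ∀ z ∈ Dplus ∪ contour, Tendsto (fun x : ℝ => exp (I * kap q₀ z * x) • W (kz q₀ z) x (J z))
        atBot (𝓝 (Ecol qb z 1)) := by
  set F := jostApprox W qb q₀ with hF
  set τ : ℝ → ℝ := fun b => ∫ y in Set.Iic b, weight u qb y with hτ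
  have hτ0 : ∀ b, 0 ≤ τ b := fun b => integral_nonneg fun y => weight_nonneg u qb y
  set ν : ℕ → ℂ → ℝ → Fin 2 → ℂ := fun N z x => exp (I * kap q₀ z * x) • W (kz q₀ z) x (F N z)
    with hν
  have hsol : ∀ N z, IsModSol u q₀ z (ν N z) := fun N z =>
    isModSol_exp_smul (hW.hasDerivAt_apply (kz q₀ z) (F N z))
  have hinit : ∀ N z, ν N z (-N) = Ecol qb z 1 := fun N z => by
    simp only [hν, hF, jostApprox]
    rw [apply_opInv (hW.Wr_apply _ _), smul_smul, ← Complex.exp_add]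
    simp
  have hzero : ∀ N z, ν N z 0 = F N z := fun N z => by
    simp [hν, hW.zero]
  have hτN : Tendsto (fun N : ℕ => τ (-N)) atTop (𝓝 0) :=
    hu.tendsto_tail.comp (tendsto_neg_atTop_atBot.comp tendsto_natCast_atTop_atTop)
  have hdist : ∀ z ∈ Dplus ∪ contour, ∀ N M : ℕ, N ≤ M →
      ‖F M z - F N z‖ ≤ jostConst u qb q₀ z * τ (-N) := by
    intro z hz N M hNM
    have hNM' : (N : ℝ) ≤ M := by exact_mod_cast hNM
    have := (hsol M z).norm_sub_le_of_le hu hz (hsol N z) (neg_le_neg hNM') (by simp)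
      (hinit M z) (hinit N z) (x := 0) (by simp) le_rfl
    rw [hzero, hzero] at this
    refine this.trans (le_of_eq ?_)
    unfold jostConst; ring
  have hlim : ∀ z ∈ Dplus ∪ contour, ∃ l, Tendsto (fun N => F N z) atTop (𝓝 l) := by
    intro z hz
    refine cauchySeq_tendsto_of_complete
      (cauchySeq_of_le_tendsto_0 (fun N : ℕ => 2 * (jostConst u qb q₀ z * τ (-N))) ?_ ?_)
    · intro n m N hn hm
      rw [dist_eq_norm]
      have h1 := hdist z hz N n hn
      have h2 := hdist z hz N m hm
      have h3 := norm_sub_le (F n z - F N z) (F m z - F N z)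
      rw [sub_sub_sub_cancel_right] at h3
      linarith
    · simpa using (hτN.const_mul (jostConst u qb q₀ z)).const_mul 2
  choose! J hJ using hlim
  have hrate : ∀ z ∈ Dplus ∪ contour, ∀ N : ℕ, ‖J z - F N z‖ ≤ jostConst u qb q₀ z * τ (-N) := by
    intro z hz N
    refine le_of_tendsto (((hJ z hz).sub_const (F N z)).norm) ?_
    filter_upwards [eventually_ge_atTop N] with M hM using hdist z hz N M hM
  have hunif : TendstoLocallyUniformlyOn F J atTop (Dplus ∪ contour) := by
    rw [Metric.tendstoLocallyUniformlyOn_iff]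
    intro ε hε z hz
    have hz0 := (mem_closedDplus_iff.1 hz).1
    have hc := (continuousAt_jostConst (u := u) (qb := qb) (q₀ := q₀) hz0).eventually_lt
      (continuousAt_const (y := jostConst u qb q₀ z + 1)) (lt_add_one _)
    refine ⟨{w | jostConst u qb q₀ w < jostConst u qb q₀ z + 1} ∩ (Dplus ∪ contour),
      inter_mem (mem_nhdsWithin_of_mem_nhds hc) self_mem_nhdsWithin, ?_⟩
    have h0 : Tendsto (fun N : ℕ => (jostConst u qb q₀ z + 1) * τ (-N)) atTop (𝓝 0) := by
      simpa using hτN.const_mul (jostConst u qb q₀ z + 1)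
    filter_upwards [h0.eventually (gt_mem_nhds hε)] with N hN w hw
    rw [dist_eq_norm]
    exact ((hrate w hw.2 N).trans (mul_le_mul_of_nonneg_right (le_of_lt hw.1) (hτ0 _))).trans_lt hN
  refine ⟨J, ?_, ?_, fun z hz => ?_⟩
  · refine hunif.continuousOn (Frequently.of_forall fun N z hz => ?_)
    exact (hW.differentiableAt_jostApprox N
      (mem_closedDplus_iff.1 hz).1).continuousAt.continuousWithinAt
  · refine (hunif.mono Set.subset_union_left).differentiableOn
      (Eventually.of_forall fun N z hz => ?_) isOpen_Dplus
    exact (hW.differentiableAt_jostApprox N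
      (mem_closedDplus_iff.1 (Or.inl hz)).1).differentiableWithinAt
  · rw [tendsto_iff_norm_sub_tendsto_zero]
    set C := kernelConst q₀ qb z * (‖Ecol qb z 1‖ *
      Real.exp (kernelConst q₀ qb z * totalWeight u qb)) with hC
    refine squeeze_zero' (Eventually.of_forall fun _ => norm_nonneg _)
      (g := fun x => C * τ x) ?_ (by simpa using hu.tendsto_tail.const_mul C)
    filter_upwards [eventually_le_atBot 0] with x hx
    have h1 : Tendsto (fun N => ‖ν N z x - Ecol qb z 1‖) atTop
        (𝓝 ‖exp (I * kap q₀ z * x) • W (kz q₀ z) x (J z) - Ecol qb z 1‖) :=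
      ((((W (kz q₀ z) x).continuous.tendsto _).comp (hJ z hz)).const_smul _ |>.sub_const _).norm
    refine le_of_tendsto h1 ?_
    -- The estimate for the N-th approximation applies as soon as its starting point -N lies to the
    -- left of x; it then passes to the limit in N.
    obtain ⟨N₀, hN₀⟩ := exists_nat_ge (-x)
    filter_upwards [eventually_ge_atTop N₀] with N hN
    have hN' : (N₀ : ℝ) ≤ N := by exact_mod_cast hN
    exact (hsol N z).norm_sub_le hu hz (hinit N z) (by linarith) hx

end

/-! ### Time evolution of the Jost solutions -/

/-- `W` is the fundamental solution, entire in `k`, of the Lax pair of `q`. -/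
structure IsLaxFlow (q : ℝ → ℝ → ℂ) (W : ℂ → ℝ → ℝ → Op) : Prop where
  zero : ∀ k, W k 0 0 = 1
  deriv_x : ∀ k x t, HasDerivAt (fun y => W k y t) (matOp (laxX (q x t) k) ∘L W k x t) x
  deriv_t : ∀ k x t, HasDerivAt (fun s => W k x s)
      (matOp (laxT (q x t) (deriv (fun y => q y t) x) k) ∘L W k x t) t
  diff : ∀ x t, Differentiable ℂ fun k => W k x t

section
variable {q : ℝ → ℝ → ℂ} {q₀ : ℝ} {qb : ℂ} {W : ℂ → ℝ → ℝ → Op}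

theorem IsLaxFlow.isSpaceFlow (hW : IsLaxFlow q W) :
    IsSpaceFlow (fun x => q x 0) fun k x => W k x 0 :=
  ⟨hW.zero, fun k x => hW.deriv_x k x 0, fun x => hW.diff x 0⟩

theorem IsLaxFlow.Wr_apply (hW : IsLaxFlow q W) (k : ℂ) (x t : ℝ) (v w : Fin 2 → ℂ) :
    Wr (W k x t v) (W k x t w) = Wr v w := by
  rw [Wr_eq_of_hasDerivAt (fun t => laxT_trace (q x t) (deriv (fun y => q y t) x) k)
    (fun t => hasDerivAt_op_apply (hW.deriv_t k x t) v)
    (fun t => hasDerivAt_op_apply (hW.deriv_t k x t) w) t 0]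
  exact hW.isSpaceFlow.Wr_apply k x v w

theorem colSign_zero : colSign 0 = 1 := rfl
theorem colSign_one : colSign 1 = -1 := rfl

theorem laxX_mulVec (u k : ℂ) (v : Fin 2 → ℂ) : laxX u k *ᵥ v =
    ![I * k ^ 2 * v 0 + k * u * v 1, -(k * conj u) * v 0 + -(I * k ^ 2) * v 1] := by
  rw [laxX_eq]
  ext i
  fin_cases i <;> simp [dotProduct, Fin.sum_univ_two]

theorem laxX_mulVec_Ecol {z : ℂ} (hz : z ≠ 0) (hqb : ‖qb‖ = q₀) (j : Fin 2) :
    laxX qb (kz q₀ z) *ᵥ Ecol qb z j = (colSign j * (I * kap q₀ z)) • Ecol qb z j := by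
  have hn : qb * conj qb = q₀ ^ 2 := by rw [Complex.mul_conj, Complex.normSq_eq_norm_sq, hqb]; simp
  have hI : I ^ 2 = -1 := I_sq
  have h1 : kz q₀ z + lamz q₀ z = z := by unfold kz lamz; ring
  have h2 : kz q₀ z * lamz q₀ z = kz q₀ z ^ 2 + kz q₀ z * (q₀ ^ 2 / z) := by
    unfold kz lamz; field_simp; ring
  have h3 : lamz q₀ z = z - kz q₀ z := by linear_combination h1
  fin_cases j
  · simp only [Fin.zero_eta, Ecol_zero, colSign_zero, laxX_mulVec, kap, one_mul]
    ext i
    fin_cases i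
    · have : I * kz q₀ z ^ 2 * 1 + kz q₀ z * qb * (I * conj qb / z) =
        I * (kz q₀ z ^ 2 + kz q₀ z * ((qb * conj qb) / z)) := by ring
      simpa [h2, hn] using this
    · have : -(kz q₀ z * conj qb) * 1 + -(I * kz q₀ z ^ 2) * (I * conj qb / z) =
        I * (kz q₀ z * lamz q₀ z) * (I * conj qb / z) := by
        rw [h3]; field_simp; linear_combination (-z * kz q₀ z * conj qb) * hI
      simpa using this
  · simp only [Fin.mk_one, Ecol_one, colSign_one, laxX_mulVec, kap]
    ext i
    fin_cases i
    · have : I * kz q₀ z ^ 2 * (I * qb / z) + kz q₀ z * qb * 1 =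
        (-1 * (I * (kz q₀ z * lamz q₀ z))) * (I * qb / z) := by
        rw [h3]; field_simp; linear_combination (z * kz q₀ z * qb) * hI
      simpa using this
    · have : -(kz q₀ z * conj qb) * (I * qb / z) + -(I * kz q₀ z ^ 2) * 1 =
        -1 * (I * (kz q₀ z ^ 2 + kz q₀ z * ((qb * conj qb) / z))) := by ring
      simpa [h2, hn] using this

theorem laxT_zero_eq (u k : ℂ) : laxT u 0 k = (-(2 * k ^ 2 - u * conj u)) • laxX u k := by
  rw [laxX_eq, laxT]
  ext i j
  fin_cases i <;> fin_cases j <;> simp <;> ring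

/-- The normalization of the Jost solutions is preserved by the flow of the Lax pair. -/
theorem tendsto_jost_transport (hq : IsSolution q) (hW : IsLaxFlow q W) (hqb : ‖qb‖ = q₀)
    {l : Filter ℝ} [l.IsCountablyGenerated] (hl : ∀ t, Tendsto (fun x => q x t) l (𝓝 qb))
    (hlx : ∀ t, Tendsto (fun x => deriv (fun y => q y t) x) l (𝓝 0))
    (hb : ∀ T : ℝ, ∃ C : ℝ, ∀ x t : ℝ, |t| ≤ T → ‖q x t‖ ≤ C ∧ ‖deriv (fun y => q y t) x‖ ≤ C)
    {z : ℂ} (hz : z ≠ 0) {j : Fin 2} {v : Fin 2 → ℂ}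
    (h0 : Tendsto (fun x => exp (-(colSign j * (I * theta q₀ x 0 z))) • W (kz q₀ z) x 0 v) l
      (𝓝 (Ecol qb z j))) (t : ℝ) :
    Tendsto (fun x => exp (-(colSign j * (I * theta q₀ x t z))) • W (kz q₀ z) x t v) l
      (𝓝 (Ecol qb z j)) := by
  have hn : qb * conj qb = q₀ ^ 2 := by rw [Complex.mul_conj, Complex.normSq_eq_norm_sq, hqb]; simp
  set k := kz q₀ z with hk
  set c : ℂ := colSign j * (I * (kap q₀ z * (2 * k ^ 2 - q₀ ^ 2))) with hc
  set E := Ecol qb z j with hE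
  set G : ℂ × ℂ → Op := fun p => matOp (laxT p.1 p.2 k) + c • 1 with hG
  have hGc : Continuous G :=
    (continuous_laxT (F := Op) matOp continuous_fst continuous_snd continuous_const).add
      continuous_const
  -- For constant potential T is the multiple -(2k² - q₀²) of X_b, so E is also an eigenvector of
  -- the limiting time equation, and c is exactly the opposite of its eigenvalue.
  have hGE : G (qb, 0) E = 0 := by
    simp only [hG, _root_.add_apply, _root_.smul_apply, matOp_apply, one_apply_eq_self]
    rw [laxT_zero_eq, Matrix.smul_mulVec, hE, laxX_mulVec_Ecol hz hqb, smul_smul, ← add_smul, hn,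
      hc]
    convert zero_smul ℂ _ using 2
    ring
  set A : ℝ → ℝ → Op := fun x s => G (q x s, deriv (fun y => q y s) x) with hA
  have hAc : ∀ x, Continuous (A x) := fun x => hGc.comp
    ((hq.continuous_q.comp (by fun_prop : Continuous fun s : ℝ => (x, s))).prodMk
      (hq.continuous_qx.comp (by fun_prop : Continuous fun s : ℝ => (x, s))))
  -- Local boundedness of q and q_x makes the generator of the time evolution bounded uniformly in
  -- x. This gives a Grönwall constant independent of x and a dominating function for the forcing.
  obtain ⟨C, hC⟩ := hb |t|
  obtain ⟨K, hK⟩ := ((isCompact_closedBall (0 : ℂ) C).prod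
    (isCompact_closedBall (0 : ℂ) C)).exists_bound_of_continuousOn hGc.continuousOn
  have hAK : ∀ x, ∀ s ∈ Set.uIcc 0 t, ‖A x s‖ ≤ K := fun x s hs => by
    have hs' : |s| ≤ |t| := by simpa using Set.abs_sub_left_of_mem_uIcc hs
    exact hK _ ⟨by simpa using (hC x s hs').1, by simpa using (hC x s hs').2⟩
  set y : ℝ → ℝ → Fin 2 → ℂ := fun x s =>
    exp (-(colSign j * (I * theta q₀ x s z))) • W k x s v - E with hy
  have hyd : ∀ x s, HasDerivAt (y x) (A x s (y x s) + A x s E) s := by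
    intro x s
    have h1 : HasDerivAt (fun s : ℝ => -(colSign j * (I * theta q₀ x s z))) c s := by
      have h2 : HasDerivAt (fun s : ℝ => -(colSign j * (I * (kap q₀ z * x))) + c * (s : ℂ)) (c * 1) s :=
        ((Complex.ofRealCLM.hasDerivAt (x := s)).const_mul c).const_add _
      rw [mul_one] at h2
      refine h2.congr_of_eventuallyEq (Eventually.of_forall fun s => ?_)
      simp only [theta_eq, hc, ← hk]
      ring
    refine ((h1.cexp.fun_smul (hasDerivAt_op_apply (hW.deriv_t k x s) v)).sub_const E).congr_deriv ?_
    rw [← map_add]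
    simp only [hy, sub_add_cancel, hA, hG, map_smul, _root_.add_apply, _root_.smul_apply,
      one_apply_eq_self]
    module
  have hbound : ∀ x, ‖y x t‖ ≤ (‖y x 0‖ + |∫ s in (0 : ℝ)..t, ‖A x s E‖|) * Real.exp (K * |t - 0|) :=
    fun x => norm_le_exp_of_hasDerivAt (hAc x) ((hAc x).clm_apply continuous_const) (hyd x) (hAK x)
  have hint : Tendsto (fun x => ∫ s in (0 : ℝ)..t, ‖A x s E‖) l (𝓝 (∫ s in (0 : ℝ)..t, (0 : ℝ))) := by
    refine intervalIntegral.tendsto_integral_filter_of_dominated_convergence (fun _ => K * ‖E‖)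
      (Eventually.of_forall fun x =>
        ((hAc x).clm_apply continuous_const).norm.aestronglyMeasurable)
      (Eventually.of_forall fun x => ae_of_all _ fun s hs => ?_) intervalIntegrable_const
      (ae_of_all _ fun s _ => ?_)
    · rw [norm_norm]
      exact ((A x s).le_opNorm E).trans (mul_le_mul_of_nonneg_right
        (hAK x s (Set.uIoc_subset_uIcc hs)) (norm_nonneg _))
    · have h1 : Tendsto (fun x => A x s) l (𝓝 (G (qb, 0))) :=
        (hGc.tendsto (qb, 0)).comp ((hl s).prodMk_nhds (hlx s))
      have h2 : Tendsto (fun x => A x s E) l (𝓝 (G (qb, 0) E)) :=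
        ((ContinuousLinearMap.apply ℂ (Fin 2 → ℂ) E).continuous.tendsto _).comp h1
      rw [hGE] at h2
      simpa using h2.norm
  rw [tendsto_iff_norm_sub_tendsto_zero] at h0 ⊢
  refine squeeze_zero (fun _ => norm_nonneg _) hbound ?_
  rw [intervalIntegral.integral_zero] at hint
  simpa using (h0.add hint.abs).mul_const (Real.exp (K * |t - 0|))

/-! ### Uniqueness of the Jost solutions -/

theorem Ecol_ne_zero (qb z : ℂ) (j : Fin 2) : Ecol qb z j ≠ 0 := by
  intro h
  have := congrFun h j
  fin_cases j <;> simp [Ecol, Emat] at this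

/-- The exponential of the `j`-th column does not grow along `l`. -/
def DecaySign (q₀ : ℝ) (l : Filter ℝ) (j : Fin 2) (z : ℂ) : Prop :=
  ∀ᶠ x : ℝ in l, 0 ≤ (colSign j).re * (kap q₀ z).im * x

theorem norm_exp_theta (j : Fin 2) (x t : ℝ) (z : ℂ) :
    ‖exp (colSign j * (I * theta q₀ x t z))‖ = Real.exp (-((colSign j).re * (kap q₀ z).im * x)) *
      ‖exp (colSign j * (I * theta q₀ 0 t z))‖ := by
  have : colSign j * (I * theta q₀ x t z) =
      colSign j * (I * kap q₀ z) * x + colSign j * (I * theta q₀ 0 t z) := by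
    simp only [theta_eq]; push_cast; ring
  rw [this, Complex.exp_add, norm_mul]
  congr 1
  rw [Complex.norm_exp, Complex.re_mul_ofReal]
  congr 1
  fin_cases j <;> simp [colSign]

/-- The Wronskian of two candidates is constant in x. It equals the square of a bounded exponential
times the Wronskian of the normalized columns, which have the same limit, so it vanishes. The
candidates are then proportional, and the diagonal entry 1 of E fixes the factor. -/
theorem IsJostColumn.unique {l : Filter ℝ} [l.NeBot] {j : Fin 2} {t : ℝ} {z : ℂ}
    (hc : Continuous fun x => q x t) (hs : DecaySign q₀ l j z) {φ ψ : ℝ → Fin 2 → ℂ}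
    (hφ : IsJostColumn q q₀ qb l j t z φ) (hψ : IsJostColumn q q₀ qb l j t z ψ) : φ = ψ := by
  set e : ℝ → ℂ := fun x => exp (colSign j * (I * theta q₀ x t z)) with he
  have hee : ∀ x, e x * exp (-(colSign j * (I * theta q₀ x t z))) = 1 := fun x => by
    rw [he, ← Complex.exp_add]; simp
  have hW : Tendsto (fun x => Wr (exp (-(colSign j * (I * theta q₀ x t z))) • φ x)
      (exp (-(colSign j * (I * theta q₀ x t z))) • ψ x)) l (𝓝 0) := by
    have := (continuous_Wr.tendsto (Ecol qb z j, Ecol qb z j)).comp (hφ.2.prodMk_nhds hψ.2)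
    rwa [Wr_self] at this
  have hzero : ∀ x, Wr (φ x) (ψ x) = 0 := by
    intro x₀
    have hconst : ∀ x, Wr (φ x) (ψ x) = e x ^ 2 * Wr (exp (-(colSign j * (I * theta q₀ x t z))) • φ x)
        (exp (-(colSign j * (I * theta q₀ x t z))) • ψ x) := fun x => by
      rw [Wr_smul_left, Wr_smul_right]
      linear_combination (-(e x * exp (-(colSign j * (I * theta q₀ x t z))) + 1) *
        Wr (φ x) (ψ x)) * hee x
    have hlim : Tendsto (fun x => Wr (φ x) (ψ x)) l (𝓝 0) := by
      simp only [hconst]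
      have hW' := hW.norm.const_mul (‖e 0‖ ^ 2)
      rw [norm_zero, mul_zero] at hW'
      refine squeeze_zero_norm' ?_ hW'
      filter_upwards [hs] with x hx
      rw [norm_mul, norm_pow]
      refine mul_le_mul_of_nonneg_right ?_ (norm_nonneg _)
      rw [he, norm_exp_theta]
      have h1 : Real.exp (-((colSign j).re * (kap q₀ z).im * x)) ≤ 1 :=
        Real.exp_le_one_iff.2 (by linarith)
      have h2 := norm_nonneg (exp (colSign j * (I * theta q₀ 0 t z)))
      gcongr
      exact mul_le_of_le_one_left h2 h1
    have h2 : Tendsto (fun x => Wr (φ x) (ψ x)) l (𝓝 (Wr (φ x₀) (ψ x₀))) := by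
      refine tendsto_const_nhds.congr fun x => ?_
      exact Wr_eq_of_hasDerivAt (fun x => laxX_trace (q x t) _) hφ.1 hψ.1 x₀ x
    exact tendsto_nhds_unique h2 hlim
  obtain ⟨x₀, hx₀⟩ : ∃ x, ψ x ≠ 0 := by
    by_contra! h
    have := hψ.2
    simp only [h, smul_zero] at this
    exact Ecol_ne_zero qb z j (tendsto_nhds_unique this tendsto_const_nhds)
  obtain ⟨c, hcx⟩ := exists_smul_eq_of_Wr_eq_zero hx₀ (hzero x₀)
  have hA : Continuous fun x => matOp (laxX (q x t) (kz q₀ z)) :=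
    continuous_laxX (F := Op) matOp hc continuous_const
  have heq : φ = fun x => c • ψ x := linear_ode_unique hA hφ.1
    (fun x => ((hψ.1 x).const_smul c).congr_deriv (by rw [matOp_apply, Matrix.mulVec_smul])) hcx
  have h1 : Tendsto (fun x => exp (-(colSign j * (I * theta q₀ x t z))) • φ x) l
      (𝓝 (c • Ecol qb z j)) := by
    refine (hψ.2.const_smul c).congr fun x => ?_
    rw [heq, smul_comm]
  have h2 : Ecol qb z j = c • Ecol qb z j := tendsto_nhds_unique hφ.2 h1
  have hc1 : c = 1 := by
    have := congrFun h2 j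
    fin_cases j <;> simpa [Ecol, Emat, eq_comm] using this
  rw [heq, hc1]
  simp

/-- Since `jost` is defined by a choice, this is how it gets identified with an explicit solution.
-/
theorem jost_eq {l : Filter ℝ} [l.NeBot] {j : Fin 2} {t : ℝ} {z : ℂ}
    (hc : Continuous fun x => q x t) (hs : DecaySign q₀ l j z) {φ : ℝ → Fin 2 → ℂ}
    (hφ : IsJostColumn q q₀ qb l j t z φ) (x : ℝ) : jost q q₀ qb l j x t z = φ x := by
  have h : ∃ φ : ℝ → Fin 2 → ℂ, IsJostColumn q q₀ qb l j t z φ := ⟨φ, hφ⟩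
  rw [jost, dif_pos h, IsJostColumn.unique hc hs h.choose_spec hφ]

end

/-! ### Symmetries of the uniformization variable -/

/-- The involution `z ↦ -q₀² / z`. -/
noncomputable def hat (q₀ : ℝ) (z : ℂ) : ℂ := -((q₀ : ℂ) ^ 2 / z)

section hat
variable {q₀ : ℝ} {z : ℂ}

theorem hat_ne_zero (hq₀ : q₀ ≠ 0) (hz : z ≠ 0) : hat q₀ z ≠ 0 := by
  simp [hat, hq₀, hz]

theorem hat_hat (hq₀ : q₀ ≠ 0) (hz : z ≠ 0) : hat q₀ (hat q₀ z) = z := by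
  have : (q₀ : ℂ) ≠ 0 := by simpa using hq₀
  unfold hat; field_simp

theorem kz_hat (hq₀ : q₀ ≠ 0) (hz : z ≠ 0) : kz q₀ (hat q₀ z) = kz q₀ z := by
  have : (q₀ : ℂ) ≠ 0 := by simpa using hq₀
  unfold kz hat; field_simp; ring

theorem lamz_hat (hq₀ : q₀ ≠ 0) (hz : z ≠ 0) : lamz q₀ (hat q₀ z) = -lamz q₀ z := by
  have : (q₀ : ℂ) ≠ 0 := by simpa using hq₀
  unfold lamz hat; field_simp; ring

theorem theta_hat (hq₀ : q₀ ≠ 0) (hz : z ≠ 0) (x t : ℝ) :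
    theta q₀ x t (hat q₀ z) = -theta q₀ x t z := by
  rw [theta, theta, kz_hat hq₀ hz, lamz_hat hq₀ hz]; ring

theorem hat_re_mul_im (hz : z ≠ 0) : (hat q₀ z).re * (hat q₀ z).im =
    -((q₀ ^ 4 / Complex.normSq z ^ 2) * (z.re * z.im)) := by
  have hn : Complex.normSq z ≠ 0 := by simpa using hz
  have h : hat q₀ z = ((-(q₀ ^ 2 / Complex.normSq z) : ℝ) : ℂ) * conj z := by
    rw [hat, div_eq_mul_inv, Complex.inv_def]; push_cast; ring
  rw [h, Complex.re_ofReal_mul, Complex.im_ofReal_mul, Complex.conj_re, Complex.conj_im]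
  field_simp

theorem hat_mem_Dplus_iff (hq₀ : q₀ ≠ 0) (hz : z ≠ 0) : hat q₀ z ∈ Dplus ↔ z ∈ Dminus := by
  have hn : 0 < Complex.normSq z := Complex.normSq_pos.2 hz
  have : 0 < q₀ ^ 4 / Complex.normSq z ^ 2 := by positivity
  simp only [Dplus, Dminus, Set.mem_ofPred_eq, hat_re_mul_im hz, Left.neg_pos_iff]
  exact mul_neg_iff.trans ⟨fun h => by
    rcases h with h | h
    · exact h.2
    · exact absurd h.1 this.not_gt, fun h => Or.inl ⟨this, h⟩⟩

theorem hat_mem_Dminus_iff (hq₀ : q₀ ≠ 0) (hz : z ≠ 0) : hat q₀ z ∈ Dminus ↔ z ∈ Dplus := by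
  rw [← hat_mem_Dplus_iff hq₀ (hat_ne_zero hq₀ hz), hat_hat hq₀ hz]

theorem hat_mem_contour (hq₀ : q₀ ≠ 0) (hz : z ∈ contour) : hat q₀ z ∈ contour := by
  have h1 := hat_re_mul_im (q₀ := q₀) hz.2
  have h2 : z.re * z.im = 0 := by rcases hz.1 with h | h <;> simp [h]
  rw [h2, mul_zero, neg_zero, mul_eq_zero] at h1
  exact ⟨h1.symm, hat_ne_zero hq₀ hz.2⟩

theorem hat_mem_closedDplus (hq₀ : q₀ ≠ 0) (hz : z ∈ Dminus ∪ contour) :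
    hat q₀ z ∈ Dplus ∪ contour := by
  have hz0 := (mem_closedDminus_iff.1 hz).1
  rcases hz with h | h
  · exact Or.inl ((hat_mem_Dplus_iff hq₀ hz0).2 h)
  · exact Or.inr (hat_mem_contour hq₀ h)

theorem hat_mem_closedDminus (hq₀ : q₀ ≠ 0) (hz : z ∈ Dplus ∪ contour) :
    hat q₀ z ∈ Dminus ∪ contour := by
  have hz0 := (mem_closedDplus_iff.1 hz).1
  rcases hz with h | h
  · exact Or.inl ((hat_mem_Dminus_iff hq₀ hz0).2 h)
  · exact Or.inr (hat_mem_contour hq₀ h)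

theorem differentiableAt_hat (hz : z ≠ 0) : DifferentiableAt ℂ (hat q₀) z := by
  unfold hat; fun_prop (disch := exact hz)

theorem kz_conj (q₀ : ℝ) (z : ℂ) : kz q₀ (conj z) = conj (kz q₀ z) := by
  simp [kz, map_ofNat]

theorem lamz_conj (q₀ : ℝ) (z : ℂ) : lamz q₀ (conj z) = conj (lamz q₀ z) := by
  simp [lamz, map_ofNat]

theorem theta_conj (q₀ x t : ℝ) (z : ℂ) : theta q₀ x t (conj z) = conj (theta q₀ x t z) := by
  simp [theta, kz_conj, lamz_conj, map_ofNat]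

theorem kz_neg (q₀ : ℝ) (z : ℂ) : kz q₀ (-z) = -kz q₀ z := by
  unfold kz; rw [div_neg]; ring

theorem lamz_neg (q₀ : ℝ) (z : ℂ) : lamz q₀ (-z) = -lamz q₀ z := by
  unfold lamz; rw [div_neg]; ring

theorem theta_neg (q₀ x t : ℝ) (z : ℂ) : theta q₀ x t (-z) = theta q₀ x t z := by
  rw [theta, theta, kz_neg, lamz_neg]; ring

theorem conj_mem_closedDplus (hz : z ∈ Dminus ∪ contour) : conj z ∈ Dplus ∪ contour := by
  rw [mem_closedDminus_iff] at hz
  rw [mem_closedDplus_iff]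
  exact ⟨by simpa using hz.1, by simpa using hz.2⟩

theorem neg_mem_closedDplus (hz : z ∈ Dplus ∪ contour) : -z ∈ Dplus ∪ contour := by
  rw [mem_closedDplus_iff] at hz ⊢
  exact ⟨by simpa using hz.1, by simpa using hz.2⟩

theorem kap_im_nonpos (q₀ : ℝ) (hz : z ∈ Dminus ∪ contour) : (kap q₀ z).im ≤ 0 := by
  rw [mem_closedDminus_iff] at hz
  rw [kap_im q₀ hz.1]
  have : 0 ≤ -(z.re * z.im) := by linarith [hz.2]
  have : 0 ≤ -(z.re * z.im) * (1 + q₀ ^ 4 / Complex.normSq z ^ 2) := by positivity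
  linarith

theorem decaySign_atBot_one (hz : z ∈ Dplus ∪ contour) : DecaySign q₀ atBot 1 z := by
  filter_upwards [eventually_le_atBot 0] with x hx
  have := kap_im_nonneg q₀ hz
  simp only [colSign_one, Complex.neg_re, Complex.one_re]
  nlinarith

theorem decaySign_atTop_zero (hz : z ∈ Dplus ∪ contour) : DecaySign q₀ atTop 0 z := by
  filter_upwards [eventually_ge_atTop 0] with x hx
  have := kap_im_nonneg q₀ hz
  simp only [colSign_zero, Complex.one_re]
  nlinarith

theorem decaySign_atBot_zero (hz : z ∈ Dminus ∪ contour) : DecaySign q₀ atBot 0 z := by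
  filter_upwards [eventually_le_atBot 0] with x hx
  have := kap_im_nonpos q₀ hz
  simp only [colSign_zero, Complex.one_re]
  nlinarith

theorem decaySign_atTop_one (hz : z ∈ Dminus ∪ contour) : DecaySign q₀ atTop 1 z := by
  filter_upwards [eventually_ge_atTop 0] with x hx
  have := kap_im_nonpos q₀ hz
  simp only [colSign_one, Complex.neg_re, Complex.one_re]
  nlinarith

end hat

/-! ### Symmetries of the Jost columns -/

section symm
variable {q : ℝ → ℝ → ℂ} {q₀ : ℝ} {qb : ℂ} {l : Filter ℝ} {t : ℝ} {z : ℂ} {φ : ℝ → Fin 2 → ℂ}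

theorem mul_conj_of_norm_eq (hqb : ‖qb‖ = q₀) : qb * conj qb = q₀ ^ 2 := by
  rw [Complex.mul_conj, Complex.normSq_eq_norm_sq, hqb]; simp

/-- The involution keeps k and reverses λ: the differential equation is the same while θ changes
sign, so the two columns are exchanged. The scalar factor is read off from E. -/
theorem isJostColumn_zero_of_hat (hq₀ : q₀ ≠ 0) (hqb : ‖qb‖ = q₀) (hz : z ≠ 0)
    (h : IsJostColumn q q₀ qb l 1 t (hat q₀ z) φ) :
    IsJostColumn q q₀ qb l 0 t z fun x => (I * conj qb / z) • φ x := by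
  have hn := mul_conj_of_norm_eq hqb
  have hI : I ^ 2 = -1 := I_sq
  have h0 : (q₀ : ℂ) ≠ 0 := by simpa using hq₀
  refine ⟨fun x => ?_, ?_⟩
  · refine ((h.1 x).const_smul (I * conj qb / z)).congr_deriv ?_
    rw [kz_hat hq₀ hz, Matrix.mulVec_smul]
  · change Tendsto _ _ (𝓝 (Ecol qb z 0))
    have hE : Ecol qb z 0 = (I * conj qb / z) • Ecol qb (hat q₀ z) 1 := by
      rw [Ecol_zero, Ecol_one, hat]
      ext i; fin_cases i
      · simp; field_simp; linear_combination I ^ 2 * hn + q₀ ^ 2 * hI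
      · simp
    rw [hE]
    refine (h.2.const_smul (I * conj qb / z)).congr fun x => ?_
    rw [smul_comm, theta_hat hq₀ hz, colSign_zero, colSign_one]
    congr 2; ring_nf

theorem isJostColumn_one_of_hat (hq₀ : q₀ ≠ 0) (hqb : ‖qb‖ = q₀) (hz : z ≠ 0)
    (h : IsJostColumn q q₀ qb l 0 t (hat q₀ z) φ) :
    IsJostColumn q q₀ qb l 1 t z fun x => (I * qb / z) • φ x := by
  have hn := mul_conj_of_norm_eq hqb
  have hI : I ^ 2 = -1 := I_sq
  have h0 : (q₀ : ℂ) ≠ 0 := by simpa using hq₀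
  refine ⟨fun x => ?_, ?_⟩
  · refine ((h.1 x).const_smul (I * qb / z)).congr_deriv ?_
    rw [kz_hat hq₀ hz, Matrix.mulVec_smul]
  · change Tendsto _ _ (𝓝 (Ecol qb z 1))
    have hE : Ecol qb z 1 = (I * qb / z) • Ecol qb (hat q₀ z) 0 := by
      rw [Ecol_zero, Ecol_one, hat]
      ext i; fin_cases i
      · simp
      · simp; field_simp; linear_combination I ^ 2 * hn + q₀ ^ 2 * hI
    rw [hE]
    refine (h.2.const_smul (I * qb / z)).congr fun x => ?_
    rw [smul_comm, theta_hat hq₀ hz, colSign_zero, colSign_one]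
    congr 2; ring_nf

/-- The antilinear map `(a, b) ↦ (b^*, -a^*)`. -/
noncomputable def conjV (v : Fin 2 → ℂ) : Fin 2 → ℂ := ![conj (v 1), -conj (v 0)]

theorem continuous_conjV : Continuous conjV := by
  unfold conjV
  refine continuous_pi fun i => ?_
  fin_cases i
  · exact Complex.continuous_conj.comp (continuous_apply 1)
  · exact (Complex.continuous_conj.comp (continuous_apply 0)).neg

theorem conjV_smul (c : ℂ) (v : Fin 2 → ℂ) : conjV (c • v) = conj c • conjV v := by
  ext i; fin_cases i <;> simp [conjV]

theorem hasDerivAt_conjV {φ' : Fin 2 → ℂ} {x : ℝ} (h : HasDerivAt φ φ' x) :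
    HasDerivAt (fun y => conjV (φ y)) (conjV φ') x := by
  rw [hasDerivAt_pi] at h ⊢
  intro i
  fin_cases i
  · exact (h 1).star
  · exact (h 0).star.fun_neg

/-- The quaternionic structure that commutes with X when k is conjugated; it exchanges the columns
and carries D⁻ to D⁺. -/
theorem conjV_laxX (u k : ℂ) (v : Fin 2 → ℂ) :
    conjV (laxX u (conj k) *ᵥ v) = laxX u k *ᵥ conjV v := by
  rw [laxX_mulVec, laxX_mulVec]
  ext i; fin_cases i <;> simp [conjV] <;> ring

theorem conjV_Ecol_one (qb z : ℂ) : conjV (Ecol qb (conj z) 1) = Ecol qb z 0 := by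
  rw [Ecol_zero, Ecol_one]
  ext i; fin_cases i <;> simp [conjV, neg_div]

theorem conjV_Ecol_zero (qb z : ℂ) : -conjV (Ecol qb (conj z) 0) = Ecol qb z 1 := by
  rw [Ecol_zero, Ecol_one]
  ext i; fin_cases i <;> simp [conjV, neg_div]

theorem conj_exp_colSign (j : Fin 2) (x t : ℝ) (z : ℂ) :
    conj (exp (-(colSign j * (I * theta q₀ x t (conj z))))) =
      exp (-(colSign (1 - j) * (I * theta q₀ x t z))) := by
  rw [← Complex.exp_conj, theta_conj]
  congr 1
  fin_cases j <;> simp [colSign]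

theorem isJostColumn_zero_of_conj (h : IsJostColumn q q₀ qb l 1 t (conj z) φ) :
    IsJostColumn q q₀ qb l 0 t z fun x => conjV (φ x) := by
  refine ⟨fun x => ?_, ?_⟩
  · refine (hasDerivAt_conjV (h.1 x)).congr_deriv ?_
    rw [kz_conj, conjV_laxX]
  · change Tendsto _ _ (𝓝 (Ecol qb z 0))
    rw [← conjV_Ecol_one]
    refine ((continuous_conjV.tendsto _).comp h.2).congr fun x => ?_
    simp only [Function.comp_apply, conjV_smul, conj_exp_colSign, sub_self]

theorem isJostColumn_one_of_conj (h : IsJostColumn q q₀ qb l 0 t (conj z) φ) :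
    IsJostColumn q q₀ qb l 1 t z fun x => -conjV (φ x) := by
  refine ⟨fun x => ?_, ?_⟩
  · refine (hasDerivAt_conjV (h.1 x)).fun_neg.congr_deriv ?_
    rw [kz_conj, conjV_laxX, Matrix.mulVec_neg]
  · change Tendsto _ _ (𝓝 (Ecol qb z 1))
    rw [← conjV_Ecol_zero]
    refine ((continuous_conjV.neg.tendsto _).comp h.2).congr fun x => ?_
    simp only [Function.comp_apply, Pi.neg_apply, conjV_smul, conj_exp_colSign, sub_zero, smul_neg]

/-- The map `(a, b) ↦ (a, -b)`. -/
noncomputable def sigV (v : Fin 2 → ℂ) : Fin 2 → ℂ := ![v 0, -v 1]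

theorem continuous_sigV : Continuous sigV := by
  unfold sigV
  refine continuous_pi fun i => ?_
  fin_cases i
  · exact continuous_apply 0
  · exact (continuous_apply 1).neg

theorem sigV_smul (c : ℂ) (v : Fin 2 → ℂ) : sigV (c • v) = c • sigV v := by
  ext i; fin_cases i <;> simp [sigV]

theorem hasDerivAt_sigV {φ' : Fin 2 → ℂ} {x : ℝ} (h : HasDerivAt φ φ' x) :
    HasDerivAt (fun y => sigV (φ y)) (sigV φ') x := by
  rw [hasDerivAt_pi] at h ⊢
  intro i
  fin_cases i
  · exact h 0
  · exact (h 1).fun_neg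

/-- Conjugation by σ₃ changes the sign of kQ only, which matches z ↦ -z, where k and λ change sign
and θ does not. -/
theorem sigV_laxX (u k : ℂ) (v : Fin 2 → ℂ) :
    sigV (laxX u (-k) *ᵥ v) = laxX u k *ᵥ sigV v := by
  rw [laxX_mulVec, laxX_mulVec]
  ext i; fin_cases i <;> simp [sigV] <;> ring

theorem sigV_Ecol_zero (qb z : ℂ) : sigV (Ecol qb (-z) 0) = Ecol qb z 0 := by
  rw [Ecol_zero, Ecol_zero]
  ext i; fin_cases i <;> simp [sigV, div_neg]

theorem sigV_Ecol_one (qb z : ℂ) : -sigV (Ecol qb (-z) 1) = Ecol qb z 1 := by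
  rw [Ecol_one, Ecol_one]
  ext i; fin_cases i <;> simp [sigV, div_neg]

theorem isJostColumn_zero_of_neg (h : IsJostColumn q q₀ qb l 0 t (-z) φ) :
    IsJostColumn q q₀ qb l 0 t z fun x => sigV (φ x) := by
  refine ⟨fun x => ?_, ?_⟩
  · refine (hasDerivAt_sigV (h.1 x)).congr_deriv ?_
    rw [kz_neg, sigV_laxX]
  · change Tendsto _ _ (𝓝 (Ecol qb z 0))
    rw [← sigV_Ecol_zero]
    refine ((continuous_sigV.tendsto _).comp h.2).congr fun x => ?_
    simp only [Function.comp_apply, sigV_smul, theta_neg]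

theorem isJostColumn_one_of_neg (h : IsJostColumn q q₀ qb l 1 t (-z) φ) :
    IsJostColumn q q₀ qb l 1 t z fun x => -sigV (φ x) := by
  refine ⟨fun x => ?_, ?_⟩
  · refine (hasDerivAt_sigV (h.1 x)).fun_neg.congr_deriv ?_
    rw [kz_neg, sigV_laxX, Matrix.mulVec_neg]
  · change Tendsto _ _ (𝓝 (Ecol qb z 1))
    rw [← sigV_Ecol_one]
    refine ((continuous_sigV.neg.tendsto _).comp h.2).congr fun x => ?_
    simp only [Function.comp_apply, Pi.neg_apply, sigV_smul, theta_neg, smul_neg]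

end symm

/-! ### Reflection of the half-line -/

/-- The map `(a, b) ↦ (b, a)`. -/
noncomputable def swapV (v : Fin 2 → ℂ) : Fin 2 → ℂ := ![v 1, v 0]

theorem continuous_swapV : Continuous swapV := by
  unfold swapV
  refine continuous_pi fun i => ?_
  fin_cases i
  · exact continuous_apply 1
  · exact continuous_apply 0

theorem swapV_smul (c : ℂ) (v : Fin 2 → ℂ) : swapV (c • v) = c • swapV v := by
  ext i; fin_cases i <;> simp [swapV]

/-- The sign is that of the reflection x ↦ -x. Swapping components and conjugating the reflected
potential therefore turns the construction at -∞ into the one at +∞. -/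
theorem swapV_laxX (u k : ℂ) (v : Fin 2 → ℂ) :
    swapV (laxX u k *ᵥ v) = -(laxX (conj u) k *ᵥ swapV v) := by
  rw [laxX_mulVec, laxX_mulVec]
  ext i; fin_cases i <;> simp [swapV]

theorem swapV_Ecol (qb z : ℂ) : swapV (Ecol (conj qb) z 1) = Ecol qb z 0 := by
  rw [Ecol_zero, Ecol_one]
  ext i; fin_cases i <;> simp [swapV]

/-- The operator of `swapV`. -/
noncomputable def swapOp : Op := matOp !![0, 1; 1, 0]

theorem swapOp_apply (v : Fin 2 → ℂ) : swapOp v = swapV v := by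
  rw [swapOp, matOp_apply]
  ext i; fin_cases i <;> simp [swapV, dotProduct, Fin.sum_univ_two]

theorem swapV_swapV (v : Fin 2 → ℂ) : swapV (swapV v) = v := by
  ext i; fin_cases i <;> simp [swapV]

theorem IsSpaceFlow.reflect {u : ℝ → ℂ} {W : ℂ → ℝ → Op} (hW : IsSpaceFlow u W) :
    IsSpaceFlow (fun x => conj (u (-x))) fun k x => swapOp ∘L W k (-x) ∘L swapOp := by
  have hc : ∀ A : Op, (swapOp ∘L A ∘L swapOp) =
      ((ContinuousLinearMap.compL ℂ (Fin 2 → ℂ) (Fin 2 → ℂ) (Fin 2 → ℂ) swapOp) ∘L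
        ((ContinuousLinearMap.compL ℂ (Fin 2 → ℂ) (Fin 2 → ℂ) (Fin 2 → ℂ)).flip swapOp)) A :=
    fun A => rfl
  refine ⟨fun k => ?_, fun k x => ?_, fun x => ?_⟩
  · simp only [neg_zero, hW.zero]
    ext v : 1
    simp [swapOp_apply, swapV_swapV]
  · have h1 := (hW.deriv k (-x)).scomp x (hasDerivAt_neg x)
    have h2 := (((ContinuousLinearMap.compL ℂ (Fin 2 → ℂ) (Fin 2 → ℂ) (Fin 2 → ℂ) swapOp) ∘L
        ((ContinuousLinearMap.compL ℂ (Fin 2 → ℂ) (Fin 2 → ℂ) (Fin 2 → ℂ)).flip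
          swapOp)).restrictScalars ℝ).hasFDerivAt (x := W k (-x)) |>.comp_hasDerivAt x h1
    refine h2.congr_deriv ?_
    ext v : 1
    change swapOp ((-1 : ℝ) • (laxX (u (-x)) k *ᵥ (W k (-x) (swapOp v)))) =
      laxX (conj (u (-x))) k *ᵥ (swapOp (W k (-x) (swapOp v)))
    rw [neg_one_smul, map_neg, swapOp_apply, swapOp_apply (W k (-x) (swapOp v)), swapV_laxX, neg_neg]
  · simp only [hc]
    exact (ContinuousLinearMap.differentiable _).comp (hW.diff (-x))

/-! ### The Jost solutions of the problem -/

section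
variable {q : ℝ → ℝ → ℂ} {q₀ : ℝ} {qm qp : ℂ} {W : ℂ → ℝ → ℝ → Op} {Jm Jp : ℂ → Fin 2 → ℂ}

theorem HasNZBC.leftPotential (hq : IsSolution q) (hbc : HasNZBC q q₀ qm qp) (t : ℝ) :
    LeftPotential (fun x => q x t) qm q₀ := by
  refine ⟨(hq.contDiff_x t).continuous, hbc.q₀_pos, hbc.norm_qm, ?_⟩
  refine (hbc.integrable_bot t).norm.congr (ae_of_all _ fun x => ?_)
  change ‖((1 + |x| : ℝ) : ℂ) * _‖ = _
  rw [norm_mul, Complex.norm_real, Real.norm_of_nonneg (by positivity), weight]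

theorem HasNZBC.leftPotential_reflect (hq : IsSolution q) (hbc : HasNZBC q q₀ qm qp) (t : ℝ) :
    LeftPotential (fun x => conj (q (-x) t)) (conj qp) q₀ := by
  refine ⟨Complex.continuous_conj.comp ((hq.contDiff_x t).continuous.comp continuous_neg),
    hbc.q₀_pos, by rw [Complex.norm_conj, hbc.norm_qp], ?_⟩
  have h : IntegrableOn (weight (fun x => q x t) qp) (Set.Ici 0) := by
    refine (hbc.integrable_top t).norm.congr (ae_of_all _ fun x => ?_)
    change ‖((1 + |x| : ℝ) : ℂ) * _‖ = _
    rw [norm_mul, Complex.norm_real, Real.norm_of_nonneg (by positivity), weight]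
  have h2 : IntegrableOn (fun x => weight (fun x => q x t) qp (-x)) (Set.Iic 0) := by
    have h3 := h.comp_neg
    rwa [Set.neg_Ici, neg_zero] at h3
  refine h2.congr (ae_of_all _ fun x => ?_)
  simp only [weight, abs_neg, ← map_sub, Complex.norm_conj]

theorem HasNZBC.tendsto_deriv_bot (hq : IsSolution q) (hbc : HasNZBC q q₀ qm qp) (t : ℝ) :
    Tendsto (fun x => deriv (fun y => q y t) x) atBot (𝓝 0) :=
  tendsto_zero_of_hasDerivAt_of_integrableOn_Iic (a := 0) (fun x _ => hq.hasDerivAt_xx x t)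
    (hbc.integrable_deriv2 t).integrableOn (hbc.integrable_deriv t).integrableOn

theorem HasNZBC.tendsto_deriv_top (hq : IsSolution q) (hbc : HasNZBC q q₀ qm qp) (t : ℝ) :
    Tendsto (fun x => deriv (fun y => q y t) x) atTop (𝓝 0) :=
  tendsto_zero_of_hasDerivAt_of_integrableOn_Ioi (a := 0) (fun x _ => hq.hasDerivAt_xx x t)
    (hbc.integrable_deriv2 t).integrableOn (hbc.integrable_deriv t).integrableOn

/-- The Jost solutions `Φ_{-2}` and `Φ_{+1}` are `W Jm` and `W Jp`, with vectors `Jm`, `Jp` that are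
analytic in `D⁺` and continuous up to `Σ`. -/
structure Scat (q : ℝ → ℝ → ℂ) (q₀ : ℝ) (qm qp : ℂ) (W : ℂ → ℝ → ℝ → Op)
    (Jm Jp : ℂ → Fin 2 → ℂ) : Prop where
  sol : IsSolution q
  bc : HasNZBC q q₀ qm qp
  flow : IsLaxFlow q W
  contM : ContinuousOn Jm (Dplus ∪ contour)
  contP : ContinuousOn Jp (Dplus ∪ contour)
  diffM : DifferentiableOn ℂ Jm Dplus
  diffP : DifferentiableOn ℂ Jp Dplus
  jostM : ∀ z ∈ Dplus ∪ contour, ∀ t,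
    IsJostColumn q q₀ qm atBot 1 t z fun x => W (kz q₀ z) x t (Jm z)
  jostP : ∀ z ∈ Dplus ∪ contour, ∀ t,
    IsJostColumn q q₀ qp atTop 0 t z fun x => W (kz q₀ z) x t (Jp z)

/-- The vectors are constructed at t = 0 only; the flow of the Lax pair carries the resulting
columns to all times with their normalization intact. -/
theorem exists_scat (hq : IsSolution q) (hbc : HasNZBC q q₀ qm qp) :
    ∃ W Jm Jp, Scat q q₀ qm qp W Jm Jp := by
  obtain ⟨W, h1, h2, h3, h4⟩ := exists_lax_flow hq
  have hW : IsLaxFlow q W := ⟨h1, h2, h3, h4⟩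
  obtain ⟨Jm, hm1, hm2, hm3⟩ := exists_left_jost (hbc.leftPotential hq 0) hW.isSpaceFlow
  obtain ⟨Jp, hp1, hp2, hp3⟩ := exists_left_jost (hbc.leftPotential_reflect hq 0)
    hW.isSpaceFlow.reflect
  have hsw : Continuous fun v => swapOp v := swapOp.continuous
  refine ⟨W, Jm, fun z => swapOp (Jp z), hq, hbc, hW, hm1, hsw.comp_continuousOn hp1, hm2,
    swapOp.differentiable.comp_differentiableOn hp2, fun z hz t => ⟨fun x => ?_, ?_⟩,
    fun z hz t => ⟨fun x => ?_, ?_⟩⟩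
  · exact hasDerivAt_op_apply (hW.deriv_x _ x t) _
  · refine tendsto_jost_transport hq hW hbc.norm_qm hbc.tendsto_bot (hbc.tendsto_deriv_bot hq)
      hbc.locally_bounded (mem_closedDplus_iff.1 hz).1 ((hm3 z hz).congr fun x => ?_) t
    simp only [theta_eq, colSign_one]
    congr 2; push_cast; ring
  · exact hasDerivAt_op_apply (hW.deriv_x _ x t) _
  · refine tendsto_jost_transport hq hW hbc.norm_qp hbc.tendsto_top (hbc.tendsto_deriv_top hq)
      hbc.locally_bounded (mem_closedDplus_iff.1 hz).1 ?_ t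
    have h := (continuous_swapV.tendsto _).comp ((hp3 z hz).comp tendsto_neg_atTop_atBot)
    rw [swapV_Ecol] at h
    refine h.congr fun x => ?_
    simp only [Function.comp_apply, swapV_smul, theta_eq, colSign_zero, neg_neg]
    congr 1
    · congr 1; push_cast; ring
    · change swapV (swapOp (W _ x 0 (swapOp (Jp z)))) = _
      rw [swapOp_apply, swapV_swapV]

section facts
variable (S : Scat q q₀ qm qp W Jm Jp) {z : ℂ}
include S

theorem Scat.q₀_ne : q₀ ≠ 0 := S.bc.q₀_pos.ne'

theorem Scat.qm_ne : qm ≠ 0 := by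
  rw [← norm_ne_zero_iff, S.bc.norm_qm]; exact S.q₀_ne

theorem Scat.qp_ne : qp ≠ 0 := by
  rw [← norm_ne_zero_iff, S.bc.norm_qp]; exact S.q₀_ne

theorem Scat.PhiM_one (hz : z ∈ Dplus ∪ contour) (x t : ℝ) :
    PhiM q q₀ qm 1 x t z = W (kz q₀ z) x t (Jm z) :=
  jost_eq (S.sol.contDiff_x t).continuous (decaySign_atBot_one hz) (S.jostM z hz t) x

theorem Scat.PhiP_zero (hz : z ∈ Dplus ∪ contour) (x t : ℝ) :
    PhiP q q₀ qp 0 x t z = W (kz q₀ z) x t (Jp z) :=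
  jost_eq (S.sol.contDiff_x t).continuous (decaySign_atTop_zero hz) (S.jostP z hz t) x

/-- No new construction is made for the columns in D⁻: existence, regularity in z and behaviour at 0
and ∞ are all pulled back from D⁺. -/
theorem Scat.PhiM_zero_hat (hz : z ∈ Dminus ∪ contour) (x t : ℝ) :
    PhiM q q₀ qm 0 x t z = (I * conj qm / z) • PhiM q q₀ qm 1 x t (hat q₀ z) := by
  have hz0 := (mem_closedDminus_iff.1 hz).1
  have hh := hat_mem_closedDplus S.q₀_ne hz
  rw [S.PhiM_one hh]
  exact jost_eq (S.sol.contDiff_x t).continuous (decaySign_atBot_zero hz)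
    (isJostColumn_zero_of_hat S.q₀_ne S.bc.norm_qm hz0 (S.jostM _ hh t)) x

theorem Scat.PhiP_one_hat (hz : z ∈ Dminus ∪ contour) (x t : ℝ) :
    PhiP q q₀ qp 1 x t z = (I * qp / z) • PhiP q q₀ qp 0 x t (hat q₀ z) := by
  have hz0 := (mem_closedDminus_iff.1 hz).1
  have hh := hat_mem_closedDplus S.q₀_ne hz
  rw [S.PhiP_zero hh]
  exact jost_eq (S.sol.contDiff_x t).continuous (decaySign_atTop_one hz)
    (isJostColumn_one_of_hat S.q₀_ne S.bc.norm_qp hz0 (S.jostP _ hh t)) x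

theorem Scat.PhiM_zero_conj (hz : z ∈ Dminus ∪ contour) (x t : ℝ) :
    PhiM q q₀ qm 0 x t z = conjV (PhiM q q₀ qm 1 x t (conj z)) := by
  have hh := conj_mem_closedDplus hz
  rw [S.PhiM_one hh]
  exact jost_eq (S.sol.contDiff_x t).continuous (decaySign_atBot_zero hz)
    (isJostColumn_zero_of_conj (S.jostM _ hh t)) x

theorem Scat.PhiP_one_conj (hz : z ∈ Dminus ∪ contour) (x t : ℝ) :
    PhiP q q₀ qp 1 x t z = -conjV (PhiP q q₀ qp 0 x t (conj z)) := by
  have hh := conj_mem_closedDplus hz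
  rw [S.PhiP_zero hh]
  exact jost_eq (S.sol.contDiff_x t).continuous (decaySign_atTop_one hz)
    (isJostColumn_one_of_conj (S.jostP _ hh t)) x

theorem Scat.PhiM_one_neg (hz : z ∈ Dplus ∪ contour) (x t : ℝ) :
    PhiM q q₀ qm 1 x t z = -sigV (PhiM q q₀ qm 1 x t (-z)) := by
  have hh := neg_mem_closedDplus hz
  rw [S.PhiM_one hh]
  exact jost_eq (S.sol.contDiff_x t).continuous (decaySign_atBot_one hz)
    (isJostColumn_one_of_neg (S.jostM _ hh t)) x

theorem Scat.PhiP_zero_neg (hz : z ∈ Dplus ∪ contour) (x t : ℝ) :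
    PhiP q q₀ qp 0 x t z = sigV (PhiP q q₀ qp 0 x t (-z)) := by
  have hh := neg_mem_closedDplus hz
  rw [S.PhiP_zero hh]
  exact jost_eq (S.sol.contDiff_x t).continuous (decaySign_atTop_zero hz)
    (isJostColumn_zero_of_neg (S.jostP _ hh t)) x

/-- `Φ_{-1}` in terms of the flow. -/
theorem Scat.PhiM_zero (hz : z ∈ Dminus ∪ contour) (x t : ℝ) :
    PhiM q q₀ qm 0 x t z = W (kz q₀ z) x t (PhiM q q₀ qm 0 0 0 z) := by
  have hz0 := (mem_closedDminus_iff.1 hz).1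
  have hh := hat_mem_closedDplus S.q₀_ne hz
  rw [S.PhiM_zero_hat hz, S.PhiM_zero_hat hz, S.PhiM_one hh, S.PhiM_one hh, S.flow.zero,
    kz_hat S.q₀_ne hz0, map_smul]
  rfl

/-- `Φ_{+2}` in terms of the flow. -/
theorem Scat.PhiP_one (hz : z ∈ Dminus ∪ contour) (x t : ℝ) :
    PhiP q q₀ qp 1 x t z = W (kz q₀ z) x t (PhiP q q₀ qp 1 0 0 z) := by
  have hz0 := (mem_closedDminus_iff.1 hz).1
  have hh := hat_mem_closedDplus S.q₀_ne hz
  rw [S.PhiP_one_hat hz, S.PhiP_one_hat hz, S.PhiP_zero hh, S.PhiP_zero hh, S.flow.zero,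
    kz_hat S.q₀_ne hz0, map_smul]
  rfl

theorem Scat.PhiM_one' (hz : z ∈ Dplus ∪ contour) (x t : ℝ) :
    PhiM q q₀ qm 1 x t z = W (kz q₀ z) x t (PhiM q q₀ qm 1 0 0 z) := by
  rw [S.PhiM_one hz, S.PhiM_one hz, S.flow.zero]; rfl

theorem Scat.PhiP_zero' (hz : z ∈ Dplus ∪ contour) (x t : ℝ) :
    PhiP q q₀ qp 0 x t z = W (kz q₀ z) x t (PhiP q q₀ qp 0 0 0 z) := by
  rw [S.PhiP_zero hz, S.PhiP_zero hz, S.flow.zero]; rfl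

/-! Regularity in `z`. -/

theorem Scat.continuousAt_flow (hz : z ≠ 0) (x t : ℝ) :
    ContinuousAt (fun z => W (kz q₀ z) x t) z :=
  ((S.flow.diff x t (kz q₀ z)).comp z (differentiableAt_kz q₀ hz)).continuousAt

theorem Scat.continuousOn_PhiM_one (x t : ℝ) :
    ContinuousOn (fun z => PhiM q q₀ qm 1 x t z) (Dplus ∪ contour) := by
  refine ContinuousOn.congr (fun z hz => ?_) fun z hz => S.PhiM_one hz x t
  exact (S.continuousAt_flow (mem_closedDplus_iff.1 hz).1 x t).continuousWithinAt.clm_apply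
    (S.contM z hz)

theorem Scat.continuousOn_PhiP_zero (x t : ℝ) :
    ContinuousOn (fun z => PhiP q q₀ qp 0 x t z) (Dplus ∪ contour) := by
  refine ContinuousOn.congr (fun z hz => ?_) fun z hz => S.PhiP_zero hz x t
  exact (S.continuousAt_flow (mem_closedDplus_iff.1 hz).1 x t).continuousWithinAt.clm_apply
    (S.contP z hz)

theorem Scat.differentiableOn_PhiM_one (x t : ℝ) :
    DifferentiableOn ℂ (fun z => PhiM q q₀ qm 1 x t z) Dplus := by
  refine DifferentiableOn.congr (fun z hz => ?_) fun z hz => S.PhiM_one (Or.inl hz) x t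
  have hz0 := (mem_closedDplus_iff.1 (Or.inl hz)).1
  exact (((S.flow.diff x t (kz q₀ z)).comp z
    (differentiableAt_kz q₀ hz0)).differentiableWithinAt).clm_apply (S.diffM z hz)

theorem Scat.differentiableOn_PhiP_zero (x t : ℝ) :
    DifferentiableOn ℂ (fun z => PhiP q q₀ qp 0 x t z) Dplus := by
  refine DifferentiableOn.congr (fun z hz => ?_) fun z hz => S.PhiP_zero (Or.inl hz) x t
  have hz0 := (mem_closedDplus_iff.1 (Or.inl hz)).1
  exact (((S.flow.diff x t (kz q₀ z)).comp z
    (differentiableAt_kz q₀ hz0)).differentiableWithinAt).clm_apply (S.diffP z hz)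

theorem Scat.continuousOn_PhiM_zero (x t : ℝ) :
    ContinuousOn (fun z => PhiM q q₀ qm 0 x t z) (Dminus ∪ contour) := by
  refine ContinuousOn.congr ?_ fun z hz => S.PhiM_zero_hat hz x t
  have h0 : ∀ z ∈ Dminus ∪ contour, z ≠ 0 := fun z hz => (mem_closedDminus_iff.1 hz).1
  exact (continuousOn_const.div continuousOn_id h0).smul ((S.continuousOn_PhiM_one x t).comp
    (fun z hz => (differentiableAt_hat (h0 z hz)).continuousAt.continuousWithinAt)
    fun z hz => hat_mem_closedDplus S.q₀_ne hz)

theorem Scat.continuousOn_PhiP_one (x t : ℝ) :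
    ContinuousOn (fun z => PhiP q q₀ qp 1 x t z) (Dminus ∪ contour) := by
  refine ContinuousOn.congr ?_ fun z hz => S.PhiP_one_hat hz x t
  have h0 : ∀ z ∈ Dminus ∪ contour, z ≠ 0 := fun z hz => (mem_closedDminus_iff.1 hz).1
  exact (continuousOn_const.div continuousOn_id h0).smul ((S.continuousOn_PhiP_zero x t).comp
    (fun z hz => (differentiableAt_hat (h0 z hz)).continuousAt.continuousWithinAt)
    fun z hz => hat_mem_closedDplus S.q₀_ne hz)

theorem Scat.differentiableOn_PhiM_zero (x t : ℝ) :
    DifferentiableOn ℂ (fun z => PhiM q q₀ qm 0 x t z) Dminus := by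
  refine DifferentiableOn.congr ?_ fun z hz => S.PhiM_zero_hat (Or.inl hz) x t
  have h0 : ∀ z ∈ Dminus, z ≠ 0 := fun z hz => (mem_closedDminus_iff.1 (Or.inl hz)).1
  exact ((differentiableOn_const _).div differentiableOn_id h0).smul
    ((S.differentiableOn_PhiM_one x t).comp
    (fun z hz => (differentiableAt_hat (h0 z hz)).differentiableWithinAt)
    fun z hz => (hat_mem_Dplus_iff S.q₀_ne (h0 z hz)).2 hz)

theorem Scat.differentiableOn_PhiP_one (x t : ℝ) :
    DifferentiableOn ℂ (fun z => PhiP q q₀ qp 1 x t z) Dminus := by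
  refine DifferentiableOn.congr ?_ fun z hz => S.PhiP_one_hat (Or.inl hz) x t
  have h0 : ∀ z ∈ Dminus, z ≠ 0 := fun z hz => (mem_closedDminus_iff.1 (Or.inl hz)).1
  exact ((differentiableOn_const _).div differentiableOn_id h0).smul
    ((S.differentiableOn_PhiP_zero x t).comp
    (fun z hz => (differentiableAt_hat (h0 z hz)).differentiableWithinAt)
    fun z hz => (hat_mem_Dplus_iff S.q₀_ne (h0 z hz)).2 hz)

end facts
end

/-! ### Asymptotic diagonalization on a half-line -/

/-- Grönwall from a with a → -∞, the initial value being replaced by the limit c. -/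
theorem gronwall_bot {u h ε : ℝ → ℝ} (hu : Continuous u) (hh : Continuous h) (hε : Continuous ε)
    (hh0 : ∀ x, 0 ≤ h x) (hε0 : ∀ x, 0 ≤ ε x) {b c : ℝ}
    (hhi : IntegrableOn h (Set.Iic b))
    (hεi : IntegrableOn ε (Set.Iic b)) (hl : Tendsto u atBot (𝓝 c))
    (H : ∀ a x, a ≤ x → u x ≤ u a + ∫ s in a..x, (h s * u s + ε s)) :
    u b ≤ (c + ∫ s in Set.Iic b, ε s) * Real.exp (∫ s in Set.Iic b, h s) := by
  have h1 : ∀ a ≤ b, u b ≤ (u a + ∫ s in a..b, ε s) * Real.exp (∫ s in a..b, h s) := fun a ha =>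
    gronwall_integral hu hh hε hh0 hε0 ha fun x hx => H a x hx.1
  have t1 := intervalIntegral_tendsto_integral_Iic b hεi tendsto_id
  have t2 := intervalIntegral_tendsto_integral_Iic b hhi tendsto_id
  refine ge_of_tendsto ((hl.add t1).mul ((Real.continuous_exp.tendsto _).comp t2)) ?_
  filter_upwards [eventually_le_atBot b] with a ha using h1 a ha

section diag
variable {α σ : ℂ} {m₁ m₂ P₁₁ P₁₂ P₂₁ P₂₂ P₁₂' : ℝ → ℂ} {v w h : ℝ → ℝ} {K ε b : ℝ}

/-- A two-dimensional system that is diagonal up to a small integrable perturbation. -/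
structure NearlyDiagonal (α σ : ℂ) (m₁ m₂ P₁₁ P₁₂ P₂₁ P₂₂ P₁₂' : ℝ → ℂ) (v w h : ℝ → ℝ)
    (K ε b : ℝ) : Prop where
  re_nonpos : α.re ≤ 0
  ne_zero : α ≠ 0
  K_nonneg : 0 ≤ K
  ε_nonneg : 0 ≤ ε
  ε_le : ε ≤ 1
  ode₁ : ∀ x, HasDerivAt m₁ (α * m₁ x + (P₁₁ x * m₁ x + P₁₂ x * m₂ x)) x
  ode₂ : ∀ x, HasDerivAt m₂ (P₂₁ x * m₁ x + P₂₂ x * m₂ x) x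
  tendsto₁ : Tendsto m₁ atBot (𝓝 0)
  tendsto₂ : Tendsto m₂ atBot (𝓝 σ)
  cont₁₁ : Continuous P₁₁
  cont₂₁ : Continuous P₂₁
  cont₂₂ : Continuous P₂₂
  deriv₁₂ : ∀ x, HasDerivAt P₁₂ (P₁₂' x) x
  cont₁₂' : Continuous P₁₂'
  cont_h : Continuous h
  h_nonneg : ∀ x, 0 ≤ h x
  h_int : IntegrableOn h (Set.Iic b)
  le₁₁ : ∀ x, ‖P₁₁ x‖ ≤ K * h x
  le₁₂ : ∀ x, ‖P₁₂ x‖ ≤ K * ε * h x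
  le₂₁ : ∀ x, ‖P₂₁ x‖ ≤ K * ε * h x
  le₂₂ : ∀ x, ‖P₂₂ x‖ ≤ K * h x
  le₁₂' : ∀ x, ‖P₁₂' x‖ ≤ K * ε * h x
  bd₁₁ : ∀ x, ‖P₁₁ x‖ ≤ K
  bd₁₂ : ∀ x, ‖P₁₂ x‖ ≤ K * ε
  bd₂₂ : ∀ x, ‖P₂₂ x‖ ≤ K
  tendsto₁₂ : Tendsto P₁₂ atBot (𝓝 0)
  deriv_v : ∀ x, HasDerivAt v (w x) x
  tendsto_v : Tendsto v atBot (𝓝 0)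
  cont_w : Continuous w
  le_w : ∀ x, ‖P₂₂ x + I * w x‖ ≤ K * ε ^ 2 * h x

variable (N : NearlyDiagonal α σ m₁ m₂ P₁₁ P₁₂ P₂₁ P₂₂ P₁₂' v w h K ε b)
include N

namespace NearlyDiagonal

theorem cont₁₂ : Continuous P₁₂ := continuous_iff_continuousAt.2 fun x => (N.deriv₁₂ x).continuousAt
theorem cont_m₁ : Continuous m₁ := continuous_iff_continuousAt.2 fun x => (N.ode₁ x).continuousAt
theorem cont_m₂ : Continuous m₂ := continuous_iff_continuousAt.2 fun x => (N.ode₂ x).continuousAt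
theorem cont_v : Continuous v := continuous_iff_continuousAt.2 fun x => (N.deriv_v x).continuousAt

theorem le₁₂_one (x : ℝ) : ‖P₁₂ x‖ ≤ K * h x := by
  refine (N.le₁₂ x).trans ?_
  have := mul_nonneg N.K_nonneg (N.h_nonneg x)
  nlinarith [N.ε_le]

theorem le₂₁_one (x : ℝ) : ‖P₂₁ x‖ ≤ K * h x := by
  refine (N.le₂₁ x).trans ?_
  have := mul_nonneg N.K_nonneg (N.h_nonneg x)
  nlinarith [N.ε_le]

theorem integral_nonneg : 0 ≤ ∫ s in Set.Iic b, h s := MeasureTheory.integral_nonneg N.h_nonneg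

theorem integrable_mono {y : ℝ} (hy : y ≤ b) : IntegrableOn h (Set.Iic y) :=
  N.h_int.mono_set (Set.Iic_subset_Iic.2 hy)

theorem integral_mono {y : ℝ} (hy : y ≤ b) : ∫ s in Set.Iic y, h s ≤ ∫ s in Set.Iic b, h s :=
  setIntegral_mono_set N.h_int (Eventually.of_forall N.h_nonneg) (Set.Iic_subset_Iic.2 hy).eventuallyLE

/-- Since Re α ≤ 0 the large diagonal term never increases ‖m₁‖. Only the integrable perturbation
makes the sum grow from its value ‖σ‖ at -∞, so the bound does not see the size of α. -/
theorem bound {y : ℝ} (hy : y ≤ b) :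
    ‖m₁ y‖ + ‖m₂ y‖ ≤ ‖σ‖ * Real.exp (2 * K * ∫ s in Set.Iic b, h s) := by
  have c11 := N.cont₁₁
  have c12 := N.cont₁₂
  have c21 := N.cont₂₁
  have c22 := N.cont₂₂
  have cm1 := N.cont_m₁
  have cm2 := N.cont_m₂
  have ch := N.cont_h
  have hl : Tendsto (fun x => ‖m₁ x‖ + ‖m₂ x‖) atBot (𝓝 (‖σ‖)) := by
    simpa using N.tendsto₁.norm.add N.tendsto₂.norm
  have hmain := gronwall_bot (u := fun x => ‖m₁ x‖ + ‖m₂ x‖) (h := fun x => 2 * K * h x)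
    (ε := fun _ => 0) (by fun_prop) (by fun_prop) continuous_const
    (fun x => mul_nonneg (mul_nonneg zero_le_two N.K_nonneg) (N.h_nonneg x)) (fun _ => le_rfl)
    ((N.integrable_mono hy).const_mul _) integrableOn_zero hl fun a x hax => ?_
  · refine hmain.trans ?_
    simp only [integral_zero, add_zero]
    gcongr
    rw [integral_const_mul]
    exact mul_le_mul_of_nonneg_left (N.integral_mono hy) (mul_nonneg zero_le_two N.K_nonneg)
  · have h1 := norm_le_of_hasDerivAt_dissipative N.re_nonpos
      (g := fun x => P₁₁ x * m₁ x + P₁₂ x * m₂ x) (by fun_prop) N.ode₁ hax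
    have h2 := norm_le_of_hasDerivAt_dissipative (α := 0) (by simp)
      (g := fun x => P₂₁ x * m₁ x + P₂₂ x * m₂ x) (by fun_prop)
      (fun x => (N.ode₂ x).congr_deriv (by simp)) hax
    have h3 : (∫ s in a..x, ‖P₁₁ s * m₁ s + P₁₂ s * m₂ s‖) +
        (∫ s in a..x, ‖P₂₁ s * m₁ s + P₂₂ s * m₂ s‖) ≤
        ∫ s in a..x, (2 * K * h s * (‖m₁ s‖ + ‖m₂ s‖) + 0) := by
      rw [← intervalIntegral.integral_add]
      · refine intervalIntegral.integral_mono_on hax ?_ ?_ fun s _ => ?_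
        · exact Continuous.intervalIntegrable (by fun_prop) _ _
        · exact Continuous.intervalIntegrable (by fun_prop) _ _
        · have e1 : ‖P₁₁ s * m₁ s + P₁₂ s * m₂ s‖ ≤ K * h s * ‖m₁ s‖ + K * h s * ‖m₂ s‖ := by
            refine (norm_add_le _ _).trans ?_
            rw [norm_mul, norm_mul]
            gcongr
            · exact N.le₁₁ s
            · exact N.le₁₂_one s
          have e2 : ‖P₂₁ s * m₁ s + P₂₂ s * m₂ s‖ ≤ K * h s * ‖m₁ s‖ + K * h s * ‖m₂ s‖ := by
            refine (norm_add_le _ _).trans ?_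
            rw [norm_mul, norm_mul]
            gcongr
            · exact N.le₂₁_one s
            · exact N.le₂₂ s
          linarith
      · exact Continuous.intervalIntegrable (by fun_prop) _ _
      · exact Continuous.intervalIntegrable (by fun_prop) _ _
    linarith

/-- The decaying component. -/
theorem norm_fst_le {y : ℝ} (hy : y ≤ b) : ‖m₁ y‖ ≤ K * (2 + 3 * K) * ‖σ‖ *
    (1 + ∫ s in Set.Iic b, h s) * Real.exp (3 * K * ∫ s in Set.Iic b, h s) * (ε / ‖α‖) := by
  have c11 := N.cont₁₁
  have c12 := N.cont₁₂
  have c21 := N.cont₂₁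
  have c22 := N.cont₂₂
  have c12' := N.cont₁₂'
  have cm1 := N.cont_m₁
  have cm2 := N.cont_m₂
  have ch := N.cont_h
  have hα := norm_pos_iff.2 N.ne_zero
  have hK := N.K_nonneg
  have hε := N.ε_nonneg
  set H := ∫ s in Set.Iic b, h s with hH
  have hH0 : 0 ≤ H := N.integral_nonneg
  set S := ‖σ‖ * Real.exp (2 * K * H) with hS
  have hS0 : 0 ≤ S := by positivity
  have hb : ∀ x ≤ b, ‖m₁ x‖ + ‖m₂ x‖ ≤ S := fun x hx => N.bound hx
  set M : ℝ → ℂ := fun x => m₁ x + α⁻¹ * (P₁₂ x * m₂ x) with hM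
  set E : ℝ → ℂ := fun x => α⁻¹ * (-(P₁₁ x * (P₁₂ x * m₂ x)) + P₁₂' x * m₂ x +
    P₁₂ x * (P₂₁ x * m₁ x + P₂₂ x * m₂ x)) with hE
  have cM : Continuous M := by fun_prop
  have cE : Continuous E := by fun_prop
  have hMd : ∀ x, HasDerivAt M (α * M x + (P₁₁ x * M x + E x)) x := fun x => by
    refine ((N.ode₁ x).fun_add (((N.deriv₁₂ x).fun_mul (N.ode₂ x)).const_mul α⁻¹)).congr_deriv ?_
    have := N.ne_zero
    simp only [hM, hE]; field_simp; ring
  have hMl : Tendsto (fun x => ‖M x‖) atBot (𝓝 0) := by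
    have := N.tendsto₁.add ((N.tendsto₁₂.mul N.tendsto₂).const_mul α⁻¹)
    simpa using this.norm
  have hEle : ∀ x ≤ b, ‖E x‖ ≤ K * (1 + 3 * K) * S * (ε / ‖α‖) * h x := by
    intro x hx
    have hm1 : ‖m₁ x‖ ≤ S := (le_add_of_nonneg_right (norm_nonneg _)).trans (hb x hx)
    have hm2 : ‖m₂ x‖ ≤ S := (le_add_of_nonneg_left (norm_nonneg _)).trans (hb x hx)
    have hh := N.h_nonneg x
    have e0 : ‖P₁₁ x * (P₁₂ x * m₂ x)‖ ≤ K * (K * ε * h x * S) := by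
      rw [norm_mul, norm_mul]
      gcongr
      · exact N.bd₁₁ x
      · exact N.le₁₂ x
    have e1 : ‖P₁₂' x * m₂ x‖ ≤ K * ε * h x * S := by
      rw [norm_mul]
      gcongr
      exact N.le₁₂' x
    have e2 : ‖P₁₂ x * (P₂₁ x * m₁ x + P₂₂ x * m₂ x)‖ ≤ K * ε * (K * h x * S + K * h x * S) := by
      rw [norm_mul]
      refine mul_le_mul (N.bd₁₂ x) ((norm_add_le _ _).trans ?_) (norm_nonneg _) (by positivity)
      rw [norm_mul, norm_mul]
      gcongr
      · exact N.le₂₁_one x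
      · exact N.le₂₂ x
    have e3 : ‖-(P₁₁ x * (P₁₂ x * m₂ x)) + P₁₂' x * m₂ x +
        P₁₂ x * (P₂₁ x * m₁ x + P₂₂ x * m₂ x)‖ ≤ K * (1 + 3 * K) * S * ε * h x := by
      refine (norm_add₃_le).trans ?_
      rw [norm_neg]
      nlinarith
    rw [hE]
    simp only [norm_mul, norm_inv]
    calc _ ≤ ‖α‖⁻¹ * (K * (1 + 3 * K) * S * ε * h x) := by gcongr
      _ = _ := by ring
  have hMle : ‖M y‖ ≤ (K * (1 + 3 * K) * S * (ε / ‖α‖) * H) * Real.exp (K * H) := by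
    -- The forcing E is controlled only to the left of b, whereas the integral inequality is
    -- required on all intervals; freezing M beyond y extends it there.
    have hmain := gronwall_bot (u := fun x => ‖M (min x y)‖) (h := fun x => K * h x)
      (ε := fun x => K * (1 + 3 * K) * S * (ε / ‖α‖) * h x) (c := 0) (b := y)
      (by fun_prop) (by fun_prop) (by fun_prop)
      (fun x => mul_nonneg hK (N.h_nonneg x)) (fun x => by have := N.h_nonneg x; positivity)
      ((N.integrable_mono hy).const_mul _) ((N.integrable_mono hy).const_mul _)
      (hMl.congr' (by
        filter_upwards [eventually_le_atBot y] with x hx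
        rw [min_eq_left hx])) fun a x hax => ?_
    · simp only [min_self, zero_add] at hmain
      refine hmain.trans ?_
      rw [integral_const_mul, integral_const_mul]
      gcongr
      · exact N.integral_mono hy
      · exact N.integral_mono hy
    · have hint : ∀ p q : ℝ, p ≤ q → q ≤ y → ‖M q‖ ≤ ‖M p‖ + ∫ s in p..q,
          (K * h s * ‖M (min s y)‖ + K * (1 + 3 * K) * S * (ε / ‖α‖) * h s) := by
        intro p q hpq hqy
        refine (norm_le_of_hasDerivAt_dissipative N.re_nonpos
          (g := fun x => P₁₁ x * M x + E x) (by fun_prop) hMd hpq).trans ?_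
        gcongr
        refine intervalIntegral.integral_mono_on hpq ?_ ?_ fun s hs => ?_
        · exact Continuous.intervalIntegrable (by fun_prop) _ _
        · exact Continuous.intervalIntegrable (by fun_prop) _ _
        · rw [min_eq_left (hs.2.trans hqy)]
          refine (norm_add_le _ _).trans (add_le_add ?_ (hEle s (hs.2.trans (hqy.trans hy))))
          rw [norm_mul]
          gcongr
          exact N.le₁₁ s
      have hnn : ∀ s, 0 ≤ K * h s * ‖M (min s y)‖ + K * (1 + 3 * K) * S * (ε / ‖α‖) * h s := by
        intro s
        have := N.h_nonneg s
        positivity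
      rcases le_total x y with hxy | hxy
      · rw [min_eq_left hxy, min_eq_left (hax.trans hxy)]
        exact hint a x hax hxy
      · rw [min_eq_right hxy]
        rcases le_total a y with hay | hay
        · rw [min_eq_left hay]
          refine (hint a y hay le_rfl).trans ?_
          gcongr
          refine intervalIntegral.integral_mono_interval le_rfl hay hxy
            (Eventually.of_forall hnn) (Continuous.intervalIntegrable (by fun_prop) _ _)
        · rw [min_eq_right hay]
          exact le_add_of_nonneg_right (intervalIntegral.integral_nonneg hax fun s _ => hnn s)
  have hm : ‖m₁ y‖ ≤ ‖M y‖ + K * S * (ε / ‖α‖) := by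
    have e : m₁ y = M y - α⁻¹ * (P₁₂ y * m₂ y) := by simp only [hM]; ring
    have hm2 : ‖m₂ y‖ ≤ S := (le_add_of_nonneg_left (norm_nonneg _)).trans (hb y hy)
    rw [e]
    refine (norm_sub_le _ _).trans ?_
    gcongr
    rw [norm_mul, norm_mul, norm_inv]
    calc _ ≤ ‖α‖⁻¹ * (K * ε * S) := by gcongr; exact N.bd₁₂ y
      _ = _ := by ring
  refine hm.trans ((add_le_add hMle le_rfl).trans ?_)
  have e1 : Real.exp (3 * K * H) = Real.exp (2 * K * H) * Real.exp (K * H) := by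
    rw [← Real.exp_add]; congr 1; ring
  have e2 : 1 ≤ Real.exp (K * H) := Real.one_le_exp (by positivity)
  rw [e1]
  set X := Real.exp (K * H)
  have e3 : 0 ≤ ε / ‖α‖ := by positivity
  have e4 : K * (1 + 3 * K) * S * (ε / ‖α‖) * H * X + K * S * (ε / ‖α‖) ≤
      K * S * (ε / ‖α‖) * ((1 + 3 * K) * H * X + X) := by
    have : 0 ≤ K * S * (ε / ‖α‖) := by positivity
    nlinarith
  refine e4.trans ?_
  calc _ ≤ K * S * (ε / ‖α‖) * ((2 + 3 * K) * (1 + H) * X) := by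
        gcongr
        nlinarith [mul_nonneg hK hH0, mul_nonneg hH0 (zero_le_one.trans e2),
          mul_nonneg hK (zero_le_one.trans e2)]
    _ = _ := by rw [hS]; ring

/-- The other component. -/
theorem norm_snd_sub_le {y : ℝ} (hy : y ≤ b) : ‖m₂ y * exp (I * v y) - σ‖ ≤
    K * ‖σ‖ * (∫ s in Set.Iic b, h s) * Real.exp (2 * K * ∫ s in Set.Iic b, h s) * ε := by
  have c21 := N.cont₂₁
  have c22 := N.cont₂₂
  have cm1 := N.cont_m₁
  have cm2 := N.cont_m₂
  have ch := N.cont_h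
  have cw := N.cont_w
  have cv := N.cont_v
  have hK := N.K_nonneg
  have hε := N.ε_nonneg
  set H := ∫ s in Set.Iic b, h s with hH
  set S := ‖σ‖ * Real.exp (2 * K * H) with hS
  have hS0 : 0 ≤ S := by positivity
  have hb : ∀ x ≤ b, ‖m₁ x‖ + ‖m₂ x‖ ≤ S := fun x hx => N.bound hx
  -- The phase e^{iv} compensates the diagonal coefficient P₂₂ ≈ -iw, which is integrable but not
  -- small. What remains in g carries a factor ε.
  set g : ℝ → ℂ := fun x => exp (I * v x) * (P₂₁ x * m₁ x + (P₂₂ x + I * w x) * m₂ x) with hg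
  have cg : Continuous g := by fun_prop
  have hd : ∀ x, HasDerivAt (fun x => m₂ x * exp (I * v x) - σ)
      ((0 : ℂ) • (m₂ x * exp (I * v x) - σ) + g x) x := fun x => by
    refine (((N.ode₂ x).fun_mul (((N.deriv_v x).ofReal_comp).const_mul I).cexp).sub_const
      σ).congr_deriv ?_
    simp only [hg, zero_smul]; ring
  have hl : Tendsto (fun x => ‖m₂ x * exp (I * v x) - σ‖) atBot (𝓝 0) := by
    have h1 : Tendsto (fun x => exp (I * v x)) atBot (𝓝 1) := by
      have h2 : Tendsto (fun x => exp (I * (v x : ℂ))) atBot (𝓝 (exp (I * ((0 : ℝ) : ℂ)))) :=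
        ((by fun_prop : Continuous fun r : ℝ => exp (I * (r : ℂ))).tendsto 0).comp N.tendsto_v
      simpa using h2
    simpa using ((N.tendsto₂.mul h1).sub_const σ).norm
  have hgle : ∀ x ≤ b, ‖g x‖ ≤ K * ε * S * h x := by
    intro x hx
    have hh := N.h_nonneg x
    have he : ‖exp (I * (v x : ℂ))‖ = 1 := by rw [mul_comm]; exact Complex.norm_exp_ofReal_mul_I _
    rw [hg]
    simp only [norm_mul, he, one_mul]
    refine (norm_add_le _ _).trans ?_
    rw [norm_mul, norm_mul]
    have e1 : ‖P₂₂ x + I * w x‖ ≤ K * ε * h x := (N.le_w x).trans (by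
      have : 0 ≤ K * ε * h x := by positivity
      nlinarith [N.ε_le])
    calc _ ≤ K * ε * h x * ‖m₁ x‖ + K * ε * h x * ‖m₂ x‖ := by
          gcongr
          exact N.le₂₁ x
      _ = K * ε * h x * (‖m₁ x‖ + ‖m₂ x‖) := by ring
      _ ≤ K * ε * h x * S := by gcongr; exact hb x hx
      _ = _ := by ring
  have hmain : ∀ a ≤ y, ‖m₂ y * exp (I * v y) - σ‖ ≤ ‖m₂ a * exp (I * v a) - σ‖ +
      K * ε * S * H := by
    intro a ha
    refine (norm_le_of_hasDerivAt_dissipative (by simp) cg hd ha).trans ?_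
    gcongr
    calc ∫ s in a..y, ‖g s‖ ≤ ∫ s in a..y, K * ε * S * h s := by
          refine intervalIntegral.integral_mono_on ha (cg.norm.intervalIntegrable _ _)
            (Continuous.intervalIntegrable (by fun_prop) _ _) fun s hs => hgle s (hs.2.trans hy)
      _ = K * ε * S * ∫ s in a..y, h s := intervalIntegral.integral_const_mul _ _
      _ ≤ K * ε * S * H := by
          gcongr
          rw [intervalIntegral.integral_of_le ha]
          exact setIntegral_mono_set N.h_int (Eventually.of_forall N.h_nonneg)
            (Set.Ioc_subset_Iic_self.trans (Set.Iic_subset_Iic.2 hy)).eventuallyLE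
  have := ge_of_tendsto (hl.add_const (K * ε * S * H))
    ((eventually_le_atBot y).mono fun a ha => hmain a ha)
  refine this.trans (le_of_eq ?_)
  rw [hS]; ring

end NearlyDiagonal
end diag

/-! ### Large-`z` behaviour of the left Jost solution -/

/-- Multiplication by the adjugate of E(u(x)), the eigenvector frame of the background frozen at x,
removes the large coupling ku. The leftover comes from |u|² - q₀² and from the x-derivative of the
frame; 1 + |u|²/z² is the determinant of the frame, and λ is written as z - k. -/
theorem diagonalize_fst {z k q₀ u ub u' a b : ℂ} (hz : z ≠ 0) (hd : 1 + u * ub / z ^ 2 ≠ 0)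
    (hk : k = (z - q₀ ^ 2 / z) / 2) :
    (I * k ^ 2 * a + k * u * b + I * (k * (z - k)) * a) - (I * u' / z * b + I * u / z *
      (-(k * ub) * a - I * k ^ 2 * b + I * (k * (z - k)) * b)) =
    2 * I * (k * (z - k)) * (a - I * u / z * b) +
      ((I * (k / z) * (u * ub - q₀ ^ 2) + ub * u' / z ^ 2) * (1 + u * ub / z ^ 2)⁻¹ *
          (a - I * u / z * b) +
        (-((I * u' + k / z * u * (u * ub - q₀ ^ 2)) / z * (1 + u * ub / z ^ 2)⁻¹)) *
          (b - I * ub / z * a)) := by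
  have hd' : z ^ 2 + u * ub ≠ 0 := fun h => hd (by field_simp; rw [h, mul_zero])
  have hd2 : z ^ 2 + ub * u ≠ 0 := by rwa [mul_comm ub]
  subst hk
  field_simp
  ring_nf
  simp only [I_sq]
  ring

theorem diagonalize_snd {z k q₀ u ub ub' a b : ℂ} (hz : z ≠ 0) (hd : 1 + u * ub / z ^ 2 ≠ 0)
    (hk : k = (z - q₀ ^ 2 / z) / 2) :
    (-(k * ub) * a - I * k ^ 2 * b + I * (k * (z - k)) * b) - (I * ub' / z * a + I * ub / z *
      (I * k ^ 2 * a + k * u * b + I * (k * (z - k)) * a)) =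
      (k / z * ub * (u * ub - q₀ ^ 2) - I * ub') / z * (1 + u * ub / z ^ 2)⁻¹ *
          (a - I * u / z * b) +
        (-(I * (k / z) * (u * ub - q₀ ^ 2)) + u * ub' / z ^ 2) * (1 + u * ub / z ^ 2)⁻¹ *
          (b - I * ub / z * a) := by
  have hd' : z ^ 2 + u * ub ≠ 0 := fun h => hd (by field_simp; rw [h, mul_zero])
  have hd2 : z ^ 2 + ub * u ≠ 0 := by rwa [mul_comm ub]
  subst hk
  field_simp
  ring_nf
  simp only [I_sq]
  ring

/-- A left potential with two integrable derivatives. -/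
structure SmoothPotential (u u₁ u₂ : ℝ → ℂ) (qb : ℂ) (q₀ B : ℝ) : Prop where
  left : LeftPotential u qb q₀
  deriv₁ : ∀ x, HasDerivAt u (u₁ x) x
  deriv₂ : ∀ x, HasDerivAt u₁ (u₂ x) x
  cont₂ : Continuous u₂
  int₁ : Integrable u₁
  int₂ : Integrable u₂
  bd : ∀ x, ‖u x‖ ≤ B
  bd₁ : ∀ x, ‖u₁ x‖ ≤ B
  tendsto : Tendsto u atBot (𝓝 qb)
  tendsto₁ : Tendsto u₁ atBot (𝓝 0)
  one_le : 1 ≤ B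
  q₀_le : q₀ ≤ B

/-- Half of the integral of `|u|² - q₀²` from `-∞`. -/
noncomputable def vLeft (u : ℝ → ℂ) (q₀ x : ℝ) : ℝ := 1 / 2 * ∫ y in Set.Iic x, (‖u y‖ ^ 2 - q₀ ^ 2)

section
variable {u u₁ u₂ : ℝ → ℂ} {qb : ℂ} {q₀ B : ℝ} (P : SmoothPotential u u₁ u₂ qb q₀ B)
include P
namespace SmoothPotential

theorem cont₁ : Continuous u₁ := continuous_iff_continuousAt.2 fun x => (P.deriv₂ x).continuousAt

theorem integrable_mass (x : ℝ) : IntegrableOn (fun y => ‖u y‖ ^ 2 - q₀ ^ 2) (Set.Iic x) := by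
  have hc := P.left.cont
  have hB := P.one_le
  have hm : Continuous fun y => ‖u y‖ ^ 2 - q₀ ^ 2 := by fun_prop
  have h0 : IntegrableOn (fun y => ‖u y‖ ^ 2 - q₀ ^ 2) (Set.Iic 0) := by
    refine (P.left.integrable.const_mul (2 * B)).mono' hm.aestronglyMeasurable
      (ae_of_all _ fun y => ?_)
    have h1 : ‖u y‖ ^ 2 - q₀ ^ 2 = (‖u y‖ - ‖qb‖) * (‖u y‖ + q₀) := by rw [P.left.norm_eq]; ring
    have h2 := P.left.pos
    have h3 := P.bd y
    have h4 := P.q₀_le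
    rw [h1, norm_mul, Real.norm_eq_abs, Real.norm_of_nonneg (by positivity), weight, mul_comm]
    have h5 : |‖u y‖ - ‖qb‖| ≤ ‖u y - qb‖ := abs_norm_sub_norm_le _ _
    have h6 : ‖u y - qb‖ ≤ (1 + |y|) * ‖u y - qb‖ :=
      le_mul_of_one_le_left (norm_nonneg _) (by linarith [abs_nonneg y])
    exact mul_le_mul (by linarith) (h5.trans h6) (abs_nonneg _) (by linarith)
  rcases le_total x 0 with hx | hx
  · exact h0.mono_set (Set.Iic_subset_Iic.2 hx)
  · rw [← Set.Iic_union_Ioc_eq_Iic hx]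
    exact h0.union ((hm.integrableOn_Icc).mono_set Set.Ioc_subset_Icc_self)

theorem hasDerivAt_vLeft (x : ℝ) :
    HasDerivAt (vLeft u q₀) ((‖u x‖ ^ 2 - q₀ ^ 2) / 2) x := by
  have hc := P.left.cont
  have hm : Continuous fun y => ‖u y‖ ^ 2 - q₀ ^ 2 := by fun_prop
  have h1 : vLeft u q₀ = fun x => 1 / 2 * ((∫ y in Set.Iic 0, (‖u y‖ ^ 2 - q₀ ^ 2)) +
      ∫ y in (0 : ℝ)..x, (‖u y‖ ^ 2 - q₀ ^ 2)) := by
    ext x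
    rw [← intervalIntegral.integral_Iic_sub_Iic (P.integrable_mass 0) (P.integrable_mass x)]
    simp [vLeft]
  rw [h1]
  exact (((hm.integral_hasStrictDerivAt 0 x).hasDerivAt.const_add _).const_mul _).congr_deriv
    (by ring)

theorem tendsto_vLeft : Tendsto (vLeft u q₀) atBot (𝓝 0) := by
  have h := (intervalIntegral_tendsto_integral_Iic 0 (P.integrable_mass 0) tendsto_id).const_sub
    (∫ y in Set.Iic (0 : ℝ), (‖u y‖ ^ 2 - q₀ ^ 2))
  rw [sub_self] at h
  have h2 := h.const_mul (1 / 2)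
  rw [mul_zero] at h2
  refine h2.congr fun x => ?_
  rw [id, ← intervalIntegral.integral_Iic_sub_Iic (P.integrable_mass x) (P.integrable_mass 0), vLeft]
  simp

set_option maxHeartbeats 1000000 in
-- The small parameter is 1/|z|, and the size function h consists of u', u'' and |u|² - q₀², all
-- integrable on left half-lines. In this frame the Jost column tends to (0, det E) at -∞, which is
-- why σ is `sdet`. The factor 100 B⁴ is a generous common bound.
theorem nearlyDiagonal {z : ℂ} (hz : z ∈ Dplus ∪ contour) (hzB : 2 * B ≤ ‖z‖)
    {ν : ℝ → Fin 2 → ℂ} (hν : IsModSol u q₀ z ν) (hl : Tendsto ν atBot (𝓝 (Ecol qb z 1))) (b : ℝ) :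
    NearlyDiagonal (2 * I * kap q₀ z) (sdet q₀ z) (fun x => ν x 0 - I * u x / z * ν x 1)
      (fun x => ν x 1 - I * conj (u x) / z * ν x 0)
      (fun x => (I * (kz q₀ z / z) * (u x * conj (u x) - q₀ ^ 2) + conj (u x) * u₁ x / z ^ 2) *
        (1 + u x * conj (u x) / z ^ 2)⁻¹)
      (fun x => -((I * u₁ x + kz q₀ z / z * u x * (u x * conj (u x) - q₀ ^ 2)) / z *
        (1 + u x * conj (u x) / z ^ 2)⁻¹))
      (fun x => (kz q₀ z / z * conj (u x) * (u x * conj (u x) - q₀ ^ 2) - I * conj (u₁ x)) / z *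
        (1 + u x * conj (u x) / z ^ 2)⁻¹)
      (fun x => (-(I * (kz q₀ z / z) * (u x * conj (u x) - q₀ ^ 2)) + u x * conj (u₁ x) / z ^ 2) *
        (1 + u x * conj (u x) / z ^ 2)⁻¹)
      (fun x => -((I * u₂ x + kz q₀ z / z * (u₁ x * (u x * conj (u x) - q₀ ^ 2) +
          u x * (u₁ x * conj (u x) + u x * conj (u₁ x)))) / z * (1 + u x * conj (u x) / z ^ 2)⁻¹ -
        (I * u₁ x + kz q₀ z / z * u x * (u x * conj (u x) - q₀ ^ 2)) / z *
          ((u₁ x * conj (u x) + u x * conj (u₁ x)) / z ^ 2 * (1 + u x * conj (u x) / z ^ 2)⁻¹ ^ 2)))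
      (vLeft u q₀) (fun x => (‖u x‖ ^ 2 - q₀ ^ 2) / 2)
      (fun x => ‖u₁ x‖ + ‖u₂ x‖ + |‖u x‖ ^ 2 - q₀ ^ 2|) (100 * B ^ 4) ‖z‖⁻¹ b := by
  have hB := P.one_le
  have hq := P.left.pos
  have hqB := P.q₀_le
  have hz0 : z ≠ 0 := (mem_closedDplus_iff.1 hz).1
  have hr0 : 0 < ‖z‖ := norm_pos_iff.2 hz0
  have hc := P.left.cont
  have hc1 := P.cont₁
  have hc2 := P.cont₂
  have hcc : Continuous fun x => conj (u x) := continuous_conj.comp hc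
  have hcc1 : Continuous fun x => conj (u₁ x) := continuous_conj.comp hc1
  have hε0 : 0 ≤ ‖z‖⁻¹ := by positivity
  have hεB : ‖z‖⁻¹ * B ≤ 1 / 2 := by
    rw [inv_mul_le_iff₀ hr0]; linarith
  have hε1 : ‖z‖⁻¹ ≤ 1 := by nlinarith
  have hε2 : ‖z‖⁻¹ ^ 2 ≤ 1 := by nlinarith
  -- This is where |z| ≥ 2B is used: the determinant of the frame stays away from zero uniformly in
  -- x.
  have hnd : ∀ x, 3 / 4 ≤ ‖1 + u x * conj (u x) / z ^ 2‖ := fun x => by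
    have h1 : ‖u x * conj (u x) / z ^ 2‖ ≤ 1 / 4 := by
      rw [norm_div, norm_mul, Complex.norm_conj, norm_pow, div_eq_mul_inv, ← inv_pow]
      calc ‖u x‖ * ‖u x‖ * ‖z‖⁻¹ ^ 2 ≤ B * B * ‖z‖⁻¹ ^ 2 := by
            gcongr <;> exact P.bd x
        _ = (‖z‖⁻¹ * B) ^ 2 := by ring
        _ ≤ (1 / 2) ^ 2 := by gcongr
        _ = _ := by norm_num
    have h2 := norm_sub_le (1 + u x * conj (u x) / z ^ 2) (u x * conj (u x) / z ^ 2)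
    rw [add_sub_cancel_right, norm_one] at h2
    linarith
  have hd0 : ∀ x, 1 + u x * conj (u x) / z ^ 2 ≠ 0 := fun x h => by
    have := hnd x; rw [h, norm_zero] at this; linarith
  have hD : ∀ x, ‖(1 + u x * conj (u x) / z ^ 2)⁻¹‖ ≤ 2 := fun x => by
    rw [norm_inv]
    exact inv_le_of_inv_le₀ two_pos (by linarith [hnd x])
  have hcD : Continuous fun x => (1 + u x * conj (u x) / z ^ 2)⁻¹ :=
    Continuous.inv₀ (by fun_prop) hd0
  have hw : ∀ x, u x * conj (u x) - q₀ ^ 2 = ((‖u x‖ ^ 2 - q₀ ^ 2 : ℝ) : ℂ) := fun x => by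
    rw [Complex.mul_conj, Complex.normSq_eq_norm_sq]; push_cast; ring
  have hwn : ∀ x, ‖u x * conj (u x) - q₀ ^ 2‖ = |‖u x‖ ^ 2 - q₀ ^ 2| := fun x => by
    rw [hw, Complex.norm_real, Real.norm_eq_abs]
  have hwB : ∀ x, |‖u x‖ ^ 2 - q₀ ^ 2| ≤ 2 * B ^ 2 := fun x => by
    have h1 : ‖u x‖ ^ 2 ≤ B ^ 2 := by gcongr; exact P.bd x
    have h2 : q₀ ^ 2 ≤ B ^ 2 := by gcongr
    rw [abs_le]; constructor <;> nlinarith [sq_nonneg ‖u x‖]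
  have hkn : ‖kz q₀ z / z‖ ≤ 1 := by
    have h1 : kz q₀ z / z = 1 / 2 - q₀ ^ 2 / z ^ 2 / 2 := by unfold kz; field_simp
    have h2 : ‖(q₀ : ℂ) ^ 2 / z ^ 2 / 2‖ ≤ 1 / 2 := by
      rw [norm_div, norm_div, norm_pow, norm_pow, Complex.norm_real, Real.norm_of_nonneg hq.le,
        Complex.norm_ofNat]
      have : q₀ ^ 2 / ‖z‖ ^ 2 ≤ 1 := (div_le_one (by positivity)).2 (by
        gcongr; linarith)
      linarith
    rw [h1]
    refine (norm_sub_le _ _).trans ?_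
    have : ‖(1 / 2 : ℂ)‖ = 1 / 2 := by simp
    linarith
  have hconj : ∀ x, HasDerivAt (fun x => conj (u x)) (conj (u₁ x)) x := fun x => (P.deriv₁ x).star
  have hDd : ∀ x, HasDerivAt (fun x => (1 + u x * conj (u x) / z ^ 2)⁻¹)
      (-((u₁ x * conj (u x) + u x * conj (u₁ x)) / z ^ 2 *
        (1 + u x * conj (u x) / z ^ 2)⁻¹ ^ 2)) x := fun x => by
    refine (((((P.deriv₁ x).fun_mul (hconj x)).div_const (z ^ 2)).const_add 1).fun_inv
      (hd0 x)).congr_deriv ?_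
    rw [neg_div, div_eq_mul_inv _ ((1 + u x * conj (u x) / z ^ 2) ^ 2), inv_pow]
  have hν0 : ∀ x, HasDerivAt (fun x => ν x 0)
      (I * kz q₀ z ^ 2 * ν x 0 + kz q₀ z * u x * ν x 1 + I * (kz q₀ z * (z - kz q₀ z)) * ν x 0) x :=
    fun x => by
      refine (hasDerivAt_pi.1 (hν x) 0).congr_deriv ?_
      have : kap q₀ z = kz q₀ z * (z - kz q₀ z) := by unfold kap kz lamz; ring
      simp [laxX_eq, this, dotProduct, Fin.sum_univ_two]
  have hν1 : ∀ x, HasDerivAt (fun x => ν x 1)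
      (-(kz q₀ z * conj (u x)) * ν x 0 - I * kz q₀ z ^ 2 * ν x 1 +
        I * (kz q₀ z * (z - kz q₀ z)) * ν x 1) x :=
    fun x => by
      refine (hasDerivAt_pi.1 (hν x) 1).congr_deriv ?_
      have : kap q₀ z = kz q₀ z * (z - kz q₀ z) := by unfold kap kz lamz; ring
      simp [laxX_eq, this, dotProduct, Fin.sum_univ_two]
      ring
  have hkap : kap q₀ z = kz q₀ z * (z - kz q₀ z) := by unfold kap kz lamz; ring
  have hl0 := (tendsto_pi_nhds.1 hl) 0
  have hl1 := (tendsto_pi_nhds.1 hl) 1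
  rw [Ecol_one] at hl0 hl1
  simp only [Matrix.cons_val_zero, Matrix.cons_val_one] at hl0 hl1
  have hqb := mul_conj_of_norm_eq P.left.norm_eq
  have hI : I ^ 2 = -1 := I_sq
  have ht := P.tendsto
  have htc : Tendsto (fun x => conj (u x)) atBot (𝓝 (conj qb)) := (continuous_conj.tendsto _).comp ht
  have ht1 := P.tendsto₁
  have hB2 : B ≤ B ^ 4 := le_self_pow₀ hB (by norm_num)
  have hB3 : B ^ 2 ≤ B ^ 4 := pow_le_pow_right₀ hB (by norm_num)
  have hB4 : B ^ 3 ≤ B ^ 4 := pow_le_pow_right₀ hB (by norm_num)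
  have hB5 : 1 ≤ B ^ 4 := one_le_pow₀ hB
  have hB0 : 0 ≤ B := by linarith
  -- basic size estimates
  have n12 : ∀ x, ‖I * u₁ x + kz q₀ z / z * u x * (u x * conj (u x) - q₀ ^ 2)‖ ≤
      ‖u₁ x‖ + B * |‖u x‖ ^ 2 - q₀ ^ 2| := fun x => by
    refine (norm_add_le _ _).trans ?_
    rw [norm_mul, norm_I, one_mul, norm_mul, hwn, norm_mul]
    gcongr
    calc _ ≤ 1 * B := by gcongr; exact P.bd x
      _ = B := one_mul B
  have n21 : ∀ x, ‖kz q₀ z / z * conj (u x) * (u x * conj (u x) - q₀ ^ 2) - I * conj (u₁ x)‖ ≤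
      ‖u₁ x‖ + B * |‖u x‖ ^ 2 - q₀ ^ 2| := fun x => by
    refine (norm_sub_le _ _).trans ?_
    rw [norm_mul I, norm_I, one_mul, norm_mul, hwn, norm_mul, Complex.norm_conj, Complex.norm_conj,
      add_comm]
    gcongr
    calc _ ≤ 1 * B := by gcongr; exact P.bd x
      _ = B := one_mul B
  have nuu : ∀ x, ‖u x * conj (u₁ x) / z ^ 2‖ ≤ B * ‖u₁ x‖ * ‖z‖⁻¹ ^ 2 := fun x => by
    rw [norm_div, norm_mul, Complex.norm_conj, norm_pow, div_eq_mul_inv, inv_pow]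
    gcongr; exact P.bd x
  have nuu' : ∀ x, ‖conj (u x) * u₁ x / z ^ 2‖ ≤ B * ‖u₁ x‖ * ‖z‖⁻¹ ^ 2 := fun x => by
    rw [norm_div, norm_mul, Complex.norm_conj, norm_pow, div_eq_mul_inv, inv_pow]
    gcongr; exact P.bd x
  have n11 : ∀ x, ‖I * (kz q₀ z / z) * (u x * conj (u x) - q₀ ^ 2) + conj (u x) * u₁ x / z ^ 2‖ ≤
      |‖u x‖ ^ 2 - q₀ ^ 2| + B * ‖u₁ x‖ := fun x => by
    refine (norm_add_le _ _).trans (add_le_add ?_ ((nuu' x).trans (mul_le_of_le_one_right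
      (by positivity) hε2)))
    rw [norm_mul, hwn, norm_mul, norm_I, one_mul]
    exact mul_le_of_le_one_left (abs_nonneg _) hkn
  have n22 : ∀ x, ‖-(I * (kz q₀ z / z) * (u x * conj (u x) - q₀ ^ 2)) + u x * conj (u₁ x) / z ^ 2‖ ≤
      |‖u x‖ ^ 2 - q₀ ^ 2| + B * ‖u₁ x‖ := fun x => by
    refine (norm_add_le _ _).trans (add_le_add ?_ ((nuu x).trans (mul_le_of_le_one_right
      (by positivity) hε2)))
    rw [norm_neg, norm_mul, hwn, norm_mul, norm_I, one_mul]
    exact mul_le_of_le_one_left (abs_nonneg _) hkn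
  have hh1 : ∀ x, ‖u₁ x‖ + B * |‖u x‖ ^ 2 - q₀ ^ 2| ≤
      B * (‖u₁ x‖ + ‖u₂ x‖ + |‖u x‖ ^ 2 - q₀ ^ 2|) := fun x => by
    nlinarith [norm_nonneg (u₁ x), norm_nonneg (u₂ x), abs_nonneg (‖u x‖ ^ 2 - q₀ ^ 2)]
  have hh2 : ∀ x, |‖u x‖ ^ 2 - q₀ ^ 2| + B * ‖u₁ x‖ ≤
      B * (‖u₁ x‖ + ‖u₂ x‖ + |‖u x‖ ^ 2 - q₀ ^ 2|) := fun x => by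
    nlinarith [norm_nonneg (u₁ x), norm_nonneg (u₂ x), abs_nonneg (‖u x‖ ^ 2 - q₀ ^ 2)]
  have hh0 : ∀ x, 0 ≤ ‖u₁ x‖ + ‖u₂ x‖ + |‖u x‖ ^ 2 - q₀ ^ 2| := fun x => by positivity
  have hb1 : ∀ x, ‖u₁ x‖ + B * |‖u x‖ ^ 2 - q₀ ^ 2| ≤ 3 * B ^ 4 := fun x => by
    nlinarith [P.bd₁ x, mul_le_mul_of_nonneg_left (hwB x) hB0]
  have hb2 : ∀ x, |‖u x‖ ^ 2 - q₀ ^ 2| + B * ‖u₁ x‖ ≤ 3 * B ^ 4 := fun x => by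
    nlinarith [mul_le_mul_of_nonneg_left (P.bd₁ x) hB0, hwB x]
  have hK : ∀ x, 2 * (B * (‖u₁ x‖ + ‖u₂ x‖ + |‖u x‖ ^ 2 - q₀ ^ 2|)) ≤
      100 * B ^ 4 * (‖u₁ x‖ + ‖u₂ x‖ + |‖u x‖ ^ 2 - q₀ ^ 2|) := fun x => by
    rw [← mul_assoc]
    exact mul_le_mul_of_nonneg_right (by linarith) (hh0 x)
  have hdiv : ∀ (y : ℂ) (x : ℝ) (c : ℝ), ‖y‖ ≤ c → ‖y / z * (1 + u x * conj (u x) / z ^ 2)⁻¹‖ ≤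
      2 * c * ‖z‖⁻¹ := fun y x c hy => by
    rw [norm_mul, norm_div, div_eq_mul_inv]
    have h0 := (norm_nonneg y).trans hy
    calc ‖y‖ * ‖z‖⁻¹ * _ ≤ c * ‖z‖⁻¹ * 2 := by gcongr; exact hD x
      _ = _ := by ring
  have hmul : ∀ (y : ℂ) (x : ℝ) (c : ℝ), ‖y‖ ≤ c → ‖y * (1 + u x * conj (u x) / z ^ 2)⁻¹‖ ≤
      2 * c := fun y x c hy => by
    rw [norm_mul]
    have h0 := (norm_nonneg y).trans hy
    calc ‖y‖ * _ ≤ c * 2 := by gcongr; exact hD x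
      _ = _ := by ring
  refine
    { re_nonpos := ?_, ne_zero := ?_, K_nonneg := by positivity, ε_nonneg := hε0, ε_le := hε1,
      ode₁ := fun x => ?_, ode₂ := fun x => ?_, tendsto₁ := ?_, tendsto₂ := ?_,
      cont₁₁ := by fun_prop, cont₂₁ := by fun_prop, cont₂₂ := by fun_prop, deriv₁₂ := fun x => ?_,
      cont₁₂' := by fun_prop, cont_h := by fun_prop, h_nonneg := hh0, h_int := ?_,
      le₁₁ := fun x => ?_, le₁₂ := fun x => ?_, le₂₁ := fun x => ?_, le₂₂ := fun x => ?_,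
      le₁₂' := fun x => ?_, bd₁₁ := fun x => ?_, bd₁₂ := fun x => ?_, bd₂₂ := fun x => ?_,
      tendsto₁₂ := ?_, deriv_v := P.hasDerivAt_vLeft, tendsto_v := P.tendsto_vLeft,
      cont_w := by fun_prop, le_w := fun x => ?_ }
  · have := kap_im_nonneg q₀ hz
    have h2 : (2 * I * kap q₀ z).re = -2 * (kap q₀ z).im := by simp
    rw [h2]; linarith
  · have h1 : kz q₀ z ≠ 0 := fun h => by
      have h2 : z - q₀ ^ 2 / z = 0 := by
        unfold kz at h; simpa using h
      have h3 : z ^ 2 = q₀ ^ 2 := by field_simp at h2; linear_combination h2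
      have h4 : ‖z‖ ^ 2 = q₀ ^ 2 := by
        rw [← norm_pow, h3, norm_pow, Complex.norm_real, Real.norm_of_nonneg hq.le]
      nlinarith
    have h1' : lamz q₀ z ≠ 0 := fun h => by
      have h2 : z + q₀ ^ 2 / z = 0 := by
        unfold lamz at h; simpa using h
      have h3 : z ^ 2 = -q₀ ^ 2 := by field_simp at h2; linear_combination h2
      have h4 : ‖z‖ ^ 2 = q₀ ^ 2 := by
        rw [← norm_pow, h3, norm_neg, norm_pow, Complex.norm_real, Real.norm_of_nonneg hq.le]
      nlinarith
    simp [kap, h1, h1', I_ne_zero]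
  · refine ((hν0 x).fun_sub ((((P.deriv₁ x).const_mul I).div_const z).fun_mul
      (hν1 x))).congr_deriv ?_
    rw [hkap]
    exact diagonalize_fst hz0 (hd0 x) rfl
  · refine ((hν1 x).fun_sub ((((hconj x).const_mul I).div_const z).fun_mul
      (hν0 x))).congr_deriv ?_
    exact diagonalize_snd hz0 (hd0 x) rfl
  · have := hl0.sub (((ht.const_mul I).div_const z).mul hl1)
    simpa using this
  · have := hl1.sub (((htc.const_mul I).div_const z).mul hl0)
    have e : sdet q₀ z = 1 - I * conj qb / z * (I * qb / z) := by
      unfold sdet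
      field_simp
      linear_combination (qb * conj qb) * hI - hqb
    rwa [e]
  · have e1 := (hconj x)
    have e2 : HasDerivAt (fun x => (I * u₁ x + kz q₀ z / z * u x * (u x * conj (u x) - q₀ ^ 2)) / z)
        ((I * u₂ x + kz q₀ z / z * (u₁ x * (u x * conj (u x) - q₀ ^ 2) +
          u x * (u₁ x * conj (u x) + u x * conj (u₁ x)))) / z) x := by
      refine ((((P.deriv₂ x).const_mul I).fun_add (((P.deriv₁ x).const_mul (kz q₀ z / z)).fun_mul
        (((P.deriv₁ x).fun_mul e1).sub_const (q₀ ^ 2 : ℂ)))).div_const z).congr_deriv ?_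
      ring
    refine (e2.fun_mul (hDd x)).fun_neg.congr_deriv ?_
    ring
  · exact (P.int₁.norm.integrableOn.add P.int₂.norm.integrableOn).add (P.integrable_mass b).abs
  · exact (hmul _ x _ ((n11 x).trans (hh2 x))).trans (hK x)
  · rw [norm_neg]
    refine (hdiv _ x _ ((n12 x).trans (hh1 x))).trans ?_
    nlinarith [mul_le_mul_of_nonneg_right (hK x) hε0]
  · refine (hdiv _ x _ ((n21 x).trans (hh1 x))).trans ?_
    nlinarith [mul_le_mul_of_nonneg_right (hK x) hε0]
  · exact (hmul _ x _ ((n22 x).trans (hh2 x))).trans (hK x)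
  · have f1 : ‖u₁ x * conj (u x) + u x * conj (u₁ x)‖ ≤ 2 * B * ‖u₁ x‖ := by
      refine (norm_add_le _ _).trans ?_
      rw [norm_mul, norm_mul, Complex.norm_conj, Complex.norm_conj]
      nlinarith [P.bd x, norm_nonneg (u₁ x)]
    have f2 : ‖I * u₂ x + kz q₀ z / z * (u₁ x * (u x * conj (u x) - q₀ ^ 2) +
          u x * (u₁ x * conj (u x) + u x * conj (u₁ x)))‖ ≤
        4 * B ^ 4 * (‖u₁ x‖ + ‖u₂ x‖ + |‖u x‖ ^ 2 - q₀ ^ 2|) := by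
      refine (norm_add_le _ _).trans ?_
      rw [norm_mul, norm_I, one_mul, norm_mul]
      have f3 : ‖u₁ x * (u x * conj (u x) - q₀ ^ 2) +
          u x * (u₁ x * conj (u x) + u x * conj (u₁ x))‖ ≤ 4 * B ^ 2 * ‖u₁ x‖ := by
        refine (norm_add_le _ _).trans ?_
        rw [norm_mul, norm_mul (u x), hwn]
        have f4 := mul_le_mul_of_nonneg_left (hwB x) (norm_nonneg (u₁ x))
        have f5 := mul_le_mul (P.bd x) f1 (norm_nonneg _) hB0
        linarith
      have f6 : ‖kz q₀ z / z‖ * ‖u₁ x * (u x * conj (u x) - q₀ ^ 2) +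
          u x * (u₁ x * conj (u x) + u x * conj (u₁ x))‖ ≤ 4 * B ^ 2 * ‖u₁ x‖ :=
        (mul_le_of_le_one_left (norm_nonneg _) hkn).trans f3
      have f7 := mul_le_mul_of_nonneg_right hB3 (norm_nonneg (u₁ x))
      have f8 := mul_le_mul_of_nonneg_right hB5 (norm_nonneg (u₂ x))
      have f9 := mul_nonneg (zero_le_one.trans hB5) (abs_nonneg (‖u x‖ ^ 2 - q₀ ^ 2))
      nlinarith [norm_nonneg (u₂ x)]
    have f3 : ‖(u₁ x * conj (u x) + u x * conj (u₁ x)) / z ^ 2‖ ≤ B * ‖u₁ x‖ := by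
      rw [norm_div, norm_pow, div_eq_mul_inv, ← inv_pow]
      have : ‖z‖⁻¹ ^ 2 ≤ 1 / 2 := by nlinarith
      calc _ ≤ 2 * B * ‖u₁ x‖ * (1 / 2) := by gcongr
        _ = _ := by ring
    have f4 : ‖(u₁ x * conj (u x) + u x * conj (u₁ x)) / z ^ 2 *
        (1 + u x * conj (u x) / z ^ 2)⁻¹ ^ 2‖ ≤ B * ‖u₁ x‖ * 4 := by
      rw [norm_mul, norm_pow]
      gcongr
      have := hD x
      nlinarith [norm_nonneg ((1 + u x * conj (u x) / z ^ 2)⁻¹)]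
    rw [norm_neg]
    refine (norm_sub_le _ _).trans ?_
    have f5 := hdiv _ x _ f2
    have f6 : ‖(I * u₁ x + kz q₀ z / z * u x * (u x * conj (u x) - q₀ ^ 2)) / z *
          ((u₁ x * conj (u x) + u x * conj (u₁ x)) / z ^ 2 *
            (1 + u x * conj (u x) / z ^ 2)⁻¹ ^ 2)‖ ≤ 3 * B ^ 3 * ‖z‖⁻¹ * (B * ‖u₁ x‖ * 4) := by
      rw [norm_mul, norm_div, div_eq_mul_inv]
      have : ‖I * u₁ x + kz q₀ z / z * u x * (u x * conj (u x) - q₀ ^ 2)‖ ≤ 3 * B ^ 3 := by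
        refine (n12 x).trans ?_
        have h3 : B ≤ B ^ 3 := le_self_pow₀ hB (by norm_num)
        have h4 := mul_le_mul_of_nonneg_left (hwB x) hB0
        rw [show B * (2 * B ^ 2) = 2 * B ^ 3 by ring] at h4
        linarith [P.bd₁ x]
      gcongr
    refine (add_le_add f5 f6).trans ?_
    have f7 : ‖u₁ x‖ ≤ ‖u₁ x‖ + ‖u₂ x‖ + |‖u x‖ ^ 2 - q₀ ^ 2| := by
      linarith [norm_nonneg (u₂ x), abs_nonneg (‖u x‖ ^ 2 - q₀ ^ 2)]
    calc _ = ‖z‖⁻¹ * B ^ 4 * (8 * (‖u₁ x‖ + ‖u₂ x‖ + |‖u x‖ ^ 2 - q₀ ^ 2|) + 12 * ‖u₁ x‖) := by ring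
      _ ≤ ‖z‖⁻¹ * B ^ 4 * (100 * (‖u₁ x‖ + ‖u₂ x‖ + |‖u x‖ ^ 2 - q₀ ^ 2|)) := by
        gcongr; linarith [norm_nonneg (u₁ x)]
      _ = _ := by ring
  · exact (hmul _ x _ ((n11 x).trans (hb2 x))).trans (by linarith)
  · rw [norm_neg]
    exact (hdiv _ x _ ((n12 x).trans (hb1 x))).trans
      (mul_le_mul_of_nonneg_right (by linarith) hε0)
  · exact (hmul _ x _ ((n22 x).trans (hb2 x))).trans (by linarith)
  · have g1 : Tendsto (fun x => (I * u₁ x + kz q₀ z / z * u x * (u x * conj (u x) - q₀ ^ 2)) / z)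
        atBot (𝓝 0) := by
      have := ((ht1.const_mul I).add ((ht.const_mul (kz q₀ z / z)).mul
        ((ht.mul htc).sub_const (q₀ ^ 2 : ℂ)))).div_const z
      simpa [hqb] using this
    have g2 := g1.zero_mul_isBoundedUnder_le (g := fun x => (1 + u x * conj (u x) / z ^ 2)⁻¹)
      (isBoundedUnder_of ⟨2, fun x => hD x⟩)
    simpa using g2.neg
  -- Since k/z = 1/2 - q₀²/(2z²), the leading part of P₂₂ is -i(|u|² - q₀²)/2, the derivative of -i
  -- `vLeft`. After this cancellation every remaining term contains 1/z².
  · have g1 : (-(I * (kz q₀ z / z) * (u x * conj (u x) - q₀ ^ 2)) + u x * conj (u₁ x) / z ^ 2) *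
        (1 + u x * conj (u x) / z ^ 2)⁻¹ + I * ((‖u x‖ ^ 2 - q₀ ^ 2) / 2 : ℝ) =
        (I * (u x * conj (u x) - q₀ ^ 2) * ((u x * conj (u x) + q₀ ^ 2) / 2) +
          u x * conj (u₁ x)) / z / z * (1 + u x * conj (u x) / z ^ 2)⁻¹ := by
      have g2 : (((‖u x‖ ^ 2 - q₀ ^ 2) / 2 : ℝ) : ℂ) = (u x * conj (u x) - q₀ ^ 2) / 2 := by
        rw [hw]; push_cast; ring
      rw [g2]
      have g3 := hd0 x
      have g4 : z ^ 2 + u x * conj (u x) ≠ 0 := fun h => g3 (by field_simp; rw [h, mul_zero])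
      unfold kz
      field_simp
      ring
    rw [g1]
    have g5 : ‖(I * (u x * conj (u x) - q₀ ^ 2) * ((u x * conj (u x) + q₀ ^ 2) / 2) +
          u x * conj (u₁ x)) / z‖ ≤ B ^ 2 * (‖u₁ x‖ + ‖u₂ x‖ + |‖u x‖ ^ 2 - q₀ ^ 2|) * ‖z‖⁻¹ := by
      rw [norm_div, div_eq_mul_inv]
      gcongr
      refine (norm_add_le _ _).trans ?_
      have g6 : ‖(u x * conj (u x) + q₀ ^ 2) / 2‖ ≤ B ^ 2 := by
        rw [norm_div, Complex.norm_ofNat]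
        have : ‖u x * conj (u x) + (q₀ : ℂ) ^ 2‖ ≤ B ^ 2 + B ^ 2 := by
          refine (norm_add_le _ _).trans ?_
          rw [norm_mul, Complex.norm_conj, norm_pow, Complex.norm_real, Real.norm_of_nonneg hq.le,
            ← sq]
          gcongr; exact P.bd x
        linarith
      rw [norm_mul, norm_mul, norm_I, one_mul, hwn, norm_mul, Complex.norm_conj]
      have g7 := mul_le_mul_of_nonneg_left g6 (abs_nonneg (‖u x‖ ^ 2 - q₀ ^ 2))
      have g8 := mul_le_mul_of_nonneg_right (P.bd x) (norm_nonneg (u₁ x))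
      have g9 : B * ‖u₁ x‖ ≤ B ^ 2 * ‖u₁ x‖ := by gcongr; nlinarith
      nlinarith [mul_nonneg (sq_nonneg B) (norm_nonneg (u₂ x))]
    refine (hdiv _ x _ g5).trans ?_
    calc _ = 2 * B ^ 2 * (‖z‖⁻¹ ^ 2 * (‖u₁ x‖ + ‖u₂ x‖ + |‖u x‖ ^ 2 - q₀ ^ 2|)) := by ring
      _ ≤ 100 * B ^ 4 * (‖z‖⁻¹ ^ 2 * (‖u₁ x‖ + ‖u₂ x‖ + |‖u x‖ ^ 2 - q₀ ^ 2|)) := by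
        gcongr ?_ * _; linarith
      _ = _ := by ring

/-- The diagonal gap 2i kλ has modulus at least |z|²/8, so the decaying component is of order |z|⁻¹
· |z|⁻². The other component has the limit e^{-iv}. The constant depends on x but not on z. -/
theorem asymptotics (x : ℝ) : ∃ C, 0 ≤ C ∧ ∀ z ∈ Dplus ∪ contour, 2 * B ≤ ‖z‖ →
    ∀ ν : ℝ → Fin 2 → ℂ, IsModSol u q₀ z ν → Tendsto ν atBot (𝓝 (Ecol qb z 1)) →
      ‖ν x 0 - I * u x / z * ν x 1‖ ≤ C / ‖z‖ ^ 3 ∧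
      ‖(ν x 1 - I * conj (u x) / z * ν x 0) * exp (I * vLeft u q₀ x) - 1‖ ≤ C / ‖z‖ := by
  have hB := P.one_le
  have hq := P.left.pos
  have hqB := P.q₀_le
  set K := 100 * B ^ 4 with hK
  set H := ∫ s in Set.Iic x, (‖u₁ s‖ + ‖u₂ s‖ + |‖u s‖ ^ 2 - q₀ ^ 2|) with hH
  have hK0 : 0 ≤ K := by positivity
  have hH0 : 0 ≤ H := integral_nonneg fun s => by positivity
  set C₁ := K * (2 + 3 * K) * 2 * (1 + H) * Real.exp (3 * K * H) * 8 with hC₁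
  set C₂ := K * 2 * H * Real.exp (2 * K * H) + q₀ ^ 2 with hC₂
  have h1 : 0 ≤ C₁ := by positivity
  have h2 : 0 ≤ C₂ := by positivity
  refine ⟨C₁ + C₂, by positivity, fun z hz hzB ν hν hl => ?_⟩
  have N := P.nearlyDiagonal hz hzB hν hl x
  have hz0 : z ≠ 0 := (mem_closedDplus_iff.1 hz).1
  have hr0 : 0 < ‖z‖ := norm_pos_iff.2 hz0
  have hr1 : 1 ≤ ‖z‖ := by linarith
  have hσ1 : ‖sdet q₀ z - 1‖ ≤ q₀ ^ 2 / ‖z‖ := by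
    rw [sdet, add_sub_cancel_left, norm_div, norm_pow, norm_pow, Complex.norm_real,
      Real.norm_of_nonneg hq.le]
    gcongr
    exact le_self_pow₀ hr1 two_ne_zero
  have hσ : ‖sdet q₀ z‖ ≤ 2 := by
    rw [sdet]
    refine (norm_add_le _ _).trans ?_
    rw [norm_one, norm_div, norm_pow, norm_pow, Complex.norm_real, Real.norm_of_nonneg hq.le]
    have : q₀ ^ 2 / ‖z‖ ^ 2 ≤ 1 := (div_le_one (by positivity)).2 (by gcongr; linarith)
    linarith
  have hα : ‖z‖ ^ 2 / 8 ≤ ‖2 * I * kap q₀ z‖ := by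
    rw [norm_mul, norm_mul, norm_I, Complex.norm_ofNat, kap_eq q₀ hz0, norm_div, Complex.norm_ofNat]
    have h3 := norm_sub_norm_le (z ^ 2) ((q₀ : ℂ) ^ 4 / z ^ 2)
    have h4 : ‖(q₀ : ℂ) ^ 4 / z ^ 2‖ ≤ ‖z‖ ^ 2 / 2 := by
      rw [norm_div, norm_pow, norm_pow, Complex.norm_real, Real.norm_of_nonneg hq.le,
        div_le_iff₀ (by positivity)]
      have h5 : q₀ ^ 2 ≤ B ^ 2 := by gcongr
      have h6 : (2 * B) ^ 2 ≤ ‖z‖ ^ 2 := by gcongr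
      nlinarith [sq_nonneg q₀]
    rw [norm_pow] at h3
    nlinarith [sq_nonneg ‖z‖]
  constructor
  · have h := N.norm_fst_le le_rfl
    have hε : ‖z‖⁻¹ / ‖2 * I * kap q₀ z‖ ≤ 8 / ‖z‖ ^ 3 := by
      calc _ ≤ ‖z‖⁻¹ / (‖z‖ ^ 2 / 8) := by gcongr
        _ = _ := by field_simp
    refine h.trans ?_
    calc _ ≤ K * (2 + 3 * K) * 2 * (1 + H) * Real.exp (3 * K * H) * (8 / ‖z‖ ^ 3) := by gcongr
      _ = C₁ / ‖z‖ ^ 3 := by rw [hC₁]; ring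
      _ ≤ _ := by gcongr; linarith
  · have h := N.norm_snd_sub_le le_rfl
    refine (norm_sub_le_norm_sub_add_norm_sub _ (sdet q₀ z) _).trans ((add_le_add h hσ1).trans ?_)
    calc _ ≤ K * 2 * H * Real.exp (2 * K * H) * ‖z‖⁻¹ + q₀ ^ 2 / ‖z‖ := by gcongr
      _ = C₂ / ‖z‖ := by rw [hC₂]; ring
      _ ≤ _ := by gcongr; linarith

end SmoothPotential
end

/-! ### Limits of the Jost solutions and of the scattering coefficients -/

theorem IsModSol.const_smul {u : ℝ → ℂ} {q₀ : ℝ} {z : ℂ} {ν : ℝ → Fin 2 → ℂ}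
    (h : IsModSol u q₀ z ν) (c : ℂ) : IsModSol u q₀ z fun x => c • ν x := fun x => by
  refine ((h x).fun_const_smul c).congr_deriv ?_
  rw [smul_add, Matrix.mulVec_smul, smul_comm c]

theorem hasDerivAt_swapV {φ : ℝ → Fin 2 → ℂ} {φ' : Fin 2 → ℂ} {x : ℝ} (h : HasDerivAt φ φ' x) :
    HasDerivAt (fun y => swapV (φ y)) (swapV φ') x := by
  rw [hasDerivAt_pi] at h ⊢
  intro i; fin_cases i
  · exact h 1
  · exact h 0

/-- Half of the integral of `|q|² - q₀²` up to `+∞`. -/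
noncomputable def vPlus (q : ℝ → ℝ → ℂ) (q₀ x t : ℝ) : ℝ := vLeft (fun y => conj (q (-y) t)) q₀ (-x)

/-- `z → ∞` in the closure of `D⁺`. -/
noncomputable def infPlus : Filter ℂ := Bornology.cobounded ℂ ⊓ 𝓟 (Dplus ∪ contour)

/-- `z → ∞` in the closure of `D⁻`. -/
noncomputable def infMinus : Filter ℂ := Bornology.cobounded ℂ ⊓ 𝓟 (Dminus ∪ contour)

theorem eventually_infPlus {p : ℂ → Prop} (R : ℝ)
    (h : ∀ z ∈ Dplus ∪ contour, R ≤ ‖z‖ → p z) : ∀ᶠ z in infPlus, p z := by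
  rw [infPlus, eventually_inf_principal]
  filter_upwards [tendsto_norm_cobounded_atTop.eventually_ge_atTop R] with z hz hz' using h z hz' hz

theorem tendsto_norm_infPlus : Tendsto (fun z : ℂ => ‖z‖) infPlus atTop :=
  tendsto_norm_cobounded_atTop.mono_left inf_le_left

theorem tendsto_inv_infPlus : Tendsto (fun z : ℂ => z⁻¹) infPlus (𝓝 0) :=
  (tendsto_inv₀_cobounded (α := ℂ)).mono_left inf_le_left

theorem tendsto_conj_infMinus : Tendsto (fun z : ℂ => conj z) infMinus infPlus := by
  refine tendsto_inf.2 ⟨?_, tendsto_principal.2 ?_⟩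
  · rw [← tendsto_norm_atTop_iff_cobounded]
    simp only [Complex.norm_conj]
    exact tendsto_norm_cobounded_atTop.mono_left inf_le_left
  · rw [infMinus, eventually_inf_principal]
    exact Eventually.of_forall fun z hz => conj_mem_closedDplus hz

theorem tendsto_norm_hat {q₀ : ℝ} (hq₀ : q₀ ≠ 0) : Tendsto (fun z => ‖hat q₀ z‖) (𝓝[≠] 0) atTop := by
  have h : ∀ z, ‖hat q₀ z‖ = q₀ ^ 2 * ‖z⁻¹‖ := fun z => by
    rw [hat, norm_neg, norm_div, norm_pow, Complex.norm_real, norm_inv, div_eq_mul_inv,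
      Real.norm_eq_abs, sq_abs]
  simp only [h]
  exact (tendsto_norm_inv_nhdsNE_zero_atTop).const_mul_atTop (by positivity)

theorem tendsto_hat_zero {q₀ : ℝ} (hq₀ : q₀ ≠ 0) :
    Tendsto (hat q₀) (𝓝[Dminus ∪ contour] 0) infPlus := by
  refine tendsto_inf.2 ⟨?_, tendsto_principal.2 ?_⟩
  · rw [← tendsto_norm_atTop_iff_cobounded]
    exact (tendsto_norm_hat hq₀).mono_left
      (nhdsWithin_mono _ fun z hz => (mem_closedDminus_iff.1 hz).1)
  · filter_upwards [self_mem_nhdsWithin] with z hz using hat_mem_closedDplus hq₀ hz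

theorem tendsto_hat_zero' {q₀ : ℝ} (hq₀ : q₀ ≠ 0) :
    Tendsto (hat q₀) (𝓝[Dplus ∪ contour] 0) infMinus := by
  refine tendsto_inf.2 ⟨?_, tendsto_principal.2 ?_⟩
  · rw [← tendsto_norm_atTop_iff_cobounded]
    exact (tendsto_norm_hat hq₀).mono_left
      (nhdsWithin_mono _ fun z hz => (mem_closedDplus_iff.1 hz).1)
  · filter_upwards [self_mem_nhdsWithin] with z hz using hat_mem_closedDminus hq₀ hz

theorem tendsto_sdet_infPlus (q₀ : ℝ) : Tendsto (sdet q₀) infPlus (𝓝 1) := by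
  have h := ((tendsto_inv_infPlus.pow 2).const_mul ((q₀ : ℂ) ^ 2)).const_add 1
  rw [zero_pow two_ne_zero, mul_zero, add_zero] at h
  refine h.congr fun z => ?_
  rw [sdet, inv_pow, div_eq_mul_inv]

section
variable {q : ℝ → ℝ → ℂ} {q₀ : ℝ} {qm qp : ℂ} {W : ℂ → ℝ → ℝ → Op} {Jm Jp : ℂ → Fin 2 → ℂ}
variable (S : Scat q q₀ qm qp W Jm Jp)
include S

theorem Scat.exists_bound (t : ℝ) : ∃ B : ℝ, 1 ≤ B ∧ q₀ ≤ B ∧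
    ∀ x, ‖q x t‖ ≤ B ∧ ‖deriv (fun y => q y t) x‖ ≤ B := by
  obtain ⟨C, hC⟩ := S.bc.locally_bounded |t|
  exact ⟨max (max 1 q₀) C, (le_max_left _ _).trans (le_max_left _ _),
    (le_max_right _ _).trans (le_max_left _ _), fun x =>
    ⟨(hC x t le_rfl).1.trans (le_max_right _ _), (hC x t le_rfl).2.trans (le_max_right _ _)⟩⟩

theorem Scat.smoothM (t : ℝ) : ∃ B, SmoothPotential (fun x => q x t) (deriv fun x => q x t)
    (deriv (deriv fun x => q x t)) qm q₀ B := by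
  obtain ⟨B, h1, h2, h3⟩ := S.exists_bound t
  exact ⟨B, S.bc.leftPotential S.sol t, fun x => S.sol.hasDerivAt_x x t,
    fun x => S.sol.hasDerivAt_xx x t, continuous_deriv_deriv_of_contDiff_two (S.sol.contDiff_x t),
    S.bc.integrable_deriv t, S.bc.integrable_deriv2 t, fun x => (h3 x).1, fun x => (h3 x).2,
    S.bc.tendsto_bot t, S.bc.tendsto_deriv_bot S.sol t, h1, h2⟩

theorem Scat.smoothP (t : ℝ) : ∃ B, SmoothPotential (fun x => conj (q (-x) t))
    (fun x => -conj (deriv (fun x => q x t) (-x)))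
    (fun x => conj (deriv (deriv fun x => q x t) (-x))) (conj qp) q₀ B := by
  obtain ⟨B, h1, h2, h3⟩ := S.exists_bound t
  have hn : ∀ x : ℝ, HasDerivAt (fun x : ℝ => -x) (-1) x := fun x => hasDerivAt_neg x
  have hcc := continuous_deriv_deriv_of_contDiff_two (S.sol.contDiff_x t)
  refine ⟨B, S.bc.leftPotential_reflect S.sol t, fun x => ?_, fun x => ?_,
    continuous_conj.comp (hcc.comp continuous_neg), ?_, ?_, fun x => by simpa using (h3 (-x)).1,
    fun x => by simpa using (h3 (-x)).2, ?_, ?_, h1, h2⟩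
  · have := ((S.sol.hasDerivAt_x (-x) t).scomp x (hn x)).star
    exact this.congr_deriv (by simp)
  · have := (((S.sol.hasDerivAt_xx (-x) t).scomp x (hn x)).star).fun_neg
    exact this.congr_deriv (by simp)
  · exact ((Complex.conjLIE.integrable_comp_iff).2 (S.bc.integrable_deriv t).comp_neg).neg
  · exact (Complex.conjLIE.integrable_comp_iff).2 (S.bc.integrable_deriv2 t).comp_neg
  · exact (continuous_conj.tendsto _).comp ((S.bc.tendsto_top t).comp tendsto_neg_atBot_atTop)
  · have := (continuous_conj.tendsto _).comp
      ((S.bc.tendsto_deriv_top S.sol t).comp tendsto_neg_atBot_atTop)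
    simpa using this.neg

theorem Scat.muM_one_asymptotics (x t : ℝ) : ∃ C R, 0 ≤ C ∧ ∀ z ∈ Dplus ∪ contour, R ≤ ‖z‖ →
    ‖muM q q₀ qm 1 x t z 0 - I * q x t / z * muM q q₀ qm 1 x t z 1‖ ≤ C / ‖z‖ ^ 3 ∧
    ‖(muM q q₀ qm 1 x t z 1 - I * conj (q x t) / z * muM q q₀ qm 1 x t z 0) *
      exp (I * vMinus q q₀ x t) - 1‖ ≤ C / ‖z‖ := by
  obtain ⟨B, P⟩ := S.smoothM t
  obtain ⟨C, hC, h⟩ := P.asymptotics x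
  refine ⟨C, 2 * B, hC, fun z hz hzB => ?_⟩
  obtain ⟨h1, h2⟩ := S.jostM z hz t
  refine h z hz hzB (fun y => muM q q₀ qm 1 y t z) ?_ ?_
  -- The time part of θ is a factor independent of x, so at fixed t the column μ solves the modified
  -- equation.
  · have h3 := (isModSol_exp_smul (u := fun x => q x t) h1).const_smul
      (exp (-(I * (kap q₀ z * (2 * kz q₀ z ^ 2 - q₀ ^ 2) * t))))
    have e : (fun y => muM q q₀ qm 1 y t z) = fun y : ℝ =>
        exp (-(I * (kap q₀ z * (2 * kz q₀ z ^ 2 - q₀ ^ 2) * t))) •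
          exp (I * kap q₀ z * y) • W (kz q₀ z) y t (Jm z) := by
      ext1 y
      rw [muM, S.PhiM_one hz, smul_smul, ← Complex.exp_add, theta_eq, colSign_one]
      congr 2; ring
    rw [e]; exact h3
  · refine h2.congr fun y => ?_
    rw [muM, S.PhiM_one hz]

/-- Swapping components and reflecting x turns Φ_{+1} into the second left Jost column of the
potential q^*(-x, t), to which the estimate at -∞ applies. -/
theorem Scat.muP_zero_asymptotics (x t : ℝ) : ∃ C R, 0 ≤ C ∧ ∀ z ∈ Dplus ∪ contour, R ≤ ‖z‖ →
    ‖muP q q₀ qp 0 x t z 1 - I * conj (q x t) / z * muP q q₀ qp 0 x t z 0‖ ≤ C / ‖z‖ ^ 3 ∧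
    ‖(muP q q₀ qp 0 x t z 0 - I * q x t / z * muP q q₀ qp 0 x t z 1) *
      exp (I * vPlus q q₀ x t) - 1‖ ≤ C / ‖z‖ := by
  obtain ⟨B, P⟩ := S.smoothP t
  obtain ⟨C, hC, h⟩ := P.asymptotics (-x)
  refine ⟨C, 2 * B, hC, fun z hz hzB => ?_⟩
  obtain ⟨h1, h2⟩ := S.jostP z hz t
  have key := h z hz hzB (fun y => swapV (muP q q₀ qp 0 (-y) t z)) ?_ ?_
  · simpa [swapV, vPlus] using key
  · have h0 : ∀ y, HasDerivAt (fun y => swapV (W (kz q₀ z) (-y) t (Jp z)))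
        (laxX (conj (q (-y) t)) (kz q₀ z) *ᵥ swapV (W (kz q₀ z) (-y) t (Jp z))) y := fun y => by
      refine ((hasDerivAt_swapV ((h1 (-y)).scomp y (hasDerivAt_neg y)))).congr_deriv ?_
      rw [neg_one_smul, show ∀ v, swapV (-v) = -swapV v from fun v => by
        ext i; fin_cases i <;> simp [swapV], swapV_laxX, neg_neg]
    have h3 := (isModSol_exp_smul (u := fun x => conj (q (-x) t)) h0).const_smul
      (exp (I * (kap q₀ z * (2 * kz q₀ z ^ 2 - q₀ ^ 2) * t)))
    have e : (fun y => swapV (muP q q₀ qp 0 (-y) t z)) = fun y : ℝ =>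
        exp (I * (kap q₀ z * (2 * kz q₀ z ^ 2 - q₀ ^ 2) * t)) •
          exp (I * kap q₀ z * y) • swapV (W (kz q₀ z) (-y) t (Jp z)) := by
      ext1 y
      rw [muP, S.PhiP_zero hz, smul_smul, ← Complex.exp_add, theta_eq, colSign_zero, swapV_smul]
      congr 2; push_cast; ring
    rw [e]; exact h3
  · have h3 := (continuous_swapV.tendsto _).comp (h2.comp tendsto_neg_atBot_atTop)
    have e : swapV (fun i => Emat qp z i 0) = Ecol (conj qp) z 1 := by
      rw [show (fun i => Emat qp z i 0) = Ecol qp z 0 from rfl, ← swapV_Ecol, swapV_swapV]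
    rw [e] at h3
    refine h3.congr fun y => ?_
    simp only [Function.comp_apply]
    rw [muP, S.PhiP_zero hz]

/-! Symmetries of the normalized columns. -/

theorem Scat.muM_zero_conj {z : ℂ} (hz : z ∈ Dminus ∪ contour) (x t : ℝ) :
    muM q q₀ qm 0 x t z = conjV (muM q q₀ qm 1 x t (conj z)) := by
  rw [muM, muM, S.PhiM_zero_conj hz, conjV_smul, ← Complex.exp_conj]
  congr 2
  simp [theta_conj, colSign_zero, colSign_one]

theorem Scat.muP_one_conj {z : ℂ} (hz : z ∈ Dminus ∪ contour) (x t : ℝ) :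
    muP q q₀ qp 1 x t z = -conjV (muP q q₀ qp 0 x t (conj z)) := by
  rw [muP, muP, S.PhiP_one_conj hz, conjV_smul, ← Complex.exp_conj, smul_neg]
  congr 3
  simp [theta_conj, colSign_zero, colSign_one]

theorem Scat.muM_zero_hat {z : ℂ} (hz : z ∈ Dminus ∪ contour) (x t : ℝ) :
    muM q q₀ qm 0 x t z = (I * conj qm / z) • muM q q₀ qm 1 x t (hat q₀ z) := by
  rw [muM, muM, S.PhiM_zero_hat hz, smul_comm, theta_hat S.q₀_ne (mem_closedDminus_iff.1 hz).1]
  simp [colSign_zero, colSign_one]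

theorem Scat.muP_one_hat {z : ℂ} (hz : z ∈ Dminus ∪ contour) (x t : ℝ) :
    muP q q₀ qp 1 x t z = (I * qp / z) • muP q q₀ qp 0 x t (hat q₀ z) := by
  rw [muP, muP, S.PhiP_one_hat hz, smul_comm, theta_hat S.q₀_ne (mem_closedDminus_iff.1 hz).1]
  simp [colSign_zero, colSign_one]

theorem Scat.muM_one_hat {z : ℂ} (hz : z ∈ Dplus ∪ contour) (x t : ℝ) :
    muM q q₀ qm 1 x t z = (I * qm / z) • muM q q₀ qm 0 x t (hat q₀ z) := by
  have hz0 := (mem_closedDplus_iff.1 hz).1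
  have hq0 : (q₀ : ℂ) ≠ 0 := by exact_mod_cast S.q₀_ne
  rw [S.muM_zero_hat (hat_mem_closedDminus S.q₀_ne hz), hat_hat S.q₀_ne hz0, smul_smul]
  have h := mul_conj_of_norm_eq S.bc.norm_qm
  have : I * qm / z * (I * conj qm / hat q₀ z) = 1 := by
    rw [hat]; field_simp; rw [I_sq]; linear_combination h
  rw [this, one_smul]

/-! The scattering coefficients at an arbitrary point. -/

theorem Scat.s11_eq {z : ℂ} (hz : z ∈ Dplus ∪ contour) (x t : ℝ) :
    s11 q q₀ qm qp z = Wr (muP q q₀ qp 0 x t z) (muM q q₀ qm 1 x t z) / sdet q₀ z := by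
  rw [s11, muP, muM, Wr_smul_left, Wr_smul_right, S.PhiP_zero' hz x, S.PhiM_one' hz x,
    S.flow.Wr_apply, ← mul_assoc, ← Complex.exp_add, colSign_zero, colSign_one]
  simp

theorem Scat.s22_conj {z : ℂ} (hz : z ∈ Dminus ∪ contour) :
    s22 q q₀ qm qp z = conj (s11 q q₀ qm qp (conj z)) := by
  rw [s22, s11, S.PhiM_zero_conj hz, S.PhiP_one_conj hz]
  simp [Wr, conjV, sdet]
  ring

theorem Scat.s22_hat {z : ℂ} (hz : z ∈ Dminus ∪ contour) :
    s22 q q₀ qm qp z = conj qm * qp / q₀ ^ 2 * s11 q q₀ qm qp (hat q₀ z) := by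
  have hz0 := (mem_closedDminus_iff.1 hz).1
  have hq0 : (q₀ : ℂ) ≠ 0 := by exact_mod_cast S.q₀_ne
  rw [s22, s11, S.PhiM_zero_hat hz, S.PhiP_one_hat hz, Wr_smul_left, Wr_smul_right, Wr_swap]
  have : sdet q₀ (hat q₀ z) = z ^ 2 / q₀ ^ 2 * sdet q₀ z := by
    unfold sdet hat; field_simp; ring
  rw [this]
  generalize sdet q₀ z = s
  -- At the branch points both sides are quotients by zero, hence both are 0.
  rcases eq_or_ne s 0 with rfl | hs
  · simp
  · field_simp; rw [I_sq]; ring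

theorem Scat.s11_neg {z : ℂ} (hz : z ∈ Dplus ∪ contour) :
    s11 q q₀ qm qp (-z) = s11 q q₀ qm qp z := by
  rw [s11, s11, S.PhiP_zero_neg hz, S.PhiM_one_neg hz]
  simp [Wr, sigV, sdet]

end

/-! Limits at infinity. -/

theorem tendsto_of_diagonal_bound_aux {a b : ℂ → ℂ} {c c' : ℂ} {v C R : ℝ}
    (h : ∀ z ∈ Dplus ∪ contour, R ≤ ‖z‖ → ‖a z - I * c / z * b z‖ ≤ C / ‖z‖ ^ 3 ∧
      ‖(b z - I * c' / z * a z) * exp (I * v) - 1‖ ≤ C / ‖z‖) :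
    Tendsto (fun z => z ^ 2 * (a z - I * c / z * b z)) infPlus (𝓝 0) ∧
      Tendsto (fun z => b z - I * c' / z * a z) infPlus (𝓝 (exp (-(I * v)))) := by
  have hn := tendsto_norm_infPlus
  have h0 : ∀ᶠ z in infPlus, z ≠ 0 := eventually_infPlus 0 fun z hz _ => (mem_closedDplus_iff.1 hz).1
  constructor
  · refine squeeze_zero_norm' (a := fun z => C / ‖z‖) ?_ (tendsto_const_nhds.div_atTop hn)
    filter_upwards [eventually_infPlus R fun z hz hR => (h z hz hR).1, h0] with z hz hz0
    have := norm_pos_iff.2 hz0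
    rw [norm_mul, norm_pow]
    calc _ ≤ ‖z‖ ^ 2 * (C / ‖z‖ ^ 3) := by gcongr
      _ = _ := by field_simp
  · have t3 : Tendsto (fun z => (b z - I * c' / z * a z) * exp (I * v) - 1) infPlus (𝓝 0) :=
      squeeze_zero_norm' (eventually_infPlus R fun z hz hR => (h z hz hR).2)
        (tendsto_const_nhds.div_atTop hn)
    have t4 := (t3.add_const 1).mul_const (exp (-(I * v)))
    simp only [sub_add_cancel, mul_assoc, ← Complex.exp_add, zero_add, one_mul] at t4
    simpa using t4

/-- The two controlled combinations form a linear system for (a, b) with determinant 1 + cc'/z² → 1;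
solving it recovers the entries themselves. -/
theorem tendsto_of_diagonal_bound {a b : ℂ → ℂ} {c c' : ℂ} {v C R : ℝ}
    (h : ∀ z ∈ Dplus ∪ contour, R ≤ ‖z‖ → ‖a z - I * c / z * b z‖ ≤ C / ‖z‖ ^ 3 ∧
      ‖(b z - I * c' / z * a z) * exp (I * v) - 1‖ ≤ C / ‖z‖) :
    Tendsto (fun z => z * a z) infPlus (𝓝 (I * c * exp (-(I * v)))) ∧
      Tendsto b infPlus (𝓝 (exp (-(I * v)))) := by
  have hi := tendsto_inv_infPlus
  have h0 : ∀ᶠ z in infPlus, z ≠ 0 := eventually_infPlus 0 fun z hz _ => (mem_closedDplus_iff.1 hz).1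
  obtain ⟨t0, t2⟩ := tendsto_of_diagonal_bound_aux h
  have t1 : Tendsto (fun z => z * (a z - I * c / z * b z)) infPlus (𝓝 0) := by
    have := hi.mul t0
    rw [zero_mul] at this
    refine this.congr' (h0.mono fun z hz => ?_)
    field_simp
  have t5 : Tendsto (fun z : ℂ => 1 + c * c' * z⁻¹ ^ 2) infPlus (𝓝 1) := by
    simpa using ((hi.pow 2).const_mul (c * c')).const_add 1
  have h5 : ∀ᶠ z in infPlus, 1 + c * c' * z⁻¹ ^ 2 ≠ 0 := t5.eventually_ne one_ne_zero
  constructor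
  · have t6 := (t1.add (t2.const_mul (I * c))).div t5 one_ne_zero
    rw [zero_add, div_one] at t6
    refine t6.congr' ?_
    filter_upwards [h0, h5] with z hz h5
    simp only [Pi.div_apply]
    rw [div_eq_iff h5]
    field_simp
    ring_nf
    rw [I_sq]; ring
  · have t6 := (t2.add (((hi.pow 2).const_mul (I * c')).mul t1)).div t5 one_ne_zero
    simp only [mul_zero, add_zero, div_one] at t6
    refine t6.congr' ?_
    filter_upwards [h0, h5] with z hz h5
    simp only [Pi.div_apply]
    rw [div_eq_iff h5]
    field_simp
    ring_nf
    rw [I_sq]; ring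

theorem tendsto_zero_of_mul {a : ℂ → ℂ} {l : ℂ} (h : Tendsto (fun z => z * a z) infPlus (𝓝 l)) :
    Tendsto a infPlus (𝓝 0) := by
  have := tendsto_inv_infPlus.mul h
  rw [zero_mul] at this
  refine this.congr' (eventually_infPlus 0 fun z hz _ => ?_)
  exact inv_mul_cancel_left₀ (mem_closedDplus_iff.1 hz).1 _

section
variable {q : ℝ → ℝ → ℂ} {q₀ : ℝ} {qm qp : ℂ} {W : ℂ → ℝ → ℝ → Op} {Jm Jp : ℂ → Fin 2 → ℂ}
variable (S : Scat q q₀ qm qp W Jm Jp)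
include S

theorem Scat.tendsto_muM_one_inf (x t : ℝ) :
    Tendsto (fun z => z * muM q q₀ qm 1 x t z 0) infPlus
      (𝓝 (I * q x t * exp (-(I * vMinus q q₀ x t)))) ∧
    Tendsto (fun z => muM q q₀ qm 1 x t z 1) infPlus (𝓝 (exp (-(I * vMinus q q₀ x t)))) := by
  obtain ⟨C, R, -, h⟩ := S.muM_one_asymptotics x t
  exact tendsto_of_diagonal_bound h

theorem Scat.tendsto_muP_zero_inf (x t : ℝ) :
    Tendsto (fun z => z * muP q q₀ qp 0 x t z 1) infPlus
      (𝓝 (I * conj (q x t) * exp (-(I * vPlus q q₀ x t)))) ∧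
    Tendsto (fun z => muP q q₀ qp 0 x t z 0) infPlus (𝓝 (exp (-(I * vPlus q q₀ x t)))) := by
  obtain ⟨C, R, -, h⟩ := S.muP_zero_asymptotics x t
  exact tendsto_of_diagonal_bound h

theorem Scat.tendsto_s11_inf (x t : ℝ) : Tendsto (s11 q q₀ qm qp) infPlus
    (𝓝 (exp (-(I * vPlus q q₀ x t)) * exp (-(I * vMinus q q₀ x t)))) := by
  obtain ⟨h1, h2⟩ := S.tendsto_muM_one_inf x t
  obtain ⟨h3, h4⟩ := S.tendsto_muP_zero_inf x t
  have h := ((h4.mul h2).sub ((tendsto_zero_of_mul h3).mul (tendsto_zero_of_mul h1))).div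
    (tendsto_sdet_infPlus q₀) one_ne_zero
  rw [mul_zero, sub_zero, div_one] at h
  refine h.congr' (eventually_infPlus 0 fun z hz _ => ?_)
  rw [S.s11_eq hz x t]; rfl

theorem Scat.tendsto_s22_inf (x t : ℝ) : Tendsto (s22 q q₀ qm qp) infMinus
    (𝓝 (exp (I * vPlus q q₀ x t) * exp (I * vMinus q q₀ x t))) := by
  have h := (continuous_conj.tendsto _).comp ((S.tendsto_s11_inf x t).comp tendsto_conj_infMinus)
  simp only [map_mul, ← Complex.exp_conj, map_neg, conj_I, Complex.conj_ofReal, neg_mul,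
    neg_neg] at h
  refine h.congr' ?_
  rw [infMinus, EventuallyEq, eventually_inf_principal]
  exact Eventually.of_forall fun z hz => (S.s22_conj hz).symm

/-- `μ_{+12} / s₂₂` at infinity. -/
theorem Scat.tendsto_muP_one_div_inf (x t : ℝ) :
    Tendsto (fun z => z * (muP q q₀ qp 1 x t z 0 / s22 q q₀ qm qp z)) infMinus
      (𝓝 (I * q x t * exp (-(I * vMinus q q₀ x t)))) := by
  have h := (continuous_conj.tendsto _).comp
    ((S.tendsto_muP_zero_inf x t).1.comp tendsto_conj_infMinus)
  have h2 := h.neg.div (S.tendsto_s22_inf x t) (mul_ne_zero (Complex.exp_ne_zero _)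
    (Complex.exp_ne_zero _))
  -- The phase of v₊ cancels between the column normalized at +∞ and s₂₂. Hence f₋ has the same
  -- limit as f₊.
  have e : -conj (I * conj (q x t) * exp (-(I * vPlus q q₀ x t))) /
      (exp (I * vPlus q q₀ x t) * exp (I * vMinus q q₀ x t)) =
      I * q x t * exp (-(I * vMinus q q₀ x t)) := by
    simp only [map_mul, ← Complex.exp_conj, map_neg, conj_I, Complex.conj_ofReal, neg_mul,
      neg_neg, Complex.conj_conj, Complex.exp_neg (I * vMinus q q₀ x t)]
    have h3 := Complex.exp_ne_zero (I * vPlus q q₀ x t)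
    have h4 := Complex.exp_ne_zero (I * vMinus q q₀ x t)
    field_simp
  rw [e] at h2
  refine h2.congr' ?_
  rw [infMinus, EventuallyEq, eventually_inf_principal]
  refine Eventually.of_forall fun z hz => ?_
  rw [S.muP_one_conj hz]
  simp [conjV]
  ring

/-- `μ_{-12}` at the origin. -/
theorem Scat.tendsto_muM_one_zero (x t : ℝ) :
    Tendsto (fun z => z * muM q q₀ qm 1 x t z 0) (𝓝[Dplus ∪ contour] 0)
      (𝓝 (I * qm * exp (I * vMinus q q₀ x t))) := by
  have h := ((continuous_conj.tendsto _).comp ((S.tendsto_muM_one_inf x t).2.comp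
    (tendsto_conj_infMinus.comp (tendsto_hat_zero' S.q₀_ne)))).const_mul (I * qm)
  simp only [← Complex.exp_conj, map_neg, map_mul, conj_I, Complex.conj_ofReal, neg_mul,
    neg_neg] at h
  refine h.congr' ?_
  filter_upwards [self_mem_nhdsWithin] with z hz
  have hz0 := (mem_closedDplus_iff.1 hz).1
  rw [S.muM_one_hat hz, S.muM_zero_conj (hat_mem_closedDminus S.q₀_ne hz)]
  simp [conjV]
  field_simp

/-- `μ_{+12} / s₂₂` at the origin. -/
theorem Scat.tendsto_muP_one_div_zero (x t : ℝ) :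
    Tendsto (fun z => z * (muP q q₀ qp 1 x t z 0 / s22 q q₀ qm qp z)) (𝓝[Dminus ∪ contour] 0)
      (𝓝 (I * qm * exp (I * vMinus q q₀ x t))) := by
  have hq0 : (q₀ : ℂ) ≠ 0 := by exact_mod_cast S.q₀_ne
  have hqm := S.qm_ne
  have hqp := S.qp_ne
  have hqm' : conj qm ≠ 0 := by simpa using hqm
  have hmm := mul_conj_of_norm_eq S.bc.norm_qm
  have h := (((S.tendsto_muP_zero_inf x t).2.comp (tendsto_hat_zero S.q₀_ne)).const_mul
    (I * qp)).div (((S.tendsto_s11_inf x t).comp (tendsto_hat_zero S.q₀_ne)).const_mul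
      (conj qm * qp / q₀ ^ 2)) (by simp [hqm, hqp, S.q₀_ne, Complex.exp_ne_zero])
  -- The phase of v₊ and the factor q₊ cancel, and q₀² / q₋^* = q₋; the limit at the origin agrees
  -- with that of f₊.
  have e : I * qp * exp (-(I * vPlus q q₀ x t)) / (conj qm * qp / q₀ ^ 2 *
      (exp (-(I * vPlus q q₀ x t)) * exp (-(I * vMinus q q₀ x t)))) =
      I * qm * exp (I * vMinus q q₀ x t) := by
    have h3 := Complex.exp_ne_zero (-(I * vPlus q q₀ x t))
    have h4 := Complex.exp_ne_zero (I * vMinus q q₀ x t)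
    rw [Complex.exp_neg (I * vMinus q q₀ x t)]
    field_simp
    rw [mul_comm, ← hmm]
  rw [e] at h
  refine h.congr' ?_
  filter_upwards [self_mem_nhdsWithin] with z hz
  have hz0 := (mem_closedDminus_iff.1 hz).1
  simp only [Pi.div_apply, Function.comp_apply]
  rw [S.muP_one_hat hz, S.s22_hat hz]
  simp
  field_simp

end

/-! ### The jump relation -/

theorem sdet_ne_zero {q₀ : ℝ} {z : ℂ} (hz : z ≠ 0) (hb : z ∉ branchPts q₀) : sdet q₀ z ≠ 0 := by
  intro h
  unfold sdet at h
  field_simp at h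
  have h2 : (z - I * q₀) * (z + I * q₀) = 0 := by
    linear_combination h - (q₀ : ℂ) ^ 2 * I_sq
  rcases mul_eq_zero.1 h2 with h3 | h3
  · exact hb (Or.inl (sub_eq_zero.1 h3))
  · exact hb (Or.inr (eq_neg_of_add_eq_zero_left h3))

theorem notMem_branchPts_of_Dplus {q₀ : ℝ} {z : ℂ} (hz : z ∈ Dplus) : z ∉ branchPts q₀ := by
  rintro (rfl | rfl) <;> simp [Dplus] at hz

theorem notMem_branchPts_of_Dminus {q₀ : ℝ} {z : ℂ} (hz : z ∈ Dminus) : z ∉ branchPts q₀ := by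
  rintro (rfl | rfl) <;> simp [Dminus] at hz

theorem differentiableAt_theta (q₀ : ℝ) {z : ℂ} (hz : z ≠ 0) (x t : ℝ) :
    DifferentiableAt ℂ (theta q₀ x t) z := by
  have h1 := differentiableAt_kz q₀ hz
  have h2 := differentiableAt_lamz q₀ hz
  unfold theta
  fun_prop

theorem continuousAt_sdet (q₀ : ℝ) {z : ℂ} (hz : z ≠ 0) : ContinuousAt (sdet q₀) z := by
  unfold sdet; fun_prop (disch := simpa using hz)

/-- θ is a real rational function of z², and z² is real on Σ. The exponentials in the jump are
therefore unimodular and play no role in its integrability. -/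
theorem contour_im_theta {q₀ : ℝ} {z : ℂ} (hz : z ∈ contour) (x t : ℝ) : (theta q₀ x t z).im = 0 := by
  have h1 : (z ^ 2).im = 0 := by
    rw [sq, Complex.mul_im]; rcases hz.1 with h | h <;> simp [h]
  have h2 : z ^ 2 = ((z ^ 2).re : ℂ) := by apply Complex.ext <;> simp [h1]
  have h3 : theta q₀ x t z = (z ^ 2 - q₀ ^ 4 / z ^ 2) / 4 *
      (x - ((z ^ 2 - 2 * q₀ ^ 2 + q₀ ^ 4 / z ^ 2) / 2 - q₀ ^ 2) * t) := by
    have hz0 := hz.2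
    unfold theta kz lamz
    field_simp; ring
  rw [h3, h2]
  norm_cast

theorem norm_exp_two_theta {q₀ : ℝ} {z : ℂ} (hz : z ∈ contour) (x t : ℝ) :
    ‖exp (2 * I * theta q₀ x t z)‖ = 1 := by
  rw [Complex.norm_exp, Real.exp_eq_one_iff]
  simp [contour_im_theta hz]

/-- Σ lies in the closure of D⁺, so the limit that defines the boundary value of M is unique. -/
theorem nhdsWithin_Dplus_neBot {z : ℂ} (hz : z ∈ contour) : (𝓝[Dplus] z).NeBot := by
  rw [← mem_closure_iff_nhdsWithin_neBot]
  obtain ⟨w, hw⟩ : ∃ w : ℂ, ∀ s : ℝ, 0 < s → z + s * w ∈ Dplus := by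
    have h0 := hz.2
    rcases hz.1 with h | h
    · have hr : z.re ≠ 0 := fun h' => h0 (Complex.ext h' h)
      refine ⟨z.re * I, fun s hs => ?_⟩
      simp only [Dplus, Set.mem_ofPred_eq]
      simp [h]
      nlinarith [mul_pos hs (mul_self_pos.2 hr)]
    · have hr : z.im ≠ 0 := fun h' => h0 (Complex.ext h h')
      refine ⟨z.im, fun s hs => ?_⟩
      simp only [Dplus, Set.mem_ofPred_eq]
      simp [h]
      nlinarith [mul_pos hs (mul_self_pos.2 hr)]
  have ht : Tendsto (fun s : ℝ => z + s * w) (𝓝[>] 0) (𝓝 z) := by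
    have : Continuous fun s : ℝ => z + s * w := by fun_prop
    have h := this.tendsto 0
    simp only [ofReal_zero, zero_mul, add_zero] at h
    exact h.mono_left nhdsWithin_le_nhds
  refine mem_closure_of_tendsto ht ?_
  filter_upwards [self_mem_nhdsWithin] with s hs using hw s hs

section
variable {q : ℝ → ℝ → ℂ} {q₀ : ℝ} {qm qp : ℂ} {W : ℂ → ℝ → ℝ → Op} {Jm Jp : ℂ → Fin 2 → ℂ}
variable (S : Scat q q₀ qm qp W Jm Jp)
include S

/-- The Wronskian is constant in x, and at -∞ it is the determinant of E_-. -/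
theorem Scat.Wr_PhiM {z : ℂ} (hz : z ∈ contour) :
    Wr (PhiM q q₀ qm 0 0 0 z) (PhiM q q₀ qm 1 0 0 z) = sdet q₀ z := by
  have hp : z ∈ Dplus ∪ contour := Or.inr hz
  have hm : z ∈ Dminus ∪ contour := Or.inr hz
  have h1 : ∀ x : ℝ, Wr (muM q q₀ qm 0 x 0 z) (muM q q₀ qm 1 x 0 z) =
      Wr (PhiM q q₀ qm 0 0 0 z) (PhiM q q₀ qm 1 0 0 z) := fun x => by
    rw [muM, muM, Wr_smul_left, Wr_smul_right, S.PhiM_zero hm x, S.PhiM_one' hp x,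
      S.flow.Wr_apply, ← mul_assoc, ← Complex.exp_add, colSign_zero, colSign_one]
    simp
  have hl : ∀ w ∈ Dplus ∪ contour, Tendsto (fun x => muM q q₀ qm 1 x 0 w) atBot
      (𝓝 (Ecol qm w 1)) := fun w hw => by
    refine (S.jostM w hw 0).2.congr fun x => ?_
    rw [muM, S.PhiM_one hw]
  have h2 : Tendsto (fun x => muM q q₀ qm 0 x 0 z) atBot (𝓝 (Ecol qm z 0)) := by
    have := (continuous_conjV.tendsto _).comp (hl _ (conj_mem_closedDplus hm))
    rw [conjV_Ecol_one] at this
    exact this.congr fun x => (S.muM_zero_conj hm x 0).symm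
  have h3 := (continuous_Wr.tendsto (Ecol qm z 0, Ecol qm z 1)).comp (h2.prodMk_nhds (hl z hp))
  have h4 := tendsto_nhds_unique (h3.congr h1) tendsto_const_nhds
  rw [← h4]
  have hq := mul_conj_of_norm_eq S.bc.norm_qm
  have hz0 := hz.2
  rw [Ecol_zero, Ecol_one]
  simp only [Wr, sdet, Matrix.cons_val_zero, Matrix.cons_val_one]
  field_simp
  rw [I_sq]
  linear_combination hq

/-- Cramer's rule in the basis Φ_-, available where det E ≠ 0; the flow then carries the identity
from the origin to every (x, t). -/
theorem Scat.PhiP_zero_eq {z : ℂ} (hz : z ∈ contour) (hb : z ∉ branchPts q₀) (x t : ℝ) :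
    PhiP q q₀ qp 0 x t z = s11 q q₀ qm qp z • PhiM q q₀ qm 0 x t z +
      s21 q q₀ qm qp z • PhiM q q₀ qm 1 x t z := by
  have hs := sdet_ne_zero hz.2 hb
  have h := Wr_smul_eq (PhiM q q₀ qm 0 0 0 z) (PhiM q q₀ qm 1 0 0 z) (PhiP q q₀ qp 0 0 0 z)
  rw [S.Wr_PhiM hz] at h
  have h2 : PhiP q q₀ qp 0 0 0 z = s11 q q₀ qm qp z • PhiM q q₀ qm 0 0 0 z +
      s21 q q₀ qm qp z • PhiM q q₀ qm 1 0 0 z := by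
    have := congrArg (fun v => (sdet q₀ z)⁻¹ • v) h
    simp only [smul_add, smul_smul, inv_mul_cancel₀ hs, one_smul] at this
    rw [this, s11, s21, div_eq_inv_mul, div_eq_inv_mul]
  rw [S.PhiP_zero' (Or.inr hz) x, S.PhiM_zero (Or.inr hz) x, S.PhiM_one' (Or.inr hz) x, h2,
    map_add, map_smul, map_smul]

theorem Scat.PhiP_one_eq {z : ℂ} (hz : z ∈ contour) (hb : z ∉ branchPts q₀) (x t : ℝ) :
    PhiP q q₀ qp 1 x t z = s12 q q₀ qm qp z • PhiM q q₀ qm 0 x t z +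
      s22 q q₀ qm qp z • PhiM q q₀ qm 1 x t z := by
  have hs := sdet_ne_zero hz.2 hb
  have h := Wr_smul_eq (PhiM q q₀ qm 0 0 0 z) (PhiM q q₀ qm 1 0 0 z) (PhiP q q₀ qp 1 0 0 z)
  rw [S.Wr_PhiM hz] at h
  have h2 : PhiP q q₀ qp 1 0 0 z = s12 q q₀ qm qp z • PhiM q q₀ qm 0 0 0 z +
      s22 q q₀ qm qp z • PhiM q q₀ qm 1 0 0 z := by
    have := congrArg (fun v => (sdet q₀ z)⁻¹ • v) h
    simp only [smul_add, smul_smul, inv_mul_cancel₀ hs, one_smul] at this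
    rw [this, s12, s22, div_eq_inv_mul, div_eq_inv_mul]
  rw [S.PhiP_one (Or.inr hz) x, S.PhiM_zero (Or.inr hz) x, S.PhiM_one' (Or.inr hz) x, h2,
    map_add, map_smul, map_smul]

/-! Regularity of the columns and of the scattering coefficients. -/

theorem Scat.continuousOn_muM_one (x t : ℝ) :
    ContinuousOn (fun z => muM q q₀ qm 1 x t z) (Dplus ∪ contour) := fun z hz => by
  have h := (differentiableAt_theta q₀ (mem_closedDplus_iff.1 hz).1 x t).continuousAt
  exact (continuousAt_const.mul (continuousAt_const.mul h)).neg.cexp.continuousWithinAt.smul (S.continuousOn_PhiM_one x t z hz)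

theorem Scat.continuousOn_muP_zero (x t : ℝ) :
    ContinuousOn (fun z => muP q q₀ qp 0 x t z) (Dplus ∪ contour) := fun z hz => by
  have h := (differentiableAt_theta q₀ (mem_closedDplus_iff.1 hz).1 x t).continuousAt
  exact (continuousAt_const.mul (continuousAt_const.mul h)).neg.cexp.continuousWithinAt.smul (S.continuousOn_PhiP_zero x t z hz)

theorem Scat.continuousOn_muP_one (x t : ℝ) :
    ContinuousOn (fun z => muP q q₀ qp 1 x t z) (Dminus ∪ contour) := fun z hz => by
  have h := (differentiableAt_theta q₀ (mem_closedDminus_iff.1 hz).1 x t).continuousAt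
  exact (continuousAt_const.mul (continuousAt_const.mul h)).neg.cexp.continuousWithinAt.smul (S.continuousOn_PhiP_one x t z hz)

theorem Scat.differentiableOn_muM_one (x t : ℝ) :
    DifferentiableOn ℂ (fun z => muM q q₀ qm 1 x t z) Dplus := fun z hz => by
  have h := differentiableAt_theta q₀ (mem_closedDplus_iff.1 (Or.inl hz)).1 x t
  exact ((h.const_mul I).const_mul (colSign 1)).neg.cexp.differentiableWithinAt.smul
    (S.differentiableOn_PhiM_one x t z hz)

theorem Scat.differentiableOn_muP_one (x t : ℝ) :
    DifferentiableOn ℂ (fun z => muP q q₀ qp 1 x t z) Dminus := fun z hz => by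
  have h := differentiableAt_theta q₀ (mem_closedDminus_iff.1 (Or.inl hz)).1 x t
  exact ((h.const_mul I).const_mul (colSign 1)).neg.cexp.differentiableWithinAt.smul
    (S.differentiableOn_PhiP_one x t z hz)

theorem Scat.continuousWithinAt_s11 {z : ℂ} (hz : z ∈ Dplus ∪ contour) (hb : z ∉ branchPts q₀) :
    ContinuousWithinAt (s11 q q₀ qm qp) (Dplus ∪ contour) z := by
  have hz0 := (mem_closedDplus_iff.1 hz).1
  exact ((continuous_Wr.continuousAt).comp_continuousWithinAt
    ((S.continuousOn_PhiP_zero 0 0 z hz).prodMk (S.continuousOn_PhiM_one 0 0 z hz))).div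
    (continuousAt_sdet q₀ hz0).continuousWithinAt (sdet_ne_zero hz0 hb)

theorem Scat.continuousWithinAt_s22 {z : ℂ} (hz : z ∈ Dminus ∪ contour) (hb : z ∉ branchPts q₀) :
    ContinuousWithinAt (s22 q q₀ qm qp) (Dminus ∪ contour) z := by
  have hz0 := (mem_closedDminus_iff.1 hz).1
  exact ((continuous_Wr.continuousAt).comp_continuousWithinAt
    ((S.continuousOn_PhiM_zero 0 0 z hz).prodMk (S.continuousOn_PhiP_one 0 0 z hz))).div
    (continuousAt_sdet q₀ hz0).continuousWithinAt (sdet_ne_zero hz0 hb)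

theorem Scat.differentiableOn_s22 : DifferentiableOn ℂ (s22 q q₀ qm qp) Dminus := fun z hz => by
  have hz0 := (mem_closedDminus_iff.1 (Or.inl hz)).1
  have h1 := fun i => (differentiableWithinAt_pi.1 (S.differentiableOn_PhiM_zero 0 0 z hz)) i
  have h2 := fun i => (differentiableWithinAt_pi.1 (S.differentiableOn_PhiP_one 0 0 z hz)) i
  have h3 : DifferentiableAt ℂ (sdet q₀) z := by
    unfold sdet; fun_prop (disch := simpa using hz0)
  exact (((h1 0).mul (h2 1)).sub ((h1 1).mul (h2 0))).div h3.differentiableWithinAt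
    (sdet_ne_zero hz0 (notMem_branchPts_of_Dminus hz))

/-- The boundary value of `M`. -/
theorem Scat.RHMplus_eq {z : ℂ} (hz : z ∈ contour) (hb : z ∉ branchPts q₀)
    (hs : s11 q q₀ qm qp z ≠ 0) (x t : ℝ) : RHMplus q q₀ qm qp x t z =
      (Matrix.of ![(s11 q q₀ qm qp z)⁻¹ • muP q q₀ qp 0 x t z, muM q q₀ qm 1 x t z])ᵀ := by
  have := nhdsWithin_Dplus_neBot hz
  refine Tendsto.limUnder_eq ?_
  have hp : z ∈ Dplus ∪ contour := Or.inr hz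
  have hmono : 𝓝[Dplus] z ≤ 𝓝[Dplus ∪ contour] z := nhdsWithin_mono _ Set.subset_union_left
  have h1 := ((S.continuousWithinAt_s11 hp hb).mono_left hmono).inv₀ hs
  have h2 := (S.continuousOn_muP_zero x t z hp).mono_left hmono
  have h3 := (S.continuousOn_muM_one x t z hp).mono_left hmono
  have h4 := h1.smul h2
  have h5 : Tendsto (fun w => (Matrix.of ![(s11 q q₀ qm qp w)⁻¹ • muP q q₀ qp 0 x t w,
      muM q q₀ qm 1 x t w])ᵀ) (𝓝[Dplus] z) (𝓝 (Matrix.of ![(s11 q q₀ qm qp z)⁻¹ •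
      muP q q₀ qp 0 x t z, muM q q₀ qm 1 x t z])ᵀ) := by
    refine tendsto_pi_nhds.2 fun i => tendsto_pi_nhds.2 fun j => ?_
    fin_cases j
    · exact tendsto_pi_nhds.1 h4 i
    · exact tendsto_pi_nhds.1 h3 i
  refine h5.congr' ?_
  filter_upwards [self_mem_nhdsWithin] with w hw
  rw [RHM, if_pos hw]

/-- Expanding μ_{+1}/s₁₁ in the columns at -∞ produces a multiple of μ_{-2} that cancels the ρρ̃
entry of J. The result agrees with `jump_diff`, so the entry of M⁺J is the difference of the
boundary values of M. -/
theorem Scat.jump_entry {z : ℂ} (hz : z ∈ contour) (hb : z ∉ branchPts q₀)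
    (hs : s11 q q₀ qm qp z ≠ 0) (x t : ℝ) :
    (RHMplus q q₀ qm qp x t z * RHJ q q₀ qm qp x t z) 0 1 =
      -(rhoT q q₀ qm qp z * exp (2 * I * theta q₀ x t z) * muM q q₀ qm 0 x t z 0) := by
  have he : exp (2 * I * theta q₀ x t z) = exp (I * theta q₀ x t z) ^ 2 := by
    rw [← Complex.exp_nat_mul]; congr 1; push_cast; ring
  have hne := Complex.exp_ne_zero (I * theta q₀ x t z)
  rw [S.RHMplus_eq hz hb hs, RHJ, muP, muM, muM, S.PhiP_zero_eq hz hb, he, colSign_zero, colSign_one]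
  simp [Matrix.mul_apply, Fin.sum_univ_two, colSign, Complex.exp_neg, rho, Matrix.diagonal]
  field_simp
  ring

theorem Scat.jump_diff {z : ℂ} (hz : z ∈ contour) (hb : z ∉ branchPts q₀)
    (hs : s22 q q₀ qm qp z ≠ 0) (x t : ℝ) :
    muM q q₀ qm 1 x t z 0 - muP q q₀ qp 1 x t z 0 / s22 q q₀ qm qp z =
      -(rhoT q q₀ qm qp z * exp (2 * I * theta q₀ x t z) * muM q q₀ qm 0 x t z 0) := by
  have he : exp (2 * I * theta q₀ x t z) = exp (I * theta q₀ x t z) ^ 2 := by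
    rw [← Complex.exp_nat_mul]; congr 1; push_cast; ring
  have hne := Complex.exp_ne_zero (I * theta q₀ x t z)
  rw [muP, muM, muM, S.PhiP_one_eq hz hb, he, colSign_zero, colSign_one]
  simp [Complex.exp_neg, rhoT]
  field_simp
  ring

end

/-! ### Integrability of the jump -/

/-- `z → ∞` along `Σ`. -/
noncomputable def infContour : Filter ℂ := Bornology.cobounded ℂ ⊓ 𝓟 contour

theorem infContour_le_plus : infContour ≤ infPlus :=
  inf_le_inf_left _ (principal_mono.2 Set.subset_union_right)

theorem infContour_le_minus : infContour ≤ infMinus :=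
  inf_le_inf_left _ (principal_mono.2 Set.subset_union_right)

/-- D is bounded near 0, is O(r⁻²) at infinity and is continuous in between, so it is dominated by a
multiple of (1 + r²)⁻¹. -/
theorem integrableOn_ray {D : ℂ → ℂ} (hc : ContinuousOn D contour)
    (h0 : Tendsto D (𝓝[contour] 0) (𝓝 0)) (hi : Tendsto (fun z => z ^ 2 * D z) infContour (𝓝 0))
    {u : ℂ} (hu : ‖u‖ = 1) (huc : ∀ r : ℝ, 0 < r → u * r ∈ contour) :
    IntegrableOn (fun r : ℝ => D (u * r)) (Set.Ioi 0) := by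
  have hcr : ContinuousOn (fun r : ℝ => D (u * r)) (Set.Ioi 0) :=
    hc.comp (by fun_prop) fun r hr => huc r hr
  have t0 : Tendsto (fun r : ℝ => u * r) (𝓝[>] 0) (𝓝[contour] 0) := by
    refine tendsto_nhdsWithin_iff.2 ⟨?_, ?_⟩
    · have : Continuous fun r : ℝ => u * (r : ℂ) := by fun_prop
      have h := this.tendsto 0
      simp only [ofReal_zero, mul_zero] at h
      exact h.mono_left nhdsWithin_le_nhds
    · filter_upwards [self_mem_nhdsWithin] with r hr using huc r hr
  have ti : Tendsto (fun r : ℝ => u * r) atTop infContour := by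
    refine tendsto_inf.2 ⟨?_, tendsto_principal.2 ?_⟩
    · rw [← tendsto_norm_atTop_iff_cobounded]
      simp only [norm_mul, hu, one_mul, Complex.norm_real]
      exact tendsto_norm_atTop_atTop
    · filter_upwards [eventually_gt_atTop 0] with r hr using huc r hr
  have e0 : ∀ᶠ r : ℝ in 𝓝[>] 0, ‖D (u * r)‖ ≤ 1 := by
    have := (h0.comp t0).norm
    rw [norm_zero] at this
    exact (this.eventually_le_const one_pos)
  have ei : ∀ᶠ r : ℝ in atTop, ‖(u * r) ^ 2 * D (u * r)‖ ≤ 1 := by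
    have := (hi.comp ti).norm
    rw [norm_zero] at this
    exact (this.eventually_le_const one_pos)
  obtain ⟨δ, hδ, h1⟩ := mem_nhdsGT_iff_exists_Ioo_subset.1 e0
  obtain ⟨R, hR⟩ := eventually_atTop.1 ei
  have hδ' : 0 < δ := hδ
  obtain ⟨K, hK⟩ := (isCompact_Icc (a := δ) (b := max R 1)).exists_bound_of_continuousOn
    (hcr.mono fun r hr => hδ'.trans_le hr.1)
  -- The three summands bound ‖D‖(1 + r²) for r large, r in the middle range and r < δ,
  -- respectively.
  have hint : Integrable fun r : ℝ => (2 + |K| * (1 + (max R 1) ^ 2) + (1 + δ ^ 2)) *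
      (1 + r ^ 2)⁻¹ := integrable_inv_one_add_sq.const_mul _
  refine hint.integrableOn.mono' (hcr.aestronglyMeasurable measurableSet_Ioi) ?_
  filter_upwards [ae_restrict_mem measurableSet_Ioi] with r hr
  have hr0 : 0 < r := hr
  have hp : 0 < 1 + r ^ 2 := by positivity
  rw [← div_eq_mul_inv, le_div_iff₀ hp]
  have hn := norm_nonneg (D (u * r))
  have hKn : 0 ≤ |K| * (1 + (max R 1) ^ 2) := by positivity
  rcases lt_or_ge r δ with h | h
  · have h2 : ‖D (u * r)‖ ≤ 1 := h1 ⟨hr0, h⟩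
    have h3 : r ^ 2 ≤ δ ^ 2 := by gcongr
    nlinarith
  · rcases le_total r (max R 1) with h' | h'
    · have h2 : ‖D (u * r)‖ ≤ |K| := (hK r ⟨h, h'⟩).trans (le_abs_self K)
      have h3 : r ^ 2 ≤ (max R 1) ^ 2 := by gcongr
      have h4 : ‖D (u * r)‖ * (1 + r ^ 2) ≤ |K| * (1 + (max R 1) ^ 2) := by gcongr
      nlinarith [sq_nonneg δ]
    · have h2 := hR r ((le_max_left _ _).trans h')
      have h3 : 1 ≤ r := (le_max_right _ _).trans h'
      rw [norm_mul, norm_pow, norm_mul, hu, one_mul, Complex.norm_real,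
        Real.norm_of_nonneg hr0.le] at h2
      have h4 : ‖D (u * r)‖ ≤ r ^ 2 * ‖D (u * r)‖ := le_mul_of_one_le_left hn (by nlinarith)
      nlinarith [sq_nonneg δ]

theorem contourIntegrable_of_tendsto {D : ℂ → ℂ} (hc : ContinuousOn D contour)
    (h0 : Tendsto D (𝓝[contour] 0) (𝓝 0)) (hi : Tendsto (fun z => z ^ 2 * D z) infContour (𝓝 0)) :
    ContourIntegrable D := by
  have key := fun (u : ℂ) hu huc => integrableOn_ray hc h0 hi (u := u) hu huc
  refine ⟨?_, ?_, key I (by simp) ?_, ?_⟩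
  · simpa using key 1 (by simp) fun r hr => by simp [contour, hr.ne']
  · simpa using key (-1) (by simp) fun r hr => by simp [contour, hr.ne']
  · exact fun r hr => by simp [contour, hr.ne']
  · simpa using key (-I) (by simp) fun r hr => by simp [contour, hr.ne']

theorem theta_zero (q₀ : ℝ) (z : ℂ) : theta q₀ 0 0 z = 0 := by simp [theta]

theorem ae_ray_congr {f g : ℂ → ℂ} {q₀ : ℝ} (h : ∀ z ∈ contour, z ∉ branchPts q₀ → f z = g z)
    {u : ℂ} (hu : u ≠ 0) (huc : ∀ r : ℝ, 0 < r → u * r ∈ contour) :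
    (fun r : ℝ => f (u * r)) =ᵐ[volume.restrict (Set.Ioi 0)] fun r : ℝ => g (u * r) := by
  have hfin : (branchPts q₀).Finite := by simp [branchPts]
  have hinj : Function.Injective fun r : ℝ => u * (r : ℂ) := fun r s h => by
    simpa [hu] using h
  have hc : ((fun r : ℝ => u * (r : ℂ)) ⁻¹' branchPts q₀).Countable :=
    (hfin.preimage hinj.injOn).countable
  filter_upwards [ae_restrict_mem measurableSet_Ioi, hc.ae_notMem _] with r hr hr2
  exact h _ (huc r hr) hr2

/-- The two branch points are negligible on the rays; this is what allows the values there, where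
`sdet` vanishes, to be ignored or redefined. -/
theorem contour_congr {f g : ℂ → ℂ} {q₀ : ℝ} (h : ∀ z ∈ contour, z ∉ branchPts q₀ → f z = g z)
    (hg : ContourIntegrable g) : ContourIntegrable f ∧ contourIntegral f = contourIntegral g := by
  have key := fun (u : ℂ) hu huc => ae_ray_congr h (u := u) hu huc
  have h1 := key 1 (by simp) fun r hr => by simp [contour, hr.ne']
  have h2 := key (-1) (by simp) fun r hr => by simp [contour, hr.ne']
  have h3 := key I (by simp) fun r hr => by simp [contour, hr.ne']
  have h4 := key (-I) (by simp) fun r hr => by simp [contour, hr.ne']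
  simp only [one_mul, neg_mul] at h1 h2 h4
  refine ⟨⟨hg.1.congr h1.symm, hg.2.1.congr h2.symm, hg.2.2.1.congr h3.symm,
    hg.2.2.2.congr h4.symm⟩, ?_⟩
  unfold contourIntegral
  rw [integral_congr_ae h1, integral_congr_ae h2, integral_congr_ae h3, integral_congr_ae h4]

section
variable {q : ℝ → ℝ → ℂ} {q₀ : ℝ} {qm qp : ℂ} {W : ℂ → ℝ → ℝ → Op} {Jm Jp : ℂ → Fin 2 → ℂ}
variable (S : Scat q q₀ qm qp W Jm Jp)
include S

theorem Scat.tendsto_muM_zero_inf (x t : ℝ) : Tendsto (fun z => muM q q₀ qm 0 x t z 0) infMinus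
    (𝓝 (exp (I * vMinus q q₀ x t))) := by
  have h := (continuous_conj.tendsto _).comp
    ((S.tendsto_muM_one_inf x t).2.comp tendsto_conj_infMinus)
  simp only [← Complex.exp_conj, map_neg, map_mul, conj_I, Complex.conj_ofReal, neg_mul,
    neg_neg] at h
  refine h.congr' ?_
  rw [infMinus, EventuallyEq, eventually_inf_principal]
  refine Eventually.of_forall fun z hz => ?_
  rw [S.muM_zero_conj hz]
  simp [conjV]

theorem Scat.exists_tendsto_muM_zero_zero (x t : ℝ) :
    ∃ l, Tendsto (fun z => muM q q₀ qm 0 x t z 0) (𝓝[Dminus ∪ contour] 0) (𝓝 l) := by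
  have hq0 : (q₀ : ℂ) ≠ 0 := by exact_mod_cast S.q₀_ne
  refine ⟨_, (((S.tendsto_muM_one_inf x t).1.comp (tendsto_hat_zero S.q₀_ne)).const_mul
    (-(I * conj qm / q₀ ^ 2))).congr' ?_⟩
  filter_upwards [self_mem_nhdsWithin] with z hz
  have hz0 := (mem_closedDminus_iff.1 hz).1
  simp only [Function.comp_apply]
  rw [S.muM_zero_hat hz]
  generalize muM q q₀ qm 1 x t (hat q₀ z) = w
  simp only [Pi.smul_apply, smul_eq_mul, hat]
  field_simp

/-- On Σ the columns μ_{+2} and μ_{-2} are both aligned with the second column of E(q(0, 0)) up to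
o(z⁻²), by the cubic rate. Their Wronskian is therefore of that order, while `sdet` tends to 1. -/
theorem Scat.tendsto_s12_inf :
    Tendsto (fun z => z ^ 2 * s12 q q₀ qm qp z) infContour (𝓝 0) := by
  obtain ⟨C, R, -, h⟩ := S.muM_one_asymptotics 0 0
  obtain ⟨C', R', -, h'⟩ := S.muP_zero_asymptotics 0 0
  obtain ⟨t1, t2⟩ := tendsto_of_diagonal_bound_aux h
  obtain ⟨t3, t4⟩ := tendsto_of_diagonal_bound_aux h'
  have hconj : Tendsto (fun z : ℂ => conj z) infContour infPlus :=
    tendsto_conj_infMinus.mono_left infContour_le_minus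
  have u1 := t1.mono_left infContour_le_plus
  have u2 := t2.mono_left infContour_le_plus
  have u3 := (continuous_conj.tendsto _).comp (t3.comp hconj)
  have u4 := (continuous_conj.tendsto _).comp (t4.comp hconj)
  have td : Tendsto (fun z : ℂ => 1 + q 0 0 * conj (q 0 0) * z⁻¹ ^ 2) infContour (𝓝 1) := by
    have := ((tendsto_inv_infPlus.pow 2).const_mul (q 0 0 * conj (q 0 0))).const_add 1
    simp only [zero_pow two_ne_zero, mul_zero, add_zero] at this
    exact this.mono_left infContour_le_plus
  have ts := (tendsto_sdet_infPlus q₀).mono_left infContour_le_plus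
  have hd := td.eventually_ne one_ne_zero
  have hs := ts.eventually_ne one_ne_zero
  have hfin := ((u3.neg.mul u2).sub (u4.mul u1)).div (td.mul ts) (by simp)
  simp only [map_zero, neg_zero, zero_mul, mul_zero, sub_zero, zero_div] at hfin
  refine hfin.congr' ?_
  have hz : ∀ᶠ z in infContour, z ∈ contour := by
    rw [infContour, eventually_inf_principal]; exact Eventually.of_forall fun z hz => hz
  filter_upwards [hz, hd, hs] with z hz hd hs
  have hz0 := hz.2
  have e : s12 q q₀ qm qp z = Wr (muP q q₀ qp 1 0 0 z) (muM q q₀ qm 1 0 0 z) / sdet q₀ z := by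
    simp [s12, muP, muM, theta_zero]
  rw [e, S.muP_one_conj (Or.inr hz)]
  simp only [Pi.div_apply, Function.comp_apply]
  rw [div_eq_iff (mul_ne_zero hd hs)]
  simp only [Wr, conjV, Pi.neg_apply, Matrix.cons_val_zero, Matrix.cons_val_one, map_mul, map_sub,
    map_pow, Complex.conj_conj, map_div₀, conj_I]
  field_simp
  ring_nf
  rw [I_sq]
  ring

/-- The involution turns the Wronskian into that of the first columns at infinity, which become
parallel. The factor z⁻² from the symmetry is harmless, since z² `sdet` = z² + q₀² has a nonzero
limit. -/
theorem Scat.tendsto_s12_zero : Tendsto (s12 q q₀ qm qp) (𝓝[contour] 0) (𝓝 0) := by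
  have hq0 : (q₀ : ℂ) ≠ 0 := by exact_mod_cast S.q₀_ne
  have hhat : Tendsto (hat q₀) (𝓝[contour] 0) infContour := by
    refine tendsto_inf.2 ⟨?_, tendsto_principal.2 ?_⟩
    · rw [← tendsto_norm_atTop_iff_cobounded]
      exact (tendsto_norm_hat S.q₀_ne).mono_left (nhdsWithin_mono _ fun z hz => hz.2)
    · filter_upwards [self_mem_nhdsWithin] with z hz using hat_mem_contour S.q₀_ne hz
  have hconj : Tendsto (fun z : ℂ => conj z) infContour infPlus :=
    tendsto_conj_infMinus.mono_left infContour_le_minus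
  obtain ⟨h1, h2⟩ := S.tendsto_muM_one_inf 0 0
  obtain ⟨h3, h4⟩ := S.tendsto_muP_zero_inf 0 0
  have u1 := (continuous_conj.tendsto _).comp ((tendsto_zero_of_mul h1).comp (hconj.comp hhat))
  have u2 := (continuous_conj.tendsto _).comp (h2.comp (hconj.comp hhat))
  have u3 := ((tendsto_zero_of_mul h3).mono_left infContour_le_plus).comp hhat
  have u4 := (h4.mono_left infContour_le_plus).comp hhat
  have ts : Tendsto (fun z : ℂ => z ^ 2 + (q₀ : ℂ) ^ 2) (𝓝[contour] 0) (𝓝 (q₀ ^ 2)) := by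
    have : Continuous fun z : ℂ => z ^ 2 + (q₀ : ℂ) ^ 2 := by fun_prop
    have h := this.tendsto 0
    simp only [zero_pow two_ne_zero, zero_add] at h
    exact h.mono_left nhdsWithin_le_nhds
  have hs := ts.eventually_ne (by simp [S.q₀_ne] : (q₀ : ℂ) ^ 2 ≠ 0)
  have hfin := (((u2.mul u3).add (u1.mul u4)).const_mul (qp * qm)).div ts (by simp [S.q₀_ne])
  simp only [map_zero, zero_mul, mul_zero, add_zero, zero_div] at hfin
  refine hfin.congr' ?_
  filter_upwards [self_mem_nhdsWithin, hs] with z hz hs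
  have hz0 := hz.2
  have e : s12 q q₀ qm qp z = Wr (muP q q₀ qp 1 0 0 z) (muM q q₀ qm 1 0 0 z) / sdet q₀ z := by
    simp [s12, muP, muM, theta_zero]
  have e2 : sdet q₀ z = (z ^ 2 + q₀ ^ 2) / z ^ 2 := by unfold sdet; field_simp
  rw [e, S.muP_one_hat (Or.inr hz), S.muM_one_hat (Or.inr hz),
    S.muM_zero_conj (Or.inr (hat_mem_contour S.q₀_ne hz)), e2]
  simp only [Pi.div_apply, Function.comp_apply, Wr, conjV, Pi.smul_apply, smul_eq_mul,
    Matrix.cons_val_zero, Matrix.cons_val_one]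
  field_simp
  ring_nf
  rw [I_sq]
  ring

/-- A version of 1/s₂₂ whose values at ± i q₀ are the assumed limits. With it f₋ is continuous up to
all of Σ, as Cauchy's theorem requires. -/
theorem Scat.exists_inv22 (hns : NoSpectralSingularity q q₀ qm qp) :
    ∃ r : ℂ → ℂ, (∀ z ∉ branchPts q₀, r z = (s22 q q₀ qm qp z)⁻¹) ∧
      ∀ z ∈ Dminus ∪ contour, (z ∉ branchPts q₀ → s22 q q₀ qm qp z ≠ 0) →
        ContinuousWithinAt r (Dminus ∪ contour) z := by
  obtain ⟨l₁, h₁⟩ := (hns.2 (I * q₀) (Or.inl rfl)).2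
  obtain ⟨l₂, h₂⟩ := (hns.2 (-(I * q₀)) (Or.inr rfl)).2
  have hne : I * (q₀ : ℂ) ≠ -(I * q₀) := fun h => by
    have h2 : I * (q₀ : ℂ) = 0 := by linear_combination h / 2
    simp [S.q₀_ne] at h2
  classical
  set r : ℂ → ℂ := fun z => if z = I * q₀ then l₁ else if z = -(I * q₀) then l₂ else
    (s22 q q₀ qm qp z)⁻¹ with hr
  have hr0 : ∀ z ∉ branchPts q₀, r z = (s22 q q₀ qm qp z)⁻¹ := fun z hz => by
    have h1 : z ≠ I * q₀ := fun h => hz (Or.inl h)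
    have h2 : z ≠ -(I * q₀) := fun h => hz (Or.inr h)
    simp [hr, h1, h2]
  refine ⟨r, hr0, fun z hz hs => ?_⟩
  by_cases hb : z ∈ branchPts q₀
  · rw [← continuousWithinAt_sdiff_self]
    rcases hb with rfl | hb
    · have e : r (I * q₀) = l₁ := by simp [hr]
      rw [ContinuousWithinAt, e]
      refine h₁.congr' ?_
      filter_upwards [self_mem_nhdsWithin, mem_nhdsWithin_of_mem_nhds (isOpen_ne.mem_nhds hne)]
        with w hw hw2
      rw [hr0 w (by rintro (h | h); exacts [hw.2 h, hw2 h]), one_div]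
    · obtain rfl : z = -(I * q₀) := hb
      have e : r (-(I * q₀)) = l₂ := by simp [hr, hne.symm]
      rw [ContinuousWithinAt, e]
      refine h₂.congr' ?_
      filter_upwards [self_mem_nhdsWithin, mem_nhdsWithin_of_mem_nhds (isOpen_ne.mem_nhds hne.symm)]
        with w hw hw2
      rw [hr0 w (by rintro (h | h); exacts [hw2 h, hw.2 h]), one_div]
  · refine ((S.continuousWithinAt_s22 hz hb).inv₀ (hs hb)).congr_of_eventuallyEq ?_ (hr0 z hb)
    have hc : IsClosed (branchPts q₀) := by
      have : (branchPts q₀).Finite := by simp [branchPts]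
      exact this.isClosed
    filter_upwards [mem_nhdsWithin_of_mem_nhds (hc.isOpen_compl.mem_nhds hb)] with w hw
    exact hr0 w hw

theorem Scat.tendsto_rhoT_inf (x t : ℝ) : Tendsto (fun z => z ^ 2 * -(rhoT q q₀ qm qp z *
    exp (2 * I * theta q₀ x t z) * muM q q₀ qm 0 x t z 0)) infContour (𝓝 0) := by
  have h1 := (S.tendsto_s12_inf.div ((S.tendsto_s22_inf x t).mono_left infContour_le_minus)
    (mul_ne_zero (Complex.exp_ne_zero _) (Complex.exp_ne_zero _))).mul
      ((S.tendsto_muM_zero_inf x t).mono_left infContour_le_minus)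
  rw [zero_div, zero_mul] at h1
  refine squeeze_zero_norm' ?_ (tendsto_zero_iff_norm_tendsto_zero.1 h1)
  rw [infContour, eventually_inf_principal]
  refine Eventually.of_forall fun z hz => le_of_eq ?_
  simp only [Pi.div_apply, norm_mul, norm_neg, norm_div, norm_exp_two_theta hz, rhoT]
  ring

theorem Scat.tendsto_rhoT_zero (x t : ℝ) : Tendsto (fun z => -(rhoT q q₀ qm qp z *
    exp (2 * I * theta q₀ x t z) * muM q q₀ qm 0 x t z 0)) (𝓝[contour] 0) (𝓝 0) := by
  obtain ⟨l, hl⟩ := S.exists_tendsto_muM_zero_zero x t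
  have hmono : 𝓝[contour] (0 : ℂ) ≤ 𝓝[Dminus ∪ contour] 0 := nhdsWithin_mono _ Set.subset_union_right
  have hq0 : (q₀ : ℂ) ≠ 0 := by exact_mod_cast S.q₀_ne
  have hqm' : conj qm ≠ 0 := by simpa using S.qm_ne
  have h22 : Tendsto (s22 q q₀ qm qp) (𝓝[contour] 0) (𝓝 (conj qm * qp / q₀ ^ 2 *
      (exp (-(I * vPlus q q₀ x t)) * exp (-(I * vMinus q q₀ x t))))) := by
    refine ((((S.tendsto_s11_inf x t).comp (tendsto_hat_zero S.q₀_ne)).const_mul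
      (conj qm * qp / q₀ ^ 2)).mono_left hmono).congr' ?_
    filter_upwards [self_mem_nhdsWithin] with z hz
    rw [S.s22_hat (Or.inr hz)]; rfl
  have h1 := (S.tendsto_s12_zero.div h22 (by simp [S.qm_ne, S.qp_ne, hq0])).mul
    (hl.mono_left hmono)
  rw [zero_div, zero_mul] at h1
  refine squeeze_zero_norm' ?_ (tendsto_zero_iff_norm_tendsto_zero.1 h1)
  filter_upwards [self_mem_nhdsWithin] with z hz
  refine le_of_eq ?_
  simp only [Pi.div_apply, norm_mul, norm_neg, norm_div, norm_exp_two_theta hz, rhoT]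
  ring

/-- Continuity is visible in the form f₊ - f₋, decay at 0 and ∞ in the form with ρ̃; the two agree
away from the branch points. -/
theorem Scat.contourIntegrable_diff (hns : NoSpectralSingularity q q₀ qm qp) {r : ℂ → ℂ}
    (hr : ∀ z ∉ branchPts q₀, r z = (s22 q q₀ qm qp z)⁻¹)
    (hrc : ∀ z ∈ Dminus ∪ contour, (z ∉ branchPts q₀ → s22 q q₀ qm qp z ≠ 0) →
        ContinuousWithinAt r (Dminus ∪ contour) z) (x t : ℝ) :
    ContourIntegrable fun z => muM q q₀ qm 1 x t z 0 - muP q q₀ qp 1 x t z 0 * r z := by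
  have heq : ∀ z ∈ contour, z ∉ branchPts q₀ →
      -(rhoT q q₀ qm qp z * exp (2 * I * theta q₀ x t z) * muM q q₀ qm 0 x t z 0) =
        muM q q₀ qm 1 x t z 0 - muP q q₀ qp 1 x t z 0 * r z := fun z hz hb => by
    rw [← S.jump_diff hz hb (hns.1 z ⟨hz, hb⟩).2, hr z hb, div_eq_mul_inv]
  have hb0 : (branchPts q₀)ᶜ ∈ 𝓝 (0 : ℂ) := by
    have : (branchPts q₀).Finite := by simp [branchPts]
    exact this.isClosed.isOpen_compl.mem_nhds (by simp [branchPts, S.q₀_ne])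
  refine contourIntegrable_of_tendsto ?_ ?_ ?_
  · intro z hz
    have h1 := continuousWithinAt_pi.1 ((S.continuousOn_muM_one x t z (Or.inr hz)).mono
      Set.subset_union_right) 0
    have h2 := continuousWithinAt_pi.1 ((S.continuousOn_muP_one x t z (Or.inr hz)).mono
      Set.subset_union_right) 0
    have h3 := (hrc z (Or.inr hz) fun hb => (hns.1 z ⟨hz, hb⟩).2).mono
      (Set.subset_union_right : contour ⊆ _)
    exact h1.sub (h2.mul h3)
  · refine (S.tendsto_rhoT_zero x t).congr' ?_
    filter_upwards [self_mem_nhdsWithin, mem_nhdsWithin_of_mem_nhds hb0] with z hz hb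
      using heq z hz hb
  · refine (S.tendsto_rhoT_inf x t).congr' ?_
    rw [infContour, EventuallyEq, eventually_inf_principal]
    filter_upwards [tendsto_norm_cobounded_atTop.eventually_gt_atTop |q₀|] with z hz hzc
    rw [heq z hzc]
    rintro (rfl | rfl) <;> simp at hz

end

/-! ### Cauchy's theorem on the four quadrants -/

/-- The closed first quadrant without the origin. -/
def quadrant : Set ℂ := {z | 0 ≤ z.re ∧ 0 ≤ z.im ∧ z ≠ 0}

theorem exp_add_mem_quadrant (x : ℝ) {y : ℝ} (hy : y ∈ Set.Icc 0 (Real.pi / 2)) :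
    exp (x + y * I) ∈ quadrant := by
  refine ⟨?_, ?_, Complex.exp_ne_zero _⟩
  · rw [Complex.exp_re]
    simp only [add_re, ofReal_re, mul_re, I_re, mul_zero, ofReal_im, I_im, mul_one, sub_self,
      add_zero, add_im, mul_im, zero_add]
    exact mul_nonneg (Real.exp_pos _).le (Real.cos_nonneg_of_mem_Icc
      ⟨by linarith [hy.1, Real.pi_pos], hy.2⟩)
  · rw [Complex.exp_im]
    simp only [add_re, ofReal_re, mul_re, I_re, mul_zero, ofReal_im, I_im, mul_one, sub_self,
      add_zero, add_im, mul_im, zero_add]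
    exact mul_nonneg (Real.exp_pos _).le (Real.sin_nonneg_of_nonneg_of_le_pi hy.1
      (by linarith [hy.2, Real.pi_pos]))

theorem norm_exp_add (x y : ℝ) : ‖exp (x + y * I)‖ = Real.exp x := by
  rw [Complex.norm_exp]; simp

/-- On an arc dz = i z dy, so only the limit of z f(z) matters. The same statement serves arcs
shrinking to 0 and arcs going to ∞. -/
theorem tendsto_arc {f : ℂ → ℂ} {l : Filter ℂ} {c : ℕ → ℝ} {a : ℂ} (hc : ContinuousOn f quadrant)
    (h : Tendsto (fun p : ℕ × ℝ => exp (c p.1 + p.2 * I)) (atTop ×ˢ 𝓟 (Set.Icc 0 (Real.pi / 2))) l)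
    (hf : Tendsto (fun z => z * f z) l (𝓝 a)) :
    Tendsto (fun n => ∫ y in (0 : ℝ)..(Real.pi / 2), exp (c n + y * I) * f (exp (c n + y * I)))
      atTop (𝓝 (Real.pi / 2 * a)) := by
  have hpi : 0 ≤ Real.pi / 2 := by positivity
  have hsub : Set.uIoc 0 (Real.pi / 2) ⊆ Set.Icc 0 (Real.pi / 2) := by
    rw [Set.uIoc_of_le hpi]; exact Set.Ioc_subset_Icc_self
  have hconst : Real.pi / 2 * a = ∫ y in (0 : ℝ)..(Real.pi / 2), a := by
    rw [intervalIntegral.integral_const]; simp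
  rw [hconst]
  have hcf := hf.comp h
  refine intervalIntegral.tendsto_integral_filter_of_dominated_convergence (fun _ => ‖a‖ + 1)
    (Eventually.of_forall fun n => ?_) ?_ (by simp) (ae_of_all _ fun y hy => ?_)
  · have : ContinuousOn (fun y : ℝ => exp (c n + y * I) * f (exp (c n + y * I)))
        (Set.Icc 0 (Real.pi / 2)) := by
      refine ContinuousOn.mul (by fun_prop) (hc.comp (by fun_prop) fun y hy =>
        exp_add_mem_quadrant _ hy)
    exact (this.mono hsub).aestronglyMeasurable measurableSet_uIoc
  · have h1 := hcf.norm.eventually_le_const (lt_add_one ‖a‖)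
    rw [eventually_prod_principal_iff] at h1
    filter_upwards [h1] with n hn
    exact ae_of_all _ fun y hy => hn y (hsub hy)
  · refine hcf.comp (Filter.Tendsto.prodMk tendsto_id (tendsto_principal.2
      (Eventually.of_forall fun _ => hsub hy)))

theorem tendsto_exp_inf : Tendsto (fun p : ℕ × ℝ => exp (((p.1 : ℝ) : ℂ) + p.2 * I))
    (atTop ×ˢ 𝓟 (Set.Icc 0 (Real.pi / 2))) (Bornology.cobounded ℂ ⊓ 𝓟 quadrant) := by
  refine tendsto_inf.2 ⟨?_, tendsto_principal.2 ?_⟩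
  · rw [← tendsto_norm_atTop_iff_cobounded]
    simp only [norm_exp_add]
    exact Real.tendsto_exp_atTop.comp (tendsto_natCast_atTop_atTop.comp tendsto_fst)
  · rw [eventually_prod_principal_iff]
    exact Eventually.of_forall fun n y hy => exp_add_mem_quadrant _ hy

theorem tendsto_exp_zero : Tendsto (fun p : ℕ × ℝ => exp (((-(p.1 : ℝ) : ℝ) : ℂ) + p.2 * I))
    (atTop ×ˢ 𝓟 (Set.Icc 0 (Real.pi / 2))) (𝓝[quadrant] 0) := by
  refine tendsto_inf.2 ⟨?_, tendsto_principal.2 ?_⟩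
  · rw [tendsto_zero_iff_norm_tendsto_zero]
    simp only [norm_exp_add]
    exact Real.tendsto_exp_neg_atTop_nhds_zero.comp (tendsto_natCast_atTop_atTop.comp tendsto_fst)
  · rw [eventually_prod_principal_iff]
    exact Eventually.of_forall fun n y hy => exp_add_mem_quadrant _ hy

theorem integral_exp_comp {g : ℝ → ℂ} (hg : ContinuousOn g (Set.Ioi 0)) (a b : ℝ) :
    ∫ x in a..b, (Real.exp x : ℂ) * g (Real.exp x) = ∫ x in (Real.exp a)..(Real.exp b), g x := by
  rw [← intervalIntegral.integral_deriv_smul_comp' (f := Real.exp) (f' := Real.exp)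
    (fun x _ => Real.hasDerivAt_exp x) Real.continuous_exp.continuousOn
    (hg.mono (by rintro _ ⟨x, -, rfl⟩; exact Real.exp_pos x))]
  simp

/-- The substitution z = e^w maps the rectangle [-n, n] × [0, π/2] onto a quarter annulus, so
Cauchy's theorem for rectangles applies to e^w f(e^w). The horizontal sides are the two rays and the
vertical sides the two arcs. -/
theorem tendsto_quadrant {f : ℂ → ℂ} {s : Set ℂ} (hs : s.Countable) {a b : ℂ}
    (hc : ContinuousOn f quadrant)
    (hd : ∀ z, 0 < z.re → 0 < z.im → z ∉ s → DifferentiableAt ℂ f z)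
    (ha : Tendsto (fun z => z * f z) (Bornology.cobounded ℂ ⊓ 𝓟 quadrant) (𝓝 a))
    (hb : Tendsto (fun z => z * f z) (𝓝[quadrant] 0) (𝓝 b)) :
    Tendsto (fun n : ℕ => (∫ x in (Real.exp (-n))..(Real.exp n), f x) -
      I * ∫ x in (Real.exp (-n))..(Real.exp n), f (I * x)) atTop (𝓝 (I * (Real.pi / 2) * (b - a))) := by
  have h1 := tendsto_arc hc tendsto_exp_inf ha
  have h2 := tendsto_arc (c := fun n : ℕ => -(n : ℝ)) hc tendsto_exp_zero hb
  have h3 := (h2.sub h1).const_mul I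
  rw [← mul_sub, ← mul_assoc] at h3
  refine h3.congr fun n => ?_
  have hpi : 0 ≤ Real.pi / 2 := by positivity
  have hnn : -(n : ℝ) ≤ n := by linarith [Nat.cast_nonneg (α := ℝ) n]
  have hsc : (exp ⁻¹' s).Countable :=
    hs.preimage_cexp
  have key := Complex.integral_boundary_rect_eq_zero_of_differentiable_on_off_countable
    (fun w => exp w * f (exp w)) (-(n : ℝ) : ℝ) ((n : ℝ) + (Real.pi / 2 : ℝ) * I) (exp ⁻¹' s) hsc
    ?_ ?_
  · simp only [ofReal_re, ofReal_im, add_re, mul_re, I_re, mul_zero, I_im, mul_one, sub_self,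
      add_zero, add_im, mul_im, zero_add, ofReal_zero, zero_mul, smul_eq_mul] at key
    have e1 : ∫ x in (-(n : ℝ))..n, exp (x : ℂ) * f (exp (x : ℂ)) =
        ∫ x in (Real.exp (-n))..(Real.exp n), f x := by
      rw [← integral_exp_comp (g := fun x : ℝ => f x)]
      · simp
      · refine hc.comp (by fun_prop) fun x hx => ?_
        have hx' : 0 < x := hx
        exact ⟨by simpa using hx'.le, by simp, by simpa using hx'.ne'⟩
    have e2 : ∫ x in (-(n : ℝ))..n, exp (x + (Real.pi / 2 : ℝ) * I) *
        f (exp (x + (Real.pi / 2 : ℝ) * I)) =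
        I * ∫ x in (Real.exp (-n))..(Real.exp n), f (I * x) := by
      rw [← integral_exp_comp (g := fun x : ℝ => f (I * x)), ← intervalIntegral.integral_const_mul]
      · refine intervalIntegral.integral_congr fun x _ => ?_
        have : exp ((x : ℂ) + (Real.pi / 2 : ℝ) * I) = I * exp x := by
          rw [Complex.exp_add]; push_cast; rw [Complex.exp_pi_div_two_mul_I]; ring
        simp only [this, ofReal_exp]; ring
      · refine hc.comp (by fun_prop) fun x hx => ?_
        have hx' : 0 < x := hx
        exact ⟨by simp, by simpa using hx'.le, by simpa using hx'.ne'⟩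
    rw [e1, e2] at key
    push_cast at key ⊢
    linear_combination -key
  · refine ContinuousOn.mul (by fun_prop) (hc.comp (by fun_prop) fun w hw => ?_)
    simp only [ofReal_re, ofReal_im, add_re, mul_re, I_re, mul_zero, I_im, mul_one, sub_self,
      add_zero, add_im, mul_im, zero_add, Set.uIcc_of_le hpi] at hw
    have := exp_add_mem_quadrant w.re hw.2
    rwa [Complex.re_add_im] at this
  · intro w hw
    simp only [ofReal_re, ofReal_im, add_re, mul_re, I_re, mul_zero, I_im, mul_one, sub_self,
      add_zero, add_im, mul_im, zero_add, min_eq_left hpi, max_eq_right hpi] at hw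
    obtain ⟨⟨-, h5, h6⟩, h7⟩ := hw
    refine differentiableAt_exp.mul ((hd _ ?_ ?_ h7).comp w differentiableAt_exp)
    · rw [Complex.exp_re]
      exact mul_pos (Real.exp_pos _) (Real.cos_pos_of_mem_Ioo ⟨by linarith [Real.pi_pos], h6⟩)
    · rw [Complex.exp_im]
      exact mul_pos (Real.exp_pos _) (Real.sin_pos_of_pos_of_lt_pi h5 (by linarith [Real.pi_pos]))

/-- The truncation matches that of the quadrants. It is needed because f₊ and f₋ need not be
integrable along the rays, where they may behave like a/z; only their difference is. -/
theorem tendsto_ray_integral {g : ℝ → ℂ} (hg : IntegrableOn g (Set.Ioi 0)) :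
    Tendsto (fun n : ℕ => ∫ x in (Real.exp (-n))..(Real.exp n), g x) atTop
      (𝓝 (∫ x in Set.Ioi 0, g x)) := by
  have hcov : AECover (volume.restrict (Set.Ioi (0 : ℝ))) atTop
      fun n : ℕ => Set.Ioc (Real.exp (-n)) (Real.exp n) := by
    refine ⟨?_, fun n => measurableSet_Ioc⟩
    filter_upwards [ae_restrict_mem measurableSet_Ioi] with x hx
    have h1 := (Real.tendsto_exp_neg_atTop_nhds_zero.comp tendsto_natCast_atTop_atTop).eventually_lt_const
      (show (0 : ℝ) < x from hx)
    have h2 := (Real.tendsto_exp_atTop.comp (tendsto_natCast_atTop_atTop (R := ℝ))).eventually_ge_atTop x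
    filter_upwards [h1, h2] with n h1 h2 using ⟨h1, h2⟩
  refine (hcov.integral_tendsto_of_countably_generated hg).congr fun n => ?_
  have hnn : Real.exp (-(n : ℝ)) ≤ Real.exp n :=
    Real.exp_le_exp.2 (by linarith [Nat.cast_nonneg (α := ℝ) n])
  rw [intervalIntegral.integral_of_le hnn, Measure.restrict_restrict measurableSet_Ioc,
    Set.inter_eq_left.2 (Set.Ioc_subset_Ioi_self.trans (Set.Ioi_subset_Ioi (Real.exp_pos _).le))]

/-- The quadrant theorem for the quadrant rotated by `u`. -/
theorem tendsto_quadrant_rotate {f : ℂ → ℂ} {s Q : Set ℂ} (hs : s.Countable) {a b u : ℂ}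
    (hu : ‖u‖ = 1) (hQ : ∀ z ∈ quadrant, u * z ∈ Q) (hc : ContinuousOn f Q)
    (hd : ∀ z, 0 < z.re → 0 < z.im → u * z ∉ s → DifferentiableAt ℂ f (u * z))
    (ha : Tendsto (fun z => z * f z) (Bornology.cobounded ℂ ⊓ 𝓟 Q) (𝓝 a))
    (hb : Tendsto (fun z => z * f z) (𝓝[Q] 0) (𝓝 b)) :
    Tendsto (fun n : ℕ => u * (∫ x in (Real.exp (-n))..(Real.exp n), f (u * x)) -
      I * (u * ∫ x in (Real.exp (-n))..(Real.exp n), f (u * (I * x)))) atTop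
        (𝓝 (I * (Real.pi / 2) * (b - a))) := by
  have hu0 : u ≠ 0 := fun h => by simp [h] at hu
  have hs' : ((fun z => u * z) ⁻¹' s).Countable := hs.preimage (mul_right_injective₀ hu0)
  have key := tendsto_quadrant (f := fun z => u * f (u * z)) hs' (a := a) (b := b)
    (continuousOn_const.mul (hc.comp (by fun_prop) hQ))
    (fun z h1 h2 h3 => ((hd z h1 h2 h3).comp z (by fun_prop)).const_mul u) ?_ ?_
  · simpa only [intervalIntegral.integral_const_mul] using key
  · have ht : Tendsto (fun z => u * z) (Bornology.cobounded ℂ ⊓ 𝓟 quadrant)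
        (Bornology.cobounded ℂ ⊓ 𝓟 Q) := by
      refine tendsto_inf.2 ⟨?_, tendsto_principal.2 ?_⟩
      · rw [← tendsto_norm_atTop_iff_cobounded]
        simp only [norm_mul, hu, one_mul]
        exact tendsto_norm_cobounded_atTop.mono_left inf_le_left
      · rw [eventually_inf_principal]; exact Eventually.of_forall hQ
    exact (ha.comp ht).congr fun z => by simp only [Function.comp_apply]; ring
  · have ht : Tendsto (fun z => u * z) (𝓝[quadrant] 0) (𝓝[Q] 0) := by
      refine tendsto_nhdsWithin_iff.2 ⟨?_, ?_⟩
      · have : Continuous fun z : ℂ => u * z := by fun_prop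
        have h := this.tendsto 0
        rw [mul_zero] at h
        exact h.mono_left nhdsWithin_le_nhds
      · filter_upwards [self_mem_nhdsWithin] with z hz using hQ z hz
    exact (hb.comp ht).congr fun z => by simp only [Function.comp_apply]; ring

/-- The integral over `Σ` of the jump of a sectionally analytic function. -/
theorem contourIntegral_jump {fp fm : ℂ → ℂ} {s : Set ℂ} (hs : s.Countable) {a b : ℂ}
    (cp : ContinuousOn fp (Dplus ∪ contour)) (cm : ContinuousOn fm (Dminus ∪ contour))
    (dp : ∀ z ∈ Dplus, z ∉ s → DifferentiableAt ℂ fp z)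
    (dm : ∀ z ∈ Dminus, z ∉ s → DifferentiableAt ℂ fm z)
    (ap : Tendsto (fun z => z * fp z) infPlus (𝓝 a))
    (am : Tendsto (fun z => z * fm z) infMinus (𝓝 a))
    (bp : Tendsto (fun z => z * fp z) (𝓝[Dplus ∪ contour] 0) (𝓝 b))
    (bm : Tendsto (fun z => z * fm z) (𝓝[Dminus ∪ contour] 0) (𝓝 b))
    (hint : ContourIntegrable fun z => fp z - fm z) :
    contourIntegral (fun z => fp z - fm z) = 2 * Real.pi * I * (b - a) := by
  have k1 := tendsto_quadrant_rotate hs (u := 1) (by simp) (fun z hz => by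
    rw [mem_closedDplus_iff, one_mul]; exact ⟨hz.2.2, mul_nonneg hz.1 hz.2.1⟩) cp
    (fun z h1 h2 h3 => dp _ (by simpa [Dplus] using mul_pos h1 h2) h3) ap bp
  have k2 := tendsto_quadrant_rotate hs (u := I) (by simp) (fun z hz => by
    rw [mem_closedDminus_iff]
    exact ⟨mul_ne_zero I_ne_zero hz.2.2, by simpa using mul_nonneg hz.2.1 hz.1⟩) cm
    (fun z h1 h2 h3 => dm _ (by simpa [Dminus] using mul_pos h2 h1) h3) am bm
  have k3 := tendsto_quadrant_rotate hs (u := -1) (by simp) (fun z hz => by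
    rw [mem_closedDplus_iff]
    exact ⟨mul_ne_zero (by simp) hz.2.2, by simpa using mul_nonneg hz.1 hz.2.1⟩) cp
    (fun z h1 h2 h3 => dp _ (by simpa [Dplus] using mul_pos h1 h2) h3) ap bp
  have k4 := tendsto_quadrant_rotate hs (u := -I) (by simp) (fun z hz => by
    rw [mem_closedDminus_iff]
    exact ⟨mul_ne_zero (by simp) hz.2.2, by simpa using mul_nonneg hz.2.1 hz.1⟩) cm
    (fun z h1 h2 h3 => dm _ (by simpa [Dminus] using mul_pos h2 h1) h3) am bm
  -- Each quadrant contributes iπ/2 · (b - a). In the sum every ray appears twice, with f₊ from one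
  -- side and f₋ from the other in opposite directions, so only the jump remains and the truncation
  -- can be removed.
  have l := ((k1.add k2).add k3).add k4
  have r := (((tendsto_ray_integral hint.1).sub (tendsto_ray_integral hint.2.1)).sub
    ((tendsto_ray_integral hint.2.2.1).const_mul I)).add
    ((tendsto_ray_integral hint.2.2.2).const_mul I)
  have e : I * (Real.pi / 2) * (b - a) + I * (Real.pi / 2) * (b - a) + I * (Real.pi / 2) * (b - a) +
      I * (Real.pi / 2) * (b - a) = 2 * Real.pi * I * (b - a) := by ring
  rw [e] at l
  refine tendsto_nhds_unique (r.congr fun n => ?_) l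
  have hsub : ∀ u : ℂ, (∀ r : ℝ, 0 < r → u * r ∈ contour) →
      ∫ x in (Real.exp (-n))..(Real.exp n), (fp (u * x) - fm (u * x)) =
      (∫ x in (Real.exp (-n))..(Real.exp n), fp (u * x)) -
        ∫ x in (Real.exp (-n))..(Real.exp n), fm (u * x) := by
    intro u hu
    have hpos : ∀ x ∈ Set.uIcc (Real.exp (-(n : ℝ))) (Real.exp n), 0 < x := fun x hx =>
      (lt_min (Real.exp_pos _) (Real.exp_pos _)).trans_le hx.1
    refine intervalIntegral.integral_sub (ContinuousOn.intervalIntegrable ?_)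
      (ContinuousOn.intervalIntegrable ?_)
    · exact cp.comp (by fun_prop) fun x hx => Or.inr (hu x (hpos x hx))
    · exact cm.comp (by fun_prop) fun x hx => Or.inr (hu x (hpos x hx))
  have m1 := hsub 1 fun r hr => by simp [contour, hr.ne']
  have m2 := hsub (-1) fun r hr => by simp [contour, hr.ne']
  have m3 := hsub I fun r hr => by simp [contour, hr.ne']
  have m4 := hsub (-I) fun r hr => by simp [contour, hr.ne']
  have hII : ∀ x : ℝ, I * (I * (x : ℂ)) = -x := fun x => by rw [← mul_assoc, I_mul_I]; ring
  simp only [one_mul, neg_mul, hII, neg_neg] at m1 m2 m3 m4 ⊢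
  rw [m1, m2, m3, m4]
  linear_combination ((∫ x in (Real.exp (-n))..(Real.exp n), fm (-(x : ℂ))) -
    ∫ x in (Real.exp (-n))..(Real.exp n), fm x) * I_sq

/-! ### Double zeros and double poles -/

/-- `f` factors as `(z - p)²` times a nonvanishing analytic function near `p`. -/
def DoubleFactor (f g : ℂ → ℂ) (p : ℂ) : Prop :=
  AnalyticAt ℂ g p ∧ g p ≠ 0 ∧ ∀ᶠ z in 𝓝 p, f z = (z - p) ^ 2 * g z

theorem analyticAt_dslope {f : ℂ → ℂ} {p : ℂ} (hf : AnalyticAt ℂ f p) :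
    AnalyticAt ℂ (dslope f p) p := by
  obtain ⟨P, hP⟩ := hf
  exact ⟨_, hP.has_fpower_series_dslope_fslope⟩

/-- Translates the derivatives of s_jj in the norming constants into the Taylor coefficients of the
nonvanishing factor. -/
theorem eventually_derivs {f g : ℂ → ℂ} {p : ℂ} (hg : AnalyticAt ℂ g p)
    (h : ∀ᶠ z in 𝓝 p, f z = (z - p) ^ 2 * g z) :
    deriv f p = 0 ∧ iteratedDeriv 2 f p = 2 * g p ∧ iteratedDeriv 3 f p = 6 * deriv g p := by
  have hga := hg.eventually_analyticAt
  have hg1 : AnalyticAt ℂ (deriv g) p := hg.deriv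
  have hg2 : AnalyticAt ℂ (deriv (deriv g)) p := hg1.deriv
  have d1 : ∀ᶠ z in 𝓝 p, deriv f z = 2 * (z - p) * g z + (z - p) ^ 2 * deriv g z := by
    filter_upwards [h.eventually_nhds, hga] with z hz hgz
    rw [EventuallyEq.deriv_eq hz]
    have e : HasDerivAt (fun z => (z - p) ^ 2) (2 * (z - p)) z := by
      simpa using ((hasDerivAt_id z).sub_const p).fun_pow 2
    exact (e.fun_mul hgz.differentiableAt.hasDerivAt).deriv
  have d2 : ∀ᶠ z in 𝓝 p, deriv (deriv f) z = 2 * g z + 4 * (z - p) * deriv g z +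
      (z - p) ^ 2 * deriv (deriv g) z := by
    filter_upwards [d1.eventually_nhds, hga, hg1.eventually_analyticAt] with z hz hgz hgz1
    rw [EventuallyEq.deriv_eq hz]
    have e : HasDerivAt (fun z => (z - p) ^ 2) (2 * (z - p)) z := by
      simpa using ((hasDerivAt_id z).sub_const p).fun_pow 2
    have e1 : HasDerivAt (fun z => 2 * (z - p)) 2 z := by
      simpa using ((hasDerivAt_id z).sub_const p).const_mul 2
    refine ((e1.fun_mul hgz.differentiableAt.hasDerivAt).fun_add
      (e.fun_mul hgz1.differentiableAt.hasDerivAt)).deriv.trans ?_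
    ring
  have d3 : deriv (deriv (deriv f)) p = 6 * deriv g p := by
    rw [EventuallyEq.deriv_eq d2]
    have e : HasDerivAt (fun z => (z - p) ^ 2) (2 * (p - p)) p := by
      simpa using ((hasDerivAt_id p).sub_const p).fun_pow 2
    have e1 : HasDerivAt (fun z => 4 * (z - p)) 4 p := by
      simpa using ((hasDerivAt_id p).sub_const p).const_mul 4
    refine (((hg.differentiableAt.hasDerivAt.const_mul 2).fun_add
      (e1.fun_mul hg1.differentiableAt.hasDerivAt)).fun_add
      (e.fun_mul hg2.differentiableAt.hasDerivAt)).deriv.trans ?_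
    ring
  refine ⟨by simpa using d1.self_of_nhds, ?_, ?_⟩
  · rw [show (2 : ℕ) = 1 + 1 from rfl, iteratedDeriv_succ, iteratedDeriv_one]
    simpa using d2.self_of_nhds
  · rw [show (3 : ℕ) = 1 + 1 + 1 from rfl, iteratedDeriv_succ, iteratedDeriv_succ, iteratedDeriv_one]
    exact d3

theorem IsDoubleZero.exists_doubleFactor {f : ℂ → ℂ} {p : ℂ} (h : IsDoubleZero f p)
    (hf : AnalyticAt ℂ f p) : ∃ g, DoubleFactor f g p := by
  have h1 := analyticAt_dslope hf
  have h2 := analyticAt_dslope h1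
  have e : ∀ z, f z = (z - p) ^ 2 * dslope (dslope f p) p z := fun z => by
    have e1 := sub_smul_dslope f p z
    have e2 := sub_smul_dslope (dslope f p) p z
    rw [dslope_same, h.2.1, sub_zero, smul_eq_mul] at e2
    rw [h.1, sub_zero, smul_eq_mul] at e1
    rw [sq, mul_assoc, e2, e1]
  refine ⟨_, h2, fun h0 => h.2.2 ?_, Eventually.of_forall e⟩
  rw [(eventually_derivs h2 (Eventually.of_forall e)).2.1, h0, mul_zero]

/-- The principal part at a double zero of the denominator. -/
theorem DoubleFactor.tendsto_sub_principal {f g N : ℂ → ℂ} {p : ℂ} (h : DoubleFactor f g p)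
    (hN : AnalyticAt ℂ N p) : ∃ l, Tendsto (fun z => N z / f z -
      (2 * N p / iteratedDeriv 2 f p / (z - p) ^ 2 +
        (2 * deriv N p / iteratedDeriv 2 f p - 2 / 3 * N p * iteratedDeriv 3 f p /
          iteratedDeriv 2 f p ^ 2) / (z - p))) (𝓝[≠] p) (𝓝 l) := by
  obtain ⟨hg, hg0, hfg⟩ := h
  obtain ⟨-, h2, h3⟩ := eventually_derivs hg hfg
  -- N/f is G/(z - p)², so the principal part is given by G(p) and G'(p), with g = f''/2 and g' =
  -- f'''/6 at p. The remainder is the second divided difference of G, which is continuous.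
  set G : ℂ → ℂ := fun z => N z / g z with hG
  have hGa : AnalyticAt ℂ G p := hN.div hg hg0
  have hGd : deriv G p = deriv N p / g p - N p * deriv g p / g p ^ 2 := by
    refine (hN.differentiableAt.hasDerivAt.fun_div hg.differentiableAt.hasDerivAt hg0).deriv.trans ?_
    field_simp
  have hc := (analyticAt_dslope (analyticAt_dslope hGa)).continuousAt
  refine ⟨_, (hc.tendsto.mono_left nhdsWithin_le_nhds).congr' ?_⟩
  filter_upwards [self_mem_nhdsWithin, mem_nhdsWithin_of_mem_nhds hfg,
    mem_nhdsWithin_of_mem_nhds (hg.continuousAt.eventually_ne hg0)] with z hz hf hgz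
  have hz0 : z - p ≠ 0 := sub_ne_zero.2 hz
  rw [dslope_of_ne _ hz, slope_def_field, dslope_same, dslope_of_ne _ hz, slope_def_field, hGd, h2,
    h3, Set.mem_ofPred_eq.mp hf]
  simp only [hG]
  field_simp
  ring

theorem DoubleFactor.congr {f f' g : ℂ → ℂ} {p : ℂ} (h : DoubleFactor f g p) (e : f' =ᶠ[𝓝 p] f) :
    DoubleFactor f' g p :=
  ⟨h.1, h.2.1, by filter_upwards [h.2.2, e] with z h1 h2; rw [h2, h1]⟩

theorem DoubleFactor.neg {f g : ℂ → ℂ} {p : ℂ} (h : DoubleFactor f g p) :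
    DoubleFactor (fun z => f (-z)) (fun z => g (-z)) (-p) := by
  have hc : Tendsto (fun z : ℂ => -z) (𝓝 (-p)) (𝓝 p) := by
    simpa using (continuous_neg.tendsto (-p))
  refine ⟨?_, by simpa using h.2.1, ?_⟩
  · exact AnalyticAt.fun_comp_of_eq h.1 analyticAt_id.neg (by simp)
  · filter_upwards [hc.eventually h.2.2] with z hz
    rw [hz]; ring

theorem DoubleFactor.conj {f g : ℂ → ℂ} {p : ℂ} (h : DoubleFactor f g p) :
    DoubleFactor (fun z => conj (f (conj z))) (fun z => conj (g (conj z))) (conj p) := by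
  have hc : Tendsto (fun z : ℂ => conj z) (𝓝 (conj p)) (𝓝 p) := by
    simpa using (continuous_conj.tendsto (conj p))
  refine ⟨?_, by simpa using h.2.1, ?_⟩
  · have h1 := h.1.eventually_analyticAt
    rw [Complex.analyticAt_iff_eventually_differentiableAt]
    filter_upwards [hc.eventually h1] with z hz
    have := hz.differentiableAt.conj_conj
    rwa [Complex.conj_conj] at this
  · filter_upwards [hc.eventually h.2.2] with z hz
    rw [hz]; simp

/-- The involution is biholomorphic off the origin, and hat z - p = (z - hat p)(-p/z) with a
nonvanishing last factor. -/
theorem DoubleFactor.hat {f g : ℂ → ℂ} {p c : ℂ} {q₀ : ℝ} (h : DoubleFactor f g p) (hc0 : c ≠ 0)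
    (hq₀ : q₀ ≠ 0) (hp : p ≠ 0) : DoubleFactor (fun z => c * f (hat q₀ z))
      (fun z => c * (-(p / z)) ^ 2 * g (DNLS.hat q₀ z)) (DNLS.hat q₀ p) := by
  have hh := hat_ne_zero hq₀ hp
  have hq : (q₀ : ℂ) ≠ 0 := by exact_mod_cast hq₀
  have hc : Tendsto (DNLS.hat q₀) (𝓝 (DNLS.hat q₀ p)) (𝓝 p) := by
    have := (differentiableAt_hat (q₀ := q₀) hh).continuousAt.tendsto
    rwa [hat_hat hq₀ hp] at this
  have hda : AnalyticAt ℂ (DNLS.hat q₀) (DNLS.hat q₀ p) := by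
    rw [Complex.analyticAt_iff_eventually_differentiableAt]
    filter_upwards [isOpen_ne.mem_nhds hh] with z hz using differentiableAt_hat hz
  refine ⟨?_, ?_, ?_⟩
  · refine (analyticAt_const.mul ((analyticAt_const.div analyticAt_id hh).neg.pow 2)).mul ?_
    exact AnalyticAt.fun_comp_of_eq h.1 hda (hat_hat hq₀ hp)
  · change c * (-(p / DNLS.hat q₀ p)) ^ 2 * g (DNLS.hat q₀ (DNLS.hat q₀ p)) ≠ 0
    rw [hat_hat hq₀ hp]
    exact mul_ne_zero (mul_ne_zero hc0 (pow_ne_zero 2 (neg_ne_zero.2 (div_ne_zero hp hh)))) h.2.1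
  · filter_upwards [hc.eventually h.2.2, isOpen_ne.mem_nhds hh] with z hz hz0
    have hz0' : z ≠ 0 := hz0
    rw [hz]
    have : DNLS.hat q₀ z - p = (z - DNLS.hat q₀ p) * (-(p / z)) := by
      unfold DNLS.hat; field_simp; ring
    rw [this]; ring

/-! ### The discrete spectrum -/

section
variable {q : ℝ → ℝ → ℂ} {q₀ : ℝ} {qm qp : ℂ} {N₁ N₂ : ℕ} {zs : Fin N₁ → ℂ} {ws : Fin N₂ → ℂ}

/-- The reflection `q₀² / z^*` of `z` in the circle of radius `q₀`. -/
noncomputable def circ (q₀ : ℝ) (z : ℂ) : ℂ := (q₀ : ℂ) ^ 2 / conj z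

theorem circ_eq (q₀ : ℝ) (z : ℂ) : circ q₀ z = conj (hat q₀ (-z)) := by
  simp [circ, hat, div_neg]

theorem circ_circ {z : ℂ} (hq₀ : q₀ ≠ 0) (hz : z ≠ 0) : circ q₀ (circ q₀ z) = z := by
  have : (q₀ : ℂ) ≠ 0 := by exact_mod_cast hq₀
  have : conj z ≠ 0 := by simpa using hz
  simp only [circ, map_div₀, map_pow, Complex.conj_ofReal, Complex.conj_conj]
  field_simp

theorem circ_eq_smul (q₀ : ℝ) (z : ℂ) : circ q₀ z = ((q₀ ^ 2 / Complex.normSq z : ℝ) : ℂ) * z := by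
  rw [circ, div_eq_mul_inv, Complex.inv_def]
  simp only [Complex.conj_conj, Complex.normSq_conj]
  push_cast; ring

theorem norm_circ (q₀ : ℝ) (z : ℂ) : ‖circ q₀ z‖ = q₀ ^ 2 / ‖z‖ := by
  rw [circ, norm_div, norm_pow, Complex.norm_conj, Complex.norm_real, Real.norm_eq_abs, sq_abs]

theorem circ_re_pos {z : ℂ} (hq₀ : q₀ ≠ 0) (hz : 0 < z.re) : 0 < (circ q₀ z).re := by
  have : z ≠ 0 := fun h => by simp [h] at hz
  have : 0 < Complex.normSq z := Complex.normSq_pos.2 this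
  rw [circ_eq_smul, Complex.re_ofReal_mul]
  positivity

theorem circ_im_pos {z : ℂ} (hq₀ : q₀ ≠ 0) (hz : 0 < z.im) : 0 < (circ q₀ z).im := by
  have : z ≠ 0 := fun h => by simp [h] at hz
  have : 0 < Complex.normSq z := Complex.normSq_pos.2 this
  rw [circ_eq_smul, Complex.im_ofReal_mul]
  positivity

theorem HasDoubleSpectrum.mem_zs (hds : HasDoubleSpectrum q q₀ qm qp zs ws) (n : Fin N₁) :
    0 < (zs n).re ∧ 0 < (zs n).im ∧ q₀ < ‖zs n‖ ∧ s11 q q₀ qm qp (zs n) = 0 := by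
  have : zs n ∈ Set.range zs := ⟨n, rfl⟩
  rwa [hds.range_zs] at this

theorem HasDoubleSpectrum.mem_ws (hds : HasDoubleSpectrum q q₀ qm qp zs ws) (n : Fin N₂) :
    0 < (ws n).re ∧ 0 < (ws n).im ∧ ‖ws n‖ = q₀ ∧ s11 q q₀ qm qp (ws n) = 0 := by
  have : ws n ∈ Set.range ws := ⟨n, rfl⟩
  rwa [hds.range_ws] at this

/-- The families are separated by the sign of the real part and by whether the modulus is above,
equal to or below q₀; within a family the given points are distinct. Distinctness ensures that each
pole carries exactly one principal part. -/
theorem HasDoubleSpectrum.eta_injective (hds : HasDoubleSpectrum q q₀ qm qp zs ws) (hq₀ : 0 < q₀) :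
    Function.Injective (eta q₀ zs ws) := by
  have hz := hds.mem_zs
  have hw := hds.mem_ws
  have hc1 : ∀ n, 0 < (circ q₀ (zs n)).re := fun n => circ_re_pos hq₀.ne' (hz n).1
  have hc2 : ∀ n, ‖circ q₀ (zs n)‖ < q₀ := fun n => by
    rw [norm_circ, div_lt_iff₀ (hq₀.trans (hz n).2.2.1), sq]
    exact mul_lt_mul_of_pos_left (hz n).2.2.1 hq₀
  have hc3 : ∀ n m, circ q₀ (zs n) = circ q₀ (zs m) → n = m := fun n m h => by
    have hne : ∀ n, zs n ≠ 0 := fun n h => by have := (hz n).1; simp [h] at this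
    have := congrArg (circ q₀) h
    rw [circ_circ hq₀.ne' (hne n), circ_circ hq₀.ne' (hne m)] at this
    exact hds.injective_zs this
  have hcd : ∀ n, (q₀ : ℂ) ^ 2 / conj (zs n) = circ q₀ (zs n) := fun n => rfl
  rintro (⟨i, n⟩ | ⟨i, n⟩) (⟨j, m⟩ | ⟨j, m⟩) h <;>
  · have hre := congrArg Complex.re h
    have hno := congrArg norm h
    fin_cases i <;> fin_cases j <;>
      simp only [eta, hcd, norm_neg, Complex.neg_re, Fin.zero_eta, Fin.mk_one, Fin.reduceFinMk,
        Matrix.cons_val_zero, Matrix.cons_val_one, Matrix.cons_val] at h hre hno <;>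
      first
      | rw [hc3 n m h]
      | rw [hc3 n m (neg_injective h)]
      | rw [hds.injective_zs h]
      | rw [hds.injective_zs (neg_injective h)]
      | rw [hds.injective_ws h]
      | rw [hds.injective_ws (neg_injective h)]
      | (exfalso; linarith [(hz n).1, (hz m).1, hc1 n, hc1 m])
      | (exfalso; linarith [(hz n).1, (hw m).1, hc1 n])
      | (exfalso; linarith [(hz m).1, (hw n).1, hc1 m])
      | (exfalso; linarith [(hw n).1, (hw m).1])
      | (exfalso; linarith [(hz n).2.2.1, (hz m).2.2.1, hc2 n, hc2 m])
      | (exfalso; linarith [(hz n).2.2.1, (hw m).2.2.1, hc2 n])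
      | (exfalso; linarith [(hz m).2.2.1, (hw n).2.2.1, hc2 m])

end

/-! ### The zeros of the scattering coefficients -/

section
variable {q : ℝ → ℝ → ℂ} {q₀ : ℝ} {qm qp : ℂ} {W : ℂ → ℝ → ℝ → Op} {Jm Jp : ℂ → Fin 2 → ℂ}
variable {N₁ N₂ : ℕ} {zs : Fin N₁ → ℂ} {ws : Fin N₂ → ℂ}
variable (S : Scat q q₀ qm qp W Jm Jp)
include S

theorem Scat.differentiableOn_s11 : DifferentiableOn ℂ (s11 q q₀ qm qp) Dplus := fun z hz => by
  have hz0 := (mem_closedDplus_iff.1 (Or.inl hz)).1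
  have h1 := fun i => (differentiableWithinAt_pi.1 (S.differentiableOn_PhiP_zero 0 0 z hz)) i
  have h2 := fun i => (differentiableWithinAt_pi.1 (S.differentiableOn_PhiM_one 0 0 z hz)) i
  have h3 : DifferentiableAt ℂ (sdet q₀) z := by
    unfold sdet; fun_prop (disch := simpa using hz0)
  exact (((h1 0).mul (h2 1)).sub ((h1 1).mul (h2 0))).div h3.differentiableWithinAt
    (sdet_ne_zero hz0 (notMem_branchPts_of_Dplus hz))

theorem Scat.scatConst_ne_zero : conj qm * qp / (q₀ : ℂ) ^ 2 ≠ 0 := by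
  have hq0 : (q₀ : ℂ) ≠ 0 := by exact_mod_cast S.q₀_ne
  exact div_ne_zero (mul_ne_zero (by simpa using S.qm_ne) S.qp_ne) (pow_ne_zero 2 hq0)

omit S in
theorem neg_mem_Dplus {z : ℂ} (hz : z ∈ Dplus) : -z ∈ Dplus := by simpa [Dplus] using hz

omit S in
theorem circ_mem_Dplus (hq₀ : q₀ ≠ 0) {z : ℂ} (hz : z ∈ Dplus) : circ q₀ z ∈ Dplus := by
  have h0 : -z ≠ 0 := neg_ne_zero.2 (mem_closedDplus_iff.1 (Or.inl hz)).1
  have := (hat_mem_Dminus_iff hq₀ h0).2 (neg_mem_Dplus hz)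
  rw [circ_eq]
  simpa [Dplus, Dminus] using this

/-- Comparing the two expressions of s₂₂, by conjugation and by the involution, at the point
-q₀²/(-z). Zeros of s₁₁ are thus symmetric in the circle |z| = q₀. -/
theorem Scat.s11_circ {z : ℂ} (hz : z ∈ Dplus) : s11 q q₀ qm qp (circ q₀ z) =
    conj (conj qm * qp / (q₀ : ℂ) ^ 2 * s11 q q₀ qm qp z) := by
  have h0 : -z ≠ 0 := neg_ne_zero.2 (mem_closedDplus_iff.1 (Or.inl hz)).1
  have hm := (hat_mem_Dminus_iff S.q₀_ne h0).2 (neg_mem_Dplus hz)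
  have h1 := S.s22_conj (Or.inl hm)
  rw [S.s22_hat (Or.inl hm), hat_hat S.q₀_ne h0, S.s11_neg (Or.inl hz), ← circ_eq] at h1
  rw [h1, Complex.conj_conj]

theorem Scat.doubleFactor_s11_neg {g : ℂ → ℂ} {p : ℂ} (hp : p ∈ Dplus)
    (h : DoubleFactor (s11 q q₀ qm qp) g p) :
    DoubleFactor (s11 q q₀ qm qp) (fun z => g (-z)) (-p) := by
  refine h.neg.congr ?_
  filter_upwards [isOpen_Dplus.mem_nhds (neg_mem_Dplus hp)] with z hz
  exact (S.s11_neg (Or.inl hz)).symm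

theorem Scat.doubleFactor_s11_circ {g : ℂ → ℂ} {p : ℂ} (hp : p ∈ Dplus)
    (h : DoubleFactor (s11 q q₀ qm qp) g p) :
    ∃ g', DoubleFactor (s11 q q₀ qm qp) g' (circ q₀ p) := by
  have h0 : -p ≠ 0 := neg_ne_zero.2 (mem_closedDplus_iff.1 (Or.inl hp)).1
  have h1 := (h.neg.hat S.scatConst_ne_zero S.q₀_ne h0).conj
  rw [← circ_eq] at h1
  refine ⟨_, h1.congr ?_⟩
  filter_upwards [isOpen_Dplus.mem_nhds (circ_mem_Dplus S.q₀_ne hp)] with z hz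
  have hz0 := (mem_closedDplus_iff.1 (Or.inl hz)).1
  have e : -hat q₀ (conj z) = circ q₀ z := by simp [hat, circ]
  rw [e, ← S.s11_circ (circ_mem_Dplus S.q₀_ne hz), circ_circ S.q₀_ne hz0]

theorem Scat.eta_spec (hds : HasDoubleSpectrum q q₀ qm qp zs ws) (n : EtaIndex N₁ N₂) :
    eta q₀ zs ws n ∈ Dplus ∧ ∃ g, DoubleFactor (s11 q q₀ qm qp) g (eta q₀ zs ws n) := by
  have han : ∀ p ∈ Dplus, AnalyticAt ℂ (s11 q q₀ qm qp) p := fun p hp =>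
    S.differentiableOn_s11.analyticAt (isOpen_Dplus.mem_nhds hp)
  have hneg : ∀ p, (p ∈ Dplus ∧ ∃ g, DoubleFactor (s11 q q₀ qm qp) g p) →
      (-p ∈ Dplus ∧ ∃ g, DoubleFactor (s11 q q₀ qm qp) g (-p)) := fun p h => by
    obtain ⟨h1, g, h2⟩ := h
    exact ⟨neg_mem_Dplus h1, _, S.doubleFactor_s11_neg h1 h2⟩
  have hz : ∀ n, zs n ∈ Dplus ∧ ∃ g, DoubleFactor (s11 q q₀ qm qp) g (zs n) := fun n => by
    have hp : zs n ∈ Dplus := mul_pos (hds.mem_zs n).1 (hds.mem_zs n).2.1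
    exact ⟨hp, (hds.double_zs n).exists_doubleFactor (han _ hp)⟩
  have hw : ∀ n, ws n ∈ Dplus ∧ ∃ g, DoubleFactor (s11 q q₀ qm qp) g (ws n) := fun n => by
    have hp : ws n ∈ Dplus := mul_pos (hds.mem_ws n).1 (hds.mem_ws n).2.1
    exact ⟨hp, (hds.double_ws n).exists_doubleFactor (han _ hp)⟩
  have hc : ∀ n, circ q₀ (zs n) ∈ Dplus ∧
      ∃ g, DoubleFactor (s11 q q₀ qm qp) g (circ q₀ (zs n)) := fun n => by
    obtain ⟨h1, g, h2⟩ := hz n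
    exact ⟨circ_mem_Dplus S.q₀_ne h1, S.doubleFactor_s11_circ h1 h2⟩
  rcases n with ⟨i, n⟩ | ⟨i, n⟩ <;> fin_cases i
  exacts [hz n, hneg _ (hz n), hc n, hneg _ (hc n), hw n, hneg _ (hw n)]

/-- Completeness of the list: z ↦ -z brings a zero to the first quadrant, and the reflection in the
circle brings it to |z| ≥ q₀, where the spectrum is given. -/
theorem Scat.exists_eta_eq (hds : HasDoubleSpectrum q q₀ qm qp zs ws) {p : ℂ} (hp : p ∈ Dplus)
    (h0 : s11 q q₀ qm qp p = 0) : ∃ n, eta q₀ zs ws n = p := by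
  have key : ∀ p : ℂ, 0 < p.re → 0 < p.im → s11 q q₀ qm qp p = 0 →
      (∃ n, zs n = p) ∨ (∃ n, circ q₀ (zs n) = p) ∨ ∃ n, ws n = p := fun p hr hi h0 => by
    have hpD : p ∈ Dplus := mul_pos hr hi
    have hp0 := (mem_closedDplus_iff.1 (Or.inl hpD)).1
    rcases lt_trichotomy q₀ ‖p‖ with h | h | h
    · left
      have : p ∈ Set.range zs := by rw [hds.range_zs]; exact ⟨hr, hi, h, h0⟩
      exact this
    · right; right
      have : p ∈ Set.range ws := by rw [hds.range_ws]; exact ⟨hr, hi, h.symm, h0⟩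
      exact this
    · right; left
      have : circ q₀ p ∈ Set.range zs := by
        rw [hds.range_zs]
        refine ⟨circ_re_pos S.q₀_ne hr, circ_im_pos S.q₀_ne hi, ?_, ?_⟩
        · rw [norm_circ, lt_div_iff₀ (norm_pos_iff.2 hp0), sq]
          exact mul_lt_mul_of_pos_left h S.bc.q₀_pos
        · rw [S.s11_circ hpD, h0]; simp
      obtain ⟨n, hn⟩ := this
      exact ⟨n, by rw [hn, circ_circ S.q₀_ne hp0]⟩
  have key2 : ∀ p : ℂ, 0 < p.re → 0 < p.im → s11 q q₀ qm qp p = 0 →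
      (∃ n, eta q₀ zs ws n = p) ∧ ∃ n, eta q₀ zs ws n = -p := fun p hr hi h0 => by
    rcases key p hr hi h0 with ⟨n, rfl⟩ | ⟨n, rfl⟩ | ⟨n, rfl⟩
    · exact ⟨⟨Sum.inl (0, n), rfl⟩, ⟨Sum.inl (1, n), rfl⟩⟩
    · exact ⟨⟨Sum.inl (2, n), rfl⟩, ⟨Sum.inl (3, n), rfl⟩⟩
    · exact ⟨⟨Sum.inr (0, n), rfl⟩, ⟨Sum.inr (1, n), rfl⟩⟩
  have hp' : 0 < p.re * p.im := hp
  rcases mul_pos_iff.1 hp' with h | h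
  · exact (key2 p h.1 h.2 h0).1
  · simpa using (key2 (-p) (by simpa using h.1) (by simpa using h.2)
      (by rw [S.s11_neg (Or.inl hp), h0])).2

theorem Scat.etaHat_mem (hds : HasDoubleSpectrum q q₀ qm qp zs ws) (n : EtaIndex N₁ N₂) :
    etaHat q₀ zs ws n ∈ Dminus := by
  have h := (S.eta_spec hds n).1
  exact (hat_mem_Dminus_iff S.q₀_ne (mem_closedDplus_iff.1 (Or.inl h)).1).2 h

theorem Scat.doubleFactor_s22 (hds : HasDoubleSpectrum q q₀ qm qp zs ws) (n : EtaIndex N₁ N₂) :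
    ∃ g, DoubleFactor (s22 q q₀ qm qp) g (etaHat q₀ zs ws n) := by
  obtain ⟨h, g, hg⟩ := S.eta_spec hds n
  have h0 := (mem_closedDplus_iff.1 (Or.inl h)).1
  refine ⟨_, (hg.hat S.scatConst_ne_zero S.q₀_ne h0).congr ?_⟩
  filter_upwards [isOpen_Dminus.mem_nhds ((hat_mem_Dminus_iff S.q₀_ne h0).2 h)] with z hz
  exact S.s22_hat (Or.inl hz)

theorem Scat.etaHat_injective (hds : HasDoubleSpectrum q q₀ qm qp zs ws) :
    Function.Injective (etaHat q₀ zs ws) := fun n m h => by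
  have h0 := fun n => (mem_closedDplus_iff.1 (Or.inl (S.eta_spec hds n).1)).1
  have h1 : hat q₀ (hat q₀ (eta q₀ zs ws n)) = hat q₀ (hat q₀ (eta q₀ zs ws m)) :=
    congrArg (hat q₀) h
  rw [hat_hat S.q₀_ne (h0 n), hat_hat S.q₀_ne (h0 m)] at h1
  exact hds.eta_injective S.bc.q₀_pos h1

theorem Scat.exists_etaHat_eq (hds : HasDoubleSpectrum q q₀ qm qp zs ws) {p : ℂ} (hp : p ∈ Dminus)
    (h0 : s22 q q₀ qm qp p = 0) : ∃ n, etaHat q₀ zs ws n = p := by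
  have hp0 := (mem_closedDminus_iff.1 (Or.inl hp)).1
  rw [S.s22_hat (Or.inl hp), mul_eq_zero, or_iff_right S.scatConst_ne_zero] at h0
  obtain ⟨n, hn⟩ := S.exists_eta_eq hds ((hat_mem_Dplus_iff S.q₀_ne hp0).2 hp) h0
  refine ⟨n, ?_⟩
  change hat q₀ (eta q₀ zs ws n) = p
  rw [hn, hat_hat S.q₀_ne hp0]

end

/-! ### Norming constants -/

theorem propCoeff_spec {u v : ℝ → ℝ → Fin 2 → ℂ} (h : ∃ c : ℂ, ∀ x t, u x t = c • v x t)
    (x t : ℝ) : u x t = propCoeff u v • v x t := by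
  rw [propCoeff, dif_pos h]
  exact h.choose_spec x t

theorem notMem_Dplus_of_Dminus {z : ℂ} (hz : z ∈ Dminus) : z ∉ Dplus := fun h =>
  lt_asymm (show z.re * z.im < 0 from hz) h

section
variable {q : ℝ → ℝ → ℂ} {q₀ : ℝ} {qm qp : ℂ} {W : ℂ → ℝ → ℝ → Op} {Jm Jp : ℂ → Fin 2 → ℂ}
variable (S : Scat q q₀ qm qp W Jm Jp)
include S

theorem Scat.PhiM_one_ne_zero {z : ℂ} (hz : z ∈ Dplus ∪ contour) : PhiM q q₀ qm 1 0 0 z ≠ 0 := by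
  rw [S.PhiM_one hz, S.flow.zero]
  intro h
  have h1 := (S.jostM z hz 0).2
  have h0 : Jm z = 0 := h
  simp only [h0, map_zero, smul_zero] at h1
  exact Ecol_ne_zero qm z 1 (tendsto_nhds_unique h1 tendsto_const_nhds)

theorem Scat.PhiP_zero_ne_zero {z : ℂ} (hz : z ∈ Dplus ∪ contour) :
    PhiP q q₀ qp 0 0 0 z ≠ 0 := by
  rw [S.PhiP_zero hz, S.flow.zero]
  intro h
  have h1 := (S.jostP z hz 0).2
  have h0 : Jp z = 0 := h
  simp only [h0, map_zero, smul_zero] at h1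
  exact Ecol_ne_zero qp z 0 (tendsto_nhds_unique h1 tendsto_const_nhds)

theorem Scat.PhiM_zero_ne_zero {z : ℂ} (hz : z ∈ Dminus ∪ contour) :
    PhiM q q₀ qm 0 0 0 z ≠ 0 := by
  rw [S.PhiM_zero_hat hz]
  exact smul_ne_zero (div_ne_zero (mul_ne_zero I_ne_zero (by simpa using S.qm_ne))
    (mem_closedDminus_iff.1 hz).1) (S.PhiM_one_ne_zero (hat_mem_closedDplus S.q₀_ne hz))

theorem Scat.PhiP_one_ne_zero {z : ℂ} (hz : z ∈ Dminus ∪ contour) :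
    PhiP q q₀ qp 1 0 0 z ≠ 0 := by
  rw [S.PhiP_one_hat hz]
  exact smul_ne_zero (div_ne_zero (mul_ne_zero I_ne_zero S.qp_ne)
    (mem_closedDminus_iff.1 hz).1) (S.PhiP_zero_ne_zero (hat_mem_closedDplus S.q₀_ne hz))

/-- A zero of s₂₂ is a zero of the Wronskian, which makes the two columns proportional at the
origin; applying W gives the same constant for every (x, t). -/
theorem Scat.coeffb_spec {p : ℂ} (hp : p ∈ Dminus) (h0 : s22 q q₀ qm qp p = 0) (x t : ℝ) :
    PhiP q q₀ qp 1 x t p = coeffb q q₀ qm qp p • PhiM q q₀ qm 0 x t p := by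
  have hs := sdet_ne_zero (q₀ := q₀) (mem_closedDminus_iff.1 (Or.inl hp)).1 (notMem_branchPts_of_Dminus hp)
  rw [s22, div_eq_zero_iff, or_iff_left hs, Wr_swap, neg_eq_zero] at h0
  obtain ⟨c, hc⟩ := exists_smul_eq_of_Wr_eq_zero (S.PhiM_zero_ne_zero (Or.inl hp)) h0
  rw [coeffb, if_neg (notMem_Dplus_of_Dminus hp)]
  refine propCoeff_spec (u := fun x t => PhiP q q₀ qp 1 x t p)
    (v := fun x t => PhiM q q₀ qm 0 x t p) ⟨c, fun x t => ?_⟩ x t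
  rw [S.PhiP_one (Or.inl hp), S.PhiM_zero (Or.inl hp), hc, map_smul]

theorem Scat.coeffb_ne_zero {p : ℂ} (hp : p ∈ Dminus) (h0 : s22 q q₀ qm qp p = 0) :
    coeffb q q₀ qm qp p ≠ 0 := fun h => by
  have := S.coeffb_spec hp h0 0 0
  rw [h, zero_smul] at this
  exact S.PhiP_one_ne_zero (Or.inl hp) this

theorem Scat.differentiableAt_PhiM_zero {p : ℂ} (hp : p ∈ Dminus) (x t : ℝ) :
    DifferentiableAt ℂ (PhiM q q₀ qm 0 x t) p :=
  (S.differentiableOn_PhiM_zero x t).differentiableAt (isOpen_Dminus.mem_nhds hp)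

theorem Scat.differentiableAt_PhiP_one {p : ℂ} (hp : p ∈ Dminus) (x t : ℝ) :
    DifferentiableAt ℂ (PhiP q q₀ qp 1 x t) p :=
  (S.differentiableOn_PhiP_one x t).differentiableAt (isOpen_Dminus.mem_nhds hp)

/-- Differentiating the Wronskian at a double zero shows that Φ_{+2}' - bΦ_{-1}' is parallel to
Φ_{-1} at the origin. Elsewhere the terms with ∂_zW cancel because Φ_{+2} = bΦ_{-1} at p, so the
constant again does not depend on x and t. -/
theorem Scat.coeffd_spec {p : ℂ} (hp : p ∈ Dminus) (h0 : s22 q q₀ qm qp p = 0)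
    (h1 : deriv (s22 q q₀ qm qp) p = 0) (x t : ℝ) :
    deriv (PhiP q q₀ qp 1 x t) p - coeffb q q₀ qm qp p • deriv (PhiM q q₀ qm 0 x t) p =
      coeffd q q₀ qm qp p • PhiM q q₀ qm 0 x t p := by
  have hp0 := (mem_closedDminus_iff.1 (Or.inl hp)).1
  set b := coeffb q q₀ qm qp p with hb
  have hM := (S.differentiableAt_PhiM_zero hp 0 0).hasDerivAt
  have hP := (S.differentiableAt_PhiP_one hp 0 0).hasDerivAt
  have hbb := S.coeffb_spec hp h0 0 0
  rw [← hb] at hbb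
  set M' := deriv (PhiM q q₀ qm 0 0 0) p
  set P' := deriv (PhiP q q₀ qp 1 0 0) p
  have hW : Wr (P' - b • M') (PhiM q q₀ qm 0 0 0 p) = 0 := by
    have e : (fun z => Wr (PhiM q q₀ qm 0 0 0 z) (PhiP q q₀ qp 1 0 0 z)) =ᶠ[𝓝 p]
        fun z => s22 q q₀ qm qp z * sdet q₀ z := by
      filter_upwards [isOpen_Dminus.mem_nhds hp] with z hz
      rw [s22, div_mul_cancel₀ _ (sdet_ne_zero (mem_closedDminus_iff.1 (Or.inl hz)).1
        (notMem_branchPts_of_Dminus hz))]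
    have hd : DifferentiableAt ℂ (sdet q₀) p := by
      unfold sdet; fun_prop (disch := simpa using hp0)
    have hs := (S.differentiableOn_s22.differentiableAt (isOpen_Dminus.mem_nhds hp)).hasDerivAt
    have l1 := (hs.fun_mul hd.hasDerivAt).congr_of_eventuallyEq e
    rw [h0, h1] at l1
    have m := hasDerivAt_pi.1 hM
    have n := hasDerivAt_pi.1 hP
    have l2 := ((m 0).fun_mul (n 1)).fun_sub ((m 1).fun_mul (n 0))
    have l3 := l1.unique l2
    have b0 := congrFun hbb 0
    have b1 := congrFun hbb 1
    simp only [Pi.smul_apply, smul_eq_mul] at b0 b1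
    rw [b0, b1] at l3
    simp only [Wr, Pi.sub_apply, Pi.smul_apply, smul_eq_mul]
    linear_combination l3
  obtain ⟨c, hc⟩ := exists_smul_eq_of_Wr_eq_zero (S.PhiM_zero_ne_zero (Or.inl hp)) hW
  rw [coeffd, if_neg (notMem_Dplus_of_Dminus hp)]
  refine propCoeff_spec (u := fun x t => deriv (PhiP q q₀ qp 1 x t) p -
    coeffb q q₀ qm qp p • deriv (PhiM q q₀ qm 0 x t) p)
    (v := fun x t => PhiM q q₀ qm 0 x t p) ⟨c, fun x t => ?_⟩ x t
  have hV : HasDerivAt (fun z => W (kz q₀ z) x t) (deriv (fun z => W (kz q₀ z) x t) p) p :=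
    DifferentiableAt.hasDerivAt ((S.flow.diff x t (kz q₀ p)).comp p (differentiableAt_kz q₀ hp0))
  have eP : PhiP q q₀ qp 1 x t =ᶠ[𝓝 p] fun z => W (kz q₀ z) x t (PhiP q q₀ qp 1 0 0 z) := by
    filter_upwards [isOpen_Dminus.mem_nhds hp] with z hz using S.PhiP_one (Or.inl hz) x t
  have eM : PhiM q q₀ qm 0 x t =ᶠ[𝓝 p] fun z => W (kz q₀ z) x t (PhiM q q₀ qm 0 0 0 z) := by
    filter_upwards [isOpen_Dminus.mem_nhds hp] with z hz using S.PhiM_zero (Or.inl hz) x t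
  rw [eP.deriv_eq, eM.deriv_eq, (hV.clm_apply hP).deriv, (hV.clm_apply hM).deriv, hbb,
    S.PhiM_zero (Or.inl hp) x t, ← map_smul (W (kz q₀ p) x t) c, ← hc, map_sub, map_smul, map_smul,
    smul_add]
  abel

/-- The principal part of `μ_{+12} / s₂₂` at a double zero of `s₂₂`. -/
theorem Scat.tendsto_sub_principal {g : ℂ → ℂ} {p : ℂ} (hp : p ∈ Dminus)
    (h : DoubleFactor (s22 q q₀ qm qp) g p) (x t : ℝ) : ∃ l, Tendsto (fun z =>
      muP q q₀ qp 1 x t z 0 / s22 q q₀ qm qp z -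
        (coeffA q q₀ qm qp p * exp (2 * I * theta q₀ x t p) * muM q q₀ qm 0 x t p 0 / (z - p) ^ 2 +
          coeffA q q₀ qm qp p * exp (2 * I * theta q₀ x t p) *
            (Dhat q q₀ qm qp x t p * muM q q₀ qm 0 x t p 0 +
              deriv (fun z => muM q q₀ qm 0 x t z 0) p) / (z - p))) (𝓝[≠] p) (𝓝 l) := by
  have hp0 := (mem_closedDminus_iff.1 (Or.inl hp)).1
  have hnh := isOpen_Dminus.mem_nhds hp
  have h0 : s22 q q₀ qm qp p = 0 := by simpa using h.2.2.self_of_nhds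
  obtain ⟨h1, h2, -⟩ := eventually_derivs h.1 h.2.2
  have h2' : iteratedDeriv 2 (s22 q q₀ qm qp) p ≠ 0 := by
    rw [h2]; exact mul_ne_zero two_ne_zero h.2.1
  have hb := S.coeffb_spec hp h0 x t
  have hd := S.coeffd_spec hp h0 h1 x t
  have hb0 := S.coeffb_ne_zero hp h0
  have hN : AnalyticAt ℂ (fun z => muP q q₀ qp 1 x t z 0) p :=
    (differentiableOn_pi.1 (S.differentiableOn_muP_one x t) 0).analyticAt hnh
  obtain ⟨l, hl⟩ := h.tendsto_sub_principal hN
  have hth := (differentiableAt_theta q₀ hp0 x t).hasDerivAt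
  have hM := hasDerivAt_pi.1 (S.differentiableAt_PhiM_zero hp x t).hasDerivAt 0
  have hP := hasDerivAt_pi.1 (S.differentiableAt_PhiP_one hp x t).hasDerivAt 0
  -- The normalized columns carry the opposite exponentials e^{iθ} and e^{-iθ}. Their logarithmic
  -- derivatives differ by 2iθ', which is the extra term in D̂_n.
  have ePm : (fun z => muP q q₀ qp 1 x t z 0) =
      fun z => exp (I * theta q₀ x t z) * PhiP q q₀ qp 1 x t z 0 := by
    ext z; simp [muP, colSign_one]
  have eMm : (fun z => muM q q₀ qm 0 x t z 0) =
      fun z => exp (-(I * theta q₀ x t z)) * PhiM q q₀ qm 0 x t z 0 := by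
    ext z; simp [muM, colSign_zero]
  have dP := ((hth.const_mul I).cexp.fun_mul hP).deriv
  have dM := ((hth.const_mul I).fun_neg.cexp.fun_mul hM).deriv
  rw [← ePm] at dP
  rw [← eMm] at dM
  have b0 := congrFun hb 0
  have d0 := congrFun hd 0
  simp only [Pi.smul_apply, Pi.sub_apply, smul_eq_mul] at b0 d0
  have d0' := sub_eq_iff_eq_add.1 d0
  have e2 : exp (2 * I * theta q₀ x t p) = exp (I * theta q₀ x t p) ^ 2 := by
    rw [← Complex.exp_nat_mul]; congr 1; push_cast; ring
  have vP : muP q q₀ qp 1 x t p 0 = _ := congrFun ePm p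
  have vM : muM q q₀ qm 0 x t p 0 = _ := congrFun eMm p
  have hE := Complex.exp_ne_zero (I * theta q₀ x t p)
  refine ⟨l, hl.congr fun z => ?_⟩
  congr 2
  · rw [vP, vM, b0, coeffA, if_neg (notMem_Dplus_of_Dminus hp), e2, Complex.exp_neg]
    field_simp
  · rw [dP, dM, vP, vM, d0', b0, coeffA, Dhat, coeffB, if_neg (notMem_Dplus_of_Dminus hp),
      if_neg (notMem_Dplus_of_Dminus hp), e2, Complex.exp_neg]
    field_simp
    ring

end

/-! ### Removal of the poles -/

section
variable {ι : Type*} [Fintype ι] {p a c : ι → ℂ}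

/-- The sum of the principal parts `a_n / (z - p_n)² + c_n / (z - p_n)`. -/
noncomputable def polePart (p a c : ι → ℂ) (z : ℂ) : ℂ :=
  ∑ n, (a n / (z - p n) ^ 2 + c n / (z - p n))

theorem differentiableAt_polePart {z : ℂ} (hz : ∀ n, z ≠ p n) :
    DifferentiableAt ℂ (polePart p a c) z := by
  have : ∀ n, z - p n ≠ 0 := fun n => sub_ne_zero.2 (hz n)
  have h2 : ∀ n, (z - p n) ^ 2 ≠ 0 := fun n => pow_ne_zero 2 (this n)
  unfold polePart
  fun_prop (disch := simp [this])

/-- At infinity only the residues contribute; together with the vanishing at 0, this is how α^T γ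
enters the formula. -/
theorem tendsto_mul_polePart_cobounded :
    Tendsto (fun z => z * polePart p a c z) (Bornology.cobounded ℂ) (𝓝 (∑ n, c n)) := by
  simp only [polePart, Finset.mul_sum]
  refine tendsto_finsetSum _ fun n _ => ?_
  have h0 : Tendsto (fun z => (z - p n)⁻¹) (Bornology.cobounded ℂ) (𝓝 0) := by
    refine tendsto_inv₀_cobounded.comp ?_
    rw [← tendsto_norm_atTop_iff_cobounded]
    refine tendsto_atTop_mono (fun z => norm_sub_norm_le z (p n)) ?_
    exact tendsto_atTop_add_const_right _ _ tendsto_norm_cobounded_atTop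
  have h1 := ((h0.const_mul (p n)).const_add 1).mul ((h0.const_mul (a n)).add_const (c n))
  rw [mul_zero, mul_zero, add_zero, zero_add, one_mul] at h1
  refine h1.congr' ?_
  filter_upwards [tendsto_norm_cobounded_atTop.eventually_gt_atTop ‖p n‖] with z hz
  have : z - p n ≠ 0 := sub_ne_zero.2 fun h => by rw [h] at hz; exact lt_irrefl _ hz
  field_simp
  ring

theorem tendsto_mul_polePart_zero (h0 : ∀ n, p n ≠ 0) :
    Tendsto (fun z => z * polePart p a c z) (𝓝 0) (𝓝 0) := by
  have h := (differentiableAt_polePart (a := a) (c := c) fun n => (h0 n).symm).continuousAt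
  simpa using tendsto_id.mul h.tendsto

/-- The difference of a function and its principal parts has a limit at each pole. -/
theorem tendsto_sub_polePart (hinj : Function.Injective p) {f : ℂ → ℂ} {n : ι} {l : ℂ}
    (h : Tendsto (fun z => f z - (a n / (z - p n) ^ 2 + c n / (z - p n))) (𝓝[≠] (p n)) (𝓝 l)) :
    ∃ l', Tendsto (fun z => f z - polePart p a c z) (𝓝[≠] (p n)) (𝓝 l') := by
  classical
  have hd : DifferentiableAt ℂ (fun z => ∑ m ∈ Finset.univ.erase n,
      (a m / (z - p m) ^ 2 + c m / (z - p m))) (p n) := by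
    refine DifferentiableAt.fun_sum fun m hm => ?_
    have : p n - p m ≠ 0 := sub_ne_zero.2 fun e => (Finset.ne_of_mem_erase hm) (hinj e).symm
    have h2 : (p n - p m) ^ 2 ≠ 0 := pow_ne_zero 2 this
    fun_prop (disch := assumption)
  refine ⟨_, (h.sub (hd.continuousAt.tendsto.mono_left nhdsWithin_le_nhds)).congr fun z => ?_⟩
  rw [polePart, ← Finset.add_sum_erase _ _ (Finset.mem_univ n), sub_sub]

end

open Classical in
/-- `F` with the values on `s` replaced by the limits of `F`. -/
noncomputable def removeOn (s : Set ℂ) (F : ℂ → ℂ) (z : ℂ) : ℂ :=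
  if z ∈ s then limUnder (𝓝[≠] z) F else F z

theorem removeOn_eventuallyEq {s : Set ℂ} (hs : s.Finite) (F : ℂ → ℂ) {z : ℂ} (hz : z ∉ s) :
    removeOn s F =ᶠ[𝓝 z] F := by
  filter_upwards [hs.isClosed.isOpen_compl.mem_nhds hz] with w hw using if_neg hw

/-- Continuity at the removed points is enough, since Cauchy's theorem above tolerates countably
many points without differentiability. -/
theorem continuousAt_removeOn {s : Set ℂ} (hs : s.Finite) {F : ℂ → ℂ} {z l : ℂ} (hz : z ∈ s)
    (h : Tendsto F (𝓝[≠] z) (𝓝 l)) : ContinuousAt (removeOn s F) z := by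
  rw [← continuousWithinAt_compl_self, ContinuousWithinAt]
  have e : removeOn s F z = l := by rw [removeOn, if_pos hz, h.limUnder_eq]
  rw [e]
  refine h.congr' ?_
  have h1 : (s \ {z})ᶜ ∈ 𝓝 z := (hs.sdiff).isClosed.isOpen_compl.mem_nhds (by simp)
  filter_upwards [mem_nhdsWithin_of_mem_nhds h1, self_mem_nhdsWithin] with w hw hne
  rw [removeOn, if_neg fun hws => hw ⟨hws, hne⟩]

/-! ### The reconstruction formula -/

section
variable {q : ℝ → ℝ → ℂ} {q₀ : ℝ} {qm qp : ℂ} {W : ℂ → ℝ → ℝ → Op} {Jm Jp : ℂ → Fin 2 → ℂ}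
variable {N₁ N₂ : ℕ} {zs : Fin N₁ → ℂ} {ws : Fin N₂ → ℂ}
variable (S : Scat q q₀ qm qp W Jm Jp)
include S

theorem Scat.s22_ne_zero (hns : NoSpectralSingularity q q₀ qm qp)
    (hds : HasDoubleSpectrum q q₀ qm qp zs ws) {z : ℂ} (hz : z ∈ Dminus ∪ contour)
    (hb : z ∉ branchPts q₀) (hr : z ∉ Set.range (etaHat q₀ zs ws)) : s22 q q₀ qm qp z ≠ 0 := by
  rcases hz with hz | hz
  · exact fun h => hr (S.exists_etaHat_eq hds hz h)
  · exact (hns.1 z ⟨hz, hb⟩).2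

/-- The integral of the jump, in terms of the residues. -/
theorem Scat.contourIntegral_diff (hns : NoSpectralSingularity q q₀ qm qp)
    (hds : HasDoubleSpectrum q q₀ qm qp zs ws) {r : ℂ → ℂ}
    (hr : ∀ z ∉ branchPts q₀, r z = (s22 q q₀ qm qp z)⁻¹)
    (hrc : ∀ z ∈ Dminus ∪ contour, (z ∉ branchPts q₀ → s22 q q₀ qm qp z ≠ 0) →
        ContinuousWithinAt r (Dminus ∪ contour) z) (x t : ℝ) :
    contourIntegral (fun z => muM q q₀ qm 1 x t z 0 - muP q q₀ qp 1 x t z 0 * r z) =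
      2 * Real.pi * I * (I * qm * exp (I * vMinus q q₀ x t) -
        (I * q x t * exp (-(I * vMinus q q₀ x t)) -
          alphaVec q q₀ qm qp zs ws x t ⬝ᵥ gammaVec q q₀ qm zs ws x t)) := by
  set p := etaHat q₀ zs ws with hp
  set e : EtaIndex N₁ N₂ → ℂ := fun n => coeffA q q₀ qm qp (p n) * exp (2 * I * theta q₀ x t (p n))
  set a : EtaIndex N₁ N₂ → ℂ := fun n => e n * muM q q₀ qm 0 x t (p n) 0 with ha
  set c : EtaIndex N₁ N₂ → ℂ := fun n => e n * (Dhat q q₀ qm qp x t (p n) *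
    muM q q₀ qm 0 x t (p n) 0 + deriv (fun z => muM q q₀ qm 0 x t z 0) (p n)) with hc
  have hsum : alphaVec q q₀ qm qp zs ws x t ⬝ᵥ gammaVec q q₀ qm zs ws x t = ∑ n, c n := by
    rw [dotProduct, Fintype.sum_sum_type, ← Finset.sum_add_distrib]
    refine Finset.sum_congr rfl fun n _ => ?_
    simp only [alphaVec, gammaVec, Sum.elim_inl, Sum.elim_inr, hc, e, ← hp]
    ring
  have hpm : ∀ n, p n ∈ Dminus := S.etaHat_mem hds
  have hp0 : ∀ n, p n ≠ 0 := fun n => (mem_closedDminus_iff.1 (Or.inl (hpm n))).1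
  have hinj : Function.Injective p := S.etaHat_injective hds
  have hfin : (Set.range p).Finite := Set.finite_range p
  have hpl : ∀ z ∈ Dplus ∪ contour, ∀ n, z ≠ p n := fun z hz n h => by
    have h1 := (mem_closedDplus_iff.1 hz).2
    have h2 : (p n).re * (p n).im < 0 := hpm n
    rw [h] at h1; linarith
  -- The same rational function is subtracted on both sides of Σ, so the jump is unchanged. It is
  -- regular on the closure of D⁺, because all poles lie in D⁻.
  set F : ℂ → ℂ := fun z => muP q q₀ qp 1 x t z 0 * r z - polePart p a c z with hF
  set fp : ℂ → ℂ := fun z => muM q q₀ qm 1 x t z 0 - polePart p a c z with hfp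
  set fm : ℂ → ℂ := removeOn (Set.range p) F with hfm
  have hpole : ∀ n, ∃ l, Tendsto F (𝓝[≠] (p n)) (𝓝 l) := fun n => by
    obtain ⟨g, hg⟩ := S.doubleFactor_s22 hds n
    obtain ⟨l, hl⟩ := S.tendsto_sub_principal (hpm n) hg x t
    obtain ⟨l', hl'⟩ := tendsto_sub_polePart (a := a) (c := c) hinj hl
    refine ⟨l', hl'.congr' ?_⟩
    filter_upwards [mem_nhdsWithin_of_mem_nhds (isOpen_Dminus.mem_nhds (hpm n))] with z hz
    simp only [hF]
    rw [hr z (notMem_branchPts_of_Dminus hz), div_eq_mul_inv]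
  have hrange : ∀ {z}, z ∉ Set.range p → ∀ n, z ≠ p n := fun hz n h => hz ⟨n, h.symm⟩
  have hoff : ∀ z ∈ contour, fp z - fm z =
      muM q q₀ qm 1 x t z 0 - muP q q₀ qp 1 x t z 0 * r z := fun z hz => by
    have : z ∉ Set.range p := fun ⟨n, hn⟩ => hpl z (Or.inr hz) n hn.symm
    simp only [hfp, hfm, hF, removeOn, if_neg this]
    ring
  have hcongr := contour_congr (q₀ := q₀) (fun z hz _ => hoff z hz)
    (S.contourIntegrable_diff hns hr hrc x t)
  rw [hsum, ← hcongr.2]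
  have hev0 : ∀ᶠ z in 𝓝 (0 : ℂ), z ∉ branchPts q₀ ∧ z ∉ Set.range p := by
    have hb : (branchPts q₀).Finite := Set.toFinite {I * (q₀ : ℂ), -(I * q₀)}
    refine Eventually.and (p := fun z => z ∉ branchPts q₀)
      (hb.isClosed.isOpen_compl.mem_nhds ?_) (hfin.isClosed.isOpen_compl.mem_nhds ?_)
    · have : I * (q₀ : ℂ) ≠ 0 := mul_ne_zero I_ne_zero (by exact_mod_cast S.q₀_ne)
      rintro (h | h)
      · exact this h.symm
      · exact this (neg_eq_zero.1 (Eq.symm h))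
    · rintro ⟨n, hn⟩
      exact hp0 n hn
  have hevi : ∀ᶠ z in Bornology.cobounded ℂ, z ∉ branchPts q₀ ∧ z ∉ Set.range p := by
    have hb : (branchPts q₀).Finite := Set.toFinite {I * (q₀ : ℂ), -(I * q₀)}
    exact Eventually.and (p := fun z => z ∉ branchPts q₀) (Bornology.isBounded_def.1 hb.isBounded)
      (Bornology.isBounded_def.1 hfin.isBounded)
  have hfmeq : ∀ z, z ∉ branchPts q₀ ∧ z ∉ Set.range p →
      z * (muP q q₀ qp 1 x t z 0 / s22 q q₀ qm qp z) - z * polePart p a c z = z * fm z :=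
    fun z hz => by
      simp only [hfm, removeOn, if_neg hz.2, hF, hr z hz.1]
      ring
  have hfpeq : ∀ z, z * muM q q₀ qm 1 x t z 0 - z * polePart p a c z = z * fp z := fun z => by
    simp only [hfp]; ring
  -- The limit at infinity is that of μ_{-12} minus the sum of the residues; at the origin the pole
  -- part contributes nothing.
  refine contourIntegral_jump hfin.countable ?_ ?_ ?_ ?_ ?_ ?_ ?_ ?_ hcongr.1
  · intro z hz
    exact (continuousOn_pi.1 (S.continuousOn_muM_one x t) 0 z hz).sub
      (differentiableAt_polePart (hpl z hz)).continuousAt.continuousWithinAt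
  · intro z hz
    by_cases hzr : z ∈ Set.range p
    · obtain ⟨n, rfl⟩ := hzr
      obtain ⟨l, hl⟩ := hpole n
      exact (continuousAt_removeOn hfin ⟨n, rfl⟩ hl).continuousWithinAt
    · have h1 : ContinuousWithinAt F (Dminus ∪ contour) z :=
        ((continuousOn_pi.1 (S.continuousOn_muP_one x t) 0 z hz).mul
          (hrc z hz fun hb => S.s22_ne_zero hns hds hz hb hzr)).sub
          (differentiableAt_polePart (hrange hzr)).continuousAt.continuousWithinAt
      exact h1.congr_of_eventuallyEq
        (mem_nhdsWithin_of_mem_nhds (removeOn_eventuallyEq hfin F hzr)) (if_neg hzr)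
  · intro z hz _
    exact ((differentiableOn_pi.1 (S.differentiableOn_muM_one x t) 0).differentiableAt
      (isOpen_Dplus.mem_nhds hz)).sub (differentiableAt_polePart (hpl z (Or.inl hz)))
  · intro z hz hzr
    have hnh := isOpen_Dminus.mem_nhds hz
    have hrd : DifferentiableAt ℂ r z := by
      refine ((S.differentiableOn_s22.differentiableAt hnh).fun_inv (S.s22_ne_zero hns hds
        (Or.inl hz) (notMem_branchPts_of_Dminus hz) hzr)).congr_of_eventuallyEq ?_
      filter_upwards [hnh] with w hw using hr w (notMem_branchPts_of_Dminus hw)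
    have h1 : DifferentiableAt ℂ F z :=
      (((differentiableOn_pi.1 (S.differentiableOn_muP_one x t) 0).differentiableAt hnh).mul
        hrd).sub (differentiableAt_polePart (hrange hzr))
    exact h1.congr_of_eventuallyEq (removeOn_eventuallyEq hfin F hzr)
  · exact ((S.tendsto_muM_one_inf x t).1.sub
      ((tendsto_mul_polePart_cobounded (p := p) (a := a) (c := c)).mono_left inf_le_left)).congr hfpeq
  · refine ((S.tendsto_muP_one_div_inf x t).sub
      ((tendsto_mul_polePart_cobounded (p := p) (a := a) (c := c)).mono_left inf_le_left)).congr' ?_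
    exact (hevi.filter_mono inf_le_left).mono hfmeq
  · have := (S.tendsto_muM_one_zero x t).sub
      ((tendsto_mul_polePart_zero (a := a) (c := c) hp0).mono_left nhdsWithin_le_nhds)
    rw [sub_zero] at this
    exact this.congr hfpeq
  · have := (S.tendsto_muP_one_div_zero x t).sub
      ((tendsto_mul_polePart_zero (a := a) (c := c) hp0).mono_left nhdsWithin_le_nhds)
    rw [sub_zero] at this
    exact this.congr' ((hev0.filter_mono nhdsWithin_le_nhds).mono hfmeq)

theorem Scat.reconstruction (hns : NoSpectralSingularity q q₀ qm qp)
    (hds : HasDoubleSpectrum q q₀ qm qp zs ws) (x t : ℝ) :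
    ContourIntegrable (fun ζ => (RHMplus q q₀ qm qp x t ζ * RHJ q q₀ qm qp x t ζ) 0 1) ∧
      q x t = exp (I * vMinus q q₀ x t) * (qm * exp (I * vMinus q q₀ x t)
        - I * (alphaVec q q₀ qm qp zs ws x t ⬝ᵥ gammaVec q q₀ qm zs ws x t)
        + 1 / (2 * Real.pi) * contourIntegral
            (fun ζ => (RHMplus q q₀ qm qp x t ζ * RHJ q q₀ qm qp x t ζ) 0 1)) := by
  obtain ⟨r, hr, hrc⟩ := S.exists_inv22 hns
  obtain ⟨h1, h2⟩ := contour_congr (q₀ := q₀)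
    (f := fun ζ => (RHMplus q q₀ qm qp x t ζ * RHJ q q₀ qm qp x t ζ) 0 1) (fun z hz hb => by
      have hn := hns.1 z ⟨hz, hb⟩
      rw [S.jump_entry hz hb hn.1, ← S.jump_diff hz hb hn.2, hr z hb, div_eq_mul_inv])
    (S.contourIntegrable_diff hns hr hrc x t)
  refine ⟨h1, ?_⟩
  rw [h2, S.contourIntegral_diff hns hds hr hrc x t, Complex.exp_neg]
  have hpi : (Real.pi : ℂ) ≠ 0 := by exact_mod_cast Real.pi_ne_zero
  have hE := Complex.exp_ne_zero (I * vMinus q q₀ x t)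
  field_simp
  ring_nf
  rw [I_sq]
  ring

theorem Scat.contourIntegral_reflectionless (hns : NoSpectralSingularity q q₀ qm qp)
    (h : ∀ z ∈ contour \ branchPts q₀, rhoT q q₀ qm qp z = 0) (x t : ℝ) :
    contourIntegral
      (fun ζ => (RHMplus q q₀ qm qp x t ζ * RHJ q q₀ qm qp x t ζ) 0 1) = 0 := by
  rw [(contour_congr (q₀ := q₀) (g := fun _ => 0) (fun z hz hb => by
    rw [S.jump_entry hz hb (hns.1 z ⟨hz, hb⟩).1, h z ⟨hz, hb⟩]; simp)
    (by simp [ContourIntegrable])).2]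
  simp [contourIntegral]

end

end DNLS

theorem mainTheorem3 (q : ℝ → ℝ → ℂ) (q₀ : ℝ) (qm qp : ℂ) {N₁ N₂ : ℕ}
    (zs : Fin N₁ → ℂ) (ws : Fin N₂ → ℂ)
    (hq : DNLS.IsSolution q)
    (hbc : DNLS.HasNZBC q q₀ qm qp)
    (hns : DNLS.NoSpectralSingularity q q₀ qm qp)
    (hds : DNLS.HasDoubleSpectrum q q₀ qm qp zs ws) :
    (∀ x t : ℝ,
      DNLS.ContourIntegrable
        (fun ζ => (DNLS.RHMplus q q₀ qm qp x t ζ * DNLS.RHJ q q₀ qm qp x t ζ) 0 1) ∧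
      q x t =
        exp (I * DNLS.vMinus q q₀ x t) *
          (qm * exp (I * DNLS.vMinus q q₀ x t)
            - I * (DNLS.alphaVec q q₀ qm qp zs ws x t ⬝ᵥ DNLS.gammaVec q q₀ qm zs ws x t)
            + 1 / (2 * Real.pi) * DNLS.contourIntegral
                (fun ζ => (DNLS.RHMplus q q₀ qm qp x t ζ * DNLS.RHJ q q₀ qm qp x t ζ) 0 1))) ∧
    ((∀ z ∈ DNLS.contour \ DNLS.branchPts q₀,
        DNLS.rho q q₀ qm qp z = 0 ∧ DNLS.rhoT q q₀ qm qp z = 0) →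
      ∀ x t : ℝ,
        q x t =
          exp (I * DNLS.vMinus q q₀ x t) *
            (qm * exp (I * DNLS.vMinus q q₀ x t)
              - I * (DNLS.alphaVec q q₀ qm qp zs ws x t
                  ⬝ᵥ DNLS.gammaVec q q₀ qm zs ws x t))) := by
  obtain ⟨W, Jm, Jp, S⟩ := DNLS.exists_scat hq hbc
  refine ⟨fun x t => S.reconstruction hns hds x t, fun h x t => ?_⟩
  have h0 := S.contourIntegral_reflectionless hns (fun z hz => (h z hz).2) x t
  have := (S.reconstruction hns hds x t).2
  rwa [h0, mul_zero, add_zero] at this
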